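/- A temporal graph $\boldsymbol{G}=(V,\boldsymbol{E},\tau)$ consists of a finite vertex set $V$, a set $\boldsymbol{E}\subseteq\binom V2\times\{1,\dots,\tau\}$ of time-edges and a maximum label $\tau$; its underlying graph $G_\downarrow$ has the edges $\{v,w\}$ with $(\{v,w\},t)\in\boldsymbol{E}$ for some $t$, and $\mathrm{tw}_\downarrow(\boldsymbol{G})$ denotes the treewidth of $G_\downarrow$. A temporal $(s,z)$-path is a sequence of time-edges $(\{v_0,v_1\},t_1),\dots,(\{v_{\ell-1},v_\ell\},t_\ell)$ of $\boldsymbol{G}$ with $v_0=s$, $v_\ell=z$, pairwise distinct $v_0,\dots,v_\ell$ and $t_1\le\dots\le t_\ell$. A temporal $(s,z)$-separator is a set $S\subseteq V\setminus\{s,z\}$ such that $\boldsymbol{G}-S$ has no temporal $(s,z)$-path. The problem Temporal $(s,z)$-Separation asks, given $\boldsymbol{G}$, two distinct vertices $s,z\in V$ and a natural number $k$, whether $\boldsymbol{G}$ has a temporal $(s,z)$-separator of size at most $k$. It is assumed that $G_\downarrow$ is connected, that there is no time-edge between $s$ and $z$, and that the time-edges are listed by ascending labels. A nice tree decomposition is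 a tree decomposition with bags $B_i$ over a rooted tree in which every node $i$ has at most two children, where $B_i=B_j=B_k$ if $i$ has two children $j,k$; $B_i=B_j\cup\{v\}$ or $B_i=B_j\setminus\{v\}$ for some vertex $v$ if $i$ has exactly one child $j$; and $|B_i|=1$ if $i$ has no child. Its width is $\max_i|B_i|-1$. Running times are measured on a random access machine with unit costs, with addition and truncated subtraction of natural numbers as its arithmetic operations. **Theorem.** (1) If a nice tree decomposition of $G_\downarrow$ of width $\mathrm{tw}$ with $O(\mathrm{tw}\cdot|V|)$ nodes is given together with the instance (in particular, one of width $\mathrm{tw}=\mathrm{tw}_\downarrow(\boldsymbol{G})$), then Temporal $(s,z)$-Separation is solvable in $$O\big((\tau+2)^{\mathrm{tw}+2}\cdot \mathrm{tw}\cdot|V|\cdot|\boldsymbol{E}|\big)$$ time. More precisely, there is one algorithm such that for every constant $c$ there is a constant $C$ for which the algorithm takes at most $C\,(\tau+2)^{\mathrm{tw}+2}\cdot\mathrm{tw}\cdot|V|\cdot|\boldsymbol{E}|$ steps whenever the decomposition has at most $c\cdot\mathrm{tw}\cdot|V|$ nodes. (2) Temporal $(s,z)$-Separation, parameterized by $\mathrm{tw}_\downarrow(\boldsymbol{G})$,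 is in XP: there are an algorithm, whose input is the instance $I=(\boldsymbol{G},s,z,k)$ only, and a computable function $f$ such that every instance $I$ is solved in at most $|I|^{f(\mathrm{tw}_\downarrow(\boldsymbol{G}))}$ steps, where $|I|$ is the number of integers in the encoding of $I$. (3) For every $w$, Temporal $(s,z)$-Separation is solvable in polynomial time on the instances with $\mathrm{tw}_\downarrow(\boldsymbol{G})\le w$. -/

import Mathlib

/-! ### Temporal graphs and separators -/

/-- An undirected temporal graph on the vertex set `V`: a finite set of time-edges
`({v, w}, t)` with `v ≠ w` and `t ∈ {1, …, τ}`, where `τ = maxLabel`. -/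
structure TemporalGraph (V : Type) where
  edges : Finset (Sym2 V × ℕ)
  maxLabel : ℕ
  loopless : ∀ e ∈ edges, ¬ e.1.IsDiag
  label_mem : ∀ e ∈ edges, 1 ≤ e.2 ∧ e.2 ≤ maxLabel

namespace TemporalGraph

variable {V : Type}

/-- The underlying static graph. -/
def underlying (G : TemporalGraph V) : SimpleGraph V where
  Adj v w := ∃ t, (s(v, w), t) ∈ G.edges
  symm := ⟨fun v w h => by
    obtain ⟨t, ht⟩ := h
    exact ⟨t, by rwa [Sym2.eq_swap]⟩⟩
  loopless := ⟨fun v h => by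
    obtain ⟨t, ht⟩ := h
    exact G.loopless _ ht (by simp)⟩

open Classical in
/-- `G - S`. The vertices of `S` are kept as isolated vertices, so that the vertex type does not
change; this makes no difference for paths between vertices outside `S`. -/
noncomputable def delete (G : TemporalGraph V) (S : Finset V) : TemporalGraph V where
  edges := G.edges.filter fun e => ∀ v ∈ e.1, v ∉ S
  maxLabel := G.maxLabel
  loopless e he := G.loopless e (Finset.mem_of_mem_filter e he)
  label_mem e he := G.label_mem e (Finset.mem_of_mem_filter e he)

/-- There is a temporal `(s, z)`-path in `G`: pairwise distinct vertices `v 0 = s, …, v ℓ = z`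
and non-decreasing labels, such that consecutive vertices are joined by a time-edge of `G`. -/
def HasTemporalPath (G : TemporalGraph V) (s z : V) : Prop :=
  ∃ (l : ℕ) (v : Fin (l + 1) → V) (t : Fin l → ℕ),
    v 0 = s ∧ v (Fin.last l) = z ∧ Function.Injective v ∧ Monotone t ∧
      ∀ i : Fin l, (s(v i.castSucc, v i.succ), t i) ∈ G.edges

/-- `S` is a temporal `(s, z)`-separator: a set of vertices other than `s` and `z` whose deletion
destroys all temporal `(s, z)`-paths. -/
def IsSeparator (G : TemporalGraph V) (s z : V) (S : Finset V) : Prop :=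
  s ∉ S ∧ z ∉ S ∧ ¬ (G.delete S).HasTemporalPath s z

/-- The list `L` of triples `(v, w, t)` contains every time-edge of `G` exactly once (with an
arbitrary choice of the order of its end points), by ascending labels. -/
def IsListing (G : TemporalGraph V) (L : List (V × V × ℕ)) : Prop :=
  (L.map fun e => (s(e.1, e.2.1), e.2.2)).Nodup ∧
    (∀ e, e ∈ G.edges ↔ e ∈ L.map fun e => (s(e.1, e.2.1), e.2.2)) ∧
    L.Pairwise fun e e' => e.2.2 ≤ e'.2.2

end TemporalGraph

/-- An instance of Temporal `(s, z)`-Separation with vertex set `{0, …, n - 1}`. The graph is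
connected and there is no time-edge between the two terminals. -/
structure SeparationInstance (n : ℕ) where
  graph : TemporalGraph (Fin n)
  s : Fin n
  z : Fin n
  k : ℕ
  s_ne_z : s ≠ z
  connected : graph.underlying.Connected
  not_adj : ¬ graph.underlying.Adj s z

/-- The question of the problem: is there a temporal `(s, z)`-separator of size at most `k`? -/
def SeparationInstance.IsYes {n : ℕ} (I : SeparationInstance n) : Prop :=
  ∃ S : Finset (Fin n), I.graph.IsSeparator I.s I.z S ∧ S.card ≤ I.k

/-! ### Tree decompositions -/

/-- A tree decomposition of `G` whose tree has the nodes `{0, …, N - 1}`. -/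
structure TreeDecomposition {V : Type} (G : SimpleGraph V) (N : ℕ) where
  tree : SimpleGraph (Fin N)
  isTree : tree.IsTree
  bag : Fin N → Finset V
  /-- The nodes whose bag contains `v` induce a (non-empty) subtree. -/
  connected : ∀ v : V, (tree.induce {i | v ∈ bag i}).Connected
  edge_mem : ∀ v w : V, G.Adj v w → ∃ i, v ∈ bag i ∧ w ∈ bag i

/-- The width: the maximal size of a bag minus one. -/
def TreeDecomposition.width {V : Type} {G : SimpleGraph V} {N : ℕ}
    (D : TreeDecomposition G N) : ℕ :=
  (Finset.univ.sup fun i => (D.bag i).card) - 1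

/-- The treewidth of a finite graph: the minimal width of a tree decomposition. -/
noncomputable def treewidth {V : Type} (G : SimpleGraph V) : ℕ :=
  sInf {w | ∃ (N : ℕ) (D : TreeDecomposition G N), D.width = w}

/-- A tree decomposition with a rooted tree. The root is its own `parent`. -/
structure RootedTreeDecomposition {V : Type} (G : SimpleGraph V) (N : ℕ)
    extends TreeDecomposition G N where
  root : Fin N
  parent : Fin N → Fin N
  parent_root : parent root = root
  reaches_root : ∀ i, ∃ k : ℕ, parent^[k] i = root
  adj_iff : ∀ i j, tree.Adj i j ↔ i ≠ j ∧ (parent i = j ∨ parent j = i)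

namespace RootedTreeDecomposition

variable {V : Type} {G : SimpleGraph V} {N : ℕ}

/-- The children of the node `i`. -/
def children (D : RootedTreeDecomposition G N) (i : Fin N) : Finset (Fin N) :=
  Finset.univ.filter fun j => j ≠ D.root ∧ D.parent j = i

/-- Nice tree decompositions: every node is a join node (two children), an introduce or
forget node (one child) or a leaf (no child). -/
structure IsNice [DecidableEq V] (D : RootedTreeDecomposition G N) : Prop where
  card_children_le : ∀ i, (D.children i).card ≤ 2
  join : ∀ i, (D.children i).card = 2 → ∀ j ∈ D.children i, D.bag i = D.bag j
  introduce_or_forget : ∀ i j, D.children i = {j} →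
    (∃ v, D.bag i = insert v (D.bag j)) ∨ (∃ v, D.bag i = (D.bag j).erase v)
  leaf : ∀ i, D.children i = ∅ → (D.bag i).card = 1

/-- `bags i` lists the elements of the bag of `i`, each exactly once, in an arbitrary order. -/
def IsBagListing (D : RootedTreeDecomposition G N) (bags : Fin N → List V) : Prop :=
  ∀ i, (bags i).Nodup ∧ ∀ v, v ∈ bags i ↔ v ∈ D.bag i

end RootedTreeDecomposition

/-! ### Random access machines

Programs for a unit-cost random access machine, in structured form (`while` loops instead of
jumps). A machine has registers, addressed by constants, and a memory that is addressed through
registers; both hold natural numbers. The arithmetic operations are addition and truncated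
subtraction. There is no multiplication, so that numbers get at most one bit longer per step, and
polynomial time on this machine is polynomial time on a Turing machine. -/

structure RAMState where
  reg : ℕ → ℕ
  mem : ℕ → ℕ

inductive RAMProgram where
  | skip : RAMProgram
  /-- `reg x := a` -/
  | const (x a : ℕ) : RAMProgram
  /-- `reg x := reg y + reg w` -/
  | add (x y w : ℕ) : RAMProgram
  /-- `reg x := reg y - reg w` (or `0`, if this is negative) -/
  | sub (x y w : ℕ) : RAMProgram
  /-- `reg x := mem (reg y)` -/
  | load (x y : ℕ) : RAMProgram
  /-- `mem (reg x) := reg y` -/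
  | store (x y : ℕ) : RAMProgram
  | seq (P Q : RAMProgram) : RAMProgram
  /-- if `reg x < reg y` then `P` else `Q` -/
  | ifLt (x y : ℕ) (P Q : RAMProgram) : RAMProgram
  /-- while `reg x < reg y` do `P` -/
  | whileLt (x y : ℕ) (P : RAMProgram) : RAMProgram

/-- `Run P σ t σ'`: started in the state `σ`, the program `P` halts in the state `σ'` after `t`
steps. Every elementary instruction and every evaluation of a test counts as one step. -/
inductive RAMProgram.Run : RAMProgram → RAMState → ℕ → RAMState → Prop
  | skip (σ : RAMState) : Run .skip σ 1 σ
  | const (x a : ℕ) (σ : RAMState) :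
      Run (.const x a) σ 1 ⟨Function.update σ.reg x a, σ.mem⟩
  | add (x y w : ℕ) (σ : RAMState) :
      Run (.add x y w) σ 1 ⟨Function.update σ.reg x (σ.reg y + σ.reg w), σ.mem⟩
  | sub (x y w : ℕ) (σ : RAMState) :
      Run (.sub x y w) σ 1 ⟨Function.update σ.reg x (σ.reg y - σ.reg w), σ.mem⟩
  | load (x y : ℕ) (σ : RAMState) :
      Run (.load x y) σ 1 ⟨Function.update σ.reg x (σ.mem (σ.reg y)), σ.mem⟩
  | store (x y : ℕ) (σ : RAMState) :
      Run (.store x y) σ 1 ⟨σ.reg, Function.update σ.mem (σ.reg x) (σ.reg y)⟩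
  | seq {P Q : RAMProgram} {σ σ' σ'' : RAMState} {t t' : ℕ} :
      Run P σ t σ' → Run Q σ' t' σ'' → Run (.seq P Q) σ (t + t') σ''
  | ifTrue {x y : ℕ} {P Q : RAMProgram} {σ σ' : RAMState} {t : ℕ} :
      σ.reg x < σ.reg y → Run P σ t σ' → Run (.ifLt x y P Q) σ (t + 1) σ'
  | ifFalse {x y : ℕ} {P Q : RAMProgram} {σ σ' : RAMState} {t : ℕ} :
      ¬ σ.reg x < σ.reg y → Run Q σ t σ' → Run (.ifLt x y P Q) σ (t + 1) σ'
  | whileTrue {x y : ℕ} {P : RAMProgram} {σ σ' σ'' : RAMState} {t t' : ℕ} :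
      σ.reg x < σ.reg y → Run P σ t σ' → Run (.whileLt x y P) σ' t' σ'' →
        Run (.whileLt x y P) σ (t + t' + 1) σ''
  | whileFalse {x y : ℕ} {P : RAMProgram} {σ : RAMState} :
      ¬ σ.reg x < σ.reg y → Run (.whileLt x y P) σ 1 σ

/-- The machine is deterministic: final state and number of steps are unique. -/
theorem RAMProgram.Run.unique {P : RAMProgram} {σ σ₁ σ₂ : RAMState} {t₁ t₂ : ℕ}
    (h₁ : P.Run σ t₁ σ₁) (h₂ : P.Run σ t₂ σ₂) : t₁ = t₂ ∧ σ₁ = σ₂ := by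
  induction h₁ generalizing t₂ σ₂ with
  | skip | const | add | sub | load | store => cases h₂; exact ⟨rfl, rfl⟩
  | seq _ _ ih ih' =>
    cases h₂ with
    | seq a b =>
      obtain ⟨rfl, rfl⟩ := ih a
      obtain ⟨rfl, rfl⟩ := ih' b
      exact ⟨rfl, rfl⟩
  | ifTrue h _ ih =>
    cases h₂ with
    | ifTrue _ a => obtain ⟨rfl, rfl⟩ := ih a; exact ⟨rfl, rfl⟩
    | ifFalse h' _ => exact absurd h h'
  | ifFalse h _ ih =>
    cases h₂ with
    | ifTrue h' _ => exact absurd h' h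
    | ifFalse _ a => obtain ⟨rfl, rfl⟩ := ih a; exact ⟨rfl, rfl⟩
  | whileTrue h _ _ ih ih' =>
    cases h₂ with
    | whileTrue _ a b =>
      obtain ⟨rfl, rfl⟩ := ih a
      obtain ⟨rfl, rfl⟩ := ih' b
      exact ⟨rfl, rfl⟩
    | whileFalse h' => exact absurd h h'
  | whileFalse h =>
    cases h₂ with
    | whileTrue h' _ _ => exact absurd h' h
    | whileFalse _ => exact ⟨rfl, rfl⟩

/-- The initial state: the input stands in the first memory cells, everything else is `0`. -/
def RAMState.initial (input : List ℕ) : RAMState where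
  reg _ := 0
  mem i := input.getD i 0

/-- On the given input, `P` halts after at most `T` steps, and register `0` then holds `1` if and
only if the answer is yes. -/
def RAMProgram.DecidesWithin (P : RAMProgram) (input : List ℕ) (answer : Prop) (T : ℕ) : Prop :=
  ∃ (t : ℕ) (σ : RAMState), P.Run (RAMState.initial input) t σ ∧ t ≤ T ∧
    (σ.reg 0 = 1 ↔ answer)

/-! ### Encodings -/

/-- `n, τ, s, z, k, |E|`, followed by the time-edges. -/
def SeparationInstance.encode {n : ℕ} (I : SeparationInstance n)
    (L : List (Fin n × Fin n × ℕ)) : List ℕ :=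
  [n, I.graph.maxLabel, I.s, I.z, I.k, L.length] ++
    L.flatMap fun e => [(e.1 : ℕ), (e.2.1 : ℕ), e.2.2]

/-- The number of nodes and the root, followed, for each node, by its parent, the size of its
bag and the vertices in its bag. -/
def RootedTreeDecomposition.encode {n : ℕ} {G : SimpleGraph (Fin n)} {N : ℕ}
    (D : RootedTreeDecomposition G N) (bags : Fin N → List (Fin n)) : List ℕ :=
  [N, (D.root : ℕ)] ++ (List.finRange N).flatMap fun i =>
    [(D.parent i : ℕ), (bags i).length] ++ (bags i).map fun v => (v : ℕ)

/-! A separator `S` is encoded by a coloring. The vertices of `S` get the color 0. Any other vertex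
gets the rank, among the labels that occur, at which it is first reached from `s` in `G - S` (at
least 1), or the largest color `Q - 1` if it is never reached. Here `Q` is the number of distinct
labels plus 2, so `Q ≤ τ + 2`. The point is that validity becomes a local condition: for each
time-edge whose ends both have a positive color, one end has a color at most the rank of the label
if and only if the other one has. Conversely, if `s` has color 1, `z` has color `Q - 1` and all
these conditions hold, then being reached propagates along every temporal path that avoids color 0,
so no such path ends in `z`. Hence the problem asks for a locally constrained coloring with at most
`k` zeros (`isYes_iff`).

Such problems yield to dynamic programming over small vertex cuts. A table for a tuple `X` and a
vertex set `C` stores, for each coloring of `X`, the least number of zeros in `C` of a feasible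
extension, as far as it is at most `k`. If `C` consists of vertices of a tuple `Y` and of parts
without edges between them whose neighbors outside lie in `Y`, then after coloring `X ∪ Y` the parts
are independent and their numbers of zeros add up (`Prob.spec_combine`). The program `combineCode`
runs through the colorings of `X ∪ Y`; both algorithms use it.

With a nice tree decomposition, `Y` is the bag of a node, `X` that of its parent, and `C` consists
of the vertices that occur below the node but not in the bag of the parent. Of two such bags one
contains the other, so there are at most `Q ^ (w + 1)` colorings. The factor between this and `(τ +
2) ^ (w + 2)` pays for computing table indices by repeated addition.

Without a decomposition, all pairs of an `m`-tuple and a component of its complement are candidates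
for `X` and `C`. Starting from nothing, a table is added whenever all the tables needed for some
step exist. Every table is correct, whatever `m` is. If `m` exceeds the treewidth, an optimal tree
decomposition shows that the pair of the empty tuple and the whole vertex set is reached eventually
(`StepClosed.of_below`). So `m = 1, 2, …` is tried until this pair has a table. This takes
polynomial time with an exponent linear in the treewidth, and polynomial time for bounded treewidth
is a special case.

To count machine steps, programs are written in a small language with arrays and counting loops,
whose semantics and cost are functions of the state (`Cmd.exec`, `Cmd.cost`). Compilation costs a
factor that depends on the program only (`Cmd.comp_run`). -/

namespace SepAlg

/-! ### A small array language on top of the random access machine -/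

/-- States of the array language: registers and (infinitely long) arrays. -/
structure St where
  reg : ℕ → ℕ
  arr : ℕ → ℕ → ℕ

namespace St

def setReg (σ : St) (x v : ℕ) : St := ⟨Function.update σ.reg x v, σ.arr⟩

def setArr (σ : St) (a i v : ℕ) : St :=
  ⟨σ.reg, Function.update σ.arr a (Function.update (σ.arr a) i v)⟩

@[simp] theorem reg_setReg (σ : St) (x v y : ℕ) :
    (σ.setReg x v).reg y = if y = x then v else σ.reg y := by
  simp [setReg, Function.update_apply]

@[simp] theorem arr_setReg (σ : St) (x v : ℕ) : (σ.setReg x v).arr = σ.arr := rfl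

@[simp] theorem reg_setArr (σ : St) (a i v : ℕ) : (σ.setArr a i v).reg = σ.reg := rfl

@[simp] theorem arr_setArr (σ : St) (a i v b : ℕ) :
    (σ.setArr a i v).arr b = if b = a then Function.update (σ.arr a) i v else σ.arr b := by
  by_cases h : b = a
  · subst h; simp [setArr]
  · simp [setArr, h]

end St

inductive Expr where
  | reg (x : ℕ)
  | lit (v : ℕ)
  | add (e f : Expr)
  | sub (e f : Expr)
  | get (a : ℕ) (e : Expr)

namespace Expr

@[simp] def eval (σ : St) : Expr → ℕ
  | reg x => σ.reg x
  | lit v => v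
  | add e f => e.eval σ + f.eval σ
  | sub e f => e.eval σ - f.eval σ
  | get a e => σ.arr a (e.eval σ)

/-- The limits come from the memory layout in `Rep`: registers from 64 on belong to the compiler,
and the arrays are interleaved with stride 32. -/
def wf : Expr → Bool
  | reg x => x < 64
  | lit _ => true
  | add e f => e.wf && f.wf
  | sub e f => e.wf && f.wf
  | get a e => a < 32 && e.wf

/-- The exact number of machine steps of the compiled expression. The 9 for an array access is 8 for
the address and 1 for the load. -/
def time : Expr → ℕ
  | reg _ => 2
  | lit _ => 1
  | add e f => e.time + (f.time + 1)
  | sub e f => e.time + (f.time + 1)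
  | get _ e => e.time + 9

instance : Add Expr := ⟨add⟩
instance : Sub Expr := ⟨sub⟩
instance (v : ℕ) : OfNat Expr v := ⟨lit v⟩

@[simp] theorem eval_add (σ : St) (e f : Expr) : (e + f).eval σ = e.eval σ + f.eval σ := rfl
@[simp] theorem eval_sub (σ : St) (e f : Expr) : (e - f).eval σ = e.eval σ - f.eval σ := rfl
@[simp] theorem eval_ofNat (σ : St) (v : ℕ) : (no_index (OfNat.ofNat v) : Expr).eval σ = v := rfl

end Expr

/-- The number of rounds of a loop is read off when it is entered. Hence every command terminates,
and execution can be a total function. -/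
inductive Cmd where
  | skip
  | set (x : ℕ) (e : Expr)
  | put (a : ℕ) (e f : Expr)
  | seq (P Q : Cmd)
  | ite (e f : Expr) (P Q : Cmd)
  | loop (i n : ℕ) (P : Cmd)

/-- The state at the head of a counting loop with counter `i` and body `f`, after `k` rounds. -/
def iterLoop (f : St → St) (i : ℕ) : ℕ → St → St
  | 0, σ => σ.setReg i 0
  | k + 1, σ => (f (iterLoop f i k σ)).setReg i (k + 1)

namespace Cmd

def exec : Cmd → St → St
  | skip => fun σ => σ
  | set x e => fun σ => σ.setReg x (e.eval σ)
  | put a e f => fun σ => σ.setArr a (e.eval σ) (f.eval σ)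
  | seq P Q => fun σ => exec Q (exec P σ)
  | ite e f P Q => fun σ => if e.eval σ < f.eval σ then exec P σ else exec Q σ
  | loop i n P => fun σ => iterLoop (exec P) i (σ.reg n) σ

@[simp] theorem exec_skip (σ : St) : skip.exec σ = σ := rfl
@[simp] theorem exec_set (σ : St) (x : ℕ) (e : Expr) :
    (set x e).exec σ = σ.setReg x (e.eval σ) := rfl
@[simp] theorem exec_put (σ : St) (a : ℕ) (e f : Expr) :
    (put a e f).exec σ = σ.setArr a (e.eval σ) (f.eval σ) := rfl
@[simp] theorem exec_seq (σ : St) (P Q : Cmd) : (seq P Q).exec σ = Q.exec (P.exec σ) := rfl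
@[simp] theorem exec_ite (σ : St) (e f : Expr) (P Q : Cmd) :
    (ite e f P Q).exec σ = if e.eval σ < f.eval σ then P.exec σ else Q.exec σ := rfl

/-- Evaluating expressions is free here: its time is determined by the program text and enters
`Cmd.factor` instead. -/
def cost : Cmd → St → ℕ
  | skip => fun _ => 1
  | set _ _ => fun _ => 1
  | put _ _ _ => fun _ => 1
  | seq P Q => fun σ => cost P σ + cost Q (exec P σ)
  | ite e f P Q => fun σ => 1 + if e.eval σ < f.eval σ then cost P σ else cost Q σ
  | loop i n P => fun σ =>
      1 + ∑ k ∈ Finset.range (σ.reg n), (1 + cost P (iterLoop (exec P) i k σ))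

/-- The registers that may be written. -/
@[simp] def regs : Cmd → List ℕ
  | skip => []
  | set x _ => [x]
  | put _ _ _ => []
  | seq P Q => P.regs ++ Q.regs
  | ite _ _ P Q => P.regs ++ Q.regs
  | loop i _ P => i :: P.regs

/-- The arrays that may be written. -/
@[simp] def arrs : Cmd → List ℕ
  | skip => []
  | set _ _ => []
  | put a _ _ => [a]
  | seq P Q => P.arrs ++ Q.arrs
  | ite _ _ P Q => P.arrs ++ Q.arrs
  | loop _ _ P => P.arrs

/-- The registers that bound loops. -/
@[simp] def bounds : Cmd → List ℕ
  | skip => []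
  | set _ _ => []
  | put _ _ _ => []
  | seq P Q => P.bounds ++ Q.bounds
  | ite _ _ P Q => P.bounds ++ Q.bounds
  | loop _ n P => n :: P.bounds

/-- The body of a loop must write neither counter nor bound; only then does the compiled `while`
loop make the prescribed number of rounds. -/
def wf : Cmd → Bool
  | skip => true
  | set x e => x < 64 && e.wf
  | put a e f => a < 32 && e.wf && f.wf
  | seq P Q => P.wf && Q.wf
  | ite e f P Q => e.wf && f.wf && P.wf && Q.wf
  | loop i n P => i < 64 && n < 64 && i != n && !P.regs.contains i && !P.regs.contains n && P.wf

/-- A bound on the cost in terms of the values of the registers that bound loops. -/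
@[simp] def ub (v : ℕ → ℕ) : Cmd → ℕ
  | skip => 1
  | set _ _ => 1
  | put _ _ _ => 1
  | seq P Q => P.ub v + Q.ub v
  | ite _ _ P Q => 1 + (P.ub v + Q.ub v)
  | loop _ n P => 1 + v n * (1 + P.ub v)

/-- `τ` differs from `σ` only where `c` may write. -/
def Agree (c : Cmd) (σ τ : St) : Prop :=
  (∀ x, x ∉ c.regs → τ.reg x = σ.reg x) ∧ ∀ a, a ∉ c.arrs → τ.arr a = σ.arr a

theorem iterLoop_agree {P : Cmd} (h : ∀ σ, P.Agree σ (P.exec σ)) (i n k : ℕ) (σ : St) :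
    (loop i n P).Agree σ (iterLoop P.exec i k σ) := by
  induction k with
  | zero =>
    refine ⟨fun x hx => ?_, fun a _ => rfl⟩
    simp only [regs, List.mem_cons, not_or] at hx
    simp [iterLoop, hx.1]
  | succ k ih =>
    refine ⟨fun x hx => ?_, fun a ha => ?_⟩
    · rw [← ih.1 x hx]
      simp only [regs, List.mem_cons, not_or] at hx
      simp [iterLoop, hx.1, (h _).1 x hx.2]
    · rw [← ih.2 a ha]
      simp only [arrs] at ha
      simp [iterLoop, (h _).2 a ha]

/-- The frame rule. For concrete commands the side conditions are decidable, so most facts are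
carried past a command by `decide`. -/
theorem agree (c : Cmd) (σ : St) : c.Agree σ (c.exec σ) := by
  induction c generalizing σ with
  | skip => exact ⟨fun _ _ => rfl, fun _ _ => rfl⟩
  | set x e => exact ⟨fun y hy => by simp_all [regs], fun _ _ => rfl⟩
  | put a e f => exact ⟨fun y hy => rfl, fun b hb => by simp_all [arrs]⟩
  | seq P Q hP hQ =>
    refine ⟨fun x hx => ?_, fun a ha => ?_⟩
    · simp only [regs, List.mem_append, not_or] at hx
      simp [(hQ _).1 x hx.2, (hP _).1 x hx.1]
    · simp only [arrs, List.mem_append, not_or] at ha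
      simp [(hQ _).2 a ha.2, (hP _).2 a ha.1]
  | ite e f P Q hP hQ =>
    refine ⟨fun x hx => ?_, fun a ha => ?_⟩
    · simp only [regs, List.mem_append, not_or] at hx
      simp only [exec]; split
      exacts [(hP _).1 x hx.1, (hQ _).1 x hx.2]
    · simp only [arrs, List.mem_append, not_or] at ha
      simp only [exec]; split
      exacts [(hP _).2 a ha.1, (hQ _).2 a ha.2]
  | loop i n P hP => exact iterLoop_agree hP i n _ σ

theorem reg_exec {c : Cmd} {σ : St} {x : ℕ} (h : x ∉ c.regs) :
    (c.exec σ).reg x = σ.reg x := (c.agree σ).1 x h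

theorem arr_exec {c : Cmd} {σ : St} {a : ℕ} (h : a ∉ c.arrs) :
    (c.exec σ).arr a = σ.arr a := (c.agree σ).2 a h

theorem iterLoop_reg (f : St → St) (i k : ℕ) (σ : St) : (iterLoop f i k σ).reg i = k := by
  cases k <;> simp [iterLoop]

theorem iterLoop_inv {P : Cmd} {i n : ℕ} {σ : St} (I : ℕ → St → Prop)
    (h0 : I 0 (σ.setReg i 0))
    (hs : ∀ k τ, k < σ.reg n → τ.reg i = k → (loop i n P).Agree σ τ → I k τ →
      I (k + 1) ((P.exec τ).setReg i (k + 1))) (k : ℕ) (hk : k ≤ σ.reg n) :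
    I k (iterLoop P.exec i k σ) := by
  induction k with
  | zero => exact h0
  | succ k ih =>
    exact hs k _ hk (iterLoop_reg _ _ _ _) (iterLoop_agree P.agree _ _ _ _) (ih (by omega))

/-- The invariant rule for loops. -/
theorem exec_loop {P : Cmd} {i n : ℕ} {σ : St} (I : ℕ → St → Prop)
    (h0 : I 0 (σ.setReg i 0))
    (hs : ∀ k τ, k < σ.reg n → τ.reg i = k → (loop i n P).Agree σ τ → I k τ →
      I (k + 1) ((P.exec τ).setReg i (k + 1))) :
    I (σ.reg n) ((loop i n P).exec σ) :=
  iterLoop_inv I h0 hs _ le_rfl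

/-- The invariant rule for loops, with costs. -/
theorem exec_loop_cost {P : Cmd} {i n : ℕ} {σ : St} (I : ℕ → St → Prop) (B : ℕ → ℕ)
    (h0 : I 0 (σ.setReg i 0))
    (hs : ∀ k τ, k < σ.reg n → τ.reg i = k → (loop i n P).Agree σ τ → I k τ →
      I (k + 1) ((P.exec τ).setReg i (k + 1)) ∧ P.cost τ ≤ B k) :
    I (σ.reg n) ((loop i n P).exec σ) ∧
      (loop i n P).cost σ ≤ 1 + ∑ k ∈ Finset.range (σ.reg n), (1 + B k) := by
  have h := iterLoop_inv (P := P) (n := n) I h0 fun k τ a b c d => (hs k τ a b c d).1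
  refine ⟨h _ le_rfl, ?_⟩
  simp only [cost]
  gcongr with k hk
  rw [Finset.mem_range] at hk
  exact (hs k _ hk (iterLoop_reg _ _ _ _) (iterLoop_agree P.agree _ _ _ _) (h k hk.le)).2

theorem exec_loop_cost_const {P : Cmd} {i n : ℕ} {σ : St} (I : ℕ → St → Prop) (B : ℕ)
    (h0 : I 0 (σ.setReg i 0))
    (hs : ∀ k τ, k < σ.reg n → τ.reg i = k → (loop i n P).Agree σ τ → I k τ →
      I (k + 1) ((P.exec τ).setReg i (k + 1)) ∧ P.cost τ ≤ B) :
    I (σ.reg n) ((loop i n P).exec σ) ∧ (loop i n P).cost σ ≤ 1 + σ.reg n * (1 + B) := by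
  simpa using exec_loop_cost I (fun _ => B) h0 hs

theorem ub_mono {c : Cmd} {v w : ℕ → ℕ} (h : ∀ x ∈ c.bounds, v x ≤ w x) : c.ub v ≤ c.ub w := by
  induction c with
  | skip | set | put => simp [ub]
  | seq P Q hP hQ | ite e f P Q hP hQ =>
    have h1 := hP fun x hx => h x (by simp [bounds, hx])
    have h2 := hQ fun x hx => h x (by simp [bounds, hx])
    simp only [ub]; omega
  | loop i n P hP =>
    have h1 := hP fun x hx => h x (by simp [bounds, hx])
    have h2 := h n (by simp [bounds])
    simp only [ub]; gcongr

/-- If no loop bound is written anywhere in `c`, then even the inner loops see the initial values of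
their bounds, and a purely syntactic bound on the cost is valid. -/
theorem cost_le_ub' (c : Cmd) (σ : St) (h : ∀ x ∈ c.bounds, x ∉ c.regs) :
    c.cost σ ≤ c.ub σ.reg := by
  induction c generalizing σ with
  | skip | set | put => simp [cost, ub]
  | seq P Q hP hQ =>
    simp only [cost, ub]
    refine add_le_add (hP _ fun x hx => ?_) ((hQ _ fun x hx => ?_).trans (ub_mono fun x hx => ?_))
    · have := h x (by simp [bounds, hx]); simp [regs] at this; exact this.1
    · have := h x (by simp [bounds, hx]); simp [regs] at this; exact this.2
    · have := h x (by simp [bounds, hx]); simp [regs] at this; rw [reg_exec this.1]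
  | ite e f P Q hP hQ =>
    have h1 := hP σ fun x hx => by
      have := h x (by simp [bounds, hx]); simp [regs] at this; exact this.1
    have h2 := hQ σ fun x hx => by
      have := h x (by simp [bounds, hx]); simp [regs] at this; exact this.2
    simp only [cost, ub]; split <;> omega
  | loop i n P hP =>
    simp only [cost, ub]
    rw [← smul_eq_mul, ← Finset.card_range (σ.reg n), ← Finset.sum_const, Finset.card_range]
    gcongr with k hk
    refine (hP _ fun x hx => ?_).trans (ub_mono fun x hx => ?_)
    · have := h x (by simp [bounds, hx]); simp [regs] at this; exact this.2
    · rw [(iterLoop_agree P.agree i n k σ).1 x (h x (by simp [bounds, hx]))]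

theorem cost_le_ub {c : Cmd} {σ : St} (v : ℕ → ℕ) (hv : ∀ x ∈ c.bounds, σ.reg x ≤ v x)
    (h : ∀ x ∈ c.bounds, x ∉ c.regs) : c.cost σ ≤ c.ub v :=
  (cost_le_ub' c σ h).trans (ub_mono hv)

theorem cost_seq (P Q : Cmd) (σ : St) : (seq P Q).cost σ = P.cost σ + Q.cost (P.exec σ) := rfl

end Cmd

/-! ### Compilation -/

/-- Register `64` holds the address of the first array cell, registers from `65` on hold
intermediate results. Cell `i` of array `a` has the address `b + 32 * i + a`. -/
structure Rep (b : ℕ) (σ : St) (ρ : RAMState) : Prop where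
  reg : ∀ x < 64, ρ.reg x = σ.reg x
  base : ρ.reg 64 = b
  mem : ∀ a < 32, ∀ i, ρ.mem (b + 32 * i + a) = σ.arr a i

open RAMProgram

/-- Replace the index in register `d` by the address of the array cell. -/
def addrCode (d a : ℕ) : RAMProgram :=
  .seq (.add d d d) <| .seq (.add d d d) <| .seq (.add d d d) <| .seq (.add d d d) <|
    .seq (.add d d d) <| .seq (.add d d 64) <| .seq (.const (d + 1) a) (.add d d (d + 1))

def Expr.comp (d : ℕ) : Expr → RAMProgram
  | .reg x => .seq (.const d 0) (.add d d x)
  | .lit v => .const d v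
  | .add e f => .seq (e.comp d) (.seq (f.comp (d + 1)) (.add d d (d + 1)))
  | .sub e f => .seq (e.comp d) (.seq (f.comp (d + 1)) (.sub d d (d + 1)))
  | .get a e => .seq (e.comp d) (.seq (addrCode d a) (.load d d))

theorem addrCode_run (d a : ℕ) (hd : 65 ≤ d) (ρ : RAMState) :
    ∃ ρ', Run (addrCode d a) ρ 8 ρ' ∧ ρ'.mem = ρ.mem ∧ (∀ x < d, ρ'.reg x = ρ.reg x) ∧
      ρ'.reg d = ρ.reg 64 + 32 * ρ.reg d + a := by
  have hd' : (64 : ℕ) ≠ d := by omega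
  refine ⟨_, .seq (.add ..) (.seq (.add ..) (.seq (.add ..) (.seq (.add ..) (.seq (.add ..)
    (.seq (.add ..) (.seq (.const ..) (.add ..))))))), rfl, fun x hx => ?_, ?_⟩
  · have h1 : x ≠ d := by omega
    have h2 : x ≠ d + 1 := by omega
    simp [Function.update_apply, h1, h2]
  · simp [hd']
    ring

/-- Registers from `d` on act as a stack. Code at depth `d` leaves all registers below `d` alone, so
the left operand survives while the right one is evaluated at depth `d + 1`. -/
theorem Expr.comp_run {b : ℕ} {σ : St} (e : Expr) (d : ℕ) (hd : 65 ≤ d) (ρ : RAMState)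
    (hρ : Rep b σ ρ) (he : e.wf) :
    ∃ ρ', Run (e.comp d) ρ e.time ρ' ∧ ρ'.mem = ρ.mem ∧ (∀ x < d, ρ'.reg x = ρ.reg x) ∧
      ρ'.reg d = e.eval σ := by
  have key : ∀ (ρ' : RAMState) (d : ℕ), 65 ≤ d → ρ'.mem = ρ.mem → (∀ x < d, ρ'.reg x = ρ.reg x) →
      Rep b σ ρ' := fun ρ' d hd h1 h2 =>
    ⟨fun x hx => by rw [h2 x (by omega), hρ.reg x hx], by rw [h2 _ (by omega), hρ.base],
      by rw [h1]; exact hρ.mem⟩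
  induction e generalizing d ρ with
  | reg x =>
    simp only [wf, decide_eq_true_eq] at he
    refine ⟨_, .seq (.const ..) (.add ..), rfl, fun y hy => ?_, ?_⟩
    · simp [Function.update_apply, hy.ne]
    · have : x ≠ d := by omega
      simp [this, hρ.reg x he]
  | lit v =>
    refine ⟨_, .const .., rfl, fun y hy => ?_, ?_⟩
    · simp [hy.ne]
    · simp
  | add e f ihe ihf =>
    simp only [wf, Bool.and_eq_true] at he
    obtain ⟨ρ1, r1, m1, k1, v1⟩ := ihe d hd ρ hρ he.1 key
    have hρ1 := key ρ1 d hd m1 k1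
    obtain ⟨ρ2, r2, m2, k2, v2⟩ := ihf (d + 1) (by omega) ρ1 hρ1 he.2 fun ρ' d' h1 h2 h3 =>
      ⟨fun x hx => by rw [h3 x (by omega), hρ1.reg x hx], by rw [h3 _ (by omega), hρ1.base],
        by rw [h2]; exact hρ1.mem⟩
    refine ⟨_, .seq r1 (.seq r2 (.add ..)), by simp [m2, m1], fun x hx => ?_, ?_⟩
    · simp [hx.ne, k2 x (by omega), k1 x hx]
    · simp [v2, k2 d (by omega), v1]
  | sub e f ihe ihf =>
    simp only [wf, Bool.and_eq_true] at he
    obtain ⟨ρ1, r1, m1, k1, v1⟩ := ihe d hd ρ hρ he.1 key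
    have hρ1 := key ρ1 d hd m1 k1
    obtain ⟨ρ2, r2, m2, k2, v2⟩ := ihf (d + 1) (by omega) ρ1 hρ1 he.2 fun ρ' d' h1 h2 h3 =>
      ⟨fun x hx => by rw [h3 x (by omega), hρ1.reg x hx], by rw [h3 _ (by omega), hρ1.base],
        by rw [h2]; exact hρ1.mem⟩
    refine ⟨_, .seq r1 (.seq r2 (.sub ..)), by simp [m2, m1], fun x hx => ?_, ?_⟩
    · simp [hx.ne, k2 x (by omega), k1 x hx]
    · simp [v2, k2 d (by omega), v1]
  | get a e ihe =>
    simp only [wf, Bool.and_eq_true, decide_eq_true_eq] at he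
    obtain ⟨ρ1, r1, m1, k1, v1⟩ := ihe d hd ρ hρ he.2 key
    obtain ⟨ρ2, r2, m2, k2, v2⟩ := addrCode_run d a hd ρ1
    refine ⟨_, .seq r1 (.seq r2 (.load ..)), by simp [m2, m1], fun x hx => ?_, ?_⟩
    · simp [hx.ne, k2 x hx, k1 x hx]
    · simp [v2, v1, m2, m1, k1 64 (by omega), hρ.base, hρ.mem a he.1]

def Cmd.comp : Cmd → RAMProgram
  | .skip => .skip
  | .set x e => .seq (e.comp 65) (.seq (.const x 0) (.add x x 65))
  | .put a e f => .seq (e.comp 65) (.seq (addrCode 65 a) (.seq (f.comp 66) (.store 65 66)))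
  | .seq P Q => .seq P.comp Q.comp
  | .ite e f P Q => .seq (e.comp 65) (.seq (f.comp 66) (.ifLt 65 66 P.comp Q.comp))
  | .loop i n P => .seq (.const i 0)
      (.whileLt i n (.seq P.comp (.seq (.const 65 1) (.add i i 65))))

/-- The overhead of compilation. -/
def Cmd.factor : Cmd → ℕ
  | .skip => 1
  | .set _ e => e.time + 2
  | .put _ e f => e.time + f.time + 9
  | .seq P Q => P.factor + Q.factor
  | .ite e f P Q => e.time + f.time + 1 + P.factor + Q.factor
  | .loop _ _ P => P.factor + 3

theorem Rep.congr {b : ℕ} {σ : St} {ρ ρ' : RAMState} (h : Rep b σ ρ)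
    (hm : ρ'.mem = ρ.mem) (hr : ∀ x < 65, ρ'.reg x = ρ.reg x) : Rep b σ ρ' :=
  ⟨fun x hx => by rw [hr x (by omega), h.reg x hx], by rw [hr _ (by omega), h.base],
    by rw [hm]; exact h.mem⟩

/-- Simulation by induction on the command. Only scratch registers beyond 64 are used in addition,
so the base address and the representation are preserved. The factor does not grow with the number
of rounds, since the cost does. -/
theorem Cmd.comp_run {b : ℕ} (c : Cmd) (σ : St) (ρ : RAMState) (hρ : Rep b σ ρ) (hc : c.wf) :
    ∃ t ρ', Run c.comp ρ t ρ' ∧ t ≤ c.factor * c.cost σ ∧ Rep b (c.exec σ) ρ' := by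
  induction c generalizing σ ρ with
  | skip => exact ⟨_, _, .skip _, by simp [factor, cost], hρ⟩
  | set x e =>
    simp only [wf, Bool.and_eq_true, decide_eq_true_eq] at hc
    obtain ⟨ρ1, r1, m1, k1, v1⟩ := e.comp_run 65 le_rfl ρ hρ hc.2
    refine ⟨_, _, .seq r1 (.seq (.const ..) (.add ..)), by simp [factor, cost], ?_, ?_, ?_⟩
    · intro y hy
      have h1 : (65 : ℕ) ≠ x := by omega
      simp only [Function.update_apply, exec, St.reg_setReg]
      by_cases h : y = x
      · simp [h, h1, v1]
      · simp [h, k1 y (by omega), hρ.reg y hy]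
    · have h1 : (64 : ℕ) ≠ x := by omega
      simp [Function.update_apply, h1, k1 64 (by omega), hρ.base]
    · simpa [m1] using hρ.mem
  | put a e f =>
    simp only [wf, Bool.and_eq_true, decide_eq_true_eq] at hc
    obtain ⟨ρ1, r1, m1, k1, v1⟩ := e.comp_run 65 le_rfl ρ hρ hc.1.2
    obtain ⟨ρ2, r2, m2, k2, v2⟩ := addrCode_run 65 a le_rfl ρ1
    have hρ2 : Rep b σ ρ2 := hρ.congr (m2.trans m1) fun x hx => (k2 x hx).trans (k1 x hx)
    obtain ⟨ρ3, r3, m3, k3, v3⟩ := f.comp_run 66 (by omega) ρ2 hρ2 hc.2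
    refine ⟨_, _, .seq r1 (.seq r2 (.seq r3 (.store ..))), ?_, ?_, ?_, ?_⟩
    · simp only [factor, cost]; omega
    · intro y hy
      simp [k3 y (by omega), hρ2.reg y hy]
    · simp [k3 64 (by omega), hρ2.base]
    · intro a' ha' i
      have : ρ3.reg 65 = b + 32 * e.eval σ + a := by
        rw [k3 65 (by omega), v2, v1, k1 64 (by omega), hρ.base]
      simp only [Function.update_apply, this, v3, exec, St.arr_setArr, m3, hρ2.mem a' ha']
      by_cases h : a' = a
      · subst h
        simp [Function.update_apply]
      · rw [if_neg (by omega)]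
        simp [h]
  | seq P Q hP hQ =>
    simp only [wf, Bool.and_eq_true] at hc
    obtain ⟨t1, ρ1, r1, c1, h1⟩ := hP σ ρ hρ hc.1
    obtain ⟨t2, ρ2, r2, c2, h2⟩ := hQ _ ρ1 h1 hc.2
    refine ⟨_, _, .seq r1 r2, ?_, h2⟩
    simp only [factor, cost]
    nlinarith [Nat.zero_le (P.factor * Q.cost (P.exec σ)), Nat.zero_le (Q.factor * P.cost σ)]
  | ite e f P Q hP hQ =>
    simp only [wf, Bool.and_eq_true] at hc
    obtain ⟨ρ1, r1, m1, k1, v1⟩ := e.comp_run 65 le_rfl ρ hρ hc.1.1.1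
    have hρ1 := hρ.congr m1 k1
    obtain ⟨ρ2, r2, m2, k2, v2⟩ := f.comp_run 66 (by omega) ρ1 hρ1 hc.1.1.2
    have hρ2 := hρ1.congr m2 fun x hx => k2 x (by omega)
    have e1 : ρ2.reg 65 = e.eval σ := by rw [k2 65 (by omega), v1]
    by_cases h : e.eval σ < f.eval σ
    · obtain ⟨t3, ρ3, r3, c3, h3⟩ := hP σ ρ2 hρ2 hc.1.2
      refine ⟨_, _, .seq r1 (.seq r2 (.ifTrue (by rwa [e1, v2]) r3)), ?_, by simpa [h] using h3⟩
      simp only [factor, cost, h, if_true]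
      nlinarith [Nat.zero_le (P.cost σ * (e.time + f.time + 1 + Q.factor))]
    · obtain ⟨t3, ρ3, r3, c3, h3⟩ := hQ σ ρ2 hρ2 hc.2
      refine ⟨_, _, .seq r1 (.seq r2 (.ifFalse (by rwa [e1, v2]) r3)), ?_, by simpa [h] using h3⟩
      simp only [factor, cost, h, if_false]
      nlinarith [Nat.zero_le (Q.cost σ * (e.time + f.time + 1 + P.factor))]
  | loop i n P hP =>
    simp only [wf, Bool.and_eq_true, decide_eq_true_eq, bne_iff_ne, Bool.not_eq_true',
      List.contains_eq_mem, decide_eq_false_iff_not] at hc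
    obtain ⟨⟨⟨⟨⟨hi, hn⟩, hin⟩, hiP⟩, hnP⟩, hwf⟩ := hc
    set N := σ.reg n with hN
    have hnreg : ∀ k, (iterLoop P.exec i k σ).reg n = N := fun k =>
      (iterLoop_agree P.agree i n k σ).1 n (by simp [regs, hnP, Ne.symm hin])
    -- Induction on the number `m` of remaining rounds. The summand 3 of the factor pays for the
    -- test and the two instructions that increase the counter.
    have main : ∀ m k, k + m = N → ∀ ρ, Rep b (iterLoop P.exec i k σ) ρ →
        ∃ t ρ', Run (.whileLt i n (.seq P.comp (.seq (.const 65 1) (.add i i 65)))) ρ t ρ' ∧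
          t ≤ 1 + ∑ l ∈ Finset.Ico k N, (P.factor + 3) *
            (1 + P.cost (iterLoop P.exec i l σ)) ∧ Rep b (iterLoop P.exec i N σ) ρ' := by
      intro m
      induction m with
      | zero =>
        intro k hk ρ hρ
        obtain rfl : k = N := by omega
        refine ⟨_, _, .whileFalse ?_, by simp, hρ⟩
        rw [hρ.reg i hi, hρ.reg n hn, iterLoop_reg, hnreg]; omega
      | succ m ih =>
        intro k hk ρ hρ
        obtain ⟨t1, ρ1, r1, c1, h1⟩ := hP _ ρ hρ hwf
        have hrep : Rep b (iterLoop P.exec i (k + 1) σ) ⟨Function.update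
            (Function.update ρ1.reg 65 1) i ((Function.update ρ1.reg 65 1) i +
              (Function.update ρ1.reg 65 1) 65), ρ1.mem⟩ := by
          have h2 : (64 : ℕ) ≠ i := by omega
          have h3 : i ≠ 65 := by omega
          refine ⟨fun x hx => ?_, ?_, h1.mem⟩
          · simp only [iterLoop, St.reg_setReg, Function.update_apply]
            by_cases h : x = i
            · have : ρ1.reg i = k := by
                rw [h1.reg i hi, reg_exec hiP, iterLoop_reg]
              simp [h, h3, this]
            · have h4 : x ≠ 65 := by omega
              simp [h, h4, h1.reg x hx]
          · simp [Function.update_apply, h2, h1.base]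
        obtain ⟨t2, ρ2, r2, c2, h2⟩ := ih (k + 1) (by omega) _ hrep
        refine ⟨_, _, .whileTrue ?_ (.seq r1 (.seq (.const ..) (.add ..))) r2, ?_, h2⟩
        · rw [hρ.reg i hi, hρ.reg n hn, iterLoop_reg, hnreg]; omega
        · rw [Finset.sum_eq_sum_Ico_succ_bot (by omega)]
          nlinarith [Nat.zero_le (P.cost (iterLoop P.exec i k σ))]
    have h0 : Rep b (iterLoop P.exec i 0 σ) ⟨Function.update ρ.reg i 0, ρ.mem⟩ := by
      have h2 : (64 : ℕ) ≠ i := by omega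
      refine ⟨fun x hx => ?_, by simp [h2, hρ.base], hρ.mem⟩
      simp [iterLoop, Function.update_apply, hρ.reg x hx]
    obtain ⟨t, ρ', r, ht, h⟩ := main N 0 (by omega) _ h0
    refine ⟨_, _, .seq (.const ..) r, ?_, h⟩
    simp only [factor, cost]
    rw [Finset.range_eq_Ico, ← hN, mul_add, Finset.mul_sum]
    omega

/-- Move the input, which ends before the cell `8 + 3 * mem 5 + mem (6 + 3 * mem 5) * (mem 0 + 2)`,
into the array `0`. -/
def prologue : RAMProgram :=
  .seq (.seq (.const 70 1) <| .seq (.load 71 65) <| .seq (.const 72 5) <| .seq (.load 73 72) <|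
    .seq (.const 64 6) <| .seq (.add 64 64 73) <| .seq (.add 64 64 73) <| .seq (.add 64 64 73) <|
    .seq (.load 74 64) <| .seq (.add 71 71 70) <| .seq (.add 71 71 70) <|
    .seq (.add 64 64 70) (.add 64 64 70)) <|
  .seq (.whileLt 75 74 (.seq (.add 64 64 71) (.add 75 75 70))) <|
  .seq (.seq (.const 77 0) <| .seq (.add 77 77 64) (.const 78 32)) <|
  .whileLt 76 64 (.seq (.load 79 76) (.seq (.store 77 79)
    (.seq (.add 77 77 78) (.add 76 76 70))))

def St.init (input : List ℕ) : St := ⟨fun _ => 0, fun a i => if a = 0 then input.getD i 0 else 0⟩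

theorem while_run {x y : ℕ} {P : RAMProgram} {t : ℕ} (I : ℕ → RAMState → Prop) (N : ℕ)
    (hs : ∀ k < N, ∀ ρ, I k ρ → ρ.reg x < ρ.reg y ∧ ∃ ρ', Run P ρ t ρ' ∧ I (k + 1) ρ')
    (he : ∀ ρ, I N ρ → ¬ ρ.reg x < ρ.reg y) (ρ : RAMState) (h0 : I 0 ρ) :
    ∃ ρ', Run (.whileLt x y P) ρ (N * (t + 1) + 1) ρ' ∧ I N ρ' := by
  have main : ∀ m k, k + m = N → ∀ ρ, I k ρ →
      ∃ ρ', Run (.whileLt x y P) ρ (m * (t + 1) + 1) ρ' ∧ I N ρ' := by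
    intro m
    induction m with
    | zero =>
      intro k hk ρ hρ
      obtain rfl : k = N := by omega
      exact ⟨ρ, by simpa using .whileFalse (he ρ hρ), hρ⟩
    | succ m ih =>
      intro k hk ρ hρ
      obtain ⟨hlt, ρ1, r1, h1⟩ := hs k (by omega) ρ hρ
      obtain ⟨ρ2, r2, h2⟩ := ih (k + 1) (by omega) ρ1 h1
      refine ⟨ρ2, ?_, h2⟩
      have : (m + 1) * (t + 1) + 1 = t + (m * (t + 1) + 1) + 1 := by ring
      rw [this]
      exact .whileTrue hlt r1 r2
  exact main N 0 (by omega) ρ h0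

/-- An upper bound for the length of the input: `n + 2` cells suffice for the record of a node. If
no decomposition is given, the cell that would hold the number of nodes lies beyond the input and
reads 0, so the last summand vanishes. -/
def baseAddr (input : List ℕ) : ℕ :=
  8 + 3 * input.getD 5 0 + input.getD (6 + 3 * input.getD 5 0) 0 * (input.getD 0 0 + 2)

theorem prologue_run (input : List ℕ) (hl : input.length ≤ baseAddr input) :
    ∃ t ρ, Run prologue (RAMState.initial input) t ρ ∧ t ≤ 30 + 8 * baseAddr input ∧
      Rep (baseAddr input) (St.init input) ρ := by
  obtain ⟨ρ0, r0, h1, h2, h3, h4, h5, h6, h7, h8⟩ : ∃ ρ0 : RAMState,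
      Run (.seq (.const 70 1) <| .seq (.load 71 65) <| .seq (.const 72 5) <| .seq (.load 73 72) <|
        .seq (.const 64 6) <| .seq (.add 64 64 73) <| .seq (.add 64 64 73) <|
        .seq (.add 64 64 73) <| .seq (.load 74 64) <| .seq (.add 71 71 70) <|
        .seq (.add 71 71 70) <| .seq (.add 64 64 70) (.add 64 64 70))
        (RAMState.initial input) 13 ρ0 ∧ (∀ x < 64, ρ0.reg x = 0) ∧ ρ0.reg 76 = 0 ∧
      ρ0.reg 70 = 1 ∧ ρ0.reg 71 = input.getD 0 0 + 2 ∧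
      ρ0.reg 74 = input.getD (6 + 3 * input.getD 5 0) 0 ∧ ρ0.reg 75 = 0 ∧
      ρ0.reg 64 = 8 + 3 * input.getD 5 0 ∧ ρ0.mem = fun i => input.getD i 0 := by
    refine ⟨_, .seq (.const ..) <| .seq (.load ..) <| .seq (.const ..) <| .seq (.load ..) <|
      .seq (.const ..) <| .seq (.add ..) <| .seq (.add ..) <| .seq (.add ..) <| .seq (.load ..) <|
      .seq (.add ..) <| .seq (.add ..) <| .seq (.add ..) (.add ..), fun x hx => ?_, ?_⟩
    · simp only [Function.update_apply]
      repeat rw [if_neg (by omega)]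
      rfl
    · simp [RAMState.initial]
      refine ⟨?_, by ring⟩
      congr 2; ring
  obtain ⟨ρ1, r1, h1, h2, h3, h6, h7, h8⟩ := while_run (x := 75) (y := 74)
    (P := .seq (.add 64 64 71) (.add 75 75 70))
    (t := 2) (fun k ρ => (∀ x < 64, ρ.reg x = 0) ∧ ρ.reg 76 = 0 ∧ ρ.reg 70 = 1 ∧
      ρ.reg 71 = input.getD 0 0 + 2 ∧ ρ.reg 74 = input.getD (6 + 3 * input.getD 5 0) 0 ∧
      ρ.reg 75 = k ∧ ρ.reg 64 = 8 + 3 * input.getD 5 0 + k * (input.getD 0 0 + 2) ∧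
      ρ.mem = fun i => input.getD i 0) (input.getD (6 + 3 * input.getD 5 0) 0)
    (by
      rintro k hk ρ ⟨h1, h2, h3, h4, h5, h6, h7, h8⟩
      refine ⟨by rw [h5, h6]; exact hk, _, .seq (.add ..) (.add ..), fun x hx => ?_, ?_, ?_, ?_,
        ?_, ?_, ?_, ?_⟩
      · have a : x ≠ 64 := by omega
        have b : x ≠ 75 := by omega
        simp [a, b, h1 x hx]
      all_goals simp [*]
      ring)
    (by
      rintro ρ ⟨h1, h2, h3, h4, h5, h6, h7, h8⟩
      rw [h5, h6]; omega)
    ρ0 ⟨h1, h2, h3, h4, h5, h6, by simp [h7], h8⟩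
  obtain ⟨ρ2, r2, h1, h2, h3, h4, h5, h6, h7⟩ : ∃ ρ2 : RAMState,
      Run (.seq (.const 77 0) <| .seq (.add 77 77 64) (.const 78 32)) ρ1 3 ρ2 ∧
      (∀ x < 64, ρ2.reg x = 0) ∧ ρ2.reg 76 = 0 ∧ ρ2.reg 70 = 1 ∧
      ρ2.reg 77 = baseAddr input ∧ ρ2.reg 78 = 32 ∧
      ρ2.reg 64 = baseAddr input ∧ ρ2.mem = fun i => input.getD i 0 := by
    refine ⟨_, .seq (.const ..) <| .seq (.add ..) (.const ..), fun x hx => ?_, ?_⟩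
    · simp only [Function.update_apply]
      repeat rw [if_neg (by omega)]
      exact h1 x hx
    · simp [*, baseAddr]
  -- Reading takes place below the base address and writing at or above it, so nothing is
  -- overwritten before it is copied. Cells of the other arrays stay 0, because the input ends
  -- before the base address.
  obtain ⟨ρ3, r3, h1, h2, h3, h4, h5, h6, h7⟩ := while_run (x := 76) (y := 64)
    (P := .seq (.load 79 76) (.seq (.store 77 79) (.seq (.add 77 77 78) (.add 76 76 70))))
    (t := 4) (fun k ρ => (∀ x < 64, ρ.reg x = 0) ∧ ρ.reg 76 = k ∧ ρ.reg 70 = 1 ∧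
      ρ.reg 77 = baseAddr input + 32 * k ∧ ρ.reg 78 = 32 ∧ ρ.reg 64 = baseAddr input ∧
      ∀ i, ρ.mem i = if i < baseAddr input then input.getD i 0 else
        if ∃ j < k, i = baseAddr input + 32 * j then input.getD ((i - baseAddr input) / 32) 0
        else 0) (baseAddr input)
    (by
      rintro k hk ρ ⟨h1, h2, h3, h4, h5, h6, h7⟩
      refine ⟨by rw [h2, h6]; exact hk, _,
        .seq (.load ..) (.seq (.store ..) (.seq (.add ..) (.add ..))), fun x hx => ?_, ?_, ?_, ?_,
        ?_, ?_, ?_⟩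
      · simp only [Function.update_apply]
        repeat rw [if_neg (by omega)]
        exact h1 x hx
      · simp [*]
      · simp [*]
      · simp [*]; ring
      · simp [*]
      · simp [*]
      · intro i
        simp only [Function.update_apply, h2, h4]
        norm_num
        by_cases hi : i = baseAddr input + 32 * k
        · subst hi
          rw [if_pos rfl, if_neg (by omega), if_pos ⟨k, by omega, rfl⟩, h7, if_pos hk]
          simp
        · rw [if_neg hi, h7]
          by_cases hb : i < baseAddr input
          · simp [hb]
          · simp only [hb, if_false]
            have : (∃ j < k, i = baseAddr input + 32 * j) ↔
                ∃ j < k + 1, i = baseAddr input + 32 * j := by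
              constructor
              · rintro ⟨j, hj, rfl⟩; exact ⟨j, by omega, rfl⟩
              · rintro ⟨j, hj, rfl⟩; exact ⟨j, by omega, rfl⟩
            simp [this])
    (by
      rintro ρ ⟨h1, h2, h3, h4, h5, h6, h7⟩
      rw [h2, h6]; omega)
    ρ2 ⟨h1, h2, h3, by simp [h4], h5, h6, fun i => by
      by_cases hb : i < baseAddr input
      · simp [hb, h7]
      · simp only [h7, hb, if_false]
        rw [if_neg (by simp), List.getD_eq_default _ _ (by omega)]⟩
  refine ⟨_, ρ3, .seq r0 (.seq r1 (.seq r2 r3)), ?_, h1, h6, fun a ha i => ?_⟩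
  · have : input.getD (6 + 3 * input.getD 5 0) 0 ≤ baseAddr input := by
      unfold baseAddr; nlinarith
    omega
  · rw [h7, if_neg (by omega)]
    by_cases h0 : a = 0
    · subst h0
      by_cases hi : i < baseAddr input
      · rw [if_pos ⟨i, hi, by omega⟩]
        simp [St.init]
      · rw [if_neg (by rintro ⟨j, hj, h⟩; omega)]
        simp only [St.init, if_true]
        rw [List.getD_eq_default _ _ (by omega)]
    · rw [if_neg (by rintro ⟨j, hj, h⟩; omega)]
      simp [St.init, h0]

/-- Running a program of the array language on an input of the random access machine. -/
theorem decidesWithin_of_exec {c : Cmd} (hc : c.wf) (input : List ℕ)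
    (hl : input.length ≤ baseAddr input) {answer : Prop} {T : ℕ}
    (ht : 30 + 8 * baseAddr input + c.factor * c.cost (St.init input) ≤ T)
    (h : (c.exec (St.init input)).reg 0 = 1 ↔ answer) :
    (RAMProgram.seq prologue c.comp).DecidesWithin input answer T := by
  obtain ⟨t1, ρ1, r1, c1, h1⟩ := prologue_run input hl
  obtain ⟨t2, ρ2, r2, c2, h2⟩ := c.comp_run _ ρ1 h1 hc
  exact ⟨_, _, .seq r1 r2, by omega, by rw [h2.reg 0 (by omega)]; exact h⟩


/-! ### Colorings

A vertex gets the color `0` if it belongs to the separator, and otherwise (an upper bound for) the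
rank of the label at which it is reached, or `Q - 1` if it is not reached. -/

/-- An instance in terms of natural numbers: `n` vertices, `M` time-edges `(ea j, eb j, et j)`,
`Q` colors. -/
structure Prob where
  (n M Q k s z : ℕ)
  (ea eb et : ℕ → ℕ)

namespace Prob

variable (P : Prob)

/-- Colors outside the vertex range are fixed to 0. So numbers that are not vertices, such as the
empty places of a tuple, do not add degrees of freedom. -/
def Col (χ : ℕ → ℕ) : Prop := (∀ v, χ v < P.Q) ∧ ∀ v, P.n ≤ v → χ v = 0

/-- If one end is reached by the time of the edge, so is the other. The condition is symmetric
because labels along a path need not increase strictly and edges are undirected. -/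
def EdgeOk (χ : ℕ → ℕ) (j : ℕ) : Prop :=
  0 < χ (P.ea j) → 0 < χ (P.eb j) → (χ (P.ea j) ≤ P.et j ↔ χ (P.eb j) ≤ P.et j)

def VertexOk (χ : ℕ → ℕ) (v : ℕ) : Prop := (v = P.s → χ v = 1) ∧ (v = P.z → χ v = P.Q - 1)

/-- Only edges that meet `C` count. Those inside the boundary are left to the table in whose set one
of their ends lies. -/
def Feasible (χ : ℕ → ℕ) (C : Finset ℕ) : Prop :=
  (∀ j < P.M, P.ea j ∈ C ∨ P.eb j ∈ C → P.EdgeOk χ j) ∧ ∀ v ∈ C, P.VertexOk χ v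

end Prob

def zeros (χ : ℕ → ℕ) (C : Finset ℕ) : ℕ := (C.filter fun v => χ v = 0).card

/-- The number whose digits in base `Q` are the colors of `X 0, …, X (m - 1)`. -/
def idx (Q : ℕ) (χ X : ℕ → ℕ) : ℕ → ℕ
  | 0 => 0
  | m + 1 => idx Q χ X m * Q + χ (X m)

theorem idx_lt {Q : ℕ} {χ : ℕ → ℕ} (h : ∀ v, χ v < Q) (X : ℕ → ℕ) (m : ℕ) :
    idx Q χ X m < Q ^ m := by
  induction m with
  | zero => simp [idx]
  | succ m ih =>
    have := h (X m)
    rw [idx, pow_succ]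
    nlinarith

theorem idx_congr {Q : ℕ} {χ ψ X : ℕ → ℕ} {m : ℕ} (h : ∀ j < m, χ (X j) = ψ (X j)) :
    idx Q χ X m = idx Q ψ X m := by
  induction m with
  | zero => rfl
  | succ m ih => rw [idx, idx, ih fun j hj => h j (by omega), h m (by omega)]

theorem idx_inj {Q : ℕ} {χ ψ X : ℕ → ℕ} (hχ : ∀ v, χ v < Q) (hψ : ∀ v, ψ v < Q) {m : ℕ}
    (h : idx Q χ X m = idx Q ψ X m) : ∀ j < m, χ (X j) = ψ (X j) := by
  induction m with
  | zero => intro j hj; omega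
  | succ m ih =>
    rw [idx, idx] at h
    have h1 := congrArg (· % Q) h
    have h2 := congrArg (· / Q) h
    simp only [Nat.mul_add_mod_self_right, Nat.mod_eq_of_lt (hχ _), Nat.mod_eq_of_lt (hψ _)] at h1
    have hQ : 0 < Q := (Nat.zero_le _).trans_lt (hχ 0)
    have key : ∀ a b, b < Q → (a * Q + b) / Q = a := fun a b hb => by
      rw [mul_comm, Nat.mul_add_div hQ, Nat.div_eq_of_lt hb, add_zero]
    simp only [key _ _ (hχ _), key _ _ (hψ _)] at h2
    intro j hj
    rcases Nat.lt_succ_iff_lt_or_eq.1 hj with hj | rfl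
    exacts [ih h2 j hj, h1]

/-- The table `tab` holds, for all colorings of the tuple `X`, the minimal number of vertices with
color `0` in a feasible extension to `C`, as far as this number is at most `k`. -/
def Prob.Spec (P : Prob) (m : ℕ) (X : ℕ → ℕ) (C : Finset ℕ) (tab : ℕ → ℕ) : Prop :=
  ∀ χ, P.Col χ → ∀ b ≤ P.k, tab (idx P.Q χ X m) ≤ b ↔
    ∃ χ', P.Col χ' ∧ (∀ v, v ∉ C → χ' v = χ v) ∧ P.Feasible χ' C ∧ zeros χ' C ≤ b

theorem Prob.Spec.congr {P : Prob} {m : ℕ} {X : ℕ → ℕ} {C : Finset ℕ} {tab tab' : ℕ → ℕ}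
    (h : P.Spec m X C tab) (ht : ∀ i < P.Q ^ m, tab' i = tab i) : P.Spec m X C tab' := by
  intro χ hχ b hb
  rw [ht _ (idx_lt hχ.1 X m)]
  exact h χ hχ b hb

/-- The first `m` entries of the tuple `X` that are vertices. -/
def InTuple (n m : ℕ) (X : ℕ → ℕ) (v : ℕ) : Prop := v < n ∧ ∃ j < m, X j = v

open Classical in
/-- `1` for the vertices in `X`, `2` for those in `Y` but not in `X`, `0` for the other ones. -/
noncomputable def mark (n mX : ℕ) (X : ℕ → ℕ) (mY : ℕ) (Y : ℕ → ℕ) (v : ℕ) : ℕ :=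
  if InTuple n mX X v then 1 else if InTuple n mY Y v then 2 else 0

theorem mark_eq_two {n mX mY v : ℕ} {X Y : ℕ → ℕ} :
    mark n mX X mY Y v = 2 ↔ ¬ InTuple n mX X v ∧ InTuple n mY Y v := by
  unfold mark; split_ifs <;> simp_all

theorem mark_eq_zero {n mX mY v : ℕ} {X Y : ℕ → ℕ} :
    mark n mX X mY Y v = 0 ↔ ¬ InTuple n mX X v ∧ ¬ InTuple n mY Y v := by
  unfold mark; split_ifs <;> simp_all

theorem mark_le (n mX mY v : ℕ) (X Y : ℕ → ℕ) : mark n mX X mY Y v ≤ 2 := by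
  unfold mark; split_ifs <;> simp

namespace Prob

variable (P : Prob)

/-- As marks are 1 on `X` and 2 on the rest of `Y`, a sum above 2 singles out the edges inside `X ∪
Y` with an end in `Y` outside `X`. -/
def LocalOk (mk χ : ℕ → ℕ) : Prop :=
  (∀ j < P.M, 2 < mk (P.ea j) + mk (P.eb j) → P.EdgeOk χ j) ∧ ∀ v, mk v = 2 → P.VertexOk χ v

theorem EdgeOk.congr {P : Prob} {χ ψ : ℕ → ℕ} {j : ℕ} (h : P.EdgeOk χ j)
    (ha : ψ (P.ea j) = χ (P.ea j)) (hb : ψ (P.eb j) = χ (P.eb j)) : P.EdgeOk ψ j := by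
  unfold EdgeOk; rw [ha, hb]; exact h

theorem VertexOk.congr {P : Prob} {χ ψ : ℕ → ℕ} {v : ℕ} (h : P.VertexOk χ v)
    (ha : ψ v = χ v) : P.VertexOk ψ v := by
  unfold VertexOk; rw [ha]; exact h

/-- One step of the dynamic program: the vertices of `C` that do not belong to `Y` are divided
into sets `D 0, …, D (r - 1)` without edges in between, whose neighbors belong to `Y`. -/
structure Splits (mX : ℕ) (X : ℕ → ℕ) (mY : ℕ) (Y : ℕ → ℕ) (C : Finset ℕ) (r : ℕ)
    (D : ℕ → Finset ℕ) : Prop where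
  mem_iff : ∀ v, v ∈ C ↔ mark P.n mX X mY Y v = 2 ∨ ∃ i < r, v ∈ D i
  notMem : ∀ v ∈ C, ¬ InTuple P.n mX X v
  part : ∀ i < r, ∀ v ∈ D i, v < P.n ∧ ¬ InTuple P.n mY Y v
  disj : ∀ i < r, ∀ i' < r, i ≠ i' → Disjoint (D i) (D i')
  part_edge : ∀ j < P.M, ∀ i < r, (P.ea j ∈ D i → P.eb j ∈ D i ∨ InTuple P.n mY Y (P.eb j)) ∧
    (P.eb j ∈ D i → P.ea j ∈ D i ∨ InTuple P.n mY Y (P.ea j))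
  edge : ∀ j < P.M, (P.ea j ∈ C → P.eb j ∈ C ∨ InTuple P.n mY Y (P.eb j)) ∧
    (P.eb j ∈ C → P.ea j ∈ C ∨ InTuple P.n mY Y (P.ea j))

/-- Once `X ∪ Y` is colored, the sets `D i` can be extended independently, since their outside
neighbors lie in `Y`. The tables are exact only up to `P.k`, which suffices: every summand is
bounded by the total. Requiring `ψ` to vanish off `X ∪ Y` leaves only finitely many colorings to be
searched. -/
theorem spec_combine {P : Prob} {mX mY r : ℕ} {X Y : ℕ → ℕ} {C : Finset ℕ} {D : ℕ → Finset ℕ}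
    (hS : P.Splits mX X mY Y C r D) {tab : ℕ → ℕ} {ctab : ℕ → ℕ → ℕ}
    (hchild : ∀ i < r, P.Spec mY Y (D i) (ctab i))
    (htab : ∀ i < P.Q ^ mX, ∀ b ≤ P.k, tab i ≤ b ↔ ∃ ψ, P.Col ψ ∧
      (∀ v, mark P.n mX X mY Y v = 0 → ψ v = 0) ∧ idx P.Q ψ X mX = i ∧
      P.LocalOk (mark P.n mX X mY Y) ψ ∧
      zeros ψ ((Finset.range P.n).filter fun v => mark P.n mX X mY Y v = 2) +
        ∑ i ∈ Finset.range r, ctab i (idx P.Q ψ Y mY) ≤ b) :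
    P.Spec mX X C tab := by
  classical
  intro χ hχ b hb
  rw [htab _ (idx_lt hχ.1 X mX) b hb]
  set mk := mark P.n mX X mY Y with hmk
  have two_lt : ∀ v, mk v = 2 → v < P.n := fun v hv => (mark_eq_two.1 hv).2.1
  constructor
  · rintro ⟨ψ, hψ, -, hidx, hok, hcost⟩
    have hX : ∀ v, InTuple P.n mX X v → ψ v = χ v := by
      rintro v ⟨-, j, hj, rfl⟩
      exact idx_inj hψ.1 hχ.1 hidx j hj
    have hlt : ∀ i < r, ctab i (idx P.Q ψ Y mY) ≤ P.k := fun i hi => by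
      have := Finset.single_le_sum (f := fun i => ctab i (idx P.Q ψ Y mY))
        (fun _ _ => Nat.zero_le _) (Finset.mem_range.2 hi)
      exact this.trans (by omega)
    have hex : ∀ i, ∃ χ', i < r → P.Col χ' ∧ (∀ v, v ∉ D i → χ' v = ψ v) ∧ P.Feasible χ' (D i) ∧
        zeros χ' (D i) ≤ ctab i (idx P.Q ψ Y mY) := by
      intro i
      by_cases hi : i < r
      · obtain ⟨χ', h⟩ := (hchild i hi ψ hψ _ (hlt i hi)).1 le_rfl
        exact ⟨χ', fun _ => h⟩
      · exact ⟨χ, fun h => absurd h hi⟩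
    choose φ hφ using hex
    -- Gluing: `ψ` on the part of `Y` outside `X`, the chosen extension `φ i` on each `D i`, and `χ`
    -- outside `C`.
    let χ' : ℕ → ℕ := fun v => if mk v = 2 then ψ v else
      if h : ∃ i < r, v ∈ D i then φ h.choose v else χ v
    have hD : ∀ i < r, ∀ v ∈ D i, χ' v = φ i v := by
      intro i hi v hv
      have h : ∃ i < r, v ∈ D i := ⟨i, hi, hv⟩
      have h2 : mk v ≠ 2 := fun h2 => (hS.part i hi v hv).2 (mark_eq_two.1 h2).2
      have : h.choose = i := by
        by_contra hne
        exact (Finset.disjoint_left.1 (hS.disj _ h.choose_spec.1 _ hi hne))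
          h.choose_spec.2 hv
      simp only [χ', h2, if_false, h, dif_pos, this]
    have h2 : ∀ v, mk v = 2 → χ' v = ψ v := fun v hv => by simp [χ', hv]
    have h3 : ∀ v, v ∉ C → χ' v = χ v := by
      intro v hv
      have a : mk v ≠ 2 := fun h => hv ((hS.mem_iff v).2 (.inl h))
      have c : ¬ ∃ i < r, v ∈ D i := fun h => hv ((hS.mem_iff v).2 (.inr h))
      simp only [χ', a, c, if_false, dif_neg, not_false_iff]
    have hY : ∀ v, InTuple P.n mY Y v → χ' v = ψ v := by
      intro v hv
      by_cases hx : InTuple P.n mX X v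
      · rw [h3 v fun h => hS.notMem v h hx, hX v hx]
      · exact h2 v (mark_eq_two.2 ⟨hx, hv⟩)
    have hYD : ∀ i < r, ∀ v, v ∈ D i ∨ InTuple P.n mY Y v → χ' v = φ i v := by
      rintro i hi v (hv | hv)
      · exact hD i hi v hv
      · rw [hY v hv, (hφ i hi).2.1 v fun h => (hS.part i hi v h).2 hv]
    have hcases : ∀ (p : ℕ → Prop), (∀ v, mk v = 2 → p v) → (∀ i < r, ∀ v ∈ D i, p v) →
        (∀ v, v ∉ C → p v) → ∀ v, p v := by
      intro p a c d v
      by_cases hv : v ∈ C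
      · rcases (hS.mem_iff v).1 hv with h | ⟨i, hi, h⟩
        exacts [a v h, c i hi v h]
      · exact d v hv
    refine ⟨χ', ⟨hcases _ ?_ ?_ ?_, hcases _ ?_ ?_ ?_⟩, h3, ⟨?_, ?_⟩, ?_⟩
    · intro v hv; rw [h2 v hv]; exact hψ.1 v
    · intro i hi v hv; rw [hD i hi v hv]; exact (hφ i hi).1.1 v
    · intro v hv; rw [h3 v hv]; exact hχ.1 v
    · intro v hv hn; rw [h2 v hv]; exact hψ.2 v hn
    · intro i hi v hv hn; rw [hD i hi v hv]; exact (hφ i hi).1.2 v hn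
    · intro v hv hn; rw [h3 v hv]; exact hχ.2 v hn
    · intro j hj hC
      -- An edge that meets some `D i` is taken care of by the feasibility of `φ i`. Any other edge
      -- that meets `C` has both ends in `Y` and one of them outside `X`, so that `LocalOk` covers
      -- it.
      by_cases hp : ∃ i < r, P.ea j ∈ D i ∨ P.eb j ∈ D i
      · obtain ⟨i, hi, hp⟩ := hp
        refine ((hφ i hi).2.2.1.1 j hj hp).congr (hYD i hi _ ?_) (hYD i hi _ ?_)
        · rcases hp with hp | hp
          exacts [.inl hp, (hS.part_edge j hj i hi).2 hp]
        · rcases hp with hp | hp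
          exacts [(hS.part_edge j hj i hi).1 hp, .inl hp]
      · push Not at hp
        have hC2 : ∀ v, v ∈ C → (∀ i < r, v ∉ D i) → mk v = 2 := fun v hv hn => by
          rcases (hS.mem_iff v).1 hv with h | ⟨i, hi, h⟩
          exacts [h, absurd h (hn i hi)]
        have e1 : ∀ v, v ∈ C ∨ InTuple P.n mY Y v → (∀ i < r, v ∉ D i) →
            InTuple P.n mY Y v := by
          rintro v (hv | hv) hn
          exacts [(mark_eq_two.1 (hC2 v hv hn)).2, hv]
        have hin : InTuple P.n mY Y (P.ea j) ∧ InTuple P.n mY Y (P.eb j) ∧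
            (mk (P.ea j) = 2 ∨ mk (P.eb j) = 2) := by
          rcases hC with h | h
          · have := hC2 _ h fun i hi => (hp i hi).1
            exact ⟨(mark_eq_two.1 this).2, e1 _ ((hS.edge j hj).1 h) fun i hi => (hp i hi).2,
              .inl this⟩
          · have := hC2 _ h fun i hi => (hp i hi).2
            exact ⟨e1 _ ((hS.edge j hj).2 h) fun i hi => (hp i hi).1, (mark_eq_two.1 this).2,
              .inr this⟩
        have pos : ∀ v, InTuple P.n mY Y v → mk v ≠ 0 := fun v hv h => (mark_eq_zero.1 h).2 hv
        have p1 := pos _ hin.1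
        have p2 := pos _ hin.2.1
        exact (hok.1 j hj (by omega)).congr (hY _ hin.1) (hY _ hin.2.1)
    · intro v hv
      rcases (hS.mem_iff v).1 hv with h | ⟨i, hi, h⟩
      · exact (hok.2 v h).congr (h2 v h)
      · exact ((hφ i hi).2.2.1.2 v h).congr (hD i hi v h)
    · refine le_trans ?_ hcost
      have hsub : (C.filter fun v => χ' v = 0) ⊆
          (((Finset.range P.n).filter fun v => mk v = 2).filter fun v => ψ v = 0) ∪
          (Finset.range r).biUnion fun i => (D i).filter fun v => φ i v = 0 := by
        intro v hv
        simp only [Finset.mem_filter, Finset.mem_union, Finset.mem_biUnion, Finset.mem_range] at hv ⊢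
        rcases (hS.mem_iff v).1 hv.1 with h | ⟨i, hi, h⟩
        · exact .inl ⟨⟨two_lt v h, h⟩, by rw [← h2 v h]; exact hv.2⟩
        · exact .inr ⟨i, hi, h, by rw [← hD i hi v h]; exact hv.2⟩
      refine (Finset.card_le_card hsub).trans ((Finset.card_union_le _ _).trans ?_)
      refine add_le_add le_rfl (Finset.card_biUnion_le.trans (Finset.sum_le_sum fun i hi => ?_))
      exact (hφ i (Finset.mem_range.1 hi)).2.2.2
  · rintro ⟨χ', hχ', hext, hfeas, hcost⟩
    have hDC : ∀ i < r, ∀ v ∈ D i, v ∈ C := fun i hi v hv => (hS.mem_iff v).2 (.inr ⟨i, hi, hv⟩)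
    -- Conversely, a given extension is cut down to `X ∪ Y`; what it does on the sets `D i` bounds
    -- the entries of their tables.
    let ψ : ℕ → ℕ := fun v => if mk v = 0 then 0 else χ' v
    have hQ : 0 < P.Q := (Nat.zero_le _).trans_lt (hχ.1 0)
    have hψ : P.Col ψ := by
      refine ⟨fun v => ?_, fun v hv => ?_⟩
      · simp only [ψ]; split_ifs
        exacts [hQ, hχ'.1 v]
      · simp only [ψ, hχ'.2 v hv, ite_self]
    have hmk0 : ∀ v, mk v ≠ 0 → ψ v = χ' v := fun v hv => by simp [ψ, hv]
    have hY : ∀ v, InTuple P.n mY Y v → ψ v = χ' v := fun v hv =>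
      hmk0 v fun h => (mark_eq_zero.1 h).2 hv
    refine ⟨ψ, hψ, fun v hv => by simp [ψ, hv], idx_congr fun j hj => ?_, ⟨?_, ?_⟩, ?_⟩
    · by_cases hn : X j < P.n
      · have hin : InTuple P.n mX X (X j) := ⟨hn, j, hj, rfl⟩
        rw [hmk0 _ fun h => (mark_eq_zero.1 h).1 hin, hext _ fun h => hS.notMem _ h hin]
      · rw [hψ.2 _ (by omega), hχ.2 _ (by omega)]
    · intro j hj hm
      have l1 := mark_le P.n mX mY (P.ea j) X Y
      have l2 := mark_le P.n mX mY (P.eb j) X Y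
      rw [← hmk] at l1 l2
      refine (hfeas.1 j hj ?_).congr (hmk0 _ (by omega)) (hmk0 _ (by omega))
      have : mk (P.ea j) = 2 ∨ mk (P.eb j) = 2 := by omega
      exact this.imp (fun h => (hS.mem_iff _).2 (.inl h)) fun h => (hS.mem_iff _).2 (.inl h)
    · intro v hv
      exact (hfeas.2 v ((hS.mem_iff v).2 (.inl hv))).congr (hmk0 v (by omega))
    · have hle : ∀ i < r, zeros χ' (D i) ≤ b := fun i hi =>
        (Finset.card_le_card (Finset.filter_subset_filter _ (hDC i hi))).trans hcost
      -- The witness agrees with `χ'` on `D i` and with `ψ` elsewhere. On `Y` both coincide, so the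
      -- edges at `D i` do not notice the difference.
      have hc : ∀ i < r, ctab i (idx P.Q ψ Y mY) ≤ zeros χ' (D i) := by
        intro i hi
        refine (hchild i hi ψ hψ _ ((hle i hi).trans hb)).2
          ⟨fun v => if v ∈ D i then χ' v else ψ v, ⟨fun v => ?_, fun v hv => ?_⟩, fun v hv => ?_,
            ⟨fun j hj hD => ?_, fun v hv => ?_⟩, ?_⟩
        · simp only; split_ifs
          exacts [hχ'.1 v, hψ.1 v]
        · simp only [hχ'.2 v hv, hψ.2 v hv, ite_self]
        · simp [hv]
        · have hval : ∀ v, v ∈ D i ∨ InTuple P.n mY Y v →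
              (if v ∈ D i then χ' v else ψ v) = χ' v := by
            intro v hv
            split_ifs with h
            · rfl
            · exact hY v (hv.resolve_left h)
          refine (hfeas.1 j hj (hD.imp (hDC i hi _) (hDC i hi _))).congr (hval _ ?_) (hval _ ?_)
          · rcases hD with hp | hp
            exacts [.inl hp, (hS.part_edge j hj i hi).2 hp]
          · rcases hD with hp | hp
            exacts [(hS.part_edge j hj i hi).1 hp, .inl hp]
        · exact (hfeas.2 v (hDC i hi v hv)).congr (by simp [hv])
        · refine Finset.card_le_card fun v hv => ?_
          simp only [Finset.mem_filter] at hv ⊢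
          exact ⟨hv.1, by simpa [hv.1] using hv.2⟩
      refine le_trans (add_le_add le_rfl (Finset.sum_le_sum fun i hi =>
        hc i (Finset.mem_range.1 hi))) (le_trans ?_ hcost)
      have hdisj : ∀ i ∈ Finset.range r, ∀ i' ∈ Finset.range r, i ≠ i' →
          Disjoint ((D i).filter fun v => χ' v = 0) ((D i').filter fun v => χ' v = 0) :=
        fun i hi i' hi' hne => Finset.disjoint_filter_filter
          (hS.disj i (Finset.mem_range.1 hi) i' (Finset.mem_range.1 hi') hne)
      unfold zeros
      rw [← Finset.card_biUnion hdisj, ← Finset.card_union_of_disjoint]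
      · refine Finset.card_le_card fun v hv => ?_
        simp only [Finset.mem_filter, Finset.mem_union, Finset.mem_biUnion, Finset.mem_range] at hv ⊢
        rcases hv with ⟨⟨h1, h2⟩, h3⟩ | ⟨i, hi, h1, h2⟩
        · exact ⟨(hS.mem_iff v).2 (.inl h2), by rw [← hmk0 v (by omega)]; exact h3⟩
        · exact ⟨hDC i hi v h1, h2⟩
      · rw [Finset.disjoint_left]
        intro v hv hv'
        simp only [Finset.mem_filter, Finset.mem_biUnion, Finset.mem_range] at hv hv'
        obtain ⟨i, hi, h1, h2⟩ := hv'
        exact (hS.part i hi v h1).2 (mark_eq_two.1 hv.1.2).2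

end Prob


/-! ### Separators and colorings -/

section Paths

variable {V : Type} {G : TemporalGraph V}

/-- Temporal paths as functions on the natural numbers. -/
def PathFn (G : TemporalGraph V) (s z : V) (l : ℕ) (v : ℕ → V) (t : ℕ → ℕ) : Prop :=
  v 0 = s ∧ v l = z ∧ (∀ i ≤ l, ∀ j ≤ l, v i = v j → i = j) ∧
    (∀ i j, i ≤ j → j < l → t i ≤ t j) ∧ ∀ i < l, (s(v i, v (i + 1)), t i) ∈ G.edges

theorem hasTemporalPath_iff {s z : V} :
    G.HasTemporalPath s z ↔ ∃ l v t, PathFn G s z l v t := by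
  constructor
  · rintro ⟨l, v, t, h0, hl, hinj, hmono, he⟩
    refine ⟨l, fun i => if h : i < l + 1 then v ⟨i, h⟩ else s,
      fun i => if h : i < l then t ⟨i, h⟩ else 0, ?_, ?_, ?_, ?_, ?_⟩
    · simpa using h0
    · simp only [Nat.lt_succ_self, dif_pos]; exact hl
    · intro i hi j hj h
      simp only at h
      rw [dif_pos (by omega), dif_pos (by omega)] at h
      simpa using hinj h
    · intro i j hij hj
      simp only
      rw [dif_pos (by omega), dif_pos hj]
      exact hmono (by simpa using hij)
    · intro i hi
      simp only
      rw [dif_pos (by omega), dif_pos (by omega), dif_pos hi]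
      exact he ⟨i, hi⟩
  · rintro ⟨l, v, t, h0, hl, hinj, hmono, he⟩
    refine ⟨l, fun i => v i, fun i => t i, by simpa using h0, by simpa using hl, ?_, ?_, ?_⟩
    · intro i j h
      exact Fin.ext (hinj i (by omega) j (by omega) h)
    · intro i j hij
      exact hmono i j hij j.2
    · intro i
      exact he i i.2

/-- `v` can be reached from `s` by a temporal path with labels of rank at most `r`. -/
def Reach (G : TemporalGraph V) (ρ : ℕ → ℕ) (s w : V) (r : ℕ) : Prop :=
  ∃ l v t, PathFn G s w l v t ∧ ∀ i < l, ρ (t i) ≤ r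

/-- If `b` already lies on the path, the path is cut off there; otherwise the edge is appended.
Either way the vertices stay distinct. The hypothesis on `ρ` turns comparisons of ranks back into
comparisons of labels. -/
theorem Reach.step {ρ : ℕ → ℕ} (hρ : ∀ e ∈ G.edges, ∀ e' ∈ G.edges, ρ e.2 ≤ ρ e'.2 → e.2 ≤ e'.2)
    {s a b : V} {r t : ℕ} (h : Reach G ρ s a r) (hr : r ≤ ρ t) (he : (s(a, b), t) ∈ G.edges) :
    Reach G ρ s b (ρ t) := by
  obtain ⟨l, v, u, ⟨h0, hl, hinj, hmono, hedge⟩, hu⟩ := h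
  by_cases hb : ∃ i ≤ l, v i = b
  · obtain ⟨i, hi, rfl⟩ := hb
    exact ⟨i, v, u, ⟨h0, rfl, fun j hj j' hj' h => hinj j (by omega) j' (by omega) h,
      fun j j' h h' => hmono j j' h (by omega), fun j hj => hedge j (by omega)⟩,
      fun j hj => (hu j (by omega)).trans hr⟩
  · push Not at hb
    refine ⟨l + 1, fun i => if i ≤ l then v i else b, fun i => if i < l then u i else t,
      ⟨by simpa using h0, by simp, ?_, ?_, ?_⟩, ?_⟩
    · intro i hi j hj h
      simp only at h
      split_ifs at h with h1 h2 h2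
      · exact hinj i h1 j h2 h
      · exact absurd h (hb i h1)
      · exact absurd h.symm (hb j h2)
      · omega
    · intro i j hij hj
      simp only
      split_ifs with h1 h2 h2
      · exact hmono i j hij h2
      · exact hρ _ (hedge i h1) _ he ((hu i h1).trans hr)
      · omega
      · exact le_rfl
    · intro i hi
      rcases Nat.lt_succ_iff_lt_or_eq.1 hi with h1 | rfl
      · simpa [h1, h1.le] using hedge i h1
      · simpa [hl] using he
    · intro i hi
      simp only
      split_ifs with h1
      exacts [(hu i h1).trans hr, le_rfl]

theorem mem_delete {S : Finset V} {a b : V} {t : ℕ} :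
    (s(a, b), t) ∈ (G.delete S).edges ↔ (s(a, b), t) ∈ G.edges ∧ a ∉ S ∧ b ∉ S := by
  classical
  simp [TemporalGraph.delete]

theorem edges_delete_subset (S : Finset V) : (G.delete S).edges ⊆ G.edges := by
  classical exact fun e he => Finset.mem_of_mem_filter e he

end Paths

section Instance

variable {n : ℕ}

def labels (L : List (Fin n × Fin n × ℕ)) : Finset ℕ := (L.map fun e => e.2.2).toFinset

/-- The rank of a label. -/
def rank (L : List (Fin n × Fin n × ℕ)) (t : ℕ) : ℕ := ((labels L).filter (· ≤ t)).card

theorem rank_le_card (L : List (Fin n × Fin n × ℕ)) (t : ℕ) : rank L t ≤ (labels L).card :=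
  Finset.card_le_card (Finset.filter_subset _ _)

theorem rank_mono (L : List (Fin n × Fin n × ℕ)) : Monotone (rank L) := fun t t' h =>
  Finset.card_le_card fun x hx => by
    simp only [Finset.mem_filter] at hx ⊢
    exact ⟨hx.1, hx.2.trans h⟩

theorem rank_lt (L : List (Fin n × Fin n × ℕ)) {t t' : ℕ} (h : t < t') (ht : t' ∈ labels L) :
    rank L t < rank L t' := by
  refine Finset.card_lt_card ⟨fun x hx => ?_, fun hsub => ?_⟩
  · simp only [Finset.mem_filter] at hx ⊢
    exact ⟨hx.1, hx.2.trans h.le⟩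
  · have := hsub (Finset.mem_filter.2 ⟨ht, le_rfl⟩)
    simp only [Finset.mem_filter] at this
    omega

/-- The instance with its labels replaced by their ranks. -/
def SeparationProb (I : SeparationInstance n) (L : List (Fin n × Fin n × ℕ)) : Prob where
  n := n
  M := L.length
  Q := (labels L).card + 2
  k := I.k
  s := I.s
  z := I.z
  ea j := (L.map fun e => (e.1 : ℕ)).getD j 0
  eb j := (L.map fun e => (e.2.1 : ℕ)).getD j 0
  et j := (L.map fun e => rank L e.2.2).getD j 0

variable {I : SeparationInstance n} {L : List (Fin n × Fin n × ℕ)}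

theorem separationProb_edge {j : ℕ} (hj : j < L.length) :
    (SeparationProb I L).ea j = L[j].1 ∧ (SeparationProb I L).eb j = L[j].2.1 ∧
      (SeparationProb I L).et j = rank L L[j].2.2 := by
  simp [SeparationProb, hj]

theorem edge_mem_of_listing (hL : I.graph.IsListing L) {j : ℕ} (hj : j < L.length) :
    (s(L[j].1, L[j].2.1), L[j].2.2) ∈ I.graph.edges := by
  rw [hL.2.1]
  exact List.mem_map.2 ⟨L[j], List.getElem_mem hj, rfl⟩

theorem exists_listing_of_edge (hL : I.graph.IsListing L) {a b : Fin n} {t : ℕ}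
    (h : (s(a, b), t) ∈ I.graph.edges) : ∃ j, ∃ hj : j < L.length, L[j].2.2 = t ∧
      (L[j].1 = a ∧ L[j].2.1 = b ∨ L[j].1 = b ∧ L[j].2.1 = a) := by
  rw [hL.2.1] at h
  obtain ⟨e, he, h⟩ := List.mem_map.1 h
  obtain ⟨j, hj, rfl⟩ := List.getElem_of_mem he
  simp only [Prod.mk.injEq, Sym2.eq_iff] at h
  exact ⟨j, hj, h.2, h.1⟩

theorem label_mem_labels (hL : I.graph.IsListing L) {e : Sym2 (Fin n) × ℕ}
    (h : e ∈ I.graph.edges) : e.2 ∈ labels L := by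
  rw [hL.2.1] at h
  obtain ⟨e, he, rfl⟩ := List.mem_map.1 h
  simp only [labels, List.mem_toFinset, List.mem_map]
  exact ⟨e, he, rfl⟩

/-- A separator gives the coloring by arrival ranks in `G - S`; its edge conditions are `Reach.step`
in both directions. For a feasible coloring, the vertices of color 0 form a separator: along a
temporal path that avoids them, the color of each vertex is at most the rank of the label by which
the path leaves it, so `z` would have a color at most the number of labels, which is less than `Q -
1`. -/
theorem isYes_iff (hL : I.graph.IsListing L) :
    I.IsYes ↔ ∃ χ, (SeparationProb I L).Col χ ∧
      (SeparationProb I L).Feasible χ (Finset.range n) ∧ zeros χ (Finset.range n) ≤ I.k := by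
  classical
  set P := SeparationProb I L with hP
  have edge_iff : ∀ {a b : Fin n} {t : ℕ}, (s(a, b), t) ∈ I.graph.edges →
      ∀ χ, (P.Feasible χ (Finset.range n)) → 0 < χ a → 0 < χ b → (χ a ≤ rank L t ↔ χ b ≤ rank L t) := by
    intro a b t h χ hχ ha hb
    obtain ⟨j, hj, rfl, hab⟩ := exists_listing_of_edge hL h
    obtain ⟨h1, h2, h3⟩ := separationProb_edge (I := I) hj
    have := hχ.1 j hj (.inl (by rw [hP, h1]; simp))
    rw [Prob.EdgeOk, hP, h1, h2, h3] at this
    rcases hab with ⟨rfl, rfl⟩ | ⟨rfl, rfl⟩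
    exacts [this ha hb, (this hb ha).symm]
  constructor
  · rintro ⟨S, ⟨hs, hz, hpath⟩, hk⟩
    set G := I.graph.delete S with hG
    have hsub : ∀ e ∈ G.edges, e ∈ I.graph.edges := edges_delete_subset S
    have hρ : ∀ e ∈ G.edges, ∀ e' ∈ G.edges, rank L e.2 ≤ rank L e'.2 → e.2 ≤ e'.2 := by
      intro e he e' _ h
      by_contra! hlt
      exact absurd (rank_lt L hlt (label_mem_labels hL (hsub e he))) (by omega)
    -- The condition `1 ≤ r` matters: the empty path reaches `s` at rank 0, but the color 0 is
    -- reserved for the separator.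
    let A : Fin n → ℕ → Prop := fun v r => 1 ≤ r ∧ Reach G (rank L) I.s v r
    let f : Fin n → ℕ := fun v => if v ∈ S then 0 else
      if h : ∃ r, r ≤ (labels L).card ∧ A v r then Nat.find h else (labels L).card + 1
    let χ : ℕ → ℕ := fun v => if h : v < n then f ⟨v, h⟩ else 0
    have hf : ∀ v, f v ≤ (labels L).card + 1 := by
      intro v
      simp only [f]
      split_ifs with h1 h2
      · omega
      · exact (Nat.find_spec h2).1.trans (by omega)
      · exact le_rfl
    have hχ : ∀ v : Fin n, χ v = f v := fun v => by simp [χ]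
    have hf0 : ∀ v, f v = 0 ↔ v ∈ S := by
      intro v
      simp only [f]
      split_ifs with h1 h2
      · simp [h1]
      · have := (Nat.find_spec h2).2.1
        simp only [h1, iff_false]; omega
      · simp [h1]
    have hstep : ∀ a b t, (s(a, b), t) ∈ I.graph.edges → a ∉ S → b ∉ S → f a ≤ rank L t →
        f b ≤ rank L t := by
      intro a b t h ha hb hle
      have hrl := rank_le_card L t
      have hmem : (s(a, b), t) ∈ G.edges := mem_delete.2 ⟨h, ha, hb⟩
      by_cases hex : ∃ r, r ≤ (labels L).card ∧ A a r
      · have e : f a = Nat.find hex := by simp only [f, ha, if_false, hex, dif_pos]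
        have hA := (Nat.find_spec hex).2
        rw [← e] at hA
        have hB : rank L t ≤ (labels L).card ∧ A b (rank L t) :=
          ⟨hrl, hA.1.trans hle, hA.2.step hρ hle hmem⟩
        have hex' : ∃ r, r ≤ (labels L).card ∧ A b r := ⟨_, hB⟩
        have e : f b = Nat.find hex' := by simp only [f, hb, if_false, hex', dif_pos]
        rw [e]
        exact Nat.find_min' hex' hB
      · have e : f a = (labels L).card + 1 := by
          simp only [f, ha, if_false, hex, dif_neg, not_false_iff]
        omega
    refine ⟨χ, ⟨fun v => ?_, fun v hv => ?_⟩, ⟨fun j hj _ => ?_, fun v hv => ⟨?_, ?_⟩⟩, ?_⟩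
    · simp only [χ]
      split_ifs with h
      · have := hf ⟨v, h⟩
        simp only [hP, SeparationProb]; omega
      · simp [hP, SeparationProb]
    · have : ¬ v < n := not_lt.2 hv
      simp [χ, this]
    · obtain ⟨h1, h2, h3⟩ := separationProb_edge (I := I) hj
      have he := edge_mem_of_listing hL hj
      rw [Prob.EdgeOk, hP, h1, h2, h3, hχ, hχ]
      intro ha hb
      have ha' : L[j].1 ∉ S := fun h => by rw [(hf0 _).2 h] at ha; omega
      have hb' : L[j].2.1 ∉ S := fun h => by rw [(hf0 _).2 h] at hb; omega
      exact ⟨hstep _ _ _ he ha' hb', hstep _ _ _ (by rwa [Sym2.eq_swap]) hb' ha'⟩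
    · rintro rfl
      change χ I.s = 1
      rw [hχ]
      have hA : A I.s 1 := ⟨le_rfl, 0, fun _ => I.s, fun _ => 0,
        ⟨rfl, rfl, by omega, by omega, by omega⟩, by omega⟩
      -- Without any label, `(labels L).card + 1 = 1` is the only positive color, and the claim
      -- holds for this reason.
      by_cases h1 : 1 ≤ (labels L).card
      · have hex : ∃ r, r ≤ (labels L).card ∧ A I.s r := ⟨1, h1, hA⟩
        have e : f I.s = Nat.find hex := by simp only [f, hs, if_false, hex, dif_pos]
        rw [e]
        exact le_antisymm (Nat.find_min' hex ⟨h1, hA⟩) (Nat.find_spec hex).2.1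
      · have := hf I.s
        have h0 : f I.s ≠ 0 := fun h => hs ((hf0 _).1 h)
        omega
    · rintro rfl
      change χ I.z = (labels L).card + 1
      rw [hχ]
      have hex : ¬ ∃ r, r ≤ (labels L).card ∧ A I.z r := by
        rintro ⟨r, -, -, l, v, t, h, -⟩
        exact hpath (hasTemporalPath_iff.2 ⟨l, v, t, h⟩)
      simp only [f, hz, if_false, hex, dif_neg, not_false_iff]
    · refine le_trans ?_ hk
      refine Finset.card_le_card_of_injOn (fun v => if h : v < n then ⟨v, h⟩ else I.s) ?_ ?_
      · intro v hv
        simp only [Finset.coe_filter, Finset.mem_range, Set.mem_ofPred_eq] at hv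
        simp only [hv.1, dif_pos, Finset.mem_coe]
        rw [← hf0, ← hχ]
        exact hv.2
      · intro v hv w hw h
        simp only [Finset.coe_filter, Finset.mem_range, Set.mem_ofPred_eq] at hv hw
        simpa [hv.1, hw.1] using h
  · rintro ⟨χ, hχ, hfeas, hk⟩
    have hs1 : χ I.s = 1 := (hfeas.2 I.s (by simp)).1 rfl
    have hz1 : χ I.z = (labels L).card + 1 := (hfeas.2 I.z (by simp)).2 rfl
    refine ⟨Finset.univ.filter fun v => χ v = 0, ⟨by simp [hs1], by simp [hz1], ?_⟩, ?_⟩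
    · rw [hasTemporalPath_iff]
      rintro ⟨l, v, t, h0, hl, -, hmono, he⟩
      have hpos : ∀ i < l, 0 < χ (v i) ∧ 0 < χ (v (i + 1)) := by
        intro i hi
        have := (mem_delete.1 (he i hi)).2
        simpa [Nat.pos_iff_ne_zero] using this
      have hmem : ∀ i < l, (s(v i, v (i + 1)), t i) ∈ I.graph.edges := fun i hi =>
        (mem_delete.1 (he i hi)).1
      have hlt : 0 < l := by
        rcases Nat.eq_zero_or_pos l with rfl | h
        · exact absurd (h0.symm.trans hl) I.s_ne_z
        · exact h
      -- The induction starts because `s` has color 1 and a label that occurs has rank at least 1.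
      -- It proceeds by the edge condition and the monotonicity of the labels.
      have hbefore : ∀ i, i < l → χ (v i) ≤ rank L (t i) := by
        intro i
        induction i with
        | zero =>
          intro hi
          rw [h0, hs1]
          refine Finset.card_pos.2 ⟨t 0, ?_⟩
          simpa using label_mem_labels hL (hmem 0 hi)
        | succ i ih =>
          intro hi
          have := (edge_iff (hmem i (by omega)) χ hfeas (hpos i (by omega)).1
            (hpos i (by omega)).2).1 (ih (by omega))
          exact this.trans (rank_mono L (hmono i (i + 1) (by omega) hi))
      have := (edge_iff (hmem (l - 1) (by omega)) χ hfeas (hpos _ (by omega)).1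
        (hpos _ (by omega)).2).1 (hbefore (l - 1) (by omega))
      rw [Nat.sub_add_cancel hlt, hl, hz1] at this
      have := rank_le_card L (t (l - 1))
      omega
    · refine le_trans ?_ hk
      refine Finset.card_le_card_of_injOn (fun v => (v : ℕ)) ?_ fun v _ w _ h => Fin.ext h
      intro v hv
      simpa using hv

end Instance


/-! ### Subroutines -/

infixr:60 " ;; " => Cmd.seq

open Cmd SepAlg.Expr

/-- `x := x + n * y` -/
def addLoop (x y i n : ℕ) : Cmd := .loop i n (.set x (.reg x + .reg y))

theorem addLoop_exec {x y i n : ℕ} (hxy : x ≠ y) (hxi : x ≠ i) (hyi : y ≠ i)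
    (σ : St) : ((addLoop x y i n).exec σ).reg x = σ.reg x + σ.reg n * σ.reg y := by
  refine (exec_loop (fun k τ => τ.reg x = σ.reg x + k * σ.reg y) (by simp [hxi])
    fun k τ hk hi hag h => ?_)
  have hy : τ.reg y = σ.reg y := hag.1 y (by simp [hyi, hxy.symm])
  simp [hxi, h, hy]; ring

/-- `d := q ^ e`, where `q` and `e` are registers. -/
def powCode (d q e : ℕ) : Cmd :=
  .set d 1 ;; .loop 16 e (.set 19 0 ;; addLoop 19 d 18 q ;; .set d (.reg 19))

theorem powCode_exec {d q e : ℕ} (hd : d ∉ [16, 18, 19]) (hq : q ∉ [16, 18, 19])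
    (hqd : q ≠ d) (hed : e ≠ d) (σ : St) :
    ((powCode d q e).exec σ).reg d = σ.reg q ^ σ.reg e := by
  simp only [List.mem_cons, List.not_mem_nil, or_false, not_or] at hd hq
  have h := exec_loop (P := .set 19 0 ;; addLoop 19 d 18 q ;; .set d (.reg 19)) (i := 16) (n := e)
    (σ := (Cmd.set d 1).exec σ) (fun k τ => τ.reg d = σ.reg q ^ k) (by simp [hd.1])
    fun k τ hk hi hag h => by
      have h1 : τ.reg q = σ.reg q := by
        rw [hag.1 q (by simp [addLoop, hq, hqd])]; simp [hqd]
      have := addLoop_exec (x := 19) (y := d) (i := 18) (n := q) (Ne.symm hd.2.2) (by decide)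
        hd.2.1 (τ.setReg 19 0)
      simp [hd.1, this, hd.2.2, hq.2.2, h1, h]
      ring
  simpa [hed, powCode] using h

/-- Clear the marks and the colors. -/
def clearCode : Cmd := .loop 16 26 (.put 7 (.reg 16) 0 ;; .put 8 (.reg 16) 0)

/-- Only a bounded range is cleared; the hypotheses, kept as invariants of the programs, provide the
zeros beyond it. -/
theorem clearCode_exec (σ : St) (h7 : ∀ v, σ.reg 26 ≤ v → σ.arr 7 v = 0)
    (h8 : ∀ v, σ.reg 26 ≤ v → σ.arr 8 v = 0) :
    (∀ v, (clearCode.exec σ).arr 7 v = 0) ∧ ∀ v, (clearCode.exec σ).arr 8 v = 0 := by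
  have h := exec_loop (P := .put 7 (.reg 16) 0 ;; .put 8 (.reg 16) 0) (i := 16) (n := 26) (σ := σ)
    (fun k τ => ∀ v, (v < k ∨ σ.reg 26 ≤ v) → τ.arr 7 v = 0 ∧ τ.arr 8 v = 0)
    (by rintro v (hv | hv); exacts [by omega, ⟨h7 v hv, h8 v hv⟩])
    fun k τ hk hi hag h v hv => by
      simp only [exec_seq, exec_put, eval, St.arr_setReg, St.arr_setArr, St.reg_setArr, hi]
      by_cases hvk : v = k
      · simp [hvk]
      · simpa [Function.update_apply, hvk] using h v (by omega)
  exact ⟨fun v => (h v (by omega)).1, fun v => (h v (by omega)).2⟩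

/-- The first `u` entries of `U` enumerate the support of `mk`. -/
def Enum (u : ℕ) (U mk : ℕ → ℕ) : Prop :=
  (∀ v, mk v ≠ 0 ↔ ∃ j < u, U j = v) ∧ ∀ i < u, ∀ j < u, U i = U j → i = j

/-- Append the unmarked vertices in the tuple in array `a`, whose length is in register `m`, to the
list `6` and mark them with `b`. -/
def buildCode (a m b : ℕ) : Cmd :=
  .loop 16 m (.set 24 (.get a (.reg 16)) ;;
    .ite (.reg 24) (.reg 1) (.ite (.get 7 (.reg 24)) 1
      (.put 7 (.reg 24) (.lit b) ;; .put 6 (.reg 12) (.reg 24) ;; .set 12 (.reg 12 + 1)) .skip)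
      .skip)

-- Entries that are not vertices are skipped as empty places, and vertices that already carry a mark
-- are left alone. So repetitions do no harm, and a vertex in both tuples keeps the mark of the
-- first.
open Classical in
theorem buildCode_exec {a m b : ℕ} (ha : a ∉ [6, 7]) (hb : b ≠ 0)
    (σ : St) (hE : Enum (σ.reg 12) (σ.arr 6) (σ.arr 7)) :
    Enum (((buildCode a m b).exec σ).reg 12) (((buildCode a m b).exec σ).arr 6)
      (((buildCode a m b).exec σ).arr 7) ∧
    ∀ v, ((buildCode a m b).exec σ).arr 7 v = if σ.arr 7 v ≠ 0 then σ.arr 7 v else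
      if InTuple (σ.reg 1) (σ.reg m) (σ.arr a) v then b else 0 := by
  simp only [List.mem_cons, List.not_mem_nil, or_false, not_or] at ha
  refine exec_loop (fun k τ => Enum (τ.reg 12) (τ.arr 6) (τ.arr 7) ∧
    ∀ v, τ.arr 7 v = if σ.arr 7 v ≠ 0 then σ.arr 7 v else
      if InTuple (σ.reg 1) k (σ.arr a) v then b else 0) ⟨by simpa using hE, by
        intro v; simp [InTuple]⟩ ?_
  rintro k τ hk hi hag ⟨hE, hmk⟩
  have h1 : τ.reg 1 = σ.reg 1 := hag.1 1 (by simp)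
  have hA : τ.arr a = σ.arr a := hag.2 a (by simp [ha])
  have hin : ∀ v, InTuple (σ.reg 1) (k + 1) (σ.arr a) v ↔
      InTuple (σ.reg 1) k (σ.arr a) v ∨ v = σ.arr a k ∧ v < σ.reg 1 := by
    intro v
    simp only [InTuple, Nat.lt_succ_iff_lt_or_eq]
    constructor
    · rintro ⟨h, j, hj | rfl, rfl⟩
      exacts [.inl ⟨h, j, hj, rfl⟩, .inr ⟨rfl, h⟩]
    · rintro (⟨h, j, hj, rfl⟩ | ⟨rfl, h⟩)
      exacts [⟨h, j, .inl hj, rfl⟩, ⟨h, k, .inr rfl, rfl⟩]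
  simp only [hin]
  by_cases hlt : σ.arr a k < σ.reg 1
  · by_cases h0 : τ.arr 7 (σ.arr a k) = 0
    · simp only [exec_seq, exec_ite, exec_set, exec_put, exec_skip, eval,
        St.reg_setReg, St.arr_setReg, hi, hA, h1, hlt, h0, zero_lt_one, if_true, Nat.reduceEqDiff,
        if_false, St.reg_setArr, St.arr_setArr, OfNat.one_ne_ofNat]
      refine ⟨⟨fun v => ?_, ?_⟩, fun v => ?_⟩
      · simp only [Function.update_apply]
        by_cases hv : v = σ.arr a k
        · subst hv
          simp only [if_true, ne_eq, hb, not_false_iff, true_iff]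
          exact ⟨τ.reg 12, by omega, by simp⟩
        · simp only [hv, if_false, hE.1 v]
          constructor
          · rintro ⟨j, hj, rfl⟩
            exact ⟨j, by omega, by rw [if_neg (by omega)]⟩
          · rintro ⟨j, hj, h⟩
            by_cases hj' : j = τ.reg 12
            · simp only [hj', if_true] at h; exact absurd h.symm hv
            · simp only [hj', if_false] at h; exact ⟨j, by omega, h⟩
      · have hne : ∀ j < τ.reg 12, τ.arr 6 j ≠ σ.arr a k := fun j hj h =>
          (hE.1 _).2 ⟨j, hj, h⟩ h0
        intro i hi j hj h
        simp only [Function.update_apply] at h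
        split_ifs at h with c d d
        · omega
        · exact absurd h.symm (hne j (by omega))
        · exact absurd h (hne i (by omega))
        · exact hE.2 i (by omega) j (by omega) h
      · simp only [Function.update_apply]
        by_cases hv : v = σ.arr a k
        · subst hv
          have := hmk (σ.arr a k)
          rw [h0] at this
          by_cases hs : σ.arr 7 (σ.arr a k) = 0
          · simp [hs, hlt]
          · simp only [ne_eq, hs, not_false_iff, if_true] at this
            exact absurd this.symm hs
        · simp only [hv, if_false, hmk v, false_and, or_false]
    · simp only [exec_seq, exec_ite, exec_set, exec_skip, eval, St.reg_setReg,
        St.arr_setReg, hi, hA, h1, hlt, Nat.lt_one_iff, h0, if_true, if_false,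
        OfNat.one_ne_ofNat, Nat.reduceEqDiff]
      refine ⟨hE, fun v => ?_⟩
      by_cases hv : v = σ.arr a k
      · subst hv
        have := hmk (σ.arr a k)
        rw [this]
        by_cases hs : σ.arr 7 (σ.arr a k) = 0
        · by_cases hin : InTuple (σ.reg 1) k (σ.arr a) (σ.arr a k)
          · simp [hs, hlt, hin]
          · simp [hs, hin] at this
            exact absurd this h0
        · simp [hs]
      · simp only [hmk v, hv, false_and, or_false]
  · simp only [exec_seq, exec_ite, exec_set, exec_skip, eval, St.reg_setReg,
      St.arr_setReg, hi, hA, h1, hlt, if_true, if_false, OfNat.one_ne_ofNat, Nat.reduceEqDiff]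
    refine ⟨hE, fun v => ?_⟩
    have : ¬ (v = σ.arr a k ∧ v < σ.reg 1) := by rintro ⟨rfl, h⟩; exact hlt h
    simp only [hmk v, this, or_false]

/-- Compute the index of the current coloring of the tuple in array `a`. -/
def indexCode (a m : ℕ) : Cmd :=
  .set 20 0 ;; .loop 16 m (.set 19 0 ;; addLoop 19 20 18 3 ;;
    .set 20 (.reg 19 + .get 8 (.get a (.reg 16))))

theorem indexCode_exec {a m : ℕ} (hm : m ∉ [16, 18, 19, 20]) (σ : St) :
    ((indexCode a m).exec σ).reg 20 = idx (σ.reg 3) (σ.arr 8) (σ.arr a) (σ.reg m) := by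
  simp only [List.mem_cons, List.not_mem_nil, or_false, not_or] at hm
  have h := exec_loop (P := .set 19 0 ;; addLoop 19 20 18 3 ;;
      .set 20 (.reg 19 + .get 8 (.get a (.reg 16)))) (i := 16) (n := m)
    (σ := (Cmd.set 20 0).exec σ) (fun k τ => τ.reg 20 = idx (σ.reg 3) (σ.arr 8) (σ.arr a) k)
    (by simp [idx])
    fun k τ hk hi hag h => by
      have h1 : τ.reg 3 = σ.reg 3 := by
        rw [hag.1 3 (by simp [addLoop])]; simp
      have h8 : τ.arr 8 = σ.arr 8 := by
        rw [hag.2 8 (by simp [addLoop])]; simp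
      have ha : τ.arr a = σ.arr a := by
        rw [hag.2 a (by simp [addLoop])]; simp
      have e1 := addLoop_exec (x := 19) (y := 20) (i := 18) (n := 3) (by decide) (by decide)
        (by decide) (τ.setReg 19 0)
      have e2 : ((addLoop 19 20 18 3).exec (τ.setReg 19 0)).reg 16 = k := by
        rw [reg_exec (by simp [addLoop])]; simp [hi]
      have e3 : ((addLoop 19 20 18 3).exec (τ.setReg 19 0)).arr = τ.arr := by
        funext b; rw [arr_exec (by simp [addLoop])]; simp
      simp [e1, e2, e3, h1, h8, ha, h, idx]
      ring
  simpa [hm, indexCode] using h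

/-- Digit 0 is the least significant one, whereas in `idx` the last entry of the tuple is the least
significant. The two numberings serve different purposes: running through colorings or tuples, and
addressing tables. -/
def dig (q c j : ℕ) : ℕ := c / q ^ j % q

theorem dig_zero (q j : ℕ) : dig q 0 j = 0 := by simp [dig]

theorem exists_dig {q : ℕ} (g : ℕ → ℕ) (hg : ∀ j, g j < q) (u : ℕ) :
    ∃ c < q ^ u, ∀ j < u, dig q c j = g j := by
  induction u generalizing g with
  | zero => exact ⟨0, by simp, by omega⟩
  | succ u ih =>
    obtain ⟨c, hc, h⟩ := ih (fun j => g (j + 1)) fun j => hg _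
    have hq : 0 < q := (Nat.zero_le _).trans_lt (hg 0)
    refine ⟨g 0 + q * c, ?_, fun j hj => ?_⟩
    · rw [pow_succ']
      have := hg 0
      nlinarith
    · cases j with
      | zero => simp [dig, Nat.mod_eq_of_lt (hg 0)]
      | succ j =>
        rw [← h j (by omega), dig, dig, pow_succ', ← Nat.div_div_eq_div_mul,
          Nat.add_mul_div_left _ _ hq, Nat.div_eq_of_lt (hg 0), zero_add]

/-- Increase the number whose `j`-th digit in base `q` is in the cell `f j` of array `a`, where `e`
evaluates to `f j` if register `16` contains `j`. -/
def incCode (a u q : ℕ) (e : Expr) : Cmd :=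
  .set 23 1 ;; .loop 16 u (.ite 0 (.reg 23)
    (.set 24 e ;; .ite (.get a (.reg 24) + 1) (.reg q)
      (.put a (.reg 24) (.get a (.reg 24) + 1) ;; .set 23 0) (.put a (.reg 24) 0)) .skip)

/-- Register `23` is the carry: before position `k` it is 1 if and only if `q ^ k` divides `c + 1`,
which is when digit `k` has to change. No bound on `c` is needed, as an overflow just drops the
carry. -/
theorem incCode_exec {a u q : ℕ} {e : Expr} {f : ℕ → ℕ} {c : ℕ} (hu : u ∉ [16, 23, 24])
    (hq : q ∉ [16, 23, 24]) (σ : St) (hf : ∀ i < σ.reg u, ∀ j < σ.reg u, f i = f j → i = j)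
    (he : ∀ τ : St, (∀ x, x ∉ [16, 23, 24] → τ.reg x = σ.reg x) →
      (∀ b, b ≠ a → τ.arr b = σ.arr b) → τ.reg 16 < σ.reg u → e.eval τ = f (τ.reg 16))
    (hq0 : 0 < σ.reg q) (hc : ∀ j < σ.reg u, σ.arr a (f j) = dig (σ.reg q) c j) :
    (∀ j < σ.reg u, ((incCode a u q e).exec σ).arr a (f j) = dig (σ.reg q) (c + 1) j) ∧
      ∀ v, (∀ j < σ.reg u, f j ≠ v) → ((incCode a u q e).exec σ).arr a v = σ.arr a v := by
  simp only [List.mem_cons, List.not_mem_nil, or_false, not_or] at hu hq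
  set Q := σ.reg q with hQ
  have h := exec_loop (P := .ite 0 (.reg 23)
    (.set 24 e ;; .ite (.get a (.reg 24) + 1) (.reg q)
      (.put a (.reg 24) (.get a (.reg 24) + 1) ;; .set 23 0) (.put a (.reg 24) 0)) .skip)
    (i := 16) (n := u) (σ := (Cmd.set 23 1).exec σ)
    (fun k τ => (∀ j < σ.reg u, τ.arr a (f j) = if j < k then dig Q (c + 1) j else dig Q c j) ∧
      (∀ v, (∀ j < σ.reg u, f j ≠ v) → τ.arr a v = σ.arr a v) ∧
      τ.reg 23 = if Q ^ k ∣ c + 1 then 1 else 0)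
    ⟨fun j hj => by simpa using hc j hj, by simp, by simp⟩
    fun k τ hk hi hag ⟨h1, h2, h3⟩ => by
      have hqτ : τ.reg q = Q := by
        rw [hag.1 q (by simp [hq])]; simp [hq, hQ]
      have hk' : k < σ.reg u := by simpa [hu] using hk
      have hek : e.eval τ = f k := by
        rw [he τ, hi]
        · intro x hx
          simp only [List.mem_cons, List.not_mem_nil, or_false, not_or] at hx
          rw [hag.1 x (by simp [hx])]; simp [hx]
        · intro b hb
          rw [hag.2 b (by simp [hb])]; simp
        · rw [hi]; exact hk'
      have hsucc : (c + 1) / Q ^ k = c / Q ^ k + if Q ^ k ∣ c + 1 then 1 else 0 := Nat.succ_div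
      -- The carry moves on exactly if it has arrived and the digit is the largest one.
      have hdvd : Q ^ (k + 1) ∣ c + 1 ↔ Q ^ k ∣ c + 1 ∧ dig Q c k + 1 = Q := by
        constructor
        · intro h
          have hk1 : Q ^ k ∣ c + 1 := (pow_dvd_pow Q (Nat.le_succ k)).trans h
          refine ⟨hk1, ?_⟩
          rw [if_pos hk1] at hsucc
          have : Q ∣ c / Q ^ k + 1 := by
            rw [← hsucc]
            obtain ⟨d, hd⟩ := h
            rw [hd, pow_succ, mul_assoc, Nat.mul_div_cancel_left _ (pow_pos hq0 k)]
            exact dvd_mul_right _ _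
          have h2 := Nat.mod_lt (c / Q ^ k) hq0
          have h4 : Q ∣ c / Q ^ k % Q + 1 := by
            have h5 := Nat.mod_add_div (c / Q ^ k) Q
            rw [← h5, add_right_comm] at this
            exact (Nat.dvd_add_left (dvd_mul_right Q _)).1 this
          have := Nat.le_of_dvd (by omega) h4
          unfold dig; omega
        · rintro ⟨hk1, h⟩
          rw [if_pos hk1] at hsucc
          have h5 := Nat.mod_add_div (c / Q ^ k) Q
          have h6 : c / Q ^ k + 1 = Q * (c / Q ^ k / Q + 1) := by
            unfold dig at h
            calc c / Q ^ k + 1 = (c / Q ^ k % Q + 1) + Q * (c / Q ^ k / Q) := by omega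
              _ = _ := by rw [h]; ring
          rw [← Nat.div_mul_cancel hk1, hsucc, h6, pow_succ, mul_comm (Q ^ k)]
          exact mul_dvd_mul_right (dvd_mul_right Q _) (Q ^ k)
      have hfk : ∀ j < σ.reg u, f j = f k ↔ j = k := fun j hj =>
        ⟨hf j hj k hk', fun h => by rw [h]⟩
      have hak : τ.arr a (f k) = dig Q c k := by rw [h1 k hk']; simp
      have hdlt : dig Q c k < Q := Nat.mod_lt _ hq0
      simp only [exec_ite, eval, h3]
      by_cases hd : Q ^ k ∣ c + 1
      · rw [if_pos hd] at hsucc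
        simp only [hd, if_true, zero_lt_one, exec_seq, exec_set, exec_put, exec_ite, eval, hek, St.reg_setReg,
          St.arr_setReg, hak, hq.2.2, if_false, hqτ]
        by_cases hlt : dig Q c k + 1 < Q
        · have hnew : dig Q (c + 1) k = dig Q c k + 1 := by
            rw [dig, hsucc, Nat.add_mod, ← dig, Nat.mod_eq_of_lt (a := 1) (by omega),
              Nat.mod_eq_of_lt hlt]
          rw [if_pos hlt]
          refine ⟨fun j hj => ?_, fun v hv => ?_, ?_⟩
          · simp only [St.arr_setReg, St.arr_setArr, if_true, Function.update_apply, hfk j hj]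
            by_cases hjk : j = k
            · simp [hjk, hnew]
            · simp only [hjk, if_false, h1 j hj]
              simp only [show j < k + 1 ↔ j < k by omega]
          · have : v ≠ f k := fun h => hv k hk' h.symm
            simpa [this] using h2 v hv
          · have : ¬ Q ^ (k + 1) ∣ c + 1 := by rw [hdvd]; omega
            simp [this]
        · have hnew : dig Q (c + 1) k = 0 := by
            rw [dig, hsucc, Nat.add_mod, ← dig]
            rcases Nat.lt_or_ge 1 Q with h | h
            · rw [Nat.mod_eq_of_lt (a := 1) (by omega), show dig Q c k + 1 = Q by omega,
                Nat.mod_self]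
            · rw [show Q = 1 by omega, Nat.mod_one]
          rw [if_neg hlt]
          refine ⟨fun j hj => ?_, fun v hv => ?_, ?_⟩
          · simp only [St.arr_setReg, St.arr_setArr, if_true, Function.update_apply, hfk j hj]
            by_cases hjk : j = k
            · simp [hjk, hnew]
            · simp only [hjk, if_false, h1 j hj]
              simp only [show j < k + 1 ↔ j < k by omega]
          · have : v ≠ f k := fun h => hv k hk' h.symm
            simpa [this] using h2 v hv
          · have : Q ^ (k + 1) ∣ c + 1 := by rw [hdvd]; exact ⟨hd, by omega⟩
            simp [this, h3, hd]
      · rw [if_neg hd, add_zero] at hsucc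
        simp only [hd, if_false, lt_irrefl]
        refine ⟨fun j hj => ?_, fun v hv => ?_, ?_⟩
        · rw [St.arr_setReg, exec_skip, h1 j hj]
          by_cases hjk : j = k
          · simp [hjk, dig, hsucc]
          · simp only [show j < k + 1 ↔ j < k by omega]
        · simpa using h2 v hv
        · have : ¬ Q ^ (k + 1) ∣ c + 1 := by rw [hdvd]; exact fun h => hd h.1
          simp [this, h3, hd]
  simp only [exec_set, St.reg_setReg, hu.2.1, if_false] at h
  refine ⟨fun j hj => ?_, fun v hv => h.2.1 v hv⟩
  have := h.1 j hj
  simp only [hj, if_true] at this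
  exact this


/-! ### Evaluating a single coloring. -/

open Cmd SepAlg.Expr

/-- The instance is stored in the registers and arrays. -/
structure Env (P : Prob) (σ : St) : Prop where
  n : σ.reg 1 = P.n
  M : σ.reg 2 = P.M
  Q : σ.reg 3 = P.Q
  k : σ.reg 4 = P.k
  s : σ.reg 5 = P.s
  z : σ.reg 6 = P.z
  n1 : σ.reg 26 = P.n + 1
  ea : ∀ j < P.M, σ.arr 1 j = P.ea j
  eb : ∀ j < P.M, σ.arr 2 j = P.eb j
  et : ∀ j < P.M, σ.arr 3 j = P.et j

theorem Env.congr {P : Prob} {σ τ : St} (h : Env P σ)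
    (hr : ∀ x ∈ [1, 2, 3, 4, 5, 6, 26], τ.reg x = σ.reg x)
    (ha : ∀ a ∈ [1, 2, 3], τ.arr a = σ.arr a) : Env P τ := by
  constructor
  · rw [hr 1 (by decide), h.n]
  · rw [hr 2 (by decide), h.M]
  · rw [hr 3 (by decide), h.Q]
  · rw [hr 4 (by decide), h.k]
  · rw [hr 5 (by decide), h.s]
  · rw [hr 6 (by decide), h.z]
  · rw [hr 26 (by decide), h.n1]
  · rw [ha 1 (by decide)]; exact h.ea
  · rw [ha 2 (by decide)]; exact h.eb
  · rw [ha 3 (by decide)]; exact h.et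

theorem Env.of_agree {P : Prob} {σ τ : St} (h : Env P σ) {c : Cmd} (hc : c.Agree σ τ)
    (hr : ∀ x ∈ [1, 2, 3, 4, 5, 6, 26], x ∉ c.regs) (ha : ∀ a ∈ [1, 2, 3], a ∉ c.arrs) : Env P τ :=
  h.congr (fun x hx => hc.1 x (hr x hx)) fun a hx => hc.2 a (ha a hx)

structure Prob.Wf (P : Prob) : Prop where
  ea : ∀ j < P.M, P.ea j < P.n
  eb : ∀ j < P.M, P.eb j < P.n
  Q : 2 ≤ P.Q

/-- Equality has to be tested by a strict comparison: with truncated subtraction, this sum is below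
1 only for equal values. -/
def absDiff (e f : Expr) : Expr := (e - f) + (f - e)

theorem eval_absDiff {e f : Expr} {σ : St} :
    (absDiff e f).eval σ < 1 ↔ e.eval σ = f.eval σ := by
  simp only [absDiff, eval_add, eval_sub]; omega

/-- Set register `21` if the current coloring violates the condition for a time-edge that is
relevant for the vertices with mark `2`. -/
def edgeCheck : Cmd :=
  .loop 16 2 (.set 24 (.get 1 (.reg 16)) ;; .set 25 (.get 2 (.reg 16)) ;;
    .set 19 (.get 3 (.reg 16)) ;;
    .ite 2 (.get 7 (.reg 24) + .get 7 (.reg 25))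
      (.ite 0 (.get 8 (.reg 24)) (.ite 0 (.get 8 (.reg 25))
        (.ite (.reg 19) (.get 8 (.reg 24))
          (.ite (.reg 19) (.get 8 (.reg 25)) .skip (.set 21 1))
          (.ite (.reg 19) (.get 8 (.reg 25)) (.set 21 1) .skip)) .skip) .skip) .skip)

theorem edgeCheck_exec {P : Prob} {σ : St} (hE : Env P σ) :
    (edgeCheck.exec σ).reg 21 = 0 ↔ σ.reg 21 = 0 ∧
      ∀ j < P.M, 2 < σ.arr 7 (P.ea j) + σ.arr 7 (P.eb j) → P.EdgeOk (σ.arr 8) j := by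
  rw [← hE.M]
  refine exec_loop (fun k τ => τ.reg 21 = 0 ↔ σ.reg 21 = 0 ∧
    ∀ j < k, 2 < σ.arr 7 (P.ea j) + σ.arr 7 (P.eb j) → P.EdgeOk (σ.arr 8) j) (by simp) ?_
  intro k τ hk hi hag h
  have hEτ : Env P τ := hE.of_agree hag (by decide) (by decide)
  have e7 : τ.arr 7 = σ.arr 7 := hag.2 7 (by decide)
  have e8 : τ.arr 8 = σ.arr 8 := hag.2 8 (by decide)
  have hkM : k < P.M := by rwa [← hE.M]
  have ea := hEτ.ea k hkM
  have eb := hEτ.eb k hkM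
  have et := hEτ.et k hkM
  have key : (∀ j < k + 1, 2 < σ.arr 7 (P.ea j) + σ.arr 7 (P.eb j) → P.EdgeOk (σ.arr 8) j) ↔
      (∀ j < k, 2 < σ.arr 7 (P.ea j) + σ.arr 7 (P.eb j) → P.EdgeOk (σ.arr 8) j) ∧
      (2 < σ.arr 7 (P.ea k) + σ.arr 7 (P.eb k) → P.EdgeOk (σ.arr 8) k) := by
    simp only [Nat.lt_succ_iff_lt_or_eq, or_imp, forall_and, forall_eq]
  rw [key, ← and_assoc, ← h]
  have e21 : ∀ P Q : St, ∀ (c : Prop) [Decidable c], (if c then P else Q).reg 21 =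
      if c then P.reg 21 else Q.reg 21 := fun _ _ _ _ => apply_ite (fun x : St => x.reg 21) _ _ _
  simp only [exec_seq, exec_set, exec_ite, exec_skip, eval, St.reg_setReg,
    St.arr_setReg, hi, ea, eb, et, e7, e8, if_true, Nat.reduceEqDiff, if_false, e21]
  unfold Prob.EdgeOk
  by_cases h0 : τ.reg 21 = 0
  · simp only [h0]
    split_ifs <;> simp <;> omega
  · split_ifs <;> simp [h0]

/-- Set register `21` if the color of a terminal with mark `2` is wrong, and count the vertices with
mark `2` and color `0` in register `22`. -/
def vertexCheck : Cmd :=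
  .loop 16 12 (.set 24 (.get 6 (.reg 16)) ;;
    .ite 1 (.get 7 (.reg 24))
      (.ite (.get 8 (.reg 24)) 1 (.set 22 (.reg 22 + 1)) .skip ;;
        .ite (absDiff (.reg 24) (.reg 5)) 1
          (.ite (absDiff (.get 8 (.reg 24)) 1) 1 .skip (.set 21 1)) .skip ;;
        .ite (absDiff (.reg 24) (.reg 6)) 1
          (.ite (absDiff (.get 8 (.reg 24)) (.reg 3 - 1)) 1 .skip (.set 21 1)) .skip) .skip)

theorem vertexCheck_exec {P : Prob} {σ : St} (hE : Env P σ)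
    (hU : Enum (σ.reg 12) (σ.arr 6) (σ.arr 7)) (h2 : ∀ v, σ.arr 7 v ≤ 2)
    (hn : ∀ v, σ.arr 7 v ≠ 0 → v < P.n) :
    ((vertexCheck.exec σ).reg 21 = 0 ↔ σ.reg 21 = 0 ∧
      ∀ v, σ.arr 7 v = 2 → P.VertexOk (σ.arr 8) v) ∧
    (vertexCheck.exec σ).reg 22 = σ.reg 22 +
      zeros (σ.arr 8) ((Finset.range P.n).filter fun v => σ.arr 7 v = 2) := by
  set U := σ.arr 6 with hU'
  have h := exec_loop (P := .set 24 (.get 6 (.reg 16)) ;;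
    .ite 1 (.get 7 (.reg 24))
      (.ite (.get 8 (.reg 24)) 1 (.set 22 (.reg 22 + 1)) .skip ;;
        .ite (absDiff (.reg 24) (.reg 5)) 1
          (.ite (absDiff (.get 8 (.reg 24)) 1) 1 .skip (.set 21 1)) .skip ;;
        .ite (absDiff (.reg 24) (.reg 6)) 1
          (.ite (absDiff (.get 8 (.reg 24)) (.reg 3 - 1)) 1 .skip (.set 21 1)) .skip) .skip)
    (i := 16) (n := 12) (σ := σ)
    (fun k τ => (τ.reg 21 = 0 ↔ σ.reg 21 = 0 ∧
      ∀ j < k, σ.arr 7 (U j) = 2 → P.VertexOk (σ.arr 8) (U j)) ∧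
      τ.reg 22 = σ.reg 22 + ((Finset.range k).filter fun j =>
        σ.arr 7 (U j) = 2 ∧ σ.arr 8 (U j) = 0).card) (by simp) (by
    rintro k τ hk hi hag ⟨h, h'⟩
    have hEτ : Env P τ := hE.of_agree hag (by decide) (by decide)
    have e6 : τ.arr 6 = U := hag.2 6 (by decide)
    have e7 : τ.arr 7 = σ.arr 7 := hag.2 7 (by decide)
    have e8 : τ.arr 8 = σ.arr 8 := hag.2 8 (by decide)
    have key : (∀ j < k + 1, σ.arr 7 (U j) = 2 → P.VertexOk (σ.arr 8) (U j)) ↔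
        (∀ j < k, σ.arr 7 (U j) = 2 → P.VertexOk (σ.arr 8) (U j)) ∧
        (σ.arr 7 (U k) = 2 → P.VertexOk (σ.arr 8) (U k)) := by
      simp only [Nat.lt_succ_iff_lt_or_eq, or_imp, forall_and, forall_eq]
    have hcard : ((Finset.range (k + 1)).filter fun j =>
        σ.arr 7 (U j) = 2 ∧ σ.arr 8 (U j) = 0).card = ((Finset.range k).filter fun j =>
        σ.arr 7 (U j) = 2 ∧ σ.arr 8 (U j) = 0).card +
        if σ.arr 7 (U k) = 2 ∧ σ.arr 8 (U k) = 0 then 1 else 0 := by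
      rw [Finset.range_add_one, Finset.filter_insert]
      split_ifs
      · rw [Finset.card_insert_of_notMem (by simp)]
      · rfl
    rw [key, ← and_assoc, ← h, hcard, ← add_assoc, ← h']
    have l2 := h2 (U k)
    have er : ∀ r (P Q : St), ∀ (c : Prop) [Decidable c], (if c then P else Q).reg r =
      if c then P.reg r else Q.reg r := fun r _ _ _ _ => apply_ite (fun x : St => x.reg r) _ _ _
    have ea : ∀ (P Q : St), ∀ (c : Prop) [Decidable c], (if c then P else Q).arr =
      if c then P.arr else Q.arr := fun _ _ _ _ => apply_ite (fun x : St => x.arr) _ _ _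
    by_cases h7 : σ.arr 7 (U k) = 2
    · have hb : ((Cmd.ite (.get 8 (.reg 24)) 1 (.set 22 (.reg 22 + 1)) .skip).exec
          (τ.setReg 24 (U k))) = (τ.setReg 24 (U k)).setReg 22
            (τ.reg 22 + if σ.arr 8 (U k) = 0 then 1 else 0) := by
        simp only [exec_ite, eval, St.reg_setReg, St.arr_setReg, e8, if_true,
          Nat.lt_one_iff, exec_set, exec_skip, Nat.reduceEqDiff, if_false]
        split_ifs
        · rfl
        · simp [St.setReg]
      simp only [exec_seq, exec_set, exec_ite, eval, St.reg_setReg, St.arr_setReg, hi,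
        e6, e7, h7, if_true, one_lt_two] at hb ⊢
      rw [hb]
      simp only [exec_skip, eval_absDiff, eval,
        eval_sub, St.reg_setReg, St.arr_setReg, e8, er, ea, ite_self,
        Nat.reduceEqDiff, if_true, if_false, hEτ.s, hEτ.z,
        hEτ.Q, true_and, Prob.VertexOk, forall_const, and_true]
      by_cases h0 : τ.reg 21 = 0
      · by_cases hs : U k = P.s <;> by_cases hz : U k = P.z <;>
          simp only [h0, hs, hz, if_true, if_false, true_imp_iff, false_imp_iff, true_and,
            and_true] <;> split_ifs <;> simp_all
      · simp only [h0, false_and, iff_false]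
        split_ifs <;> simp [h0]
    · have h1 : ¬ 1 < σ.arr 7 (U k) := by omega
      simp only [exec_seq, exec_set, exec_ite, eval, St.reg_setReg, St.arr_setReg, hi,
        e6, e7, h1, h7, if_true, if_false, exec_skip, Nat.reduceEqDiff, false_and, false_imp_iff,
        and_true, add_zero])
  refine ⟨h.1.trans (and_congr Iff.rfl ⟨fun H v hv => ?_, fun H j hj => H _⟩), h.2.trans ?_⟩
  · obtain ⟨j, hj, rfl⟩ := (hU.1 v).1 (by omega)
    exact H j hj hv
  · congr 1
    refine Finset.card_bij (fun j _ => U j) ?_ ?_ ?_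
    · intro j hj
      simp only [Finset.mem_filter, Finset.mem_range] at hj ⊢
      exact ⟨⟨hn _ (by omega), hj.2.1⟩, hj.2.2⟩
    · intro i hi j hj h
      simp only [Finset.mem_filter, Finset.mem_range] at hi hj
      exact hU.2 i hi.1 j hj.1 h
    · intro v hv
      simp only [Finset.mem_filter, Finset.mem_range] at hv
      obtain ⟨j, hj, rfl⟩ := (hU.1 v).1 (by omega)
      exact ⟨j, by simp [hj, hv], rfl⟩

/-- Add the entries of the tables of the children to register `22`. -/
def sumCode : Cmd := .loop 16 9 (.set 22 (.reg 22 + .get 10 (.get 9 (.reg 16) + .reg 20)))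

theorem sumCode_exec (σ : St) : (sumCode.exec σ).reg 22 =
    σ.reg 22 + ∑ i ∈ Finset.range (σ.reg 9), σ.arr 10 (σ.arr 9 i + σ.reg 20) := by
  refine exec_loop (fun k τ => τ.reg 22 = σ.reg 22 +
    ∑ i ∈ Finset.range k, σ.arr 10 (σ.arr 9 i + σ.reg 20)) (by simp) ?_
  intro k τ hk hi hag h
  have e9 : τ.arr 9 = σ.arr 9 := hag.2 9 (by decide)
  have e10 : τ.arr 10 = σ.arr 10 := hag.2 10 (by decide)
  have e20 : τ.reg 20 = σ.reg 20 := hag.1 20 (by decide)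
  simp [h, hi, e9, e10, e20, Finset.sum_range_succ, add_assoc]

/-- Update the table with the current coloring. -/
def evalCode : Cmd :=
  .set 21 0 ;; .set 22 0 ;; edgeCheck ;; vertexCheck ;; indexCode 5 8 ;; sumCode ;;
    .ite (.reg 21) 1 (indexCode 4 7 ;;
      .ite (.reg 22) (.get 10 (.reg 10 + .reg 20)) (.put 10 (.reg 10 + .reg 20) (.reg 22)) .skip)
      .skip

open Classical in
theorem evalCode_exec {P : Prob} {σ : St} (hE : Env P σ)
    (hU : Enum (σ.reg 12) (σ.arr 6) (σ.arr 7)) (h2 : ∀ v, σ.arr 7 v ≤ 2)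
    (hn : ∀ v, σ.arr 7 v ≠ 0 → v < P.n) (i : ℕ) :
    (evalCode.exec σ).arr 10 i = if P.LocalOk (σ.arr 7) (σ.arr 8) ∧
        i = σ.reg 10 + idx P.Q (σ.arr 8) (σ.arr 4) (σ.reg 7) then
      min (σ.arr 10 i) (zeros (σ.arr 8) ((Finset.range P.n).filter fun v => σ.arr 7 v = 2) +
        ∑ j ∈ Finset.range (σ.reg 9), σ.arr 10 (σ.arr 9 j +
          idx P.Q (σ.arr 8) (σ.arr 5) (σ.reg 8))) else σ.arr 10 i := by
  obtain ⟨σ1, h1⟩ : ∃ σ1, σ1 = (σ.setReg 21 0).setReg 22 0 := ⟨_, rfl⟩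
  have hE1 : Env P σ1 := hE.congr (by rw [h1]; simp) (by rw [h1]; simp)
  obtain ⟨σ2, hσ2⟩ : ∃ σ2, σ2 = edgeCheck.exec σ1 := ⟨_, rfl⟩
  have ag2 := edgeCheck.agree σ1
  rw [← hσ2] at ag2
  have hE2 : Env P σ2 := hE1.of_agree ag2 (by decide) (by decide)
  have b2 := edgeCheck_exec hE1
  rw [← hσ2] at b2
  have r2 : ∀ x ∈ [3, 7, 8, 9, 10, 12], σ2.reg x = σ.reg x := by
    intro x hx
    rw [ag2.1 x (by revert x; decide), h1]
    revert x; simp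
  have a2 : σ2.arr = σ.arr := by
    funext a; rw [ag2.2 a (by simp [edgeCheck]), h1]; rfl
  have c2 : σ2.reg 22 = 0 := by rw [ag2.1 22 (by decide), h1]; simp
  obtain ⟨σ3, hσ3⟩ : ∃ σ3, σ3 = vertexCheck.exec σ2 := ⟨_, rfl⟩
  have ag3 := vertexCheck.agree σ2
  rw [← hσ3] at ag3
  have b3 := vertexCheck_exec hE2 (by rw [r2 12 (by decide), a2]; exact hU) (by rwa [a2])
    (by rwa [a2])
  rw [← hσ3, c2, a2, b2] at b3
  have r3 : ∀ x ∈ [3, 7, 8, 9, 10], σ3.reg x = σ.reg x := by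
    intro x hx
    rw [ag3.1 x (by revert x; decide), r2 x (by revert x; decide)]
  have a3 : σ3.arr = σ.arr := by
    funext a; rw [ag3.2 a (by simp [vertexCheck]), a2]
  obtain ⟨σ4, hσ4⟩ : ∃ σ4, σ4 = (indexCode 5 8).exec σ3 := ⟨_, rfl⟩
  have ag4 := (indexCode 5 8).agree σ3
  rw [← hσ4] at ag4
  have b4 := indexCode_exec (a := 5) (m := 8) (by decide) σ3
  rw [← hσ4, r3 3 (by decide), r3 8 (by decide), a3, hE.Q] at b4
  have r4 : ∀ x ∈ [3, 7, 9, 10], σ4.reg x = σ.reg x := by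
    intro x hx
    rw [ag4.1 x (by revert x; decide), r3 x (by revert x; decide)]
  have a4 : σ4.arr = σ.arr := by
    funext a; rw [ag4.2 a (by simp [indexCode, addLoop]), a3]
  have d4 : σ4.reg 21 = σ3.reg 21 := ag4.1 21 (by decide)
  have d4' : σ4.reg 22 = σ3.reg 22 := ag4.1 22 (by decide)
  obtain ⟨σ5, hσ5⟩ : ∃ σ5, σ5 = sumCode.exec σ4 := ⟨_, rfl⟩
  have ag5 := sumCode.agree σ4
  rw [← hσ5] at ag5
  have b5 := sumCode_exec σ4
  rw [← hσ5, r4 9 (by decide), b4, a4, d4', b3.2] at b5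
  have r5 : ∀ x ∈ [3, 7, 10], σ5.reg x = σ.reg x := by
    intro x hx
    rw [ag5.1 x (by revert x; decide), r4 x (by revert x; decide)]
  have a5 : σ5.arr = σ.arr := by
    funext a; rw [ag5.2 a (by simp [sumCode]), a4]
  have d5 : σ5.reg 21 = σ3.reg 21 := by rw [ag5.1 21 (by decide), d4]
  have hev : evalCode.exec σ = (Cmd.ite (.reg 21) 1 (indexCode 4 7 ;;
      .ite (.reg 22) (.get 10 (.reg 10 + .reg 20)) (.put 10 (.reg 10 + .reg 20) (.reg 22)) .skip)
      .skip).exec σ5 := by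
    rw [hσ5, hσ4, hσ3, hσ2, h1]; rfl
  have hbad : σ5.reg 21 = 0 ↔ P.LocalOk (σ.arr 7) (σ.arr 8) := by
    rw [d5, b3.1, h1]; simp [Prob.LocalOk]
  rw [hev]
  by_cases hok : P.LocalOk (σ.arr 7) (σ.arr 8)
  · obtain ⟨σ6, hσ6⟩ : ∃ σ6, σ6 = (indexCode 4 7).exec σ5 := ⟨_, rfl⟩
    have ag6 := (indexCode 4 7).agree σ5
    rw [← hσ6] at ag6
    have b6 := indexCode_exec (a := 4) (m := 7) (by decide) σ5
    rw [← hσ6, r5 3 (by decide), r5 7 (by decide), a5, hE.Q] at b6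
    have a6 : σ6.arr = σ.arr := by
      funext a; rw [ag6.2 a (by simp [indexCode, addLoop]), a5]
    have d6 : σ6.reg 10 = σ.reg 10 := by rw [ag6.1 10 (by decide), r5 10 (by decide)]
    have d6' : σ6.reg 22 = σ5.reg 22 := ag6.1 22 (by decide)
    simp only [exec_ite, eval, hbad.2 hok, zero_lt_one, if_true, exec_seq, ← hσ6,
      b6, a6, d6, d6', b5, exec_put, exec_skip, hok, true_and, zero_add]
    by_cases hi : i = σ.reg 10 + idx P.Q (σ.arr 8) (σ.arr 4) (σ.reg 7)
    · subst hi
      rw [if_pos rfl]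
      split_ifs with hlt
      · simp only [St.arr_setArr, if_true, Function.update_self]
        omega
      · rw [a6]; omega
    · rw [if_neg hi]
      split_ifs with hlt
      · simp [St.arr_setArr, hi, a6]
      · rw [a6]
  · have : ¬ σ5.reg 21 < 1 := by
      have := mt hbad.1 hok; omega
    simp [hok, this, a5]


/-! ### Computing one table from those of the parts. -/

open Cmd SepAlg.Expr

/-- The value `k + 1` plays the role of infinity, since entries matter only as far as they are at
most `k`. -/
def initCode : Cmd := .loop 16 13 (.put 10 (.reg 10 + .reg 16) (.reg 4 + 1))

theorem initCode_exec (σ : St) :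
    (∀ i < σ.reg 10, (initCode.exec σ).arr 10 i = σ.arr 10 i) ∧
      ∀ i < σ.reg 13, (initCode.exec σ).arr 10 (σ.reg 10 + i) = σ.reg 4 + 1 := by
  refine exec_loop (fun k τ => (∀ i < σ.reg 10, τ.arr 10 i = σ.arr 10 i) ∧
      ∀ i < k, τ.arr 10 (σ.reg 10 + i) = σ.reg 4 + 1) ⟨by simp, by simp⟩ ?_
  rintro k τ hk hi hag ⟨h1, h2⟩
  have e10 : τ.reg 10 = σ.reg 10 := hag.1 10 (by decide)
  have e4 : τ.reg 4 = σ.reg 4 := hag.1 4 (by decide)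
  simp only [exec_put, eval, hi, e10, e4, St.arr_setReg, St.arr_setArr,
    if_true, Function.update_apply]
  refine ⟨fun i hi => ?_, fun i hi => ?_⟩
  · rw [if_neg (by omega), h1 i hi]
  · by_cases h : i = k
    · simp [h]
    · rw [if_neg (by omega), h2 i (by omega)]

def combineMarks : Cmd :=
  clearCode ;; .set 12 0 ;; buildCode 4 7 1 ;; buildCode 5 8 2 ;; powCode 13 3 7

def combineInit : Cmd := powCode 14 3 12 ;; initCode

def combineBody : Cmd := evalCode ;; incCode 8 12 3 (.get 6 (.reg 16))

/-- Append a table for the tuple `4` to the array `10`, which is computed from the tables for the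
tuple `5` whose addresses are listed in array `9`. -/
def combineCode : Cmd :=
  combineMarks ;; combineInit ;; .loop 15 14 combineBody ;; .set 11 (.reg 10) ;;
    .set 10 (.reg 10 + .reg 13)

theorem Enum.le_card {u : ℕ} {U mk : ℕ → ℕ} (h : Enum u U mk) (W : Finset ℕ)
    (hW : ∀ v, mk v ≠ 0 → v ∈ W) : u ≤ W.card := by
  have := Finset.card_le_card_of_injOn (s := Finset.range u) (t := W) U
    (fun j hj => hW _ ((h.1 _).2 ⟨j, by simpa using hj, rfl⟩))
    fun i hi j hj => h.2 i (by simpa using hi) j (by simpa using hj)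
  simpa using this

theorem combineMarks_exec {P : Prob} {σ : St} (hE : Env P σ)
    (h7 : ∀ v, P.n < v → σ.arr 7 v = 0) (h8 : ∀ v, P.n < v → σ.arr 8 v = 0) :
    Enum ((combineMarks.exec σ).reg 12) ((combineMarks.exec σ).arr 6)
      ((combineMarks.exec σ).arr 7) ∧
    (combineMarks.exec σ).arr 7 = mark P.n (σ.reg 7) (σ.arr 4) (σ.reg 8) (σ.arr 5) ∧
    (combineMarks.exec σ).arr 8 = (fun _ => 0) ∧
    (combineMarks.exec σ).reg 13 = P.Q ^ σ.reg 7 := by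
  classical
  obtain ⟨σ1, h1⟩ : ∃ σ1, σ1 = clearCode.exec σ := ⟨_, rfl⟩
  have ag1 := clearCode.agree σ
  have b1 := clearCode_exec σ (fun v hv => h7 v (by rw [hE.n1] at hv; omega))
    (fun v hv => h8 v (by rw [hE.n1] at hv; omega))
  rw [← h1] at ag1 b1
  obtain ⟨σ2, h2⟩ : ∃ σ2, σ2 = (buildCode 4 7 1).exec (σ1.setReg 12 0) := ⟨_, rfl⟩
  have ag2 := (buildCode 4 7 1).agree (σ1.setReg 12 0)
  have b2 := buildCode_exec (a := 4) (m := 7) (b := 1) (by decide) (by decide) (σ1.setReg 12 0)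
    (by simp [Enum, b1])
  rw [← h2] at ag2 b2
  obtain ⟨σ3, h3⟩ : ∃ σ3, σ3 = (buildCode 5 8 2).exec σ2 := ⟨_, rfl⟩
  have ag3 := (buildCode 5 8 2).agree σ2
  have b3 := buildCode_exec (a := 5) (m := 8) (b := 2) (by decide) (by decide) σ2 b2.1
  rw [← h3] at ag3 b3
  have b4 := powCode_exec (d := 13) (q := 3) (e := 7) (by decide) (by decide) (by decide)
    (by decide) σ3
  have e : combineMarks.exec σ = (powCode 13 3 7).exec σ3 := by rw [h3, h2, h1]; rfl
  have r1 : ∀ x ∈ [1, 3, 7, 8], σ1.reg x = σ.reg x := fun x hx =>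
    ag1.1 x (by revert x; decide)
  have r2 : ∀ x ∈ [1, 3, 7, 8], σ2.reg x = σ.reg x := fun x hx => by
    rw [ag2.1 x (by revert x; decide), ← r1 x hx]; revert x; simp
  have r3 : ∀ x ∈ [1, 3, 7, 8], σ3.reg x = σ.reg x := fun x hx => by
    rw [ag3.1 x (by revert x; decide), r2 x hx]
  have a1 : ∀ a ∈ [4, 5], σ1.arr a = σ.arr a := fun a ha => ag1.2 a (by revert a; decide)
  have a2 : ∀ a ∈ [4, 5], σ2.arr a = σ.arr a := fun a ha => by
    rw [ag2.2 a (by revert a; decide), St.arr_setReg, a1 a ha]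
  have c1 : (σ1.setReg 12 0).reg 1 = P.n := by rw [← hE.n, ← r1 1 (by decide)]; simp
  have c2 : (σ1.setReg 12 0).reg 7 = σ.reg 7 := by rw [← r1 7 (by decide)]; simp
  rw [e, b4, (powCode 13 3 7).agree σ3 |>.1 12 (by decide),
    (powCode 13 3 7).agree σ3 |>.2 6 (by decide), (powCode 13 3 7).agree σ3 |>.2 7 (by decide),
    (powCode 13 3 7).agree σ3 |>.2 8 (by decide)]
  refine ⟨b3.1, funext fun v => ?_, ?_, ?_⟩
  · rw [b3.2 v, b2.2 v, r2 1 (by decide), r2 8 (by decide), a2 5 (by decide), c1, c2, hE.n]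
    simp only [St.arr_setReg, b1.1, a1 4 (by decide), mark]
    split_ifs <;> simp_all
  · rw [ag3.2 8 (by decide), ag2.2 8 (by decide)]
    funext v; exact b1.2 v
  · rw [r3 3 (by decide), r3 7 (by decide), hE.Q]

open Classical in
/-- The coloring with number `c` of the vertices `U 0, …, U (u - 1)`. -/
noncomputable def colorOf (Q u : ℕ) (U : ℕ → ℕ) (c v : ℕ) : ℕ :=
  if h : ∃ j < u, U j = v then dig Q c h.choose else 0

theorem colorOf_apply {Q u : ℕ} {U mk : ℕ → ℕ} (hU : Enum u U mk) {c j : ℕ} (hj : j < u) :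
    colorOf Q u U c (U j) = dig Q c j := by
  have h : ∃ i < u, U i = U j := ⟨j, hj, rfl⟩
  rw [colorOf, dif_pos h, hU.2 _ h.choose_spec.1 j hj h.choose_spec.2]

theorem colorOf_eq {Q u : ℕ} {U mk χ : ℕ → ℕ} (hU : Enum u U mk) {c : ℕ}
    (h1 : ∀ j < u, χ (U j) = dig Q c j) (h2 : ∀ v, mk v = 0 → χ v = 0) :
    χ = colorOf Q u U c := by
  funext v
  by_cases h : mk v = 0
  · rw [h2 v h, colorOf, dif_neg fun h' => (hU.1 v).2 h' h]
  · obtain ⟨j, hj, rfl⟩ := (hU.1 v).1 h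
    rw [h1 j hj, colorOf_apply hU hj]

theorem exists_colorOf {Q u : ℕ} {U mk : ℕ → ℕ} (hU : Enum u U mk) {χ : ℕ → ℕ}
    (hχ : ∀ v, χ v < Q) (h0 : ∀ v, mk v = 0 → χ v = 0) : ∃ c < Q ^ u, χ = colorOf Q u U c := by
  obtain ⟨c, hc, h⟩ := exists_dig (fun j => χ (U j)) (fun j => hχ _) u
  exact ⟨c, hc, colorOf_eq hU (fun j hj => (h j hj).symm) h0⟩

theorem combineBody_exec {P : Prob} (hP : P.Wf) {σ : St} (hE : Env P σ)
    (hU : Enum (σ.reg 12) (σ.arr 6) (σ.arr 7)) {c : ℕ}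
    (hc : σ.arr 8 = colorOf P.Q (σ.reg 12) (σ.arr 6) c) :
    (combineBody.exec σ).arr 10 = (evalCode.exec σ).arr 10 ∧
      (combineBody.exec σ).arr 8 = colorOf P.Q (σ.reg 12) (σ.arr 6) (c + 1) := by
  obtain ⟨σ1, h1⟩ : ∃ σ1, σ1 = evalCode.exec σ := ⟨_, rfl⟩
  have ag1 := evalCode.agree σ
  rw [← h1] at ag1
  have b := incCode_exec (a := 8) (u := 12) (q := 3) (e := .get 6 (.reg 16)) (f := σ.arr 6) (c := c)
    (by decide) (by decide) σ1 (by rw [ag1.1 12 (by decide)]; exact hU.2)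
    (fun τ _ ha _ => by simp [ha 6 (by decide), ag1.2 6 (by decide)])
    (by rw [ag1.1 3 (by decide), hE.Q]; have := hP.Q; omega)
    (by
      intro j hj
      rw [ag1.1 12 (by decide)] at hj
      rw [ag1.2 8 (by decide), hc, colorOf_apply hU hj, ag1.1 3 (by decide), hE.Q])
  have e : combineBody.exec σ = (incCode 8 12 3 (.get 6 (.reg 16))).exec σ1 := by rw [h1]; rfl
  rw [← e, ag1.1 12 (by decide), ag1.1 3 (by decide), hE.Q, ag1.2 8 (by decide)] at b
  refine ⟨by rw [e, arr_exec (by decide), h1], colorOf_eq hU b.1 fun v hv => ?_⟩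
  rw [b.2 v fun j hj h => ?_, hc]
  · rw [colorOf, dif_neg fun h' => (hU.1 v).2 h' hv]
  · exact (hU.1 v).2 ⟨j, hj, h⟩ hv

/-- A bound for the costs of computing a table. -/
def combineBound (n M Q mX mY r w : ℕ) : ℕ :=
  100 * (n + 1 + (mX + mY + w + 1) * (Q + 1) + Q ^ mX +
    Q ^ w * (M + (mX + mY + 1) * (Q + 1) + w + r))

/-- Register `10` is the first free cell of array `10`; the new table is appended there, and all
earlier tables stay intact. After `c` rounds, an entry is at most `b` if and only if one of the
colorings with a number below `c` witnesses it; after all `Q ^ u` rounds this is the hypothesis of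
`Prob.spec_combine`. The cost is stated for any `W` that contains both tuples, because the number of
rounds depends on the size of their union rather than on the sum of their lengths. -/
theorem combineCode_exec {P : Prob} (hP : P.Wf) {σ : St} (hE : Env P σ)
    (h7 : ∀ v, P.n < v → σ.arr 7 v = 0) (h8 : ∀ v, P.n < v → σ.arr 8 v = 0)
    {C : Finset ℕ} {D : ℕ → Finset ℕ}
    (hS : P.Splits (σ.reg 7) (σ.arr 4) (σ.reg 8) (σ.arr 5) C (σ.reg 9) D)
    (hchild : ∀ i < σ.reg 9, σ.arr 9 i + P.Q ^ σ.reg 8 ≤ σ.reg 10 ∧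
      P.Spec (σ.reg 8) (σ.arr 5) (D i) fun x => σ.arr 10 (σ.arr 9 i + x)) :
    (combineCode.exec σ).reg 11 = σ.reg 10 ∧
    (combineCode.exec σ).reg 10 = σ.reg 10 + P.Q ^ σ.reg 7 ∧
    (∀ i < σ.reg 10, (combineCode.exec σ).arr 10 i = σ.arr 10 i) ∧
    P.Spec (σ.reg 7) (σ.arr 4) C (fun x => (combineCode.exec σ).arr 10 (σ.reg 10 + x)) ∧
    (∀ v, P.n < v → (combineCode.exec σ).arr 7 v = 0) ∧
    (∀ v, P.n < v → (combineCode.exec σ).arr 8 v = 0) ∧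
    ∀ W : Finset ℕ, (∀ v, InTuple P.n (σ.reg 7) (σ.arr 4) v ∨
      InTuple P.n (σ.reg 8) (σ.arr 5) v → v ∈ W) → combineCode.cost σ ≤
        combineBound P.n P.M P.Q (σ.reg 7) (σ.reg 8) (σ.reg 9) W.card := by
  classical
  set mk := mark P.n (σ.reg 7) (σ.arr 4) (σ.reg 8) (σ.arr 5) with hmk
  obtain ⟨σ1, h1⟩ : ∃ σ1, σ1 = combineMarks.exec σ := ⟨_, rfl⟩
  have ag1 := combineMarks.agree σ
  have b1 := combineMarks_exec hE h7 h8
  rw [← h1] at ag1 b1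
  obtain ⟨hU, hm, h0, h13⟩ := b1
  rw [← hmk] at hm
  have hE1 : Env P σ1 := hE.of_agree ag1 (by decide) (by decide)
  obtain ⟨σ2, h2⟩ : ∃ σ2, σ2 = (powCode 14 3 12).exec σ1 := ⟨_, rfl⟩
  have ag2 := (powCode 14 3 12).agree σ1
  have b2 := powCode_exec (d := 14) (q := 3) (e := 12) (by decide) (by decide)
    (by decide) (by decide) σ1
  rw [← h2] at ag2 b2
  obtain ⟨σ3, h3⟩ : ∃ σ3, σ3 = initCode.exec σ2 := ⟨_, rfl⟩
  have ag3 := initCode.agree σ2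
  have b3 := initCode_exec σ2
  rw [← h3] at ag3 b3
  have hinit : combineInit.exec σ1 = σ3 := by rw [h3, h2]; rfl
  set u := σ1.reg 12 with hu
  set U := σ1.arr 6 with hU'
  have hE2 : Env P σ2 := hE1.of_agree ag2 (by decide) (by decide)
  have hE3 : Env P σ3 := hE2.of_agree ag3 (by decide) (by decide)
  have r10 : σ2.reg 10 = σ.reg 10 := by rw [ag2.1 10 (by decide), ag1.1 10 (by decide)]
  have r13 : σ2.reg 13 = P.Q ^ σ.reg 7 := by rw [ag2.1 13 (by decide), h13]
  have a10 : σ2.arr 10 = σ.arr 10 := by rw [ag2.2 10 (by decide), ag1.2 10 (by decide)]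
  rw [r10, r13, a10, hE2.k] at b3
  have r3 : ∀ x ∈ [7, 8, 9, 10], σ3.reg x = σ.reg x := fun x hx => by
    rw [ag3.1 x (by revert x; decide), ag2.1 x (by revert x; decide),
      ag1.1 x (by revert x; decide)]
  have r3' : σ3.reg 12 = u := by rw [ag3.1 12 (by decide), ag2.1 12 (by decide)]
  have r14 : σ3.reg 14 = P.Q ^ u := by rw [ag3.1 14 (by decide), b2, hE1.Q]
  have r3'' : σ3.reg 13 = P.Q ^ σ.reg 7 := by rw [ag3.1 13 (by decide), r13]
  have a3 : ∀ a ∈ [4, 5, 9], σ3.arr a = σ.arr a := fun a ha => by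
    rw [ag3.2 a (by revert a; decide), ag2.2 a (by revert a; decide),
      ag1.2 a (by revert a; decide)]
  have a3' : ∀ a ∈ [6, 7, 8], σ3.arr a = σ1.arr a := fun a ha => by
    rw [ag3.2 a (by revert a; decide), ag2.2 a (by revert a; decide)]
  have hmk2 : ∀ v, mk v ≤ 2 := fun v => mark_le ..
  have hmkn : ∀ v, mk v ≠ 0 → v < P.n := by
    intro v hv
    by_contra hn
    exact hv (mark_eq_zero.2 ⟨fun h => hn h.1, fun h => hn h.1⟩)
  rw [hm] at hU
  have hQ0 : 0 < P.Q := by have := hP.Q; omega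
  let cand : ℕ → ℕ → ℕ → Prop := fun c i b => idx P.Q (colorOf P.Q u U c) (σ.arr 4) (σ.reg 7) = i ∧
    P.LocalOk mk (colorOf P.Q u U c) ∧
    zeros (colorOf P.Q u U c) ((Finset.range P.n).filter fun v => mk v = 2) +
      ∑ j ∈ Finset.range (σ.reg 9),
        σ.arr 10 (σ.arr 9 j + idx P.Q (colorOf P.Q u U c) (σ.arr 5) (σ.reg 8)) ≤ b
  have hcol : ∀ c v, colorOf P.Q u U c v < P.Q := by
    intro c v
    rw [colorOf]; split_ifs
    exacts [Nat.mod_lt _ hQ0, hQ0]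
  obtain ⟨⟨hcol4, htop, htab⟩, hcost⟩ := exec_loop_cost_const (P := combineBody) (i := 15) (n := 14)
    (σ := σ3) (fun c τ => τ.arr 8 = colorOf P.Q u U c ∧
      (∀ i < σ.reg 10, τ.arr 10 i = σ.arr 10 i) ∧
      ∀ i < P.Q ^ σ.reg 7, ∀ b ≤ P.k, τ.arr 10 (σ.reg 10 + i) ≤ b ↔ ∃ c' < c, cand c' i b)
    (combineBody.ub σ3.reg)
    ⟨by
      rw [St.arr_setReg, a3' 8 (by decide), h0]
      exact colorOf_eq hU (fun j _ => (dig_zero _ _).symm) fun _ _ => rfl, b3.1, fun i hi b hb => by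
      rw [St.arr_setReg, b3.2 i hi]
      simp only [Nat.not_lt_zero, false_and, exists_false, iff_false]; omega⟩
    (by
      rintro c τ hc hic hag ⟨hτ8, hτtop, hτtab⟩
      have hEτ : Env P τ := hE3.of_agree hag (by decide) (by decide)
      have e12 : τ.reg 12 = u := by rw [hag.1 12 (by decide), r3']
      have e6 : τ.arr 6 = U := by rw [hag.2 6 (by decide), a3' 6 (by decide)]
      have e7 : τ.arr 7 = mk := by rw [hag.2 7 (by decide), a3' 7 (by decide), hm]
      have er : ∀ x ∈ [7, 8, 9, 10], τ.reg x = σ.reg x := fun x hx => by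
        rw [hag.1 x (by revert x; decide), r3 x hx]
      have ea : ∀ a ∈ [4, 5, 9], τ.arr a = σ.arr a := fun a hx => by
        rw [hag.2 a (by revert a; decide), a3 a hx]
      have hUτ : Enum (τ.reg 12) (τ.arr 6) (τ.arr 7) := by rw [e12, e6, e7]; exact hU
      have hτ8' : τ.arr 8 = colorOf P.Q (τ.reg 12) (τ.arr 6) c := by rw [e12, e6]; exact hτ8
      obtain ⟨f1, f2⟩ := combineBody_exec hP hEτ hUτ hτ8'
      have f3 := evalCode_exec hEτ hUτ (by rwa [e7]) (by rwa [e7])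
      rw [e7, hτ8, er 10 (by decide), er 7 (by decide), er 8 (by decide), er 9 (by decide),
        ea 4 (by decide), ea 5 (by decide), ea 9 (by decide)] at f3
      rw [e12, e6] at f2
      have hidx := idx_lt (hcol c) (σ.arr 5) (σ.reg 8)
      -- The tables of the parts end below the old top, where the loop has not written.
      have hsum : ∑ j ∈ Finset.range (σ.reg 9), τ.arr 10 (σ.arr 9 j +
          idx P.Q (colorOf P.Q u U c) (σ.arr 5) (σ.reg 8)) =
          ∑ j ∈ Finset.range (σ.reg 9), σ.arr 10 (σ.arr 9 j +
          idx P.Q (colorOf P.Q u U c) (σ.arr 5) (σ.reg 8)) := by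
        refine Finset.sum_congr rfl fun j hj => hτtop _ ?_
        have := (hchild j (by simpa using hj)).1
        omega
      rw [hsum] at f3
      refine ⟨⟨by rw [St.arr_setReg, f2], fun i hi => ?_, fun i hi b hb => ?_⟩, ?_⟩
      · rw [St.arr_setReg, f1, f3, if_neg (by omega), hτtop i hi]
      · rw [St.arr_setReg, f1, f3]
        have hs : (∃ c' < c + 1, cand c' i b) ↔ (∃ c' < c, cand c' i b) ∨ cand c i b := by
          simp only [Nat.lt_succ_iff_lt_or_eq, or_and_right, exists_or, exists_eq_left]
        rw [hs, ← hτtab i hi b hb]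
        by_cases hcd : P.LocalOk mk (colorOf P.Q u U c) ∧ σ.reg 10 + i =
            σ.reg 10 + idx P.Q (colorOf P.Q u U c) (σ.arr 4) (σ.reg 7)
        · rw [if_pos hcd, min_le_iff]
          have hi' : idx P.Q (colorOf P.Q u U c) (σ.arr 4) (σ.reg 7) = i := by omega
          simp only [cand, hi', hcd.1, true_and]
        · rw [if_neg hcd]
          refine ⟨Or.inl, fun h => h.resolve_right fun h => hcd ⟨h.2.1, by rw [h.1]⟩⟩
      · refine cost_le_ub _ (fun x hx => le_of_eq (hag.1 x ?_)) (by decide)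
        revert x; decide)
  rw [r14] at hcol4 htab hcost
  obtain ⟨σ4, h4⟩ : ∃ σ4, σ4 = (Cmd.loop 15 14 combineBody).exec σ3 := ⟨_, rfl⟩
  have ag4 := (Cmd.loop 15 14 combineBody).agree σ3
  rw [← h4] at ag4 hcol4 htop htab
  have e4 : combineCode.exec σ = (σ4.setReg 11 (σ4.reg 10)).setReg 10 (σ4.reg 10 + σ4.reg 13) := by
    simp only [combineCode, exec_seq, ← h1, hinit, ← h4, exec_set, eval]
    simp
  have r4 : σ4.reg 10 = σ.reg 10 := by rw [ag4.1 10 (by decide), r3 10 (by decide)]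
  have r4' : σ4.reg 13 = P.Q ^ σ.reg 7 := by rw [ag4.1 13 (by decide), r3'']
  rw [e4]
  simp only [St.reg_setReg, St.arr_setReg, r4, r4', Nat.reduceEqDiff, if_true, if_false, true_and]
  refine ⟨htop, ?_, ?_, ?_, ?_⟩
  · refine Prob.spec_combine (ctab := fun i x => σ.arr 10 (σ.arr 9 i + x)) hS
      (fun i hi => (hchild i hi).2) fun i hi b hb => ?_
    rw [htab i hi b hb]
    constructor
    · rintro ⟨c, hc, h1, h2, h3⟩
      refine ⟨_, ⟨hcol c, fun v hv => ?_⟩, fun v hv => ?_, h1, h2, h3⟩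
      · rw [colorOf, dif_neg]
        exact fun h => absurd (hmkn v ((hU.1 v).2 h)) (by omega)
      · rw [colorOf, dif_neg fun h => (hU.1 v).2 h hv]
    · rintro ⟨ψ, hψ, hψ0, h1, h2, h3⟩
      obtain ⟨c, hc, rfl⟩ := exists_colorOf hU hψ.1 hψ0
      exact ⟨c, hc, h1, h2, h3⟩
  · intro v hv
    rw [ag4.2 7 (by decide), a3' 7 (by decide), hm]
    by_contra h
    have := hmkn v h; omega
  · intro v hv
    rw [hcol4, colorOf, dif_neg]
    exact fun h => absurd (hmkn v ((hU.1 v).2 h)) (by omega)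
  · intro W hW
    have huW : u ≤ W.card := hU.le_card W fun v hv => hW v (by
      by_contra h
      push Not at h
      exact hv (mark_eq_zero.2 h))
    have hpow : P.Q ^ u ≤ P.Q ^ W.card := Nat.pow_le_pow_right hQ0 huW
    have c1 := cost_le_ub' combineMarks σ (by decide)
    have c2 := cost_le_ub' combineInit σ1 (by decide)
    have e : combineCode.cost σ = combineMarks.cost σ + (combineInit.cost σ1 +
        ((Cmd.loop 15 14 combineBody).cost σ3 + (1 + 1))) := by
      simp only [combineCode, cost_seq, ← h1, hinit]; rfl
    rw [e]
    have hb : combineBody.ub σ3.reg ≤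
        40 * (1 + P.M + (σ.reg 7 + σ.reg 8 + 1) * (P.Q + 1) + W.card + σ.reg 9) := by
      simp only [combineBody, evalCode, edgeCheck, vertexCheck, indexCode, sumCode, incCode,
        addLoop, ub, r3 7 (by decide), r3 8 (by decide), r3 9 (by decide), r3', hE3.M, hE3.Q]
      ring_nf
      omega
    have hb1 : combineMarks.ub σ.reg ≤ 20 * (P.n + 1 + (σ.reg 7 + σ.reg 8 + 1) * (P.Q + 1)) := by
      simp only [combineMarks, clearCode, buildCode, powCode, addLoop, ub, hE.n1, hE.Q]
      ring_nf
      omega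
    have hb2 : combineInit.ub σ1.reg ≤ 20 * (1 + u * (P.Q + 1) + P.Q ^ σ.reg 7) := by
      simp only [combineInit, initCode, powCode, addLoop, ub, hE1.Q, ← hu, h13]
      ring_nf
      omega
    have hw : u * (P.Q + 1) ≤ W.card * (P.Q + 1) := Nat.mul_le_mul_right _ huW
    have hmain : P.Q ^ u * (1 + combineBody.ub σ3.reg) ≤ P.Q ^ W.card * (1 +
        40 * (1 + P.M + (σ.reg 7 + σ.reg 8 + 1) * (P.Q + 1) + W.card + σ.reg 9)) := by
      gcongr
    have h1W : P.Q ^ W.card * 1 ≤ P.Q ^ W.card * ((σ.reg 7 + σ.reg 8 + 1) * (P.Q + 1)) :=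
      Nat.mul_le_mul_left _ (Nat.succ_le_of_lt (by positivity))
    refine (add_le_add (c1.trans hb1) (add_le_add (c2.trans hb2)
      (add_le_add (hcost.trans (add_le_add le_rfl hmain)) le_rfl))).trans ?_
    unfold combineBound
    have e2 : (σ.reg 7 + σ.reg 8 + W.card + 1) * (P.Q + 1) =
      (σ.reg 7 + σ.reg 8 + 1) * (P.Q + 1) + W.card * (P.Q + 1) := by ring
    rw [e2]
    generalize P.Q ^ W.card = A at *
    generalize (σ.reg 7 + σ.reg 8 + 1) * (P.Q + 1) = B at *
    generalize W.card * (P.Q + 1) = B' at *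
    generalize u * (P.Q + 1) = B'' at *
    simp only [mul_add, mul_one] at *
    simp only [mul_left_comm A 40] at *
    omega


open Cmd SepAlg.Expr

/-! ### Reading the instance -/

def readHead : Cmd :=
  .set 1 (.get 0 0) ;; .set 5 (.get 0 2) ;; .set 6 (.get 0 3) ;; .set 4 (.get 0 4) ;;
    .set 2 (.get 0 5) ;; .set 26 (.reg 1 + 1) ;; .set 27 6

/-- Read the time-edges and replace the labels by their ranks. -/
def readEdges : Cmd :=
  .loop 16 2 (.put 1 (.reg 16) (.get 0 (.reg 27)) ;; .put 2 (.reg 16) (.get 0 (.reg 27 + 1)) ;;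
    .set 30 (.get 0 (.reg 27 + 2)) ;;
    .ite (.reg 28) (.reg 30) (.set 29 (.reg 29 + 1) ;; .set 28 (.reg 30)) .skip ;;
    .put 3 (.reg 16) (.reg 29) ;; .set 27 (.reg 27 + 3))

def readCode : Cmd := readHead ;; readEdges ;; .set 3 (.reg 29 + 2)

variable {n : ℕ} {I : SeparationInstance n} {L : List (Fin n × Fin n × ℕ)}

theorem getD_flatMap_triple {α : Type} (f : α → List ℕ) (hf : ∀ a, (f a).length = 3) (L : List α)
    (rest : List ℕ) {j i : ℕ} (hj : j < L.length) (hi : i < 3) :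
    (L.flatMap f ++ rest).getD (3 * j + i) 0 = (f L[j]).getD i 0 := by
  induction L generalizing j with
  | nil => simp at hj
  | cons a L ih =>
    rw [List.flatMap_cons, List.append_assoc]
    cases j with
    | zero =>
      rw [List.getD_append _ _ _ _ (by rw [hf]; omega)]
      simp
    | succ j =>
      rw [List.getD_append_right _ _ _ _ (by rw [hf]; omega), hf,
        show 3 * (j + 1) + i - 3 = 3 * j + i by omega]
      exact ih (by simpa using hj)

theorem encode_length (I : SeparationInstance n) (L : List (Fin n × Fin n × ℕ)) :
    (I.encode L).length = 6 + 3 * L.length := by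
  simp [SeparationInstance.encode, List.length_flatMap]; omega

theorem getD_encode (rest : List ℕ) {j i : ℕ} (hj : j < L.length) (hi : i < 3) :
    (I.encode L ++ rest).getD (6 + 3 * j + i) 0 =
      [(L[j].1 : ℕ), (L[j].2.1 : ℕ), L[j].2.2].getD i 0 := by
  rw [SeparationInstance.encode, List.append_assoc, List.getD_append_right _ _ _ _ (by simp; omega)]
  rw [← getD_flatMap_triple (fun e : Fin n × Fin n × ℕ => [(e.1 : ℕ), (e.2.1 : ℕ), e.2.2])
    (by simp) L rest hj hi]
  congr 1
  simp; omega

/-- Since the listing is sorted, all labels before position `k` are at most `p` and all later ones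
at least that of position `k`. So this is the only label in the step from `p`. -/
theorem rank_succ (hL : I.graph.IsListing L) {k p : ℕ} (hk : k < L.length)
    (h1 : ∀ j, ∀ hj : j < L.length, j < k → L[j].2.2 ≤ p) (hp : p < L[k].2.2) :
    rank L L[k].2.2 = rank L p + 1 := by
  unfold rank
  rw [← Finset.card_insert_of_notMem (a := L[k].2.2)
    (s := (labels L).filter (· ≤ p)) (by simp; omega)]
  congr 1
  ext t
  simp only [Finset.mem_filter, Finset.mem_insert]
  have hmem : ∀ j, ∀ hj : j < L.length, L[j].2.2 ∈ labels L := fun j hj => by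
    simp only [labels, List.mem_toFinset, List.mem_map]
    exact ⟨_, List.getElem_mem hj, rfl⟩
  constructor
  · rintro ⟨ht, hle⟩
    have ht' := ht
    simp only [labels, List.mem_toFinset, List.mem_map] at ht
    obtain ⟨e, he, rfl⟩ := ht
    obtain ⟨j, hj, rfl⟩ := List.getElem_of_mem he
    by_cases hjk : j < k
    · exact .inr ⟨ht', h1 j hj hjk⟩
    · rcases Nat.lt_or_ge k j with h | h
      · have := List.pairwise_iff_getElem.1 hL.2.2 k j hk hj h
        exact .inl (le_antisymm hle this)
      · obtain rfl : j = k := by omega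
        exact .inl rfl
  · rintro (rfl | ⟨h, h'⟩)
    exacts [⟨hmem k hk, le_rfl⟩, ⟨h, by omega⟩]

/-- Ranks are computed in one pass: register `28` holds the last label, register `29` its rank, and
the rank goes up exactly if a larger label comes. The initial label 0 has rank 0, as labels are
positive. The last rank is the number of distinct labels, whence `Q`. -/
theorem readCode_exec (hL : I.graph.IsListing L) (rest : List ℕ) :
    Env (SeparationProb I L) (readCode.exec (St.init (I.encode L ++ rest))) ∧
      readCode.cost (St.init (I.encode L ++ rest)) ≤ 20 * (L.length + 1) := by
  set inp := I.encode L ++ rest with hinp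
  obtain ⟨σ1, h1⟩ : ∃ σ1, σ1 = readHead.exec (St.init inp) := ⟨_, rfl⟩
  have hget : ∀ i < 6, inp.getD i 0 = [n, I.graph.maxLabel, I.s, I.z, I.k, L.length].getD i 0 := by
    intro i hi
    rw [hinp, SeparationInstance.encode, List.append_assoc, List.getD_append _ _ _ _ (by simpa)]
  have q1 : σ1.reg 1 = n ∧ σ1.reg 5 = I.s ∧ σ1.reg 6 = I.z ∧ σ1.reg 4 = I.k ∧
      σ1.reg 2 = L.length ∧ σ1.reg 26 = n + 1 ∧ σ1.reg 27 = 6 ∧ σ1.reg 28 = 0 ∧ σ1.reg 29 = 0 := by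
    have g0 := hget 0 (by omega)
    have g2 := hget 2 (by omega)
    have g3 := hget 3 (by omega)
    have g4 := hget 4 (by omega)
    have g5 := hget 5 (by omega)
    rw [h1]
    simp only [readHead, exec_seq, exec_set, eval, St.reg_setReg,
      St.arr_setReg]
    simp only [St.init, if_true, g0, g2, g3, g4, g5]
    simp
  obtain ⟨c1, c5, c6, c4, c2, c26, c27, c28, c29⟩ := q1
  have a0 : σ1.arr 0 = fun i => inp.getD i 0 := by
    rw [h1, arr_exec (by decide)]
    simp [St.init]
  have hrank0 : rank L 0 = 0 := by
    rw [rank, Finset.card_eq_zero, Finset.filter_eq_empty_iff]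
    intro t ht h
    simp only [labels, List.mem_toFinset, List.mem_map] at ht
    obtain ⟨e, he, rfl⟩ := ht
    have := (I.graph.label_mem (s(e.1, e.2.1), e.2.2)
      ((hL.2.1 _).2 (List.mem_map.2 ⟨e, he, rfl⟩))).1
    simp only at this
    omega
  obtain ⟨σ2, h2⟩ : ∃ σ2, σ2 = readEdges.exec σ1 := ⟨_, rfl⟩
  have hloop := exec_loop (P := .put 1 (.reg 16) (.get 0 (.reg 27)) ;;
    .put 2 (.reg 16) (.get 0 (.reg 27 + 1)) ;;
    .set 30 (.get 0 (.reg 27 + 2)) ;;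
    .ite (.reg 28) (.reg 30) (.set 29 (.reg 29 + 1) ;; .set 28 (.reg 30)) .skip ;;
    .put 3 (.reg 16) (.reg 29) ;; .set 27 (.reg 27 + 3)) (i := 16) (n := 2) (σ := σ1)
    (fun k τ => τ.reg 27 = 6 + 3 * k ∧ τ.reg 29 = rank L (τ.reg 28) ∧
      (∀ j, ∀ hj : j < L.length, j < k → L[j].2.2 ≤ τ.reg 28) ∧
      (∀ j, ∀ hj : j < L.length, k ≤ j → τ.reg 28 ≤ L[j].2.2) ∧
      ∀ j, ∀ hj : j < L.length, j < k → τ.arr 1 j = L[j].1 ∧ τ.arr 2 j = L[j].2.1 ∧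
        τ.arr 3 j = rank L L[j].2.2)
    (by simp [c27, c28, c29, hrank0]) (by
    rintro k τ hk hi hag ⟨i1, i2, i3, i4, i5⟩
    rw [c2] at hk
    have e0 : τ.arr 0 = fun i => inp.getD i 0 := by rw [hag.2 0 (by decide), a0]
    have g0 := getD_encode (I := I) rest hk (i := 0) (by omega)
    have g1 := getD_encode (I := I) rest hk (i := 1) (by omega)
    have g2 := getD_encode (I := I) rest hk (i := 2) (by omega)
    rw [← hinp] at g0 g1 g2
    simp only [List.getD_cons_zero, List.getD_cons_succ] at g0 g1 g2
    simp only [exec_seq, exec_put, exec_set, eval, hi, i1, e0, St.reg_setArr,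
      St.arr_setArr, St.reg_setReg, St.arr_setReg, Nat.reduceEqDiff, if_false, if_true,
      OfNat.zero_ne_ofNat, OfNat.one_ne_ofNat, zero_ne_one]
    simp only [add_zero] at g0
    simp only [g0, g1, g2]
    obtain ⟨τ0, hτ0⟩ : ∃ τ0, τ0 = ((τ.setArr 1 k ↑L[k].1).setArr 2 k ↑L[k].2.1).setReg 30
      L[k].2.2 := ⟨_, rfl⟩
    rw [← hτ0]
    have hite : (Cmd.ite (.reg 28) (.reg 30) (.set 29 (.reg 29 + 1) ;; .set 28 (.reg 30))
        .skip).exec τ0 = (τ0.setReg 29 (rank L L[k].2.2)).setReg 28 L[k].2.2 := by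
      simp only [exec_ite, eval, exec_seq, exec_set, exec_skip,
        St.reg_setReg, Nat.reduceEqDiff, if_false]
      have f28 : τ0.reg 28 = τ.reg 28 := by rw [hτ0]; simp
      have f29 : τ0.reg 29 = τ.reg 29 := by rw [hτ0]; simp
      have f30 : τ0.reg 30 = L[k].2.2 := by rw [hτ0]; simp
      rw [f28, f30]
      split_ifs with hlt
      · rw [f29, i2, rank_succ hL hk i3 hlt]
      · have heq : L[k].2.2 = τ.reg 28 := le_antisymm (not_lt.1 hlt) (i4 k hk le_rfl)
        rw [heq, ← i2, ← f29, ← f28]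
        simp [St.setReg]
    rw [hite]
    have f27 : τ0.reg 27 = 6 + 3 * k := by rw [hτ0]; simp [i1]
    have f16 : τ0.reg 16 = k := by rw [hτ0]; simp [hi]
    have fa1 : τ0.arr 1 = Function.update (τ.arr 1) k L[k].1 := by rw [hτ0]; simp
    have fa2 : τ0.arr 2 = Function.update (τ.arr 2) k L[k].2.1 := by rw [hτ0]; simp
    have fa3 : τ0.arr 3 = τ.arr 3 := by rw [hτ0]; simp
    simp only [St.reg_setReg, St.arr_setReg, Nat.reduceEqDiff, if_false, if_true,
      f27, f16, fa1, fa2, fa3, true_and]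
    refine ⟨by ring, fun j hj hjk => ?_, fun j hj hjk => ?_, fun j hj hjk => ?_⟩
    · rcases Nat.lt_succ_iff_lt_or_eq.1 hjk with h | rfl
      · exact List.pairwise_iff_getElem.1 hL.2.2 j k hj hk h
      · exact le_rfl
    · exact List.pairwise_iff_getElem.1 hL.2.2 k j hk hj (by omega)
    · rcases Nat.lt_succ_iff_lt_or_eq.1 hjk with h | rfl
      · simpa [Function.update_apply, h.ne] using i5 j hj h
      · simp)
  have ag2 := readEdges.agree σ1
  rw [show (Cmd.loop 16 2 _).exec σ1 = σ2 from h2.symm] at hloop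
  rw [← h2] at ag2
  rw [c2] at hloop
  obtain ⟨-, i2, i3, -, i5⟩ := hloop
  have hcard : rank L (σ2.reg 28) = (labels L).card := by
    rw [rank, Finset.filter_true_of_mem]
    intro t ht
    simp only [labels, List.mem_toFinset, List.mem_map] at ht
    obtain ⟨e, he, rfl⟩ := ht
    obtain ⟨j, hj, rfl⟩ := List.getElem_of_mem he
    exact i3 j hj hj
  have e : readCode.exec (St.init inp) = σ2.setReg 3 (σ2.reg 29 + 2) := by rw [h2, h1]; rfl
  refine ⟨?_, ?_⟩
  · rw [e]
    refine ⟨?_, ?_, ?_, ?_, ?_, ?_, ?_, fun j hj => ?_, fun j hj => ?_, fun j hj => ?_⟩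
    · simp [ag2.1 1 (by decide), c1, SeparationProb]
    · simp [ag2.1 2 (by decide), c2, SeparationProb]
    · simp [i2, hcard, SeparationProb]
    · simp [ag2.1 4 (by decide), c4, SeparationProb]
    · simp [ag2.1 5 (by decide), c5, SeparationProb]
    · simp [ag2.1 6 (by decide), c6, SeparationProb]
    · simp [ag2.1 26 (by decide), c26, SeparationProb]
    · rw [(separationProb_edge hj).1]; exact (i5 j hj hj).1
    · rw [(separationProb_edge hj).2.1]; exact (i5 j hj hj).2.1
    · rw [(separationProb_edge hj).2.2]; exact (i5 j hj hj).2.2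
  · have k1 := cost_le_ub' readEdges σ1 (by decide)
    have e : readCode.cost (St.init inp) = 7 + (readEdges.cost σ1 + 1) := by
      rw [h1]; rfl
    rw [e]
    simp only [readEdges, ub, c2] at k1 ⊢
    omega

theorem separationProb_wf : (SeparationProb I L).Wf := by
  refine ⟨fun j hj => ?_, fun j hj => ?_, by simp [SeparationProb]⟩
  · rw [(separationProb_edge hj).1]; exact L[j].1.2
  · rw [(separationProb_edge hj).2.1]; exact L[j].2.1.2

/-! ### Sizes -/

theorem card_edges_eq (hL : I.graph.IsListing L) : I.graph.edges.card = L.length := by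
  classical
  have : I.graph.edges = (L.map fun e => (s(e.1, e.2.1), e.2.2)).toFinset := by
    ext e; rw [List.mem_toFinset]; exact hL.2.1 e
  rw [this, List.toFinset_card_of_nodup hL.1, List.length_map]

/-- A connected graph has at least `n - 1` edges, and each edge of the underlying graph comes from a
time-edge. This lets terms in `n` be absorbed by the number of time-edges. -/
theorem card_vertices_le (hL : I.graph.IsListing L) : n ≤ L.length + 1 := by
  classical
  have h := I.connected.card_vert_le_card_edgeSet_add_one
  rw [Nat.card_eq_fintype_card, Fintype.card_fin] at h
  refine h.trans (Nat.succ_le_succ ?_)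
  rw [← card_edges_eq hL, ← Set.ncard_coe_finset, ← Nat.card_coe_set_eq]
  refine (Nat.card_mono (Set.Finite.image Prod.fst (Finset.finite_toSet I.graph.edges))
    fun e he => ?_).trans ?_
  · induction e using Sym2.ind with
    | _ a b =>
      obtain ⟨t, ht⟩ := he
      exact ⟨_, ht, rfl⟩
  · rw [Nat.card_coe_set_eq, Nat.card_coe_set_eq]
    exact Set.ncard_image_le (Finset.finite_toSet _)

theorem two_le_n (I : SeparationInstance n) : 2 ≤ n := by
  by_contra h
  have h1 := I.s.2
  have h2 := I.z.2
  exact I.s_ne_z (Fin.ext (by omega))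

theorem one_le_length (hL : I.graph.IsListing L) : 1 ≤ L.length := by
  have := card_vertices_le hL
  have := two_le_n I
  omega

/-- The reason for using ranks: the maximum label is a single number of the input and not bounded by
its length, but the number of distinct labels is. -/
theorem card_labels_le_length (L : List (Fin n × Fin n × ℕ)) : (labels L).card ≤ L.length := by
  refine (List.toFinset_card_le _).trans ?_
  simp

theorem card_labels_le_maxLabel (hL : I.graph.IsListing L) :
    (labels L).card ≤ I.graph.maxLabel := by
  have : labels L ⊆ Finset.Icc 1 I.graph.maxLabel := by
    intro t ht
    simp only [labels, List.mem_toFinset, List.mem_map] at ht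
    obtain ⟨e, he, rfl⟩ := ht
    exact Finset.mem_Icc.2 (I.graph.label_mem (s(e.1, e.2.1), e.2.2)
      ((hL.2.1 _).2 (List.mem_map.2 ⟨e, he, rfl⟩)))
  simpa using Finset.card_le_card this


/-! ### Rooted tree decompositions -/

section Rooted

variable {V : Type} {G : SimpleGraph V} {N : ℕ} (D : RootedTreeDecomposition G N)

/-- `j` is a descendant of `i`. -/
def Desc (i j : Fin N) : Prop := ∃ k : ℕ, D.parent^[k] j = i

open Classical in
noncomputable def depth (i : Fin N) : ℕ := Nat.find (D.reaches_root i)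

variable {D}

theorem depth_parent {i : Fin N} (hi : i ≠ D.root) : depth D i = depth D (D.parent i) + 1 := by
  classical
  have h := Nat.find_spec (D.reaches_root i)
  refine le_antisymm (Nat.find_min' _ ?_) ?_
  · rw [Function.iterate_succ_apply]
    exact Nat.find_spec (D.reaches_root (D.parent i))
  · obtain ⟨k, hk⟩ : ∃ k, Nat.find (D.reaches_root i) = k + 1 := by
      refine ⟨Nat.find (D.reaches_root i) - 1, ?_⟩
      have : Nat.find (D.reaches_root i) ≠ 0 := fun h0 => hi (by rw [h0] at h; exact h)
      omega
    have : depth D (D.parent i) ≤ k := by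
      refine Nat.find_min' _ ?_
      rw [hk, Function.iterate_succ_apply] at h
      exact h
    unfold depth at this ⊢
    rw [hk]
    omega

theorem depth_parent_le (i : Fin N) : depth D (D.parent i) ≤ depth D i := by
  by_cases h : i = D.root
  · rw [h, D.parent_root]
  · rw [depth_parent h]; omega

theorem depth_iterate_le (i : Fin N) (k : ℕ) : depth D (D.parent^[k] i) ≤ depth D i := by
  induction k with
  | zero => rfl
  | succ k ih => rw [Function.iterate_succ_apply']; exact (depth_parent_le _).trans ih

theorem iterate_depth (i : Fin N) : D.parent^[depth D i] i = D.root := by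
  classical
  exact Nat.find_spec (D.reaches_root i)

theorem iterate_ne_root {i : Fin N} {k : ℕ} (hk : k < depth D i) : D.parent^[k] i ≠ D.root := by
  classical
  exact Nat.find_min (D.reaches_root i) hk

theorem depth_iterate {i : Fin N} {k : ℕ} (hk : k ≤ depth D i) :
    depth D (D.parent^[k] i) = depth D i - k := by
  induction k with
  | zero => rfl
  | succ k ih =>
    have := depth_parent (iterate_ne_root (D := D) (i := i) (k := k) (by omega))
    rw [ih (by omega)] at this
    rw [Function.iterate_succ_apply']
    omega

/-- The iterated parents up to the root have pairwise different depths, so they are distinct nodes.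
-/
theorem depth_lt (i : Fin N) : depth D i < N := by
  have := Finset.card_le_card_of_injOn (s := Finset.range (depth D i + 1))
    (t := (Finset.univ : Finset (Fin N))) (fun k => D.parent^[k] i) (by simp) (by
      intro a ha b hb h
      simp only [Finset.coe_range, Set.mem_Iio] at ha hb
      have h1 := depth_iterate (D := D) (i := i) (k := a) (by omega)
      have h2 := depth_iterate (D := D) (i := i) (k := b) (by omega)
      simp only at h
      rw [h, h2] at h1
      omega)
  simpa using this

theorem Desc.depth_le {i j : Fin N} (h : Desc D i j) : depth D i ≤ depth D j := by
  obtain ⟨k, rfl⟩ := h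
  exact depth_iterate_le j k

theorem Desc.trans {i j l : Fin N} (h : Desc D i j) (h' : Desc D j l) : Desc D i l := by
  obtain ⟨k, rfl⟩ := h
  obtain ⟨k', rfl⟩ := h'
  exact ⟨k + k', Function.iterate_add_apply ..⟩

theorem desc_root (i : Fin N) : Desc D D.root i := D.reaches_root i

theorem not_desc_parent {i : Fin N} (hi : i ≠ D.root) : ¬ Desc D i (D.parent i) := fun h => by
  have := h.depth_le
  rw [depth_parent hi] at this
  omega

theorem cross_adj {i a b : Fin N} (h : D.tree.Adj a b) (ha : Desc D i a) (hb : ¬ Desc D i b) :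
    a = i ∧ b = D.parent i := by
  rcases ((D.adj_iff a b).1 h).2 with h | h
  · obtain ⟨k, hk⟩ := ha
    cases k with
    | zero => obtain rfl : a = i := hk; exact ⟨rfl, h.symm⟩
    | succ k => exact absurd ⟨k, by rw [← h]; exact hk⟩ hb
  · exact absurd (ha.trans ⟨1, h⟩) hb

/-- The nodes whose bag contains `v` are connected, and the only tree edge that leaves the subtree
at `i` joins `i` to its parent (`cross_adj`). -/
theorem mem_bag_of_desc {i j j' : Fin N} {v : V} (hj : v ∈ D.bag j) (hj' : v ∈ D.bag j')
    (h : Desc D i j) (h' : ¬ Desc D i j') : i ≠ D.root ∧ v ∈ D.bag i ∧ v ∈ D.bag (D.parent i) := by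
  refine ⟨fun hi => h' (hi ▸ desc_root j'), ?_⟩
  have hr := (D.connected v).preconnected ⟨j, hj⟩ ⟨j', hj'⟩
  rw [SimpleGraph.reachable_iff_reflTransGen] at hr
  by_contra hcon
  have : ∀ x, Relation.ReflTransGen (D.tree.induce {i | v ∈ D.bag i}).Adj ⟨j, hj⟩ x →
      Desc D i x.1 := by
    intro x hx
    induction hx with
    | refl => exact h
    | @tail b c _ hbc ih =>
      by_contra hc
      obtain ⟨h1, h2⟩ := cross_adj hbc ih hc
      exact hcon ⟨h1 ▸ b.2, h2 ▸ c.2⟩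
  exact h' (this _ hr)

variable (D)

/-- The vertices that occur in bags below the node `i` only, not in that of its parent. -/
def Below (i : Fin N) (v : V) : Prop :=
  (∃ j, Desc D i j ∧ v ∈ D.bag j) ∧ (i ≠ D.root → v ∉ D.bag (D.parent i))

def IsChild (i j : Fin N) : Prop := j ≠ D.root ∧ D.parent j = i

variable {D}

theorem Below.desc {i j : Fin N} {v : V} (h : Below D i v) (hj : v ∈ D.bag j) : Desc D i j := by
  by_contra hn
  obtain ⟨⟨j', h1, h2⟩, h3⟩ := h
  obtain ⟨h4, -, h5⟩ := mem_bag_of_desc h2 hj h1 hn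
  exact h3 h4 h5

theorem Desc.eq_or_child {i j : Fin N} (h : Desc D i j) :
    j = i ∨ ∃ c, IsChild D i c ∧ Desc D c j := by
  obtain ⟨k, hk⟩ := h
  induction k with
  | zero => exact .inl hk
  | succ k ih =>
    by_cases hc : D.parent^[k] j = D.root
    · refine ih ?_
      rw [Function.iterate_succ_apply', hc, D.parent_root] at hk
      rw [hc, hk]
    · rw [Function.iterate_succ_apply'] at hk
      exact .inr ⟨_, ⟨hc, hk⟩, k, rfl⟩

theorem IsChild.depth {i j : Fin N} (h : IsChild D i j) : depth D j = depth D i + 1 := by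
  rw [depth_parent h.1, h.2]

theorem IsChild.not_below {i j : Fin N} {v : V} (h : IsChild D i j) (hv : Below D j v) :
    v ∉ D.bag i := h.2 ▸ hv.2 h.1

theorem below_iff {i : Fin N} {v : V} : Below D i v ↔
    (v ∈ D.bag i ∧ (i ≠ D.root → v ∉ D.bag (D.parent i))) ∨ ∃ j, IsChild D i j ∧ Below D j v := by
  constructor
  · rintro ⟨⟨j, h1, h2⟩, h3⟩
    by_cases hi : v ∈ D.bag i
    · exact .inl ⟨hi, h3⟩
    · rcases h1.eq_or_child with rfl | ⟨c, hc, hcj⟩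
      · exact absurd h2 hi
      · exact .inr ⟨c, hc, ⟨j, hcj, h2⟩, fun _ => hc.2.symm ▸ hi⟩
  · rintro (⟨h1, h2⟩ | ⟨j, hj, hv⟩)
    · exact ⟨⟨i, ⟨0, rfl⟩, h1⟩, h2⟩
    · obtain ⟨l, hl, hvl⟩ := hv.1
      refine ⟨⟨l, Desc.trans ⟨1, hj.2⟩ hl, hvl⟩, fun hi hp => ?_⟩
      -- If `v` were in the bag of the parent of `i`, this parent would be a descendant of the child
      -- `j`, although it is less deep.
      have h1 := (hv.desc hp).depth_le
      rw [hj.depth, depth_parent hi] at h1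
      omega

/-- A node whose bag contains `v` is a descendant of both children. If they differed, one would be a
proper ancestor of the other, which is impossible at equal depth. -/
theorem IsChild.disjoint {i j j' : Fin N} {v : V} (hj : IsChild D i j) (hj' : IsChild D i j')
    (h : Below D j v) (h' : Below D j' v) : j = j' := by
  obtain ⟨l, ⟨k, hk⟩, hv⟩ := h.1
  obtain ⟨k', hk'⟩ := h'.desc hv
  have key : ∀ {a b : Fin N} {k k' : ℕ}, IsChild D i a → IsChild D i b → D.parent^[k] l = a →
      D.parent^[k'] l = b → k ≤ k' → a = b := by
    intro a b k k' ha hb h1 h2 hle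
    obtain ⟨d, rfl⟩ := Nat.exists_eq_add_of_le hle
    rw [add_comm, Function.iterate_add_apply, h1] at h2
    cases d with
    | zero => exact h2
    | succ d =>
      rw [Function.iterate_succ_apply, ha.2] at h2
      have := depth_iterate_le (D := D) i d
      rw [h2, hb.depth] at this
      omega
  rcases le_total k k' with h | h
  · exact key hj hj' hk hk' h
  · exact (key hj' hj hk' hk h).symm

/-- Some bag contains both `a` and `b`, and it belongs to a descendant of `i`. If `b` also occurs in
the bag of the parent, connectivity puts it into the bag of `i` as well. -/
theorem Below.adj {i : Fin N} {a b : V} (h : Below D i a) (hab : G.Adj a b) :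
    Below D i b ∨ (i ≠ D.root ∧ b ∈ D.bag i ∧ b ∈ D.bag (D.parent i)) := by
  obtain ⟨x, hx1, hx2⟩ := D.edge_mem a b hab
  have hd := h.desc hx1
  by_cases hp : i ≠ D.root ∧ b ∈ D.bag (D.parent i)
  · exact .inr (mem_bag_of_desc hx2 hp.2 hd (not_desc_parent hp.1))
  · push Not at hp
    exact .inl ⟨⟨x, hd, hx2⟩, hp⟩

theorem below_root (v : V) : Below D D.root v := by
  obtain ⟨⟨i, hi⟩⟩ := (D.connected v).nonempty
  exact ⟨⟨i, desc_root i, hi⟩, fun h => absurd rfl h⟩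

end Rooted

/-! ### Rooting a tree decomposition; existence of an optimal one. -/

section Rooting

variable {V : Type} {G : SimpleGraph V} {N : ℕ}

/-- Any node serves as root; the parent is the second node on the unique path to it. For an edge
`ij`, either `j` lies on the path from `i` and is its second node by acyclicity, or putting `j` in
front of this path gives the path from `j`. -/
theorem exists_rooted (D : TreeDecomposition G N) :
    ∃ D' : RootedTreeDecomposition G N, D'.toTreeDecomposition = D := by
  classical
  obtain ⟨r⟩ := D.isTree.connected.nonempty
  have hacyc := D.isTree.isAcyclic
  choose p hp hup using fun i => D.isTree.existsUnique_path i r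
  have hpr : ∀ i, i ≠ r → ¬ (p i).Nil := fun i hi hn => hi hn.eq
  have hprr : p r = .nil := (hup r .nil .nil).symm
  let par : Fin N → Fin N := fun i => if i = r then r else (p i).snd
  have htail : ∀ i, i ≠ r → ∀ k, (p i).length = k + 1 → (p (par i)).length = k := by
    intro i hi k hk
    have h1 : par i = (p i).snd := if_neg hi
    have h2 : (p i).tail = p (p i).snd := hup _ _ (hp i).tail
    rw [h1, ← h2]
    have := SimpleGraph.Walk.length_tail_add_one (hpr i hi)
    omega
  have hlen0 : ∀ i, (p i).length = 0 → i = r := fun i h => SimpleGraph.Walk.eq_of_length_eq_zero h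
  refine ⟨⟨D, r, par, if_pos rfl, ?_, ?_⟩, rfl⟩
  · intro i
    suffices ∀ k i, (p i).length = k → par^[k] i = r from ⟨_, this _ i rfl⟩
    intro k
    induction k with
    | zero => exact hlen0
    | succ k ih =>
      intro i hi
      rw [Function.iterate_succ_apply]
      refine ih _ (htail i ?_ k hi)
      rintro rfl
      rw [hprr] at hi
      simp at hi
  · intro i j
    constructor
    · intro h
      refine ⟨h.ne, ?_⟩
      by_cases hj : j ∈ (p i).support
      · have hi : i ≠ r := by
          rintro rfl
          rw [hprr] at hj
          simp only [SimpleGraph.Walk.support_nil, List.mem_singleton] at hj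
          exact h.ne hj.symm
        left
        simp only [par, hi, if_false]
        exact (hacyc.eq_snd_of_adj_start (hp i) h hj).symm
      · right
        have hjr : j ≠ r := by
          rintro rfl
          exact hj (SimpleGraph.Walk.end_mem_support _)
        have : SimpleGraph.Walk.cons h.symm (p i) = p j :=
          hup _ _ ((SimpleGraph.Walk.cons_isPath_iff _ _).2 ⟨hp i, hj⟩)
        simp only [par, hjr, if_false]
        rw [← this]
        simp
    · have key : ∀ i j, i ≠ j → par i = j → D.tree.Adj i j := by
        intro i j hij h
        have hi : i ≠ r := by
          rintro rfl
          exact hij (by rw [← h]; exact (if_pos rfl).symm)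
        have h1 : par i = (p i).snd := if_neg hi
        rw [← h, h1]
        exact SimpleGraph.Walk.adj_snd (hpr i hi)
      rintro ⟨hij, h | h⟩
      · exact key i j hij h
      · exact (key j i hij.symm h).symm

/-- The decomposition with a single bag. -/
def trivialDecomposition {n : ℕ} (G : SimpleGraph (Fin n)) : TreeDecomposition G 1 where
  tree := ⊥
  isTree := .of_subsingleton
  bag _ := Finset.univ
  connected v := by
    have : Subsingleton {i : Fin 1 | v ∈ (Finset.univ : Finset (Fin n))} := inferInstance
    have : Nonempty {i : Fin 1 | v ∈ (Finset.univ : Finset (Fin n))} := ⟨⟨0, by simp⟩⟩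
    exact (SimpleGraph.IsTree.of_subsingleton).connected
  edge_mem v w _ := ⟨0, by simp, by simp⟩

/-- Guarantees that the search over tuple lengths up to `n` finds an answer. -/
theorem treewidth_le {n : ℕ} (G : SimpleGraph (Fin n)) : treewidth G ≤ n - 1 :=
  Nat.sInf_le ⟨1, trivialDecomposition G, by simp [TreeDecomposition.width, trivialDecomposition]⟩

theorem exists_rooted_treewidth {n : ℕ} (G : SimpleGraph (Fin n)) :
    ∃ (N : ℕ) (D : RootedTreeDecomposition G N), D.width = treewidth G := by
  have hne : {w | ∃ (N : ℕ) (D : TreeDecomposition G N), D.width = w}.Nonempty :=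
    ⟨_, 1, trivialDecomposition G, rfl⟩
  obtain ⟨N, D, hD⟩ := Nat.sInf_mem hne
  obtain ⟨D', rfl⟩ := exists_rooted D
  exact ⟨N, D', hD⟩

theorem card_bag_le (D : TreeDecomposition G N) (i : Fin N) : (D.bag i).card ≤ D.width + 1 := by
  have : (D.bag i).card ≤ Finset.univ.sup fun i => (D.bag i).card :=
    Finset.le_sup (f := fun i => (D.bag i).card) (Finset.mem_univ i)
  unfold TreeDecomposition.width
  omega

end Rooting


open Cmd SepAlg.Expr

/-! ### Reading the tree decomposition -/

def readTreeHead : Cmd :=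
  .set 31 (6 + (.reg 2 + (.reg 2 + .reg 2))) ;; .set 32 (.get 0 (.reg 31)) ;;
    .set 33 (.get 0 (.reg 31 + 1)) ;; .set 31 (.reg 31 + 2)

/-- Store the parents, the sizes of the bags and their addresses in the arrays `11`, `12`, `13`. -/
def readNodes : Cmd :=
  .loop 34 32 (.put 11 (.reg 34) (.get 0 (.reg 31)) ;;
    .put 12 (.reg 34) (.get 0 (.reg 31 + 1)) ;; .put 13 (.reg 34) (.reg 31 + 2) ;;
    .set 31 (.reg 31 + (2 + .get 0 (.reg 31 + 1))))

def walkCode : Cmd :=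
  .loop 37 32 (.ite (absDiff (.reg 35) (.reg 33)) 1 .skip
    (.set 35 (.get 11 (.reg 35)) ;; .set 36 (.reg 36 + 1)))

/-- Store the depths of the nodes in array `14`. -/
def depthCode : Cmd :=
  .loop 34 32 (.set 35 (.reg 34) ;; .set 36 0 ;; walkCode ;; .put 14 (.reg 34) (.reg 36))

def readTree : Cmd := readTreeHead ;; readNodes ;; depthCode

variable {n N : ℕ} {G : SimpleGraph (Fin n)}

/-- The decomposition is stored in the registers and arrays. -/
structure TreeEnv (D : RootedTreeDecomposition G N) (bags : Fin N → List (Fin n)) (σ : St) :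
    Prop where
  size : σ.reg 32 = N
  root : σ.reg 33 = D.root
  parent : ∀ i : Fin N, σ.arr 11 i = D.parent i
  length : ∀ i : Fin N, σ.arr 12 i = (bags i).length
  bag : ∀ i : Fin N, ∀ l, ∀ hl : l < (bags i).length, σ.arr 0 (σ.arr 13 i + l) = (bags i)[l]
  depth : ∀ i : Fin N, σ.arr 14 i = depth D i

variable {D : RootedTreeDecomposition G N} {bags : Fin N → List (Fin n)}

theorem TreeEnv.of_agree {σ τ : St} (h : TreeEnv D bags σ) {c : Cmd} (hc : c.Agree σ τ)
    (hr : ∀ x ∈ [32, 33], x ∉ c.regs) (ha : ∀ a ∈ [0, 11, 12, 13, 14], a ∉ c.arrs) :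
    TreeEnv D bags τ := by
  have e0 := hc.2 0 (ha 0 (by decide))
  have e11 := hc.2 11 (ha 11 (by decide))
  have e12 := hc.2 12 (ha 12 (by decide))
  have e13 := hc.2 13 (ha 13 (by decide))
  have e14 := hc.2 14 (ha 14 (by decide))
  constructor
  · rw [hc.1 32 (hr 32 (by decide)), h.size]
  · rw [hc.1 33 (hr 33 (by decide)), h.root]
  · rw [e11]; exact h.parent
  · rw [e12]; exact h.length
  · rw [e0, e13]; exact h.bag
  · rw [e14]; exact h.depth

/-- The walk towards the root makes `N` rounds, but stands still once the root is reached; after `k`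
rounds it has made `min k (depth D i)` moves. As depths are below `N`, it always arrives. -/
theorem walkCode_exec {σ : St} (h32 : σ.reg 32 = N) (h33 : σ.reg 33 = D.root)
    (h11 : ∀ i : Fin N, σ.arr 11 i = D.parent i) (i : Fin N) (h35 : σ.reg 35 = i)
    (h36 : σ.reg 36 = 0) : (walkCode.exec σ).reg 36 = depth D i := by
  have h := exec_loop (P := .ite (absDiff (.reg 35) (.reg 33)) 1 .skip
    (.set 35 (.get 11 (.reg 35)) ;; .set 36 (.reg 36 + 1))) (i := 37) (n := 32) (σ := σ)
    (fun k τ => τ.reg 35 = (D.parent^[min k (depth D i)] i : Fin N) ∧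
      τ.reg 36 = min k (depth D i)) (by simp [h35, h36]) (by
    rintro k τ hk hi hag ⟨i1, i2⟩
    have e33 : τ.reg 33 = D.root := by rw [hag.1 33 (by decide), h33]
    have e11 : τ.arr 11 = σ.arr 11 := hag.2 11 (by decide)
    simp only [exec_ite, eval_absDiff, eval_ofNat]
    simp only [eval, i1, e33]
    by_cases hlt : k < depth D i
    · have hne := iterate_ne_root (D := D) hlt
      rw [min_eq_left hlt.le] at i1 i2 ⊢
      rw [min_eq_left (by omega), if_neg (fun h => hne (Fin.ext h))]
      simp only [exec_seq, exec_set, eval, i1, i2, St.reg_setReg,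
        e11, h11]
      simp [Function.iterate_succ_apply']
    · rw [min_eq_right (by omega)] at i1 i2 ⊢
      rw [min_eq_right (by omega), iterate_depth, if_pos rfl]
      rw [iterate_depth] at i1
      simp [i1, i2])
  have := h.2
  rw [h32, min_eq_right (depth_lt i).le] at this
  exact this

/-- The record of a node in the encoding of a decomposition. -/
def nodeCode (D : RootedTreeDecomposition G N) (bags : Fin N → List (Fin n)) (i : Fin N) : List ℕ :=
  [(D.parent i : ℕ), (bags i).length] ++ (bags i).map fun v => (v : ℕ)

/-- The position of the record of the `k`-th node. -/
def nodePos (D : RootedTreeDecomposition G N) (bags : Fin N → List (Fin n)) (k : ℕ) : ℕ :=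
  (((List.finRange N).take k).flatMap (nodeCode D bags)).length

theorem nodePos_succ {k : ℕ} (hk : k < N) :
    nodePos D bags (k + 1) = nodePos D bags k + (2 + (bags ⟨k, hk⟩).length) := by
  rw [nodePos, List.take_succ_eq_append_getElem (by simpa), List.flatMap_append,
    List.length_append]
  simp [nodePos, nodeCode]
  omega

variable {I : SeparationInstance n} {L : List (Fin n × Fin n × ℕ)}
  {D : RootedTreeDecomposition I.graph.underlying N}

theorem getD_decomposition (i : Fin N) {x : ℕ} (hx : x < 2 + (bags i).length) :
    (I.encode L ++ D.encode bags).getD (8 + 3 * L.length + nodePos D bags i + x) 0 =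
      (nodeCode D bags i).getD x 0 := by
  have hpos : 8 + 3 * L.length + nodePos D bags i + x - (6 + 3 * L.length) =
      nodePos D bags i + x + 2 := by omega
  rw [List.getD_append_right _ _ _ _ (by rw [encode_length]; omega), encode_length, hpos]
  change ([N, (D.root : ℕ)] ++ (List.finRange N).flatMap (nodeCode D bags)).getD _ 0 = _
  rw [List.getD_append_right _ _ _ _ (by simp)]
  have hsplit : List.finRange N = (List.finRange N).take i ++ i :: (List.finRange N).drop (i + 1) := by
    conv_lhs => rw [← List.take_append_drop i (List.finRange N)]
    rw [List.drop_eq_getElem_cons (by simp)]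
    simp
  rw [hsplit, List.flatMap_append, List.flatMap_cons]
  rw [List.getD_append_right _ _ _ _ (by unfold nodePos; simp)]
  rw [List.getD_append _ _ _ _ (by unfold nodePos; simp [nodeCode]; omega)]
  congr 1
  unfold nodePos
  simp

theorem readTree_exec {σ : St} (h0 : σ.arr 0 = fun i => (I.encode L ++ D.encode bags).getD i 0)
    (h2 : σ.reg 2 = L.length) :
    TreeEnv D bags (readTree.exec σ) ∧ readTree.cost σ ≤ 20 * ((N + 1) * (N + 1)) := by
  set inp := I.encode L ++ D.encode bags with hinp
  have hhead : ∀ x < 2, inp.getD (6 + 3 * L.length + x) 0 = [N, (D.root : ℕ)].getD x 0 := by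
    intro x hx
    rw [hinp, List.getD_append_right _ _ _ _ (by rw [encode_length]; omega), encode_length,
      RootedTreeDecomposition.encode, List.getD_append _ _ _ _ (by simp; omega)]
    congr 1
    omega
  have g0 := hhead 0 (by omega)
  have g1 := hhead 1 (by omega)
  simp only [List.getD_cons_zero, List.getD_cons_succ, add_zero] at g0 g1
  obtain ⟨σ1, h1⟩ : ∃ σ1, σ1 = readTreeHead.exec σ := ⟨_, rfl⟩
  have e6 : 6 + (L.length + (L.length + L.length)) = 6 + 3 * L.length := by omega
  have q1 : σ1.reg 32 = N ∧ σ1.reg 33 = D.root ∧ σ1.reg 31 = 8 + 3 * L.length := by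
    rw [h1]
    simp only [readTreeHead, exec_seq, exec_set, eval, St.reg_setReg,
      St.arr_setReg, h2, h0, e6]
    simp only [if_true, Nat.reduceEqDiff, if_false, g0, g1, true_and]
    omega
  obtain ⟨c32, c33, c31⟩ := q1
  have a0 : σ1.arr 0 = fun i => inp.getD i 0 := by rw [h1, arr_exec (by decide), h0]
  obtain ⟨σ2, h2'⟩ : ∃ σ2, σ2 = readNodes.exec σ1 := ⟨_, rfl⟩
  have hloop := exec_loop (P := .put 11 (.reg 34) (.get 0 (.reg 31)) ;;
    .put 12 (.reg 34) (.get 0 (.reg 31 + 1)) ;; .put 13 (.reg 34) (.reg 31 + 2) ;;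
    .set 31 (.reg 31 + (2 + .get 0 (.reg 31 + 1)))) (i := 34) (n := 32) (σ := σ1)
    (fun k τ => τ.reg 31 = 8 + 3 * L.length + nodePos D bags k ∧
      ∀ i : Fin N, (i : ℕ) < k → τ.arr 11 i = D.parent i ∧ τ.arr 12 i = (bags i).length ∧
        τ.arr 13 i = 8 + 3 * L.length + nodePos D bags i + 2)
    (by simp [c31, nodePos]) (by
    rintro k τ hk hi hag ⟨i1, i2⟩
    rw [c32] at hk
    have e0 : τ.arr 0 = fun i => inp.getD i 0 := by rw [hag.2 0 (by decide), a0]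
    have q0 := getD_decomposition (I := I) (L := L) (D := D) (bags := bags) ⟨k, hk⟩ (x := 0)
      (by omega)
    have q1 := getD_decomposition (I := I) (L := L) (D := D) (bags := bags) ⟨k, hk⟩ (x := 1)
      (by omega)
    rw [← hinp] at q0 q1
    simp only [nodeCode, List.cons_append, List.getD_cons_zero, List.getD_cons_succ,
      add_zero] at q0 q1
    simp only [exec_seq, exec_put, exec_set, eval, hi, i1, e0, St.reg_setArr,
      St.arr_setArr, St.reg_setReg, St.arr_setReg, Nat.reduceEqDiff, if_false, if_true,
      OfNat.zero_ne_ofNat, q0, q1, nodePos_succ hk, Function.update_apply]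
    refine ⟨by omega, fun i hik => ?_⟩
    by_cases hik' : (i : ℕ) = k
    · obtain rfl : i = ⟨k, hk⟩ := Fin.ext hik'
      simp
    · simpa [hik'] using i2 i (by omega))
  rw [show (Cmd.loop 34 32 _).exec σ1 = σ2 from h2'.symm, c32] at hloop
  have ag2 := readNodes.agree σ1
  rw [← h2'] at ag2
  have b32 : σ2.reg 32 = N := by rw [ag2.1 32 (by decide), c32]
  have b33 : σ2.reg 33 = D.root := by rw [ag2.1 33 (by decide), c33]
  have b11 : ∀ i : Fin N, σ2.arr 11 i = D.parent i := fun i => (hloop.2 i i.2).1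
  obtain ⟨σ3, h3⟩ : ∃ σ3, σ3 = depthCode.exec σ2 := ⟨_, rfl⟩
  have hloop2 := exec_loop (P := .set 35 (.reg 34) ;; .set 36 0 ;; walkCode ;;
    .put 14 (.reg 34) (.reg 36)) (i := 34) (n := 32) (σ := σ2)
    (fun k τ => ∀ i : Fin N, (i : ℕ) < k → τ.arr 14 i = depth D i) (by simp) (by
    rintro k τ hk hi hag i1
    rw [b32] at hk
    have e := walkCode_exec (D := D) (σ := (τ.setReg 35 k).setReg 36 0)
      (by simp [hag.1 32 (by decide), b32]) (by simp [hag.1 33 (by decide), b33])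
      (by simpa [hag.2 11 (by decide)] using b11) ⟨k, hk⟩ (by simp) (by simp)
    intro i hik
    have e34 : (walkCode.exec ((τ.setReg 35 k).setReg 36 0)).reg 34 = k := by
      rw [reg_exec (by decide)]; simp [hi]
    have e14 : (walkCode.exec ((τ.setReg 35 k).setReg 36 0)).arr 14 = τ.arr 14 := by
      rw [arr_exec (by decide)]; simp
    simp only [exec_seq, exec_set, exec_put, eval, hi, St.arr_setReg, St.arr_setArr,
      if_true, e, e34, e14, Function.update_apply]
    by_cases hik' : (i : ℕ) = k
    · obtain rfl : i = ⟨k, hk⟩ := Fin.ext hik'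
      simp
    · simpa [hik'] using i1 i (by omega))
  rw [show (Cmd.loop 34 32 _).exec σ2 = σ3 from h3.symm, b32] at hloop2
  have ag3 := depthCode.agree σ2
  rw [← h3] at ag3
  have e : readTree.exec σ = σ3 := by rw [h3, h2', h1]; rfl
  rw [e]
  refine ⟨⟨?_, ?_, ?_, ?_, ?_, fun i => hloop2 i i.2⟩, ?_⟩
  · rw [ag3.1 32 (by decide), b32]
  · rw [ag3.1 33 (by decide), b33]
  · rw [ag3.2 11 (by decide)]; exact b11
  · rw [ag3.2 12 (by decide)]; exact fun i => (hloop.2 i i.2).2.1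
  · intro i l hl
    rw [ag3.2 13 (by decide), ag3.2 0 (by decide), (hloop.2 i i.2).2.2, ag2.2 0 (by decide), a0]
    have := getD_decomposition (I := I) (L := L) (D := D) (bags := bags) i (x := 2 + l)
      (by omega)
    rw [← add_assoc, ← hinp] at this
    simp only [this, nodeCode]
    rw [List.getD_append_right _ _ _ _ (by simp)]
    have e2 : 2 + l - [(D.parent i : ℕ), (bags i).length].length = l := by simp
    -- The list of vertices appears here in the form of a monadic coercion to `List ℕ`; this is the
    -- same as mapping `Fin.val`.
    have e3 : (do let a ← bags i; pure (a : ℕ)) = List.map Fin.val (bags i) := by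
      rw [List.map_eq_flatMap]; rfl
    rw [e2, List.map_id', List.getD_eq_getElem _ _ (by rw [e3]; simpa using hl),
      List.getElem_of_eq e3, List.getElem_map]
  · have k1 := cost_le_ub' readNodes σ1 (by decide)
    have k2 := cost_le_ub' depthCode σ2 (by decide)
    have e : readTree.cost σ = 4 + (readNodes.cost σ1 + depthCode.cost σ2) := by
      rw [h2', h1]; rfl
    rw [e]
    simp only [readNodes, depthCode, walkCode, ub, c32, b32] at k1 k2 ⊢
    ring_nf at k1 k2 ⊢
    omega

/-- Bags are listed without repetition, so the record of a node has at most `n + 2` entries. -/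
theorem decomposition_length_le (hb : D.IsBagListing bags) :
    (I.encode L ++ D.encode bags).length ≤ baseAddr (I.encode L ++ D.encode bags) := by
  have h5 : (I.encode L ++ D.encode bags).getD 5 0 = L.length := by
    rw [SeparationInstance.encode, List.append_assoc, List.getD_append _ _ _ _ (by simp)]; rfl
  have h0 : (I.encode L ++ D.encode bags).getD 0 0 = n := by
    rw [SeparationInstance.encode, List.append_assoc, List.getD_append _ _ _ _ (by simp)]; rfl
  have hN : (I.encode L ++ D.encode bags).getD (6 + 3 * L.length) 0 = N := by
    rw [List.getD_append_right _ _ _ _ (by rw [encode_length]), encode_length]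
    simp [RootedTreeDecomposition.encode]
  rw [baseAddr, h5, h0, hN, List.length_append, encode_length]
  have hsum : ((List.finRange N).flatMap (nodeCode D bags)).length ≤ N * (n + 2) := by
    rw [List.length_flatMap]
    refine (List.sum_le_card_nsmul _ (n + 2) ?_).trans (by simp)
    intro x hx
    obtain ⟨i, -, rfl⟩ := List.mem_map.1 hx
    have := (hb i).1.length_le_card
    simp only [Fintype.card_fin] at this
    simp [nodeCode]; omega
  have : (D.encode bags).length = 2 + ((List.finRange N).flatMap (nodeCode D bags)).length := by
    simp only [RootedTreeDecomposition.encode, List.length_append]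
    rfl
  omega

theorem baseAddr_decomposition : baseAddr (I.encode L ++ D.encode bags) =
    8 + 3 * L.length + N * (n + 2) := by
  have h5 : (I.encode L ++ D.encode bags).getD 5 0 = L.length := by
    rw [SeparationInstance.encode, List.append_assoc, List.getD_append _ _ _ _ (by simp)]; rfl
  have h0 : (I.encode L ++ D.encode bags).getD 0 0 = n := by
    rw [SeparationInstance.encode, List.append_assoc, List.getD_append _ _ _ _ (by simp)]; rfl
  have hN : (I.encode L ++ D.encode bags).getD (6 + 3 * L.length) 0 = N := by
    rw [List.getD_append_right _ _ _ _ (by rw [encode_length]), encode_length]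
    simp [RootedTreeDecomposition.encode]
  rw [baseAddr, h5, h0, hN]


open Cmd SepAlg.Expr

/-! ### The dynamic program on a tree decomposition -/

theorem Prob.Spec.tuple_congr {P : Prob} {m : ℕ} {X X' : ℕ → ℕ} {C : Finset ℕ} {tab : ℕ → ℕ}
    (h : P.Spec m X C tab) (hX : ∀ j < m, X' j = X j) : P.Spec m X' C tab := by
  intro χ hχ b hb
  have : ∀ k ≤ m, idx P.Q χ X' k = idx P.Q χ X k := by
    intro k hk
    induction k with
    | zero => rfl
    | succ k ih => rw [idx, idx, ih (by omega), hX k (by omega)]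
  rw [this m le_rfl]
  exact h χ hχ b hb

section Below

variable {n N : ℕ} {G : SimpleGraph (Fin n)}

open Classical in
noncomputable def belowSet (D : RootedTreeDecomposition G N) (i : Fin N) : Finset ℕ :=
  (Finset.univ.filter fun v => Below D i v).image fun v : Fin n => (v : ℕ)

theorem mem_belowSet {D : RootedTreeDecomposition G N} {i : Fin N} {v : ℕ} :
    v ∈ belowSet D i ↔ ∃ h : v < n, Below D i ⟨v, h⟩ := by
  simp only [belowSet, Finset.mem_image, Finset.mem_filter, Finset.mem_univ, true_and]
  constructor
  · rintro ⟨v, h, rfl⟩; exact ⟨v.2, h⟩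
  · rintro ⟨h, h'⟩; exact ⟨_, h', rfl⟩

theorem belowSet_root (D : RootedTreeDecomposition G N) : belowSet D D.root = Finset.range n := by
  ext v
  rw [mem_belowSet, Finset.mem_range]
  exact ⟨fun h => h.1, fun h => ⟨h, below_root _⟩⟩

end Below

section Tree

variable {n N : ℕ} {I : SeparationInstance n} {L : List (Fin n × Fin n × ℕ)}
  {D : RootedTreeDecomposition I.graph.underlying N} {bags : Fin N → List (Fin n)}

theorem separationProb_adj (hL : I.graph.IsListing L) {j : ℕ} (hj : j < (SeparationProb I L).M) :
    ∃ a b : Fin n, (SeparationProb I L).ea j = a ∧ (SeparationProb I L).eb j = b ∧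
      I.graph.underlying.Adj a b :=
  ⟨_, _, (separationProb_edge hj).1, (separationProb_edge hj).2.1, _, edge_mem_of_listing hL hj⟩

/-- The sets of vertices below the nodes in the list `l`. -/
noncomputable def belowSets (D : RootedTreeDecomposition I.graph.underlying N) (l : List (Fin N))
    (x : ℕ) : Finset ℕ :=
  if h : x < l.length then belowSet D l[x] else ∅

theorem belowSets_of_lt {l : List (Fin N)} {x : ℕ} (h : x < l.length) :
    belowSets D l x = belowSet D l[x] := dif_pos h

/-- The step at a node: `X` is the bag of the parent (empty at the root), `Y` the bag of the node,
and the parts belong to the children. The requirements are `below_iff`, `IsChild.disjoint`,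
`IsChild.not_below` and `Below.adj`. -/
theorem splits_tree (hL : I.graph.IsListing L) {i : Fin N} {mX mY : ℕ} {X Y : ℕ → ℕ}
    (hX : ∀ v, InTuple n mX X v ↔ ∃ h : v < n, i ≠ D.root ∧ ⟨v, h⟩ ∈ D.bag (D.parent i))
    (hY : ∀ v, InTuple n mY Y v ↔ ∃ h : v < n, ⟨v, h⟩ ∈ D.bag i)
    {l : List (Fin N)} (hl : l.Nodup) (hl' : ∀ j, j ∈ l ↔ IsChild D i j) :
    (SeparationProb I L).Splits mX X mY Y (belowSet D i) l.length (belowSets D l) := by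
  have hX' : ∀ v, InTuple (SeparationProb I L).n mX X v ↔
    ∃ h : v < n, i ≠ D.root ∧ ⟨v, h⟩ ∈ D.bag (D.parent i) := hX
  have hY' : ∀ v, InTuple (SeparationProb I L).n mY Y v ↔ ∃ h : v < n, ⟨v, h⟩ ∈ D.bag i := hY
  have hch : ∀ {x} (hx : x < l.length), IsChild D i l[x] := fun hx =>
    (hl' _).1 (List.getElem_mem hx)
  constructor
  · intro v
    rw [mem_belowSet, mark_eq_two, hX', hY']
    constructor
    · rintro ⟨hv, h⟩
      rcases below_iff.1 h with ⟨h1, h2⟩ | ⟨j, hj, hjv⟩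
      · exact .inl ⟨fun ⟨_, h3, h4⟩ => h2 h3 h4, hv, h1⟩
      · obtain ⟨x, hx, rfl⟩ := List.getElem_of_mem ((hl' j).2 hj)
        exact .inr ⟨x, hx, by rw [belowSets_of_lt hx, mem_belowSet]; exact ⟨hv, hjv⟩⟩
    · rintro (⟨h1, hv, h2⟩ | ⟨x, hx, hv⟩)
      · exact ⟨hv, below_iff.2 (.inl ⟨h2, fun h3 h4 => h1 ⟨hv, h3, h4⟩⟩)⟩
      · rw [belowSets_of_lt hx, mem_belowSet] at hv
        exact ⟨hv.1, below_iff.2 (.inr ⟨_, hch hx, hv.2⟩)⟩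
  · intro v hv
    rw [mem_belowSet] at hv
    rw [hX']
    exact fun ⟨h1, h2, h3⟩ => hv.2.2 h2 h3
  · intro x hx v hv
    rw [belowSets_of_lt hx, mem_belowSet] at hv
    rw [hY']
    exact ⟨hv.1, fun ⟨h1, h2⟩ => (hch hx).not_below hv.2 h2⟩
  · intro x hx y hy hxy
    rw [belowSets_of_lt hx, belowSets_of_lt hy, Finset.disjoint_left]
    intro v h1 h2
    rw [mem_belowSet] at h1 h2
    exact hxy ((hl.getElem_inj_iff).1 ((hch hx).disjoint (hch hy) h1.2 h2.2))
  · intro j hj x hx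
    obtain ⟨a, b, h1, h2, hab⟩ := separationProb_adj hL hj
    rw [h1, h2, belowSets_of_lt hx, mem_belowSet, mem_belowSet, hY', hY']
    refine ⟨fun ⟨h, ha⟩ => ?_, fun ⟨h, ha⟩ => ?_⟩
    · rcases ha.adj hab with h | ⟨-, -, h⟩
      · exact .inl ⟨b.2, h⟩
      · rw [(hch hx).2] at h; exact .inr ⟨b.2, h⟩
    · rcases ha.adj hab.symm with h | ⟨-, -, h⟩
      · exact .inl ⟨a.2, h⟩
      · rw [(hch hx).2] at h; exact .inr ⟨a.2, h⟩
  · intro j hj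
    obtain ⟨a, b, h1, h2, hab⟩ := separationProb_adj hL hj
    rw [h1, h2, mem_belowSet, mem_belowSet, hY', hY']
    refine ⟨fun ⟨h, ha⟩ => ?_, fun ⟨h, ha⟩ => ?_⟩
    · rcases ha.adj hab with h | ⟨-, h, -⟩
      exacts [.inl ⟨b.2, h⟩, .inr ⟨b.2, h⟩]
    · rcases ha.adj hab.symm with h | ⟨-, h, -⟩
      exacts [.inl ⟨a.2, h⟩, .inr ⟨a.2, h⟩]

/-- Copy the bag of the node in register `41` to array `a`, and its size to register `m`. -/
def copyBag (a m : ℕ) : Cmd :=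
  .set m (.get 12 (.reg 41)) ;; .set 40 (.get 13 (.reg 41)) ;;
    .loop 16 m (.put a (.reg 16) (.get 0 (.reg 40 + .reg 16)))

def parentBag : Cmd :=
  .ite (absDiff (.reg 34) (.reg 33)) 1 (.set 7 0) (.set 41 (.get 11 (.reg 34)) ;; copyBag 4 7)

/-- Collect the addresses of the tables of the children in array `9`. -/
def childrenCode : Cmd :=
  .set 9 0 ;; .loop 16 32 (.ite (absDiff (.get 11 (.reg 16)) (.reg 34)) 1
    (.ite (absDiff (.reg 16) (.reg 33)) 1 .skip
      (.put 9 (.reg 9) (.get 15 (.reg 16)) ;; .set 9 (.reg 9 + 1))) .skip)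

def nodePrep : Cmd := .set 41 (.reg 34) ;; copyBag 5 8 ;; parentBag ;; childrenCode

def nodeStep : Cmd := nodePrep ;; combineCode ;; .put 15 (.reg 34) (.reg 11)

/-- Instead of sorting the nodes by depth, all nodes are scanned once per level. The quadratic
overhead in `N` fits into the bound. -/
def levelCode : Cmd :=
  .loop 34 32 (.ite (absDiff (.get 14 (.reg 34)) (.reg 39)) 1 nodeStep .skip)

def treeCode : Cmd := .loop 38 32 (.set 39 (.reg 32 - (.reg 38 + 1)) ;; levelCode)

def treeProgram : Cmd :=
  readCode ;; readTree ;; treeCode ;;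
    .ite (.get 10 (.get 15 (.reg 33))) (.reg 4 + 1) (.set 0 1) (.set 0 0)

theorem treeProgram_wf : treeProgram.wf = true := by decide

theorem copyBag_exec {a m : ℕ} (ha : a ∉ [0, 12, 13]) (hm : m ∉ [16, 40, 41]) {σ : St}
    (hT : TreeEnv D bags σ) {i : Fin N} (hi : σ.reg 41 = i) :
    ((copyBag a m).exec σ).reg m = (bags i).length ∧
      ∀ l, ∀ hl : l < (bags i).length, ((copyBag a m).exec σ).arr a l = (bags i)[l] := by
  simp only [List.mem_cons, List.not_mem_nil, or_false, not_or] at ha hm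
  obtain ⟨σ1, h1⟩ : ∃ σ1, σ1 = (Cmd.set 40 (.get 13 (.reg 41))).exec
    ((Cmd.set m (.get 12 (.reg 41))).exec σ) := ⟨_, rfl⟩
  have hm1 : σ1.reg m = (bags i).length := by
    rw [h1]; simp [hm, hi, hT.length i]
  have h40 : σ1.reg 40 = σ.arr 13 i := by
    rw [h1]; simp [hi, Ne.symm hm.2.2]
  have ha1 : σ1.arr = σ.arr := by rw [h1]; rfl
  have hloop := exec_loop (P := .put a (.reg 16) (.get 0 (.reg 40 + .reg 16))) (i := 16) (n := m)
    (σ := σ1) (fun k τ => ∀ l, ∀ hl : l < (bags i).length, l < k → τ.arr a l = (bags i)[l])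
    (by intro l _ h; omega) (by
    rintro k τ hk hik hag h l hl hlk
    have e40 : τ.reg 40 = σ.arr 13 i := by rw [hag.1 40 (by simp), h40]
    have e0 : τ.arr 0 = σ.arr 0 := by rw [hag.2 0 (by simpa using Ne.symm ha.1), ha1]
    simp only [exec_put, eval, e40, e0, hik, St.arr_setReg, St.arr_setArr, if_true,
      Function.update_apply]
    by_cases hlk' : l = k
    · subst hlk'; simpa using hT.bag i l hl
    · rw [if_neg hlk']; exact h l hl (by omega))
  have e : (copyBag a m).exec σ = (Cmd.loop 16 m
      (.put a (.reg 16) (.get 0 (.reg 40 + .reg 16)))).exec σ1 := by rw [h1]; rfl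
  rw [e]
  refine ⟨by rw [reg_exec (by simp [hm]), hm1], fun l hl => hloop l hl (by omega)⟩

theorem childrenCode_exec {σ : St} (hT : TreeEnv D bags σ) {i : Fin N} (hi : σ.reg 34 = i) :
    ∃ l : List (Fin N), l.Nodup ∧ (∀ j, j ∈ l ↔ IsChild D i j) ∧
      (childrenCode.exec σ).reg 9 = l.length ∧
      ∀ x, ∀ hx : x < l.length, (childrenCode.exec σ).arr 9 x = σ.arr 15 l[x] := by
  have hloop := exec_loop (P := .ite (absDiff (.get 11 (.reg 16)) (.reg 34)) 1
    (.ite (absDiff (.reg 16) (.reg 33)) 1 .skip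
      (.put 9 (.reg 9) (.get 15 (.reg 16)) ;; .set 9 (.reg 9 + 1))) .skip) (i := 16) (n := 32)
    (σ := σ.setReg 9 0) (fun k τ => ∃ l : List (Fin N), l.Nodup ∧
      (∀ j, j ∈ l ↔ IsChild D i j ∧ (j : ℕ) < k) ∧ τ.reg 9 = l.length ∧
      ∀ x, ∀ hx : x < l.length, τ.arr 9 x = σ.arr 15 l[x])
    ⟨[], by simp⟩ (by
    rintro k τ hk hik hag ⟨l, h1, h2, h3, h4⟩
    have hk : k < N := by rw [← hT.size]; simpa using hk
    have e34 : τ.reg 34 = i := by rw [hag.1 34 (by decide)]; simpa using hi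
    have e33 : τ.reg 33 = D.root := by rw [hag.1 33 (by decide)]; simpa using hT.root
    have e11 : τ.arr 11 k = D.parent ⟨k, hk⟩ := by
      rw [hag.2 11 (by decide)]; simpa using hT.parent ⟨k, hk⟩
    have e15 : τ.arr 15 = σ.arr 15 := by rw [hag.2 15 (by decide)]; simp
    simp only [exec_ite, eval_absDiff, eval_ofNat]
    simp only [eval, hik, e34, e33, e11]
    have skip : ¬ IsChild D i ⟨k, hk⟩ → ∃ l : List (Fin N), l.Nodup ∧
      (∀ j, j ∈ l ↔ IsChild D i j ∧ (j : ℕ) < k + 1) ∧ τ.reg 9 = l.length ∧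
      ∀ x, ∀ hx : x < l.length, τ.arr 9 x = σ.arr 15 l[x] := by
      intro hnc
      refine ⟨l, h1, fun j => ?_, h3, h4⟩
      rw [h2 j]
      refine and_congr_right fun hj => ⟨fun h => by omega, fun h => ?_⟩
      have : (j : ℕ) ≠ k := by rintro rfl; exact hnc hj
      omega
    by_cases hp : D.parent ⟨k, hk⟩ = i
    · rw [if_pos (by rw [hp])]
      by_cases hr : (⟨k, hk⟩ : Fin N) = D.root
      · rw [if_pos (by rw [← hr])]
        simpa using skip fun h => h.1 hr
      · rw [if_neg fun h => hr (Fin.ext h)]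
        simp only [exec_seq, exec_put, exec_set, eval, hik, h3, e15,
          St.reg_setArr, St.reg_setReg, St.arr_setReg, St.arr_setArr, if_true, Nat.reduceEqDiff,
          if_false]
        refine ⟨l ++ [⟨k, hk⟩], ?_, fun j => ?_, by simp, fun x hx => ?_⟩
        · refine List.nodup_append.2 ⟨h1, by simp, fun a ha b hb => ?_⟩
          rw [List.mem_singleton] at hb
          rintro rfl
          have := ((h2 a).1 ha).2
          rw [hb] at this
          exact lt_irrefl _ this
        · rw [List.mem_append, h2, List.mem_singleton]
          constructor
          · rintro (⟨h, h'⟩ | rfl)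
            exacts [⟨h, by omega⟩, ⟨⟨hr, hp⟩, by simp⟩]
          · rintro ⟨h, h'⟩
            by_cases hjk : (j : ℕ) = k
            · exact .inr (Fin.ext hjk)
            · exact .inl ⟨h, by omega⟩
        · simp only [Function.update_apply]
          by_cases hx' : x = l.length
          · subst hx'; simp
          · have hx2 : x < l.length := by simp at hx; omega
            rw [if_neg hx', h4 x hx2, List.getElem_append_left hx2]
    · rw [if_neg fun h => hp (Fin.ext h)]
      simpa using skip fun h => hp h.2)
  obtain ⟨l, h1, h2, h3, h4⟩ := hloop
  refine ⟨l, h1, fun j => ?_, h3, h4⟩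
  rw [h2 j]
  have e : (σ.setReg 9 0).reg 32 = N := by simpa using hT.size
  rw [e]
  exact and_iff_left j.2

/-- The vertices in the bag of the parent of `i`. -/
def parentTuple (D : RootedTreeDecomposition I.graph.underlying N) (bags : Fin N → List (Fin n))
    (i : Fin N) : List (Fin n) :=
  if i = D.root then [] else bags (D.parent i)

theorem inTuple_of_list {l : List (Fin n)} {X : ℕ → ℕ}
    (hX : ∀ j, ∀ hj : j < l.length, X j = l[j]) (v : ℕ) :
    InTuple n l.length X v ↔ ∃ h : v < n, ⟨v, h⟩ ∈ l := by
  refine exists_prop.symm.trans (exists_congr fun h => ⟨?_, fun hv => ?_⟩)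
  · rintro ⟨j, hj, rfl⟩
    have : (⟨X j, h⟩ : Fin n) = l[j] := Fin.ext (hX j hj)
    rw [this]; exact List.getElem_mem hj
  · obtain ⟨j, hj, h'⟩ := List.getElem_of_mem hv
    exact ⟨j, hj, by rw [hX j hj, h']⟩

end Tree


/-! ### Nice decompositions and the processing of one node. -/

open Cmd SepAlg.Expr

section Nice

variable {V : Type} [DecidableEq V] {G : SimpleGraph V} {N : ℕ} {D : RootedTreeDecomposition G N}

/-- In a nice decomposition the bags of a node and its parent are comparable, so the larger one
covers both. This keeps the number of colorings of both bags at `Q ^ (width + 1)`; in general their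
union could be nearly twice as large. -/
theorem exists_cover_of_nice (hD : D.IsNice) (i : Fin N) : ∃ W : Finset V, D.bag i ⊆ W ∧
    (i ≠ D.root → D.bag (D.parent i) ⊆ W) ∧ W.card ≤ D.width + 1 := by
  by_cases hi : i = D.root
  · exact ⟨D.bag i, subset_rfl, fun h => absurd hi h, card_bag_le _ i⟩
  have hmem : i ∈ D.children (D.parent i) := by simp [RootedTreeDecomposition.children, hi]
  have h2 := hD.card_children_le (D.parent i)
  have h0 := Finset.card_pos.2 ⟨i, hmem⟩
  by_cases h : (D.children (D.parent i)).card = 2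
  · have := hD.join _ h i hmem
    exact ⟨D.bag i, subset_rfl, fun _ => this.subset, card_bag_le _ i⟩
  · obtain ⟨j, hj⟩ := Finset.card_eq_one.1 (show (D.children (D.parent i)).card = 1 by omega)
    have hij : i = j := by rwa [hj, Finset.mem_singleton] at hmem
    subst hij
    rcases hD.introduce_or_forget _ _ hj with ⟨v, hv⟩ | ⟨v, hv⟩
    · exact ⟨D.bag (D.parent i), by rw [hv]; exact Finset.subset_insert _ _,
        fun _ => subset_rfl, card_bag_le _ _⟩
    · exact ⟨D.bag i, subset_rfl, fun _ => by rw [hv]; exact Finset.erase_subset _ _,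
        card_bag_le _ i⟩

theorem length_children_le (hD : D.IsNice) {i : Fin N} {l : List (Fin N)} (hl : l.Nodup)
    (hl' : ∀ j, j ∈ l ↔ IsChild D i j) : l.length ≤ 2 := by
  have : l.toFinset = D.children i := by
    ext j
    rw [List.mem_toFinset, hl']
    simp [RootedTreeDecomposition.children, IsChild]
  rw [← List.toFinset_card_of_nodup hl, this]
  exact hD.card_children_le i

end Nice

theorem combineBound_mono {n M Q mX mX' mY mY' r r' w w' : ℕ} (hQ : 0 < Q) (hX : mX ≤ mX')
    (hY : mY ≤ mY') (hr : r ≤ r') (hw : w ≤ w') :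
    combineBound n M Q mX mY r w ≤ combineBound n M Q mX' mY' r' w' := by
  unfold combineBound
  have h1 := Nat.pow_le_pow_right hQ hX
  have h2 := Nat.pow_le_pow_right hQ hw
  gcongr

section Tree

variable {n N : ℕ} {I : SeparationInstance n} {L : List (Fin n × Fin n × ℕ)}
  {D : RootedTreeDecomposition I.graph.underlying N} {bags : Fin N → List (Fin n)}

def tupleOf (l : List (Fin n)) (x : ℕ) : ℕ := if h : x < l.length then l[x] else 0

theorem tupleOf_of_lt {l : List (Fin n)} {x : ℕ} (h : x < l.length) : tupleOf l x = l[x] :=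
  dif_pos h

/-- The table for the node `i` has been computed. -/
def TableOk (L : List (Fin n × Fin n × ℕ)) (D : RootedTreeDecomposition I.graph.underlying N)
    (bags : Fin N → List (Fin n)) (σ : St) (i : Fin N) : Prop :=
  σ.arr 15 i + (SeparationProb I L).Q ^ (parentTuple D bags i).length ≤ σ.reg 10 ∧
    (SeparationProb I L).Spec (parentTuple D bags i).length (tupleOf (parentTuple D bags i))
      (belowSet D i) fun x => σ.arr 10 (σ.arr 15 i + x)

structure TreeInv (L : List (Fin n × Fin n × ℕ)) (D : RootedTreeDecomposition I.graph.underlying N)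
    (bags : Fin N → List (Fin n)) (σ : St) : Prop where
  env : Env (SeparationProb I L) σ
  tree : TreeEnv D bags σ
  marks : ∀ v, n < v → σ.arr 7 v = 0
  colors : ∀ v, n < v → σ.arr 8 v = 0

theorem TreeInv.of_agree {σ τ : St} (h : TreeInv L D bags σ) {c : Cmd} (hc : c.Agree σ τ)
    (hr : ∀ x ∈ [1, 2, 3, 4, 5, 6, 26, 32, 33], x ∉ c.regs)
    (ha : ∀ a ∈ [0, 1, 2, 3, 7, 8, 11, 12, 13, 14], a ∉ c.arrs) : TreeInv L D bags τ :=
  ⟨h.env.of_agree hc (fun x hx => hr x (by revert x; decide))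
      fun a hx => ha a (by revert a; decide),
    h.tree.of_agree hc (fun x hx => hr x (by revert x; decide))
      fun a hx => ha a (by revert a; decide),
    by rw [hc.2 7 (ha 7 (by decide))]; exact h.marks,
    by rw [hc.2 8 (ha 8 (by decide))]; exact h.colors⟩

theorem TableOk.of_agree {σ τ : St} {i : Fin N} (h : TableOk L D bags σ i) {c : Cmd}
    (hc : c.Agree σ τ) (hr : 10 ∉ c.regs) (ha : ∀ a ∈ [10, 15], a ∉ c.arrs) :
    TableOk L D bags τ i := by
  unfold TableOk
  rw [hc.1 10 hr, hc.2 10 (ha 10 (by decide)), hc.2 15 (ha 15 (by decide))]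
  exact h

theorem parentBag_exec {σ : St} (hT : TreeEnv D bags σ) {i : Fin N} (hi : σ.reg 34 = i) :
    (parentBag.exec σ).reg 7 = (parentTuple D bags i).length ∧
      ∀ l, ∀ hl : l < (parentTuple D bags i).length,
        (parentBag.exec σ).arr 4 l = (parentTuple D bags i)[l] := by
  unfold parentBag parentTuple
  simp only [exec_ite, eval_absDiff, eval_ofNat]
  simp only [eval, hi, hT.root]
  by_cases hr : i = D.root
  · simp [hr]
  · rw [if_neg fun h => hr (Fin.ext h)]
    simp only [hr, if_false]
    have := copyBag_exec (a := 4) (m := 7) (by decide) (by decide) (D := D) (bags := bags)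
      (σ := (Cmd.set 41 (.get 11 (.reg 34))).exec σ)
      (hT.of_agree (Cmd.agree _ σ) (by decide) (by decide)) (i := D.parent i)
      (by simp [hi, hT.parent])
    exact this

theorem copyBag_cost {a m : ℕ} (hm : m ∉ [16, 40]) (σ : St) :
    (copyBag a m).cost σ ≤ 3 + 2 * σ.arr 12 (σ.reg 41) := by
  simp only [List.mem_cons, List.not_mem_nil, or_false, not_or] at hm
  obtain ⟨σ1, h1⟩ : ∃ σ1, σ1 = (Cmd.set 40 (.get 13 (.reg 41))).exec
    ((Cmd.set m (.get 12 (.reg 41))).exec σ) := ⟨_, rfl⟩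
  have := cost_le_ub' (.loop 16 m (.put a (.reg 16) (.get 0 (.reg 40 + .reg 16)))) σ1
    (by simp [hm])
  have e : (copyBag a m).cost σ = 1 + (1 + (Cmd.loop 16 m
    (.put a (.reg 16) (.get 0 (.reg 40 + .reg 16)))).cost σ1) := by rw [h1]; rfl
  have e1 : σ1.reg m = σ.arr 12 (σ.reg 41) := by rw [h1]; simp [hm]
  simp only [ub, e1] at this
  omega

theorem nodePrep_exec {σ : St} (hT : TreeInv L D bags σ) {i : Fin N} (hi : σ.reg 34 = i) :
    (nodePrep.exec σ).reg 7 = (parentTuple D bags i).length ∧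
    (∀ l, ∀ hl : l < (parentTuple D bags i).length,
        (nodePrep.exec σ).arr 4 l = (parentTuple D bags i)[l]) ∧
    (nodePrep.exec σ).reg 8 = (bags i).length ∧
    (∀ l, ∀ hl : l < (bags i).length, (nodePrep.exec σ).arr 5 l = (bags i)[l]) ∧
    (∃ l : List (Fin N), l.Nodup ∧ (∀ j, j ∈ l ↔ IsChild D i j) ∧
      (nodePrep.exec σ).reg 9 = l.length ∧
      ∀ x, ∀ hx : x < l.length, (nodePrep.exec σ).arr 9 x = σ.arr 15 l[x]) ∧
    nodePrep.cost σ ≤ 20 * (1 + N + (bags i).length + (parentTuple D bags i).length) := by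
  obtain ⟨σ1, h1⟩ : ∃ σ1, σ1 = (copyBag 5 8).exec ((Cmd.set 41 (.reg 34)).exec σ) := ⟨_, rfl⟩
  have ag1 := (Cmd.set 41 (.reg 34) ;; copyBag 5 8).agree σ
  rw [exec_seq, ← h1] at ag1
  have b1 := copyBag_exec (a := 5) (m := 8) (by decide) (by decide) (D := D) (bags := bags)
      (σ := (Cmd.set 41 (.reg 34)).exec σ)
      (hT.tree.of_agree (Cmd.agree _ σ) (by decide) (by decide)) (i := i) (by simp [hi])
  rw [← h1] at b1
  have hT1 := hT.of_agree ag1 (by decide) (by decide)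
  have hi1 : σ1.reg 34 = i := by rw [ag1.1 34 (by decide), hi]
  obtain ⟨σ2, h2⟩ : ∃ σ2, σ2 = parentBag.exec σ1 := ⟨_, rfl⟩
  have ag2 := parentBag.agree σ1
  have b2 := parentBag_exec hT1.tree hi1
  rw [← h2] at ag2 b2
  have hT2 := hT1.of_agree ag2 (by decide) (by decide)
  have hi2 : σ2.reg 34 = i := by rw [ag2.1 34 (by decide), hi1]
  obtain ⟨l, c1, c2, c3, c4⟩ := childrenCode_exec hT2.tree hi2
  have ag3 := childrenCode.agree σ2
  have e : nodePrep.exec σ = childrenCode.exec σ2 := by rw [h2, h1]; rfl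
  rw [← e] at c3 c4 ag3
  refine ⟨?_, ?_, ?_, ?_, ⟨l, c1, c2, c3, fun x hx => ?_⟩, ?_⟩
  · rw [ag3.1 7 (by decide), b2.1]
  · rw [ag3.2 4 (by decide)]; exact b2.2
  · rw [ag3.1 8 (by decide), ag2.1 8 (by decide), b1.1]
  · rw [ag3.2 5 (by decide), ag2.2 5 (by decide)]; exact b1.2
  · rw [c4 x hx, ag2.2 15 (by decide), ag1.2 15 (by decide)]
  · have k1 : (copyBag 5 8).cost ((Cmd.set 41 (.reg 34)).exec σ) ≤ 3 + 2 * (bags i).length := by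
      have := copyBag_cost (a := 5) (m := 8) (by decide) ((Cmd.set 41 (.reg 34)).exec σ)
      simpa [hi, hT.tree.length] using this
    have k2 : parentBag.cost σ1 ≤ 6 + 2 * (parentTuple D bags i).length := by
      unfold parentBag parentTuple
      simp only [Cmd.cost, eval_absDiff, eval_ofNat]
      simp only [eval, hi1, hT1.tree.root]
      by_cases hr : i = D.root
      · simp [hr]
      · rw [if_neg fun h => hr (Fin.ext h)]
        simp only [hr, if_false]
        have := copyBag_cost (a := 4) (m := 7) (by decide)
          ((Cmd.set 41 (.get 11 (.reg 34))).exec σ1)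
        simp only [exec_set, eval, St.reg_setReg, if_true, St.arr_setReg, hi1,
          hT1.tree.length, hT1.tree.parent] at this ⊢
        omega
    have k3 := cost_le_ub' childrenCode σ2 (by decide)
    have e : nodePrep.cost σ = 1 + ((copyBag 5 8).cost ((Cmd.set 41 (.reg 34)).exec σ) +
        (parentBag.cost σ1 + childrenCode.cost σ2)) := by
      rw [h2, h1]; rfl
    rw [e]
    simp only [childrenCode, ub, hT2.tree.size] at k3 ⊢
    omega

def nodeBound (n M Q N w : ℕ) : ℕ :=
  20 * (4 + N + 2 * w) + combineBound n M Q (w + 1) (w + 1) 2 (w + 1)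

theorem length_bag_le (hb : D.IsBagListing bags) (i : Fin N) :
    (bags i).length ≤ D.width + 1 := by
  have : (bags i).toFinset = D.bag i := by
    ext v; rw [List.mem_toFinset]; exact (hb i).2 v
  rw [← List.toFinset_card_of_nodup (hb i).1, this]
  exact card_bag_le _ i

theorem length_parentTuple_le (hb : D.IsBagListing bags) (i : Fin N) :
    (parentTuple D bags i).length ≤ D.width + 1 := by
  unfold parentTuple
  split_ifs
  exacts [by simp, length_bag_le hb _]

theorem mem_parentTuple (hb : D.IsBagListing bags) (i : Fin N) (v : Fin n) :
    v ∈ parentTuple D bags i ↔ i ≠ D.root ∧ v ∈ D.bag (D.parent i) := by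
  unfold parentTuple
  split_ifs with h
  · simp [h]
  · simp [h, (hb _).2]

theorem nodeStep_exec (hL : I.graph.IsListing L) (hD : D.IsNice) (hb : D.IsBagListing bags)
    {σ : St} (hT : TreeInv L D bags σ) {i : Fin N} (hi : σ.reg 34 = i)
    (hch : ∀ j, IsChild D i j → TableOk L D bags σ j) :
    TreeInv L D bags (nodeStep.exec σ) ∧
    (∀ j, j ≠ i → TableOk L D bags σ j → TableOk L D bags (nodeStep.exec σ) j) ∧
    TableOk L D bags (nodeStep.exec σ) i ∧
    nodeStep.cost σ ≤ nodeBound n L.length (SeparationProb I L).Q N D.width := by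
  set P := SeparationProb I L with hP
  obtain ⟨b7, b4, b8, b5, ⟨l, l1, l2, b9, b9'⟩, bc⟩ := nodePrep_exec hT hi
  obtain ⟨σ1, h1⟩ : ∃ σ1, σ1 = nodePrep.exec σ := ⟨_, rfl⟩
  have ag1 := nodePrep.agree σ
  rw [← h1] at ag1 b7 b4 b8 b5 b9 b9'
  have hT1 := hT.of_agree ag1 (by decide) (by decide)
  have hi1 : σ1.reg 34 = i := by rw [ag1.1 34 (by decide), hi]
  have hX : ∀ v, InTuple n (σ1.reg 7) (σ1.arr 4) v ↔
      ∃ h : v < n, i ≠ D.root ∧ ⟨v, h⟩ ∈ D.bag (D.parent i) := fun v => by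
    rw [b7, inTuple_of_list b4]
    simp only [mem_parentTuple hb]
  have hY : ∀ v, InTuple n (σ1.reg 8) (σ1.arr 5) v ↔ ∃ h : v < n, ⟨v, h⟩ ∈ D.bag i := fun v => by
    rw [b8, inTuple_of_list b5]
    simp only [(hb i).2]
  have hS := splits_tree hL hX hY l1 l2
  rw [← b9] at hS
  have e10 : σ1.reg 10 = σ.reg 10 := ag1.1 10 (by decide)
  have f10 : σ1.arr 10 = σ.arr 10 := ag1.2 10 (by decide)
  have f15 : σ1.arr 15 = σ.arr 15 := ag1.2 15 (by decide)
  obtain ⟨c11, c10, ctop, cspec, c7, c8, ccost⟩ := combineCode_exec separationProb_wf hT1.env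
    hT1.marks hT1.colors hS (by
      intro x hx
      rw [b9] at hx
      have hc := (l2 _).1 (List.getElem_mem hx)
      -- The table of a child is indexed by the bag of its parent, which is the tuple `Y` of the
      -- present step.
      have hpt : parentTuple D bags l[x] = bags i := by
        rw [parentTuple, if_neg hc.1, hc.2]
      obtain ⟨t1, t2⟩ := hch _ hc
      rw [hpt, ← b8] at t1 t2
      rw [b9' x hx, e10, f10, belowSets_of_lt hx]
      refine ⟨t1, t2.tuple_congr fun j hj => ?_⟩
      rw [b8] at hj
      rw [b5 j hj, tupleOf_of_lt hj])
  obtain ⟨σ2, h2⟩ : ∃ σ2, σ2 = combineCode.exec σ1 := ⟨_, rfl⟩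
  have ag2 := combineCode.agree σ1
  rw [← h2] at ag2 c11 c10 ctop cspec c7 c8
  have hT2 : TreeInv L D bags σ2 := ⟨hT1.env.of_agree ag2 (by decide) (by decide),
    hT1.tree.of_agree ag2 (by decide) (by decide), c7, c8⟩
  obtain ⟨σ3, h3⟩ : ∃ σ3, σ3 = nodeStep.exec σ := ⟨_, rfl⟩
  have e3 : σ3 = (Cmd.put 15 (.reg 34) (.reg 11)).exec σ2 := by rw [h3, h2, h1]; rfl
  have hi2 : σ2.reg 34 = i := by rw [ag2.1 34 (by decide), hi1]
  have g15 : σ2.arr 15 = σ.arr 15 := by rw [ag2.2 15 (by decide), f15]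
  have ag3 := (Cmd.put 15 (.reg 34) (.reg 11)).agree σ2
  rw [← e3] at ag3
  have hT3 := hT2.of_agree ag3 (by decide) (by decide)
  have k15 : ∀ j : Fin N, σ3.arr 15 j = if j = i then σ.reg 10 else σ.arr 15 j := fun j => by
    rw [e3]
    simp [hi2, g15, c11, e10, Function.update_apply, Fin.ext_iff]
  have k10 : σ3.reg 10 = σ.reg 10 + P.Q ^ (parentTuple D bags i).length := by
    rw [ag3.1 10 (by decide), c10, e10, b7]
  have ka : σ3.arr 10 = σ2.arr 10 := ag3.2 10 (by decide)
  rw [← h3]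
  refine ⟨hT3, fun j hj hjt => ?_, ?_, ?_⟩
  · obtain ⟨t1, t2⟩ := hjt
    refine ⟨?_, ?_⟩
    · rw [k15, if_neg hj, k10]; exact t1.trans (Nat.le_add_right _ _)
    · refine t2.congr fun x hx => ?_
      rw [k15, if_neg hj, ka, ctop _ (by rw [e10]; omega), f10]
  · refine ⟨?_, ?_⟩
    · rw [k15, if_pos rfl, k10]
    · rw [k15, if_pos rfl, ka, ← e10, ← b7]
      refine cspec.tuple_congr fun j hj => ?_
      rw [b7] at hj
      rw [b4 j hj, tupleOf_of_lt hj]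
  · obtain ⟨W, hW1, hW2, hW3⟩ := exists_cover_of_nice hD i
    have hk := ccost (W.image fun v : Fin n => (v : ℕ)) (by
      rintro v (hv | hv)
      · obtain ⟨h, h', h''⟩ := (hX v).1 hv
        exact Finset.mem_image.2 ⟨_, hW2 h' h'', rfl⟩
      · obtain ⟨h, h'⟩ := (hY v).1 hv
        exact Finset.mem_image.2 ⟨_, hW1 h', rfl⟩)
    have hc := Finset.card_image_le (s := W) (f := fun v : Fin n => (v : ℕ))
    have hp := length_parentTuple_le hb i
    have hq := length_bag_le hb i
    have hr := length_children_le hD l1 l2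
    have := hk.trans (combineBound_mono (by simp [SeparationProb]) (b7.trans_le hp)
      (b8.trans_le hq) (b9.trans_le hr) (hc.trans hW3))
    have e : nodeStep.cost σ = nodePrep.cost σ + (combineCode.cost σ1 + 1) := by rw [h1]; rfl
    rw [e]
    unfold nodeBound
    have : (SeparationProb I L).n = n := rfl
    have : (SeparationProb I L).M = L.length := rfl
    simp only [*] at *
    omega

/-- The children of a node of depth `d` have depth `d + 1`, so their tables are ready. The cost is
charged to the nodes of depth `d` only, so that summing over the levels charges each node once. -/
theorem levelCode_exec (hL : I.graph.IsListing L) (hD : D.IsNice) (hb : D.IsBagListing bags)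
    {σ : St} (hT : TreeInv L D bags σ) {d : ℕ} (hd : σ.reg 39 = d)
    (hσ : ∀ j, d < depth D j → TableOk L D bags σ j) :
    TreeInv L D bags (levelCode.exec σ) ∧
    (∀ j, d ≤ depth D j → TableOk L D bags (levelCode.exec σ) j) ∧
    levelCode.cost σ ≤ 1 + 3 * N + (Finset.univ.filter fun i => depth D i = d).card *
      nodeBound n L.length (SeparationProb I L).Q N D.width := by
  set B := nodeBound n L.length (SeparationProb I L).Q N D.width with hB
  have h := exec_loop_cost (P := .ite (absDiff (.get 14 (.reg 34)) (.reg 39)) 1 nodeStep .skip)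
    (i := 34) (n := 32) (σ := σ) (fun k τ => TreeInv L D bags τ ∧
      ∀ j, (d < depth D j ∨ depth D j = d ∧ (j : ℕ) < k) → TableOk L D bags τ j)
    (fun k => 2 + if h : k < N then (if depth D ⟨k, h⟩ = d then B else 0) else 0)
    ⟨hT.of_agree (c := .set 34 0) ((Cmd.set 34 0).agree σ) (by decide) (by decide), by
      rintro j (hj | hj)
      · exact (hσ j hj).of_agree (c := .set 34 0) ((Cmd.set 34 0).agree σ) (by decide) (by decide)
      · omega⟩
    (by
      rintro k τ hk hik hag ⟨hTτ, hτ⟩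
      rw [hT.tree.size] at hk
      have e39 : τ.reg 39 = d := by rw [hag.1 39 (by decide), hd]
      have e14 : τ.arr 14 k = depth D ⟨k, hk⟩ := hTτ.tree.depth ⟨k, hk⟩
      rw [dif_pos hk]
      simp only [exec_ite, Cmd.cost, eval_absDiff, eval_ofNat]
      simp only [eval, hik, e39, e14]
      by_cases hdk : depth D ⟨k, hk⟩ = d
      · simp only [hdk, if_true]
        obtain ⟨f1, f2, f3, f4⟩ := nodeStep_exec hL hD hb hTτ (i := ⟨k, hk⟩) hik fun j hj =>
          hτ j (.inl (by rw [hj.depth]; omega))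
        have fl := fun j (hj : TableOk L D bags (nodeStep.exec τ) j) =>
          hj.of_agree (c := .set 34 (.lit (k + 1)))
            ((Cmd.set 34 (.lit (k + 1))).agree (nodeStep.exec τ)) (by simp) (by simp)
        refine ⟨⟨f1.of_agree (c := .set 34 (.lit (k + 1))) (Cmd.agree _ _) (by simp) (by simp),
          fun j hj => fl j ?_⟩, by omega⟩
        by_cases hjk : j = ⟨k, hk⟩
        · rw [hjk]; exact f3
        · refine f2 j hjk (hτ j ?_)
          rcases hj with hj | ⟨hj, hj'⟩
          · exact .inl hj
          · refine .inr ⟨hj, ?_⟩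
            have : (j : ℕ) ≠ k := fun h => hjk (Fin.ext h)
            omega
      · simp only [hdk, if_false]
        refine ⟨⟨hTτ.of_agree (c := .set 34 (.lit (k + 1))) (Cmd.agree _ _) (by simp) (by simp),
          fun j hj => (hτ j ?_).of_agree (c := .set 34 (.lit (k + 1))) (Cmd.agree _ _) (by simp)
            (by simp)⟩, by omega⟩
        rcases hj with hj | ⟨hj, hj'⟩
        · exact .inl hj
        · refine .inr ⟨hj, ?_⟩
          have : (j : ℕ) ≠ k := by rintro rfl; exact hdk hj
          omega)
  rw [hT.tree.size] at h
  obtain ⟨⟨h1, h2⟩, h3⟩ := h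
  refine ⟨h1, fun j hj => h2 j ?_, h3.trans ?_⟩
  · rcases Nat.lt_or_ge d (depth D j) with h | h
    · exact .inl h
    · exact .inr ⟨by omega, j.2⟩
  · rw [Finset.sum_range fun k => 1 + (2 + if h : k < N then (if depth D ⟨k, h⟩ = d then B else 0) else 0)]
    simp only [Fin.is_lt, dif_pos, Fin.eta, Finset.sum_add_distrib, Finset.sum_ite,
      Finset.sum_const_zero, Finset.sum_const, smul_eq_mul, Finset.card_univ, Fintype.card_fin]
    omega

theorem treeCode_exec (hL : I.graph.IsListing L) (hD : D.IsNice) (hb : D.IsBagListing bags)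
    {σ : St} (hT : TreeInv L D bags σ) :
    TreeInv L D bags (treeCode.exec σ) ∧
    (∀ j, TableOk L D bags (treeCode.exec σ) j) ∧
    treeCode.cost σ ≤ 1 + N * (3 + 3 * N) +
      N * nodeBound n L.length (SeparationProb I L).Q N D.width := by
  set B := nodeBound n L.length (SeparationProb I L).Q N D.width with hB
  have h := exec_loop_cost (P := .set 39 (.reg 32 - (.reg 38 + 1)) ;; levelCode)
    (i := 38) (n := 32) (σ := σ) (fun k τ => TreeInv L D bags τ ∧
      ∀ j, N ≤ depth D j + k → TableOk L D bags τ j)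
    (fun k => 2 + 3 * N + (Finset.univ.filter fun i => depth D i = N - (k + 1)).card * B)
    ⟨hT.of_agree (c := .set 38 0) ((Cmd.set 38 0).agree σ) (by decide) (by decide), by
      intro j hj
      have := depth_lt (D := D) j
      omega⟩
    (by
      rintro k τ hk hik hag ⟨hTτ, hτ⟩
      rw [hT.tree.size] at hk
      have ag := (Cmd.set 39 (.reg 32 - (.reg 38 + 1))).agree τ
      obtain ⟨f1, f2, f3⟩ := levelCode_exec hL hD hb (d := N - (k + 1))
        (hTτ.of_agree ag (by decide) (by decide)) (by simp [hTτ.tree.size, hik]) fun j hj =>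
          (hτ j (by omega)).of_agree ag (by decide) (by decide)
      refine ⟨⟨f1.of_agree (c := .set 38 (.lit (k + 1))) (Cmd.agree _ _) (by simp) (by simp),
        fun j hj => (f2 j (by omega)).of_agree (c := .set 38 (.lit (k + 1))) (Cmd.agree _ _)
          (by simp) (by simp)⟩, ?_⟩
      rw [cost_seq, hB]
      have e : (Cmd.set 39 (.reg 32 - (.reg 38 + 1))).cost τ = 1 := rfl
      omega)
  rw [hT.tree.size] at h
  obtain ⟨⟨h1, h2⟩, h3⟩ := h
  refine ⟨h1, fun j => h2 j (by omega), h3.trans ?_⟩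
  -- Every node has exactly one depth, and it is below `N`.
  have hsum : ∑ k ∈ Finset.range N, (Finset.univ.filter fun i => depth D i = N - (k + 1)).card
      = N := by
    have := Finset.sum_range_reflect
      (fun d => (Finset.univ.filter fun i : Fin N => depth D i = d).card) N
    have e : ∀ k, N - (k + 1) = N - 1 - k := fun k => by omega
    rw [Finset.sum_congr rfl fun k _ => by rw [e k], this]
    rw [← Finset.card_eq_sum_card_fiberwise fun i _ => by simpa using depth_lt i]
    simp
  simp only [Finset.sum_add_distrib, ← Finset.sum_mul, hsum, Finset.sum_const, Finset.card_range,
    smul_eq_mul]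
  ring_nf
  omega

/-- At the root the tuple is empty and the set consists of all vertices. So the table has one entry,
which is at most `k` if and only if some feasible coloring has at most `k` zeros. -/
theorem treeProgram_exec (hL : I.graph.IsListing L) (hD : D.IsNice) (hb : D.IsBagListing bags) :
    ((treeProgram.exec (St.init (I.encode L ++ D.encode bags))).reg 0 = 1 ↔ I.IsYes) ∧
    treeProgram.cost (St.init (I.encode L ++ D.encode bags)) ≤
      20 * (L.length + 1) + 20 * ((N + 1) * (N + 1)) + (3 + N * (3 + 3 * N) +
        N * nodeBound n L.length (SeparationProb I L).Q N D.width) := by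
  set P := SeparationProb I L with hP
  obtain ⟨σ0, h0⟩ : ∃ σ0, σ0 = St.init (I.encode L ++ D.encode bags) := ⟨_, rfl⟩
  obtain ⟨r1, r2⟩ := readCode_exec hL (D.encode bags)
  obtain ⟨σ1, h1⟩ : ∃ σ1, σ1 = readCode.exec σ0 := ⟨_, rfl⟩
  have ag1 := readCode.agree σ0
  rw [← h0, ← h1] at r1
  rw [← h1] at ag1
  obtain ⟨t1, t2⟩ := readTree_exec (σ := σ1) (D := D) (bags := bags) (I := I) (L := L)
    (by rw [ag1.2 0 (by decide), h0]; funext i; simp [St.init]) r1.M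
  obtain ⟨σ2, h2⟩ : ∃ σ2, σ2 = readTree.exec σ1 := ⟨_, rfl⟩
  have ag2 := readTree.agree σ1
  rw [← h2] at ag2 t1
  have hz : ∀ a ∈ [7, 8], ∀ v, σ2.arr a v = 0 := fun a ha v => by
    rw [ag2.2 a (by revert a; decide), ag1.2 a (by revert a; decide), h0]
    have : a ≠ 0 := by rintro rfl; revert ha; decide
    simp [St.init, this]
  have hT : TreeInv L D bags σ2 := ⟨r1.of_agree ag2 (by decide) (by decide), t1,
    fun v _ => hz 7 (by decide) v, fun v _ => hz 8 (by decide) v⟩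
  obtain ⟨u1, u2, u3⟩ := treeCode_exec hL hD hb hT
  obtain ⟨σ3, h3⟩ : ∃ σ3, σ3 = treeCode.exec σ2 := ⟨_, rfl⟩
  rw [← h3] at u1 u2
  have e : treeProgram.exec σ0 = (Cmd.ite (.get 10 (.get 15 (.reg 33))) (.reg 4 + 1)
      (.set 0 1) (.set 0 0)).exec σ3 := by rw [h3, h2, h1]; rfl
  have ec : treeProgram.cost σ0 = readCode.cost σ0 + (readTree.cost σ1 + (treeCode.cost σ2 +
      (Cmd.ite (.get 10 (.get 15 (.reg 33))) (.reg 4 + 1)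
      (.set 0 1) (.set 0 0)).cost σ3)) := by rw [h3, h2, h1]; rfl
  rw [← h0] at r2 ⊢
  constructor
  · obtain ⟨-, sp⟩ := u2 D.root
    have hpt : parentTuple D bags D.root = [] := if_pos rfl
    rw [hpt, belowSet_root] at sp
    have hk : P.k = I.k := rfl
    have hlt : σ3.arr 10 (σ3.arr 15 D.root) ≤ I.k ↔ I.IsYes := by
      have h00 : P.Col fun _ => 0 := ⟨fun _ => by simp [hP, SeparationProb], fun _ _ => rfl⟩
      rw [isYes_iff hL]
      refine (sp _ h00 P.k le_rfl).trans (exists_congr fun χ => ?_)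
      refine and_congr_right fun hχ => and_iff_right fun v hv => ?_
      exact hχ.2 v (by simpa [hP, SeparationProb] using hv)
    rw [e, ← hlt]
    simp only [exec_ite, eval, u1.tree.root, u1.env.k]
    rw [hk]
    split_ifs with h
    · simp; omega
    · simp; omega
  · rw [ec]
    have : (Cmd.ite (.get 10 (.get 15 (.reg 33))) (.reg 4 + 1)
      (.set 0 1) (.set 0 0)).cost σ3 = 2 := by simp [Cmd.cost]
    rw [← hP] at u3
    omega

end Tree


/-! ### The running time with a given decomposition. -/

section Tree

variable {n N : ℕ} {I : SeparationInstance n} {L : List (Fin n × Fin n × ℕ)}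
  {D : RootedTreeDecomposition I.graph.underlying N} {bags : Fin N → List (Fin n)}

theorem one_le_width (hL : I.graph.IsListing L) (D : RootedTreeDecomposition I.graph.underlying N) :
    1 ≤ D.width := by
  have h0 := one_le_length hL
  have h := edge_mem_of_listing hL (j := 0) (one_le_length hL)
  have hadj : I.graph.underlying.Adj L[0].1 L[0].2.1 := ⟨_, h⟩
  obtain ⟨i, h1, h2⟩ := D.edge_mem _ _ hadj
  have := Finset.one_lt_card.2 ⟨_, h1, _, h2, hadj.ne⟩
  have := card_bag_le D.toTreeDecomposition i
  omega

theorem width_lt (D : RootedTreeDecomposition I.graph.underlying N) : D.width < n := by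
  have h : (Finset.univ.sup fun i => (D.bag i).card) ≤ n :=
    Finset.sup_le fun i _ => (Finset.card_le_univ _).trans (by simp)
  have := two_le_n I
  unfold TreeDecomposition.width
  omega

/-- Of the `w + 2` factors `R`, the first `w + 1` count colorings. The last one pays for computing
indices: multiplication by `Q` is a loop, so an index costs about `w * Q`, and `w ≤ M`. -/
theorem nodeBound_le {n M Q R N w : ℕ} (hQ : 2 ≤ Q) (hR : Q ≤ R) (hw : 1 ≤ w) (hwM : w ≤ M)
    (hn : n ≤ M + 1) : nodeBound n M Q N w ≤ 20 * N + 3420 * (R ^ (w + 2) * M) := by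
  have hQR : Q ^ (w + 1) ≤ R ^ (w + 1) := Nat.pow_le_pow_left hR _
  have h1 : R ^ (w + 1) ≤ R ^ (w + 2) := Nat.pow_le_pow_right (by omega) (by omega)
  have h0 : 1 ≤ R ^ (w + 2) := Nat.one_le_pow _ _ (by omega)
  have hRA : R ≤ R ^ (w + 2) := Nat.le_self_pow (by omega) R
  set A := R ^ (w + 2) with hA
  have hAM : M ≤ A * M := Nat.le_mul_of_pos_left _ h0
  have hAM' : A ≤ A * M := Nat.le_mul_of_pos_right _ (by omega)
  have e1 : (w + 1 + (w + 1) + (w + 1) + 1) * (Q + 1) ≤ 14 * (A * M) := by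
    calc _ ≤ (7 * M) * (2 * A) := Nat.mul_le_mul (by omega) (by omega)
      _ = _ := by ring
  have e2 : Q ^ (w + 1) * M ≤ A * M := Nat.mul_le_mul_right _ (hQR.trans h1)
  have e3 : Q ^ (w + 1) * ((w + 1 + (w + 1) + 1) * (Q + 1)) ≤ 10 * (A * M) := by
    calc _ ≤ R ^ (w + 1) * ((5 * M) * (2 * R)) :=
          Nat.mul_le_mul hQR (Nat.mul_le_mul (by omega) (by omega))
      _ = _ := by rw [hA, pow_succ R (w + 1)]; ring
  have e4 : Q ^ (w + 1) * (w + 1 + 2) ≤ 4 * (A * M) := by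
    calc _ ≤ A * (4 * M) := Nat.mul_le_mul (hQR.trans h1) (by omega)
      _ = _ := by ring
  unfold nodeBound combineBound
  have e5 : Q ^ (w + 1) * (M + (w + 1 + (w + 1) + 1) * (Q + 1) + (w + 1) + 2) =
      Q ^ (w + 1) * M + Q ^ (w + 1) * ((w + 1 + (w + 1) + 1) * (Q + 1)) +
        Q ^ (w + 1) * (w + 1 + 2) := by ring
  rw [e5]
  omega

end Tree

theorem exists_program_of_decomposition :
    ∃ P : RAMProgram, ∀ c : ℕ, ∃ C : ℕ,
      ∀ (n : ℕ) (I : SeparationInstance n) (L : List (Fin n × Fin n × ℕ)) (N : ℕ)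
        (D : RootedTreeDecomposition I.graph.underlying N) (bags : Fin N → List (Fin n)),
        I.graph.IsListing L → D.IsNice → D.IsBagListing bags → N ≤ c * (D.width * n) →
          P.DecidesWithin (I.encode L ++ D.encode bags) I.IsYes
            (C * ((I.graph.maxLabel + 2) ^ (D.width + 2) * D.width * n * I.graph.edges.card)) := by
  -- The part `150 * c` covers the prologue, the rest the compiled program. The terms with `c * c`
  -- come from `N * N`, those with `c` from `N * T`, where `T` is the bound per node.
  refine ⟨.seq prologue treeProgram.comp, fun c => ⟨150 * c + treeProgram.factor *
    (172 * c * c + 3483 * c), fun n I L N D bags hL hD hb hN => ?_⟩⟩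
  obtain ⟨h1, h2⟩ := treeProgram_exec hL hD hb
  refine decidesWithin_of_exec treeProgram_wf _ (decomposition_length_le hb) ?_ h1
  rw [baseAddr_decomposition, card_edges_eq hL]
  have hM := one_le_length hL
  have hn := card_vertices_le hL
  have hw := one_le_width hL D
  have hwn := width_lt D
  have hlab := card_labels_le_maxLabel hL
  have hNpos : 1 ≤ N := by have := D.root.2; omega
  set M := L.length
  set w := D.width
  set R := I.graph.maxLabel + 2 with hR
  have hB := nodeBound_le (n := n) (M := M) (Q := (SeparationProb I L).Q) (R := R) (N := N) (w := w)
    (by simp [SeparationProb]) (by simp only [SeparationProb]; omega) hw (by omega) hn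
  have hA : w ≤ R ^ (w + 2) := by
    calc w ≤ 2 ^ w := (Nat.lt_two_pow_self).le
      _ ≤ 2 ^ (w + 2) := Nat.pow_le_pow_right (by omega) (by omega)
      _ ≤ _ := Nat.pow_le_pow_left (by omega) _
  set B := nodeBound n M (SeparationProb I L).Q N w
  set A := R ^ (w + 2)
  set T := A * M with hT
  set Z := w * n * T with hZ
  have eZ : A * w * n * M = Z := by rw [hZ, hT]; ring
  rw [eZ]
  have hMT : M ≤ T := Nat.le_mul_of_pos_left _ (by omega)
  have hNT : N * T ≤ c * Z := by
    calc N * T ≤ c * (w * n) * T := Nat.mul_le_mul_right _ hN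
      _ = _ := by rw [hZ]; ring
  have hp : w * n ≤ 2 * T := by
    calc w * n ≤ A * (2 * M) := Nat.mul_le_mul hA (by omega)
      _ = _ := by rw [hT]; ring
  -- The quadratic overhead is harmless: one factor `N` is at most `2 * c * T`, because `w ≤ A` and
  -- `n ≤ 2 * M`.
  have hNN : N * N ≤ 2 * (c * c * Z) := by
    calc N * N ≤ N * (c * (2 * T)) := Nat.mul_le_mul_left _ (hN.trans (Nat.mul_le_mul_left _ hp))
      _ = 2 * c * (N * T) := by ring
      _ ≤ 2 * c * (c * Z) := Nat.mul_le_mul_left _ hNT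
      _ = _ := by ring
  have hTN : T ≤ N * T := Nat.le_mul_of_pos_left _ hNpos
  have hN2 : N ≤ N * N := Nat.le_mul_of_pos_left _ hNpos
  have hNn : N * (n + 2) ≤ 4 * (N * T) := by
    calc N * (n + 2) ≤ N * (4 * T) := Nat.mul_le_mul_left _ (by omega)
      _ = _ := by ring
  have hNB : N * B ≤ 20 * (N * N) + 3420 * (N * T) := by
    calc N * B ≤ N * (20 * N + 3420 * T) := Nat.mul_le_mul_left _ hB
      _ = _ := by ring
  -- Using `N ≤ N * N` and `1 ≤ M ≤ T ≤ N * T`, the cost is at most `86 * (N * N) + 3483 * (N * T)`.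
  have hcost : treeProgram.cost (St.init (I.encode L ++ D.encode bags)) ≤
      172 * (c * c * Z) + 3483 * (c * Z) := by
    refine h2.trans ?_
    have e1 : (N + 1) * (N + 1) = N * N + 2 * N + 1 := by ring
    have e2 : N * (3 + 3 * N) = 3 * N + 3 * (N * N) := by ring
    rw [e1, e2]
    omega
  have hfac := Nat.mul_le_mul_left treeProgram.factor hcost
  have e3 : (150 * c + treeProgram.factor * (172 * c * c + 3483 * c)) * Z = 150 * (c * Z) +
      treeProgram.factor * (172 * (c * c * Z) + 3483 * (c * Z)) := by ring
  rw [e3]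
  omega


open Cmd SepAlg.Expr

/-! ### Connected components -/

/-- `S` is a union of connected components after the deletion of the vertices in the tuple. -/
def Prob.Closed (P : Prob) (m : ℕ) (X : ℕ → ℕ) (S : ℕ → Prop) : Prop :=
  ∀ j < P.M, ¬ InTuple P.n m X (P.ea j) → ¬ InTuple P.n m X (P.eb j) → (S (P.ea j) ↔ S (P.eb j))

/-- `ρ` assigns to every vertex a number `u + 1`, where `u` is a vertex in the same component. -/
structure Prob.PreRep (P : Prob) (m : ℕ) (X ρ : ℕ → ℕ) : Prop where
  zero : ∀ v < P.n, ρ v = 0 ↔ InTuple P.n m X v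
  le : ∀ v < P.n, ρ v ≤ v + 1
  conn : ∀ v < P.n, ρ v ≠ 0 → ∀ S, P.Closed m X S → (S (ρ v - 1) ↔ S v)

def Prob.EdgeRep (P : Prob) (ρ : ℕ → ℕ) (j : ℕ) : Prop :=
  ρ (P.ea j) ≠ 0 → ρ (P.eb j) ≠ 0 → ρ (P.ea j) = ρ (P.eb j)

/-- `ρ v = u + 1`, where `u` is the smallest vertex in the component of `v` after the deletion of
the vertices in the tuple `X`, and `ρ v = 0` for the vertices in the tuple. -/
structure Prob.Rep (P : Prob) (m : ℕ) (X ρ : ℕ → ℕ) : Prop extends P.PreRep m X ρ where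
  edge : ∀ j < P.M, P.EdgeRep ρ j

section Rep

variable {P : Prob} {m : ℕ} {X X' ρ ρ' : ℕ → ℕ}

theorem InTuple.congr {n v : ℕ} (hX : ∀ j < m, X' j = X j) : InTuple n m X' v ↔ InTuple n m X v := by
  unfold InTuple
  refine and_congr_right fun _ => exists_congr fun j => and_congr_right fun hj => ?_
  rw [hX j hj]

theorem Prob.Closed.tuple_congr {S : ℕ → Prop} (h : P.Closed m X S) (hX : ∀ j < m, X' j = X j) :
    P.Closed m X' S := fun j hj => by
  rw [InTuple.congr hX, InTuple.congr hX]; exact h j hj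

theorem Prob.Rep.tuple_congr (h : P.Rep m X ρ) (hX : ∀ j < m, X' j = X j) : P.Rep m X' ρ :=
  ⟨⟨fun v hv => by rw [InTuple.congr hX]; exact h.zero v hv, h.le, fun v hv h0 S hS =>
    h.conn v hv h0 S (hS.tuple_congr fun j hj => (hX j hj).symm)⟩, h.edge⟩

/-- `ρ` is constant along edges outside the tuple, so any condition on its value describes a union
of components. -/
theorem Prob.Rep.closed (hP : P.Wf) (h : P.Rep m X ρ) (p : ℕ → Prop) :
    P.Closed m X fun w => p (ρ w) := fun j hj ha hb => by
  simp only
  rw [h.edge j hj (mt (h.zero _ (hP.ea j hj)).1 ha) (mt (h.zero _ (hP.eb j hj)).1 hb)]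

theorem Prob.Rep.rep (hP : P.Wf) (h : P.Rep m X ρ) {v : ℕ} (hv : v < P.n) (h0 : ρ v ≠ 0) :
    ρ (ρ v - 1) = ρ v :=
  (h.conn v hv h0 _ (h.closed hP fun x => x = ρ v)).2 rfl

/-- The number `ρ v - 1` lies in the component of `v`, so `ρ'` takes the same value at both, and at
`ρ v - 1` it is at most `ρ v`. Uniqueness identifies the components computed at different times. -/
theorem Prob.Rep.unique_le (hP : P.Wf) (h : P.Rep m X ρ) (h' : P.Rep m X ρ') {v : ℕ}
    (hv : v < P.n) : ρ' v ≤ ρ v := by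
  by_cases h0 : ρ v = 0
  · rw [(h'.zero v hv).2 ((h.zero v hv).1 h0)]; exact Nat.zero_le _
  · have h1 := (h.conn v hv h0 _ (h'.closed hP fun x => x = ρ' v)).2 rfl
    have h2 := h.le v hv
    have h3 := h'.le (ρ v - 1) (by omega)
    omega

theorem Prob.Rep.unique (hP : P.Wf) (h : P.Rep m X ρ) (h' : P.Rep m X ρ') {v : ℕ}
    (hv : v < P.n) : ρ' v = ρ v :=
  le_antisymm (h.unique_le hP h' hv) (h'.unique_le hP h hv)

theorem exists_rep (P : Prob) (m : ℕ) (X : ℕ → ℕ) : ∃ ρ, P.Rep m X ρ := by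
  classical
  let conn : ℕ → ℕ → Prop := fun v u => ∀ S, P.Closed m X S → (S u ↔ S v)
  have hex : ∀ v, ∃ u, conn v u := fun v => ⟨v, fun _ _ => Iff.rfl⟩
  refine ⟨fun v => if InTuple P.n m X v then 0 else Nat.find (hex v) + 1, ⟨?_, ?_, ?_⟩, ?_⟩
  · intro v hv
    by_cases h : InTuple P.n m X v <;> simp [h]
  · intro v hv
    by_cases h : InTuple P.n m X v
    · simp [h]
    · have := Nat.find_min' (hex v) (m := v) fun _ _ => Iff.rfl
      simpa [h] using this
  · intro v hv h0 S hS
    by_cases h : InTuple P.n m X v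
    · simp [h] at h0
    · simpa [h] using Nat.find_spec (hex v) S hS
  · intro j hj ha hb
    have ha' : ¬ InTuple P.n m X (P.ea j) := by rintro h; simp [h] at ha
    have hb' : ¬ InTuple P.n m X (P.eb j) := by rintro h; simp [h] at hb
    have : conn (P.ea j) = conn (P.eb j) := by
      funext u
      exact propext (forall_congr' fun S => forall_congr' fun hS => by rw [hS j hj ha' hb'])
    simp only [ha', hb', if_false]
    congr 2

/-- Reducing one value to that of an adjacent vertex. -/
theorem Prob.PreRep.update (h : P.PreRep m X ρ) {a b : ℕ} (ha : a < P.n) (hb : b < P.n)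
    (h0 : ρ a ≠ 0) (hlt : ρ a < ρ b) (hab : ∀ S, P.Closed m X S → (S a ↔ S b)) :
    P.PreRep m X (Function.update ρ b (ρ a)) ∧
      ∑ v ∈ Finset.range P.n, Function.update ρ b (ρ a) v < ∑ v ∈ Finset.range P.n, ρ v := by
  refine ⟨⟨fun v hv => ?_, fun v hv => ?_, fun v hv hv0 S hS => ?_⟩, ?_⟩
  · by_cases hvb : v = b
    · subst hvb
      rw [Function.update_self, ← h.zero v hv]; omega
    · rw [Function.update_of_ne hvb]; exact h.zero v hv
  · by_cases hvb : v = b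
    · subst hvb
      rw [Function.update_self]
      have := h.le v hv; omega
    · rw [Function.update_of_ne hvb]; exact h.le v hv
  · by_cases hvb : v = b
    · subst hvb
      rw [Function.update_self, h.conn a ha h0 S hS]
      exact hab S hS
    · rw [Function.update_of_ne hvb] at hv0 ⊢; exact h.conn v hv hv0 S hS
  · refine Finset.sum_lt_sum (fun v _ => ?_) ⟨b, by simpa using hb, by simpa using hlt⟩
    by_cases hvb : v = b
    · subst hvb; rw [Function.update_self]; exact hlt.le
    · rw [Function.update_of_ne hvb]

def relax (r : ℕ) : Cmd :=
  .set 24 (.get 1 (.reg 16)) ;; .set 25 (.get 2 (.reg 16)) ;;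
    .ite 0 (.get r (.reg 24)) (.ite 0 (.get r (.reg 25))
      (.ite (.get r (.reg 24)) (.get r (.reg 25)) (.put r (.reg 25) (.get r (.reg 24)))
        (.ite (.get r (.reg 25)) (.get r (.reg 24)) (.put r (.reg 24) (.get r (.reg 25))) .skip))
      .skip) .skip

/-- Compute the components after the deletion of the tuple in array `a`, whose length is in
register `m`. Register `45` contains the number of rounds. -/
def repCode (a m r : ℕ) : Cmd :=
  .loop 16 1 (.put r (.reg 16) (.reg 16 + 1)) ;; .loop 16 m (.put r (.get a (.reg 16)) 0) ;;
    .loop 53 45 (.loop 16 2 (relax r))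

theorem relax_exec (hP : P.Wf) {r : ℕ} {σ : St} (hE : Env P σ) {j : ℕ}
    (hj : j < P.M) (hσ : σ.reg 16 = j) (h : P.PreRep m X (σ.arr r)) :
    P.PreRep m X (((relax r).exec σ).arr r) ∧
    (∑ v ∈ Finset.range P.n, ((relax r).exec σ).arr r v < ∑ v ∈ Finset.range P.n, σ.arr r v ∧
      ¬ P.EdgeRep (σ.arr r) j ∨
      ((relax r).exec σ).arr r = σ.arr r ∧ P.EdgeRep (σ.arr r) j) := by
  have hS : σ.arr r (P.ea j) ≠ 0 → σ.arr r (P.eb j) ≠ 0 → ∀ S, P.Closed m X S →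
      (S (P.ea j) ↔ S (P.eb j)) := fun ha hb S hS =>
    hS j hj (mt (h.zero _ (hP.ea j hj)).2 ha) (mt (h.zero _ (hP.eb j hj)).2 hb)
  simp only [relax, exec_seq, exec_set, exec_ite, exec_put, exec_skip, eval, hσ,
    hE.ea j hj, hE.eb j hj, St.reg_setReg, St.arr_setReg, if_true, Nat.reduceEqDiff, if_false,
    Nat.pos_iff_ne_zero]
  unfold Prob.EdgeRep
  split_ifs with h1 h2 h3 h4
  · simp only [St.arr_setArr, if_true, St.arr_setReg]
    have := h.update (hP.ea j hj) (hP.eb j hj) h1 h3 (hS h1 h2)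
    exact ⟨this.1, .inl ⟨this.2, fun h => by have := h h1 h2; omega⟩⟩
  · simp only [St.arr_setArr, if_true, St.arr_setReg]
    have := h.update (hP.eb j hj) (hP.ea j hj) h2 h4 fun S hS' => (hS h1 h2 S hS').symm
    exact ⟨this.1, .inl ⟨this.2, fun h => by have := h h1 h2; omega⟩⟩
  · exact ⟨h, .inr ⟨rfl, fun _ _ => by omega⟩⟩
  · exact ⟨h, .inr ⟨rfl, fun _ h => absurd h h2⟩⟩
  · exact ⟨h, .inr ⟨rfl, fun h _ => absurd h h1⟩⟩

theorem relaxLoop_exec (hP : P.Wf) {r : ℕ} (hr : r ∉ [1, 2, 3]) {σ : St} (hE : Env P σ)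
    (h : P.PreRep m X (σ.arr r)) :
    P.PreRep m X (((Cmd.loop 16 2 (relax r)).exec σ).arr r) ∧
    (∑ v ∈ Finset.range P.n, ((Cmd.loop 16 2 (relax r)).exec σ).arr r v <
        ∑ v ∈ Finset.range P.n, σ.arr r v ∧ ¬ (∀ j < P.M, P.EdgeRep (σ.arr r) j) ∨
      ((Cmd.loop 16 2 (relax r)).exec σ).arr r = σ.arr r ∧ ∀ j < P.M, P.EdgeRep (σ.arr r) j) := by
  rw [← hE.M]
  refine exec_loop (fun k τ => P.PreRep m X (τ.arr r) ∧
    (∑ v ∈ Finset.range P.n, τ.arr r v < ∑ v ∈ Finset.range P.n, σ.arr r v ∧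
      ¬ (∀ j < σ.reg 2, P.EdgeRep (σ.arr r) j) ∨ τ.arr r = σ.arr r ∧ ∀ j < k, P.EdgeRep (σ.arr r) j)) ⟨h, .inr ⟨rfl, by simp⟩⟩ ?_
  rintro k τ hk hi hag ⟨h1, h2⟩
  simp only [List.mem_cons, List.not_mem_nil, or_false, not_or] at hr
  have hEτ : Env P τ := hE.of_agree hag (by simp [relax]) (by simp [relax, Ne.symm hr.1,
    Ne.symm hr.2.1, Ne.symm hr.2.2])
  obtain ⟨f1, f2⟩ := relax_exec hP hEτ (by rwa [← hE.M]) hi h1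
  refine ⟨f1, ?_⟩
  simp only [St.arr_setReg]
  rcases h2 with ⟨h2, h3⟩ | ⟨h2, h3⟩
  · left
    rcases f2 with ⟨f2, -⟩ | ⟨f2, -⟩
    · exact ⟨f2.trans h2, h3⟩
    · rw [f2]; exact ⟨h2, h3⟩
  · rcases f2 with ⟨f2, f3⟩ | ⟨f2, f3⟩
    · left; rw [h2] at f2 f3; exact ⟨f2, fun h => f3 (h k hk)⟩
    · right
      rw [h2] at f2 f3
      refine ⟨f2, fun j hj => ?_⟩
      rcases Nat.lt_succ_iff_lt_or_eq.1 hj with hj | rfl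
      exacts [h3 j hj, f3]

/-- A pass over all edges either finds every edge satisfied and changes nothing, or lowers the sum
of the values. This sum is at most `n * n` at the beginning, so `n * n + 1` passes suffice. -/
theorem repCode_exec (hP : P.Wf) {a l r : ℕ} (ha : a ≠ r) (hr : r ∉ [1, 2, 3])
    (hl : l ∉ [16, 53]) {σ : St} (hE : Env P σ) (h45 : σ.reg 45 = P.n * P.n + 1) :
    P.Rep (σ.reg l) (σ.arr a) (((repCode a l r).exec σ).arr r) := by
  have hr' := hr
  simp only [List.mem_cons, List.not_mem_nil, or_false, not_or] at hr' hl
  obtain ⟨σ1, h1⟩ : ∃ σ1, σ1 = (Cmd.loop 16 1 (.put r (.reg 16) (.reg 16 + 1))).exec σ := ⟨_, rfl⟩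
  have ag1 := (Cmd.loop 16 1 (.put r (.reg 16) (.reg 16 + 1))).agree σ
  rw [← h1] at ag1
  have b1 : ∀ v < P.n, σ1.arr r v = v + 1 := by
    have := exec_loop (P := .put r (.reg 16) (.reg 16 + 1)) (i := 16) (n := 1) (σ := σ)
      (fun k τ => ∀ v < k, τ.arr r v = v + 1) (by simp) (by
      rintro k τ hk hi hag h v hv
      simp only [exec_put, eval, hi, St.arr_setReg, St.arr_setArr, if_true,
        Function.update_apply]
      by_cases hvk : v = k
      · simp [hvk]
      · rw [if_neg hvk, h v (by omega)])
    rw [← h1, hE.n] at this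
    exact this
  obtain ⟨σ2, h2⟩ : ∃ σ2, σ2 = (Cmd.loop 16 l (.put r (.get a (.reg 16)) 0)).exec σ1 := ⟨_, rfl⟩
  have ag2 := (Cmd.loop 16 l (.put r (.get a (.reg 16)) 0)).agree σ1
  rw [← h2] at ag2
  have e1 : σ1.reg l = σ.reg l := ag1.1 l (by simp [hl])
  have e2 : σ1.arr a = σ.arr a := ag1.2 a (by simp [ha])
  have b2 : ∀ v < P.n, (InTuple P.n (σ.reg l) (σ.arr a) v → σ2.arr r v = 0) ∧
      (¬ InTuple P.n (σ.reg l) (σ.arr a) v → σ2.arr r v = v + 1) := by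
    have := exec_loop (P := .put r (.get a (.reg 16)) 0) (i := 16) (n := l) (σ := σ1)
      (fun k τ => ∀ v < P.n, (InTuple P.n k (σ.arr a) v → τ.arr r v = 0) ∧
        (¬ InTuple P.n k (σ.arr a) v → τ.arr r v = v + 1))
      (fun v hv => ⟨fun h => by simp [InTuple] at h, fun _ => b1 v hv⟩) (by
      rintro k τ hk hi hag h v hv
      have e3 : τ.arr a = σ.arr a := by rw [hag.2 a (by simp [ha]), e2]
      simp only [exec_put, eval, hi, e3, St.arr_setReg, St.arr_setArr, if_true,
        Function.update_apply]
      have hin : InTuple P.n (k + 1) (σ.arr a) v ↔ InTuple P.n k (σ.arr a) v ∨ v = σ.arr a k := by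
        simp only [InTuple, hv, true_and, Nat.lt_succ_iff_lt_or_eq]
        constructor
        · rintro ⟨j, hj | rfl, rfl⟩
          exacts [.inl ⟨j, hj, rfl⟩, .inr rfl]
        · rintro (⟨j, hj, rfl⟩ | rfl)
          exacts [⟨j, .inl hj, rfl⟩, ⟨k, .inr rfl, rfl⟩]
      rw [hin]
      by_cases hvk : v = σ.arr a k
      · simp [hvk]
      · simpa [hvk] using h v hv)
    rw [← h2, e1] at this
    exact this
  have hE2 : Env P σ2 := (hE.of_agree ag1 (by simp) (by simp [Ne.symm hr'.1, Ne.symm hr'.2.1,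
    Ne.symm hr'.2.2])).of_agree ag2 (by simp) (by simp [Ne.symm hr'.1, Ne.symm hr'.2.1,
    Ne.symm hr'.2.2])
  have hpre : P.PreRep (σ.reg l) (σ.arr a) (σ2.arr r) := by
    refine ⟨fun v hv => ?_, fun v hv => ?_, fun v hv h0 S hS => ?_⟩
    · by_cases h : InTuple P.n (σ.reg l) (σ.arr a) v
      · simp [(b2 v hv).1 h, h]
      · simp [(b2 v hv).2 h, h]
    · by_cases h : InTuple P.n (σ.reg l) (σ.arr a) v
      · simp [(b2 v hv).1 h]
      · simp [(b2 v hv).2 h]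
    · rw [(b2 v hv).2 fun h => h0 ((b2 v hv).1 h)]; rfl
  have hsum : ∑ v ∈ Finset.range P.n, σ2.arr r v ≤ P.n * P.n := by
    have := Finset.sum_le_card_nsmul (Finset.range P.n) (σ2.arr r) P.n fun v hv => by
      rw [Finset.mem_range] at hv
      have := hpre.le v hv
      omega
    simpa using this
  have hloop := exec_loop (P := .loop 16 2 (relax r)) (i := 53) (n := 45) (σ := σ2)
    (fun k τ => P.PreRep (σ.reg l) (σ.arr a) (τ.arr r) ∧
      (∑ v ∈ Finset.range P.n, τ.arr r v + k ≤ P.n * P.n ∨ ∀ j < P.M, P.EdgeRep (τ.arr r) j))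
    ⟨hpre, .inl hsum⟩ (by
    rintro k τ hk hi hag ⟨i1, i2⟩
    have hEτ : Env P τ := hE2.of_agree hag (by simp [relax]) (by simp [relax, Ne.symm hr'.1,
      Ne.symm hr'.2.1, Ne.symm hr'.2.2])
    obtain ⟨f1, f2⟩ := relaxLoop_exec hP hr hEτ i1
    refine ⟨f1, ?_⟩
    simp only [St.arr_setReg]
    rcases f2 with ⟨f2, f3⟩ | ⟨f2, f3⟩
    · left
      have := i2.resolve_right f3
      omega
    · right; rw [f2]; exact f3)
  rw [ag2.1 45 (by simp), ag1.1 45 (by simp), h45] at hloop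
  have e : (repCode a l r).exec σ = (Cmd.loop 53 45 (.loop 16 2 (relax r))).exec σ2 := by
    rw [h2, h1]; rfl
  rw [e]
  exact ⟨hloop.1, hloop.2.resolve_left (by omega)⟩

end Rep


/-! ### Separations -/

def classSet (n : ℕ) (ρ : ℕ → ℕ) (u : ℕ) : Finset ℕ := (Finset.range n).filter fun v => ρ v = u + 1

theorem mem_classSet {n u v : ℕ} {ρ : ℕ → ℕ} : v ∈ classSet n ρ u ↔ v < n ∧ ρ v = u + 1 := by
  simp [classSet]

/-- The component of `u` after the deletion of one tuple can be handled with the help of another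
tuple `Y`: the vertices in `Y` belong to the component or to the first tuple, and all neighbors of
the component outside belong to `Y`. -/
structure Prob.Step (P : Prob) (ρX ρY : ℕ → ℕ) (u : ℕ) : Prop where
  sub : ∀ y < P.n, ρY y = 0 → ρX y = 0 ∨ ρX y = u + 1
  nbr : ∀ j < P.M, (ρX (P.ea j) = u + 1 → ρX (P.eb j) = 0 → ρY (P.eb j) = 0) ∧
    (ρX (P.eb j) = u + 1 → ρX (P.ea j) = 0 → ρY (P.ea j) = 0)

section Step

variable {P : Prob} {mX mY u : ℕ} {X Y ρX ρY : ℕ → ℕ}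

/-- An edge that leaves the component ends in a vertex of the first tuple, hence in `Y`. So the
component, minus `Y`, is a union of components of the complement of `Y`. -/
theorem Prob.Step.closed (hP : P.Wf) (hX : P.Rep mX X ρX) (hY : P.Rep mY Y ρY)
    (h : P.Step ρX ρY u) : P.Closed mY Y fun w => ρX w = u + 1 := fun j hj ha hb => by
  have ha' := mt (hY.zero _ (hP.ea j hj)).1 ha
  have hb' := mt (hY.zero _ (hP.eb j hj)).1 hb
  beta_reduce
  constructor
  · intro h1
    have h2 := fun h0 => hb' ((h.nbr j hj).1 h1 h0)
    rw [← hX.edge j hj (by omega) h2, h1]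
  · intro h1
    have h2 := fun h0 => ha' ((h.nbr j hj).2 h1 h0)
    rw [hX.edge j hj h2 (by omega), h1]

theorem Prob.Step.class_eq (hP : P.Wf) (hX : P.Rep mX X ρX) (hY : P.Rep mY Y ρY)
    (h : P.Step ρX ρY u) {v : ℕ} (hv : v < P.n) (h0 : ρY v ≠ 0) :
    ρX (ρY v - 1) = u + 1 ↔ ρX v = u + 1 :=
  hY.conn v hv h0 _ (h.closed hP hX hY)

/-- The parts are the components of the complement of `Y` that lie inside the component of `u`. The
list `l` names each of them by its smallest vertex, the one with `ρY v = v + 1`. -/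
theorem Prob.Step.splits (hP : P.Wf) (hX : P.Rep mX X ρX) (hY : P.Rep mY Y ρY)
    (h : P.Step ρX ρY u) {l : List ℕ} (hl : l.Nodup)
    (hl' : ∀ v, v ∈ l ↔ v < P.n ∧ ρY v = v + 1 ∧ ρX v = u + 1) :
    P.Splits mX X mY Y (classSet P.n ρX u) l.length fun x => classSet P.n ρY (l.getD x 0) := by
  have hmem : ∀ x < l.length, l.getD x 0 ∈ l := fun x hx => by
    rw [List.getD_eq_getElem _ _ hx]; exact List.getElem_mem hx
  constructor
  · intro v
    simp only [mem_classSet, mark_eq_two]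
    constructor
    · rintro ⟨hv, h1⟩
      by_cases h0 : ρY v = 0
      · exact .inl ⟨fun hi => by rw [(hX.zero v hv).2 hi] at h1; omega, (hY.zero v hv).1 h0⟩
      · have hle := hY.le v hv
        have : ρY v - 1 ∈ l := (hl' _).2 ⟨by omega, by rw [hY.rep hP hv h0]; omega,
          (h.class_eq hP hX hY hv h0).2 h1⟩
        obtain ⟨x, hx, h2⟩ := List.getElem_of_mem this
        exact .inr ⟨x, hx, hv, by rw [List.getD_eq_getElem _ _ hx, h2]; omega⟩
    · rintro (⟨h1, h2⟩ | ⟨x, hx, hv, h1⟩)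
      · exact ⟨h2.1, (h.sub v h2.1 ((hY.zero v h2.1).2 h2)).resolve_left fun h0 =>
          h1 ((hX.zero v h2.1).1 h0)⟩
      · refine ⟨hv, (h.class_eq hP hX hY hv (by omega)).1 ?_⟩
        rw [h1, Nat.add_sub_cancel]
        exact ((hl' _).1 (hmem x hx)).2.2
  · intro v hv hi
    rw [mem_classSet] at hv
    rw [(hX.zero v hv.1).2 hi] at hv
    omega
  · intro x hx v hv
    rw [mem_classSet] at hv
    refine ⟨hv.1, fun hi => ?_⟩
    rw [(hY.zero v hv.1).2 hi] at hv
    omega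
  · intro x hx x' hx' hne
    rw [Finset.disjoint_left]
    intro v h1 h2
    rw [mem_classSet, List.getD_eq_getElem _ _ hx] at h1
    rw [mem_classSet, List.getD_eq_getElem _ _ hx'] at h2
    exact hne (hl.getElem_inj_iff.1 (show l[x] = l[x'] by omega))
  · intro j hj x hx
    simp only [mem_classSet]
    have ha := hP.ea j hj
    have hb := hP.eb j hj
    constructor
    · rintro ⟨-, h1⟩
      by_cases h0 : ρY (P.eb j) = 0
      · exact .inr ((hY.zero _ hb).1 h0)
      · exact .inl ⟨hb, by rw [← hY.edge j hj (by omega) h0, h1]⟩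
    · rintro ⟨-, h1⟩
      by_cases h0 : ρY (P.ea j) = 0
      · exact .inr ((hY.zero _ ha).1 h0)
      · exact .inl ⟨ha, by rw [hY.edge j hj h0 (by omega), h1]⟩
  · intro j hj
    simp only [mem_classSet]
    have ha := hP.ea j hj
    have hb := hP.eb j hj
    constructor
    · rintro ⟨-, h1⟩
      by_cases h0 : ρX (P.eb j) = 0
      · exact .inr ((hY.zero _ hb).1 ((h.nbr j hj).1 h1 h0))
      · exact .inl ⟨hb, by rw [← hX.edge j hj (by omega) h0, h1]⟩
    · rintro ⟨-, h1⟩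
      by_cases h0 : ρX (P.ea j) = 0
      · exact .inr ((hY.zero _ ha).1 ((h.nbr j hj).2 h1 h0))
      · exact .inl ⟨ha, by rw [hX.edge j hj h0 (by omega), h1]⟩

end Step

/-- The tuple with the number `c`. The number `n` stands for an empty place. -/
def tup (n c j : ℕ) : ℕ := dig (n + 1) c j

/-- For `q = n + 1` this says that the largest number stands for the tuple all of whose places are
empty. -/
theorem dig_pow_sub_one {q m j : ℕ} (hq : 0 < q) (hj : j < m) : dig q (q ^ m - 1) j = q - 1 := by
  obtain ⟨d, rfl⟩ := Nat.exists_eq_add_of_lt hj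
  have h1 : 0 < q ^ j := Nat.pow_pos hq
  have h2 : 0 < q ^ d := Nat.pow_pos hq
  have e1 : q ^ (j + d + 1) - 1 = q ^ j * (q * (q ^ d - 1) + (q - 1)) + (q ^ j - 1) := by
    obtain ⟨a, ha⟩ : ∃ a, q ^ d = a + 1 := ⟨q ^ d - 1, by omega⟩
    obtain ⟨b, hb⟩ : ∃ b, q = b + 1 := ⟨q - 1, by omega⟩
    have e : q ^ (j + d + 1) = q ^ j * (q * q ^ d) := by ring
    rw [e, ha, Nat.add_sub_cancel]
    have : q * (a + 1) = (q * a + (q - 1)) + 1 := by rw [mul_add, mul_one]; omega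
    rw [this, mul_add, mul_one]
    omega
  rw [dig, e1, Nat.mul_add_div h1, Nat.div_eq_of_lt (a := q ^ j - 1) (by omega), add_zero,
    Nat.mul_add_mod, Nat.mod_eq_of_lt (by omega)]

theorem exists_tup {n m : ℕ} (Y : Finset ℕ) (hY : ∀ v ∈ Y, v < n) (hm : Y.card ≤ m) :
    ∃ c < (n + 1) ^ m, ∀ v, InTuple n m (tup n c) v ↔ v ∈ Y := by
  have hlen : Y.toList.length = Y.card := Finset.length_toList Y
  obtain ⟨c, hc, h⟩ := exists_dig (q := n + 1) (fun j => Y.toList.getD j n) (fun j => by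
    by_cases hj : j < Y.toList.length
    · rw [List.getD_eq_getElem _ _ hj]
      have := hY _ (Finset.mem_toList.1 (List.getElem_mem hj))
      omega
    · rw [List.getD_eq_default _ _ (by omega)]; omega) m
  refine ⟨c, hc, fun v => ⟨?_, fun hv => ⟨hY v hv, ?_⟩⟩⟩
  · rintro ⟨hv, j, hj, rfl⟩
    rw [tup, h j hj] at hv ⊢
    by_cases hj : j < Y.toList.length
    · rw [List.getD_eq_getElem _ _ hj]
      exact Finset.mem_toList.1 (List.getElem_mem hj)
    · rw [List.getD_eq_default _ _ (by omega)] at hv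
      omega
  · obtain ⟨j, hj, rfl⟩ := List.getElem_of_mem (Finset.mem_toList.2 hv)
    exact ⟨j, by omega, by rw [tup, h j (by omega), List.getD_eq_getElem _ _ hj]⟩

/-- A set of separations that is closed under the steps of the dynamic program. -/
def StepClosed (P : Prob) (m : ℕ) (K : ℕ → ℕ → Prop) : Prop :=
  ∀ c < (P.n + 1) ^ m, ∀ u < P.n, ∀ d < (P.n + 1) ^ m, ∀ ρX ρY, P.Rep m (tup P.n c) ρX →
    P.Rep m (tup P.n d) ρY → P.Step ρX ρY u →
    (∀ v < P.n, ρY v = v + 1 → ρX v = u + 1 → K d v) → K c u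

section Complete

variable {n N : ℕ} {I : SeparationInstance n} {L : List (Fin n × Fin n × ℕ)}
  {D : RootedTreeDecomposition I.graph.underlying N}

theorem exists_edge_of_adj (hL : I.graph.IsListing L) {a b : Fin n}
    (h : I.graph.underlying.Adj a b) : ∃ j < (SeparationProb I L).M,
      ((SeparationProb I L).ea j = a ∧ (SeparationProb I L).eb j = b) ∨
      ((SeparationProb I L).ea j = b ∧ (SeparationProb I L).eb j = a) := by
  obtain ⟨t, ht⟩ := h
  obtain ⟨j, hj, -, h⟩ := exists_listing_of_edge hL ht
  refine ⟨j, hj, ?_⟩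
  rw [(separationProb_edge hj).1, (separationProb_edge hj).2.1]
  rcases h with ⟨rfl, rfl⟩ | ⟨rfl, rfl⟩
  exacts [.inl ⟨rfl, rfl⟩, .inr ⟨rfl, rfl⟩]

theorem Prob.Rep.eq_of_adj (hL : I.graph.IsListing L) {m : ℕ} {X ρ : ℕ → ℕ}
    (h : (SeparationProb I L).Rep m X ρ) {a b : Fin n} (hab : I.graph.underlying.Adj a b)
    (ha : ρ a ≠ 0) (hb : ρ b ≠ 0) : ρ a = ρ b := by
  obtain ⟨j, hj, ⟨h1, h2⟩ | ⟨h1, h2⟩⟩ := exists_edge_of_adj hL hab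
  · have := h.edge j hj
    rw [EdgeRep, h1, h2] at this
    exact this ha hb
  · have := h.edge j hj
    rw [EdgeRep, h1, h2] at this
    exact (this hb ha).symm

/-- Completeness of the search: a component that occurs below the node `i` only, with its outside
neighbors in the bag of the parent, belongs to every closed set `K`. The induction goes from the
leaves to the root. The step uses the vertices of the bag of `i` that belong or are adjacent to the
component. Each remaining smaller component lies below a single child of `i` and has its outside
neighbors in the bag of `i`, so the induction hypothesis applies to it. -/
theorem StepClosed.of_below (hL : I.graph.IsListing L) {m : ℕ} (hm : D.width + 1 ≤ m)
    {K : ℕ → ℕ → Prop} (hK : StepClosed (SeparationProb I L) m K) (h : ℕ) :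
    ∀ (i : Fin N), N ≤ depth D i + h → ∀ c < (n + 1) ^ m, ∀ u < n, ∀ ρ,
    (SeparationProb I L).Rep m (tup n c) ρ → (∀ v : Fin n, ρ v = u + 1 → Below D i v) →
    (∀ a b : Fin n, ρ a = u + 1 → I.graph.underlying.Adj a b →
      ρ b = u + 1 ∨ (i ≠ D.root ∧ b ∈ D.bag (D.parent i))) → K c u := by
  classical
  induction h with
  | zero => intro i hi; have := depth_lt (D := D) i; omega
  | succ h ih =>
    intro i hi c hc u hu ρ hρ hbelow hnbr
    have hwf := separationProb_wf (I := I) (L := L)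
    have hbag : ∀ a b : Fin n, ρ a = u + 1 → I.graph.underlying.Adj a b → ρ b ≠ u + 1 →
        b ∈ D.bag i := by
      intro a b ha hab hb
      obtain ⟨h1, h2⟩ := (hnbr a b ha hab).resolve_left hb
      rcases (hbelow a ha).adj hab with h | ⟨-, h, -⟩
      · exact absurd h2 (h.2 h1)
      · exact h
    -- The whole bag would not do: `Prob.Step` admits only vertices of the component or of the given
    -- tuple.
    let Y' : Finset (Fin n) := (D.bag i).filter fun y => ρ y = u + 1 ∨
      ∃ a : Fin n, ρ a = u + 1 ∧ I.graph.underlying.Adj a y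
    let Y : Finset ℕ := Y'.image fun v : Fin n => (v : ℕ)
    have hcard : Y.card ≤ m := Finset.card_image_le.trans ((Finset.card_filter_le _ _).trans
      ((card_bag_le _ i).trans hm))
    obtain ⟨d, hd, hdY⟩ := exists_tup (n := n) Y (fun v hv => by
      obtain ⟨v, -, rfl⟩ := Finset.mem_image.1 hv
      exact v.2) hcard
    have hY : ∀ y : Fin n, InTuple n m (tup n d) y ↔ y ∈ Y' := fun y => by
      rw [hdY, Finset.mem_image]
      exact ⟨fun ⟨z, hz, h⟩ => Fin.ext h ▸ hz, fun h => ⟨y, h, rfl⟩⟩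
    have hY' : ∀ y : Fin n, y ∈ Y' ↔ y ∈ D.bag i ∧ (ρ y = u + 1 ∨
      ∃ a : Fin n, ρ a = u + 1 ∧ I.graph.underlying.Adj a y) := fun y => Finset.mem_filter
    obtain ⟨ρY, hρY⟩ := exists_rep (SeparationProb I L) m (tup n d)
    have hz : ∀ y : Fin n, ρY y = 0 ↔ y ∈ Y' := fun y => (hρY.zero y y.2).trans (hY y)
    have hcross : ∀ a b : Fin n, ρ a = u + 1 → I.graph.underlying.Adj a b → ρY b ≠ 0 →
        ρ b = u + 1 := fun a b ha hab hb => by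
      by_contra h
      exact hb ((hz b).2 ((hY' b).2 ⟨hbag a b ha hab h, .inr ⟨a, ha, hab⟩⟩))
    have hstep : (SeparationProb I L).Step ρ ρY u := by
      refine ⟨fun y hy hy0 => ?_, fun j hj => ?_⟩
      · obtain ⟨-, h | ⟨a, ha, hay⟩⟩ := (hY' _).1 ((hz ⟨y, hy⟩).1 hy0)
        · exact .inr h
        · by_cases h0 : ρ y = 0
          · exact .inl h0
          · exact .inr ((hρ.eq_of_adj hL hay (by omega) h0).symm.trans ha)
      · obtain ⟨a, b, h1, h2, hab⟩ := separationProb_adj hL hj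
        rw [h1, h2]
        refine ⟨fun ha hb => ?_, fun ha hb => ?_⟩
        · by_contra h
          have := hcross a b ha hab h; omega
        · by_contra h
          have := hcross b a ha hab.symm h; omega
    refine hK c hc u hu d hd ρ ρY hρ hρY hstep fun v hv hvY hvX => ?_
    obtain ⟨x, hx⟩ : ∃ x : Fin n, (x : ℕ) = v := ⟨⟨v, hv⟩, rfl⟩
    subst hx
    have hvi : x ∉ D.bag i := fun hxi => by
      have := (hz x).2 ((hY' x).2 ⟨hxi, .inl hvX⟩)
      omega
    obtain ⟨j, hj, hjx⟩ := (below_iff.1 (hbelow x hvX)).resolve_left fun h => hvi h.1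
    -- An edge that leaves the vertices below `j` ends in the bag of `i`. Within the component such
    -- an end belongs to `Y'` and has been deleted. Hence the smaller component of `x` stays below
    -- `j`.
    have hcl : (SeparationProb I L).Closed m (tup n d) fun w =>
        ρ w = u + 1 ∧ ∃ hw : w < n, Below D j ⟨w, hw⟩ := by
      have key : ∀ a b : Fin n, I.graph.underlying.Adj a b → ρY b ≠ 0 →
          (ρ a = u + 1 ∧ ∃ hw : (a : ℕ) < n, Below D j ⟨a, hw⟩) →
          (ρ b = u + 1 ∧ ∃ hw : (b : ℕ) < n, Below D j ⟨b, hw⟩) := by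
        rintro a b hab hb ⟨h1, h2, h3⟩
        have h4 := hcross a b h1 hab hb
        refine ⟨h4, b.2, ?_⟩
        rcases h3.adj hab with h | ⟨-, -, h⟩
        · exact h
        · rw [hj.2] at h
          exact absurd ((hz b).2 ((hY' b).2 ⟨h, .inl h4⟩)) hb
      intro j' hj' ha hb
      obtain ⟨a, b, h1, h2, hab⟩ := separationProb_adj hL hj'
      rw [h1] at ha
      rw [h2] at hb
      simp only [h1, h2]
      exact ⟨key a b hab (mt (hρY.zero b b.2).1 hb), key b a hab.symm (mt (hρY.zero a a.2).1 ha)⟩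
    have hcls : ∀ w : Fin n, ρY w = x + 1 → ρ w = u + 1 ∧ Below D j w := fun w hw => by
      have := (hρY.conn w w.2 (by omega) _ hcl).1 (by
        rw [hw, Nat.add_sub_cancel]; exact ⟨hvX, x.2, hjx⟩)
      exact ⟨this.1, this.2.2⟩
    refine ih j (by rw [hj.depth]; omega) d hd x hv ρY hρY (fun w hw => (hcls w hw).2) ?_
    intro a b ha hab
    by_cases h0 : ρY b = 0
    · exact .inr ⟨hj.1, hj.2 ▸ ((hY' b).1 ((hz b).1 h0)).1⟩
    · exact .inl ((hρY.eq_of_adj hL hab (by omega) h0).symm.trans ha)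

theorem not_inTuple_tup {n m v : ℕ} : ¬ InTuple n m (tup n ((n + 1) ^ m - 1)) v := by
  rintro ⟨hv, j, hj, rfl⟩
  rw [tup, dig_pow_sub_one (by omega) hj] at hv
  omega

/-- With nothing deleted, the connected graph is a single component with smallest vertex 0, and its
representative is stored as `0 + 1`. -/
theorem classSet_top (hL : I.graph.IsListing L) {m : ℕ} {ρ : ℕ → ℕ}
    (hρ : (SeparationProb I L).Rep m (tup n ((n + 1) ^ m - 1)) ρ) :
    ∀ v < n, ρ v = 1 := by
  have hz : ∀ v : Fin n, ρ v ≠ 0 := fun v h => not_inTuple_tup ((hρ.zero v v.2).1 h)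
  have hn := two_le_n I
  have h0 : ρ 0 = 1 := by
    have := hρ.le 0 (by change 0 < n; omega)
    have := hz ⟨0, by omega⟩
    simp only at this
    omega
  intro v hv
  have hr := I.connected.preconnected ⟨0, by omega⟩ ⟨v, hv⟩
  rw [SimpleGraph.reachable_iff_reflTransGen] at hr
  have : ∀ x, Relation.ReflTransGen I.graph.underlying.Adj ⟨0, by omega⟩ x → ρ x = 1 := by
    intro x hx
    induction hx with
    | refl => exact h0
    | tail _ hbc ih => rw [← hρ.eq_of_adj hL hbc (hz _) (hz _), ih]
  exact this _ hr

/-- Every vertex is below the root of an optimal decomposition, and the whole vertex set has no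
outside neighbors. -/
theorem StepClosed.top (hL : I.graph.IsListing L) {m : ℕ}
    (hm : treewidth I.graph.underlying + 1 ≤ m)
    {K : ℕ → ℕ → Prop} (hK : StepClosed (SeparationProb I L) m K) : K ((n + 1) ^ m - 1) 0 := by
  obtain ⟨N, D, hD⟩ := exists_rooted_treewidth I.graph.underlying
  obtain ⟨ρ, hρ⟩ := exists_rep (SeparationProb I L) m (tup n ((n + 1) ^ m - 1))
  have h1 := classSet_top hL hρ
  have hn := two_le_n I
  exact hK.of_below hL (D := D) (by omega) N D.root (by omega) _
    (Nat.sub_lt (Nat.pow_pos (by omega)) (by omega)) 0 (by omega) ρ hρ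
    (fun v _ => below_root v) fun a b _ _ => .inl (h1 b b.2)

end Complete


open Cmd SepAlg.Expr

/-! ### The dynamic program without a tree decomposition -/

def nbrCheck (a b : ℕ) : Cmd :=
  .ite (absDiff (.get 17 (.reg a)) (.reg 49 + 1)) 1 (.ite (.get 17 (.reg b)) 1
    (.ite 0 (.get 18 (.reg b)) (.set 54 0) .skip) .skip) .skip

/-- A vertex of `Y` must belong to the first tuple or to the component. A smallest vertex of a
smaller component inside must have a table already; its address is collected. -/
def vertexStep : Cmd :=
  .ite (.get 18 (.reg 16)) 1
    (.ite 0 (.get 17 (.reg 16))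
      (.ite (absDiff (.get 17 (.reg 16)) (.reg 49 + 1)) 1 .skip (.set 54 0)) .skip)
    (.ite (absDiff (.get 18 (.reg 16)) (.reg 16 + 1)) 1
      (.ite (absDiff (.get 17 (.reg 16)) (.reg 49 + 1)) 1
        (.ite 0 (.get 16 (.reg 51 + .reg 16))
          (.put 9 (.reg 9) (.get 16 (.reg 51 + .reg 16) - 1) ;; .set 9 (.reg 9 + 1))
          (.set 54 0)) .skip) .skip)

def edgeStep : Cmd :=
  .set 24 (.get 1 (.reg 16)) ;; .set 25 (.get 2 (.reg 16)) ;; nbrCheck 24 25 ;; nbrCheck 25 24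

/-- Set register `54` to `0` if the step is not possible, and collect the addresses of the tables
for the smaller components in array `9`. -/
def checkCode : Cmd :=
  (.set 54 1 ;; .set 9 0) ;; .loop 16 1 vertexStep ;; .loop 16 2 edgeStep

section Check

variable {P : Prob}

def VertexStepOk (ρX ρY K : ℕ → ℕ) (u v : ℕ) : Prop :=
  (ρY v = 0 → ρX v = 0 ∨ ρX v = u + 1) ∧ (ρY v = v + 1 → ρX v = u + 1 → K v ≠ 0)

def Prob.EdgeStepOk (P : Prob) (ρX ρY : ℕ → ℕ) (u j : ℕ) : Prop :=
  (ρX (P.ea j) = u + 1 → ρX (P.eb j) = 0 → ρY (P.eb j) = 0) ∧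
    (ρX (P.eb j) = u + 1 → ρX (P.ea j) = 0 → ρY (P.ea j) = 0)

/-- The addresses of the tables for the components in the list `l` are in array `9`. -/
def Listed (σ : St) (K : ℕ → ℕ) (l : List ℕ) : Prop :=
  σ.reg 9 = l.length ∧ ∀ x, ∀ hx : x < l.length, σ.arr 9 x = K l[x] - 1

theorem vertexStep_exec {σ : St} {ρX ρY K : ℕ → ℕ} {u k : ℕ} (h17 : σ.arr 17 = ρX)
    (h18 : σ.arr 18 = ρY) (h49 : σ.reg 49 = u) (hK : ∀ v, σ.arr 16 (σ.reg 51 + v) = K v)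
    (hk : σ.reg 16 = k) {l : List ℕ} (hl : l.Nodup)
    (hl' : ∀ v, v ∈ l ↔ v < k ∧ ρY v = v + 1 ∧ ρX v = u + 1 ∧ K v ≠ 0) (h9 : Listed σ K l) :
    ((vertexStep.exec σ).reg 54 ≠ 0 ↔ σ.reg 54 ≠ 0 ∧ VertexStepOk ρX ρY K u k) ∧
    ∃ l : List ℕ, l.Nodup ∧ (∀ v, v ∈ l ↔ v < k + 1 ∧ ρY v = v + 1 ∧ ρX v = u + 1 ∧ K v ≠ 0) ∧
      Listed (vertexStep.exec σ) K l := by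
  have skip : ¬ (ρY k = k + 1 ∧ ρX k = u + 1 ∧ K k ≠ 0) → ∀ τ, Listed τ K l →
      ∃ l : List ℕ, l.Nodup ∧ (∀ v, v ∈ l ↔ v < k + 1 ∧ ρY v = v + 1 ∧ ρX v = u + 1 ∧ K v ≠ 0) ∧
      Listed τ K l := fun hn τ hτ => ⟨l, hl, fun v => by
    rw [hl' v]
    refine ⟨fun h => ⟨by omega, h.2⟩, fun h => ⟨?_, h.2⟩⟩
    have : v ≠ k := by rintro rfl; exact hn h.2
    omega, hτ⟩
  unfold vertexStep VertexStepOk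
  simp only [exec_ite, eval_absDiff, eval_ofNat]
  simp only [exec_skip, exec_set, exec_put, exec_seq, eval, eval_sub, h17, h18,
    h49, hK, hk, Nat.lt_one_iff, Nat.pos_iff_ne_zero, St.reg_setArr]
  by_cases h0 : ρY k = 0
  · rw [if_pos h0]
    have hn : ¬ (ρY k = k + 1 ∧ ρX k = u + 1 ∧ K k ≠ 0) := fun h => by omega
    split_ifs with h1 h2
    · exact ⟨by simp [h0, h2], skip hn _ h9⟩
    · exact ⟨by simp [h0, h1, h2], skip hn _ (by simpa [Listed] using h9)⟩
    · exact ⟨by simp at h1; simp [h0, h1], skip hn _ h9⟩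
  · rw [if_neg h0]
    split_ifs with h1 h2 h3
    · refine ⟨by simp [h1, h2, h3], l ++ [k], ?_, fun v => ?_, ?_, fun x hx => ?_⟩
      · refine List.nodup_append.2 ⟨hl, by simp, fun a ha b hb => ?_⟩
        rw [List.mem_singleton] at hb
        have := (hl' a).1 ha
        omega
      · rw [List.mem_append, hl', List.mem_singleton]
        constructor
        · rintro (⟨h, h'⟩ | rfl)
          exacts [⟨by omega, h'⟩, ⟨by omega, h1, h2, h3⟩]
        · rintro ⟨h, h'⟩
          by_cases hvk : v = k
          · exact .inr hvk
          · exact .inl ⟨by omega, h'⟩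
      · simp [h9.1]
      · simp only [St.arr_setReg, St.arr_setArr, if_true, Function.update_apply, h9.1]
        by_cases hx' : x = l.length
        · subst hx'; simp
        · have hx2 : x < l.length := by simp at hx; omega
          rw [if_neg hx', h9.2 x hx2, List.getElem_append_left hx2]
    · refine ⟨by simp at h3; simp [h1, h2, h3], skip (fun h => h3 h.2.2) _
        (by simpa [Listed] using h9)⟩
    · exact ⟨by simp [h1, h2], skip (fun h => h2 h.2.1) _ h9⟩
    · exact ⟨by simp [h0, h1], skip (fun h => h1 h.1) _ h9⟩

theorem edgeStep_exec {σ : St} (hE : Env P σ) {ρX ρY : ℕ → ℕ} {u j : ℕ} (h17 : σ.arr 17 = ρX)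
    (h18 : σ.arr 18 = ρY) (h49 : σ.reg 49 = u) (hj : j < P.M) (hσ : σ.reg 16 = j) :
    (edgeStep.exec σ).reg 54 ≠ 0 ↔ σ.reg 54 ≠ 0 ∧ P.EdgeStepOk ρX ρY u j := by
  have key : ∀ (a b x y : ℕ) (τ : St), τ.arr 17 = ρX → τ.arr 18 = ρY → τ.reg 49 = u →
      τ.reg a = x → τ.reg b = y → (((nbrCheck a b).exec τ).reg 54 ≠ 0 ↔
        τ.reg 54 ≠ 0 ∧ (ρX x = u + 1 → ρX y = 0 → ρY y = 0)) := by
    rintro a b x y τ rfl rfl rfl rfl rfl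
    unfold nbrCheck
    simp only [exec_ite, eval_absDiff, eval_ofNat]
    simp only [exec_skip, exec_set, eval, Nat.lt_one_iff,
      Nat.pos_iff_ne_zero]
    split_ifs <;> simp_all
  obtain ⟨τ, hτ⟩ : ∃ τ, τ = (Cmd.set 25 (.get 2 (.reg 16))).exec
    ((Cmd.set 24 (.get 1 (.reg 16))).exec σ) := ⟨_, rfl⟩
  have hag : (nbrCheck 24 25).Agree τ _ := agree _ τ
  have e : edgeStep.exec σ = (nbrCheck 25 24).exec ((nbrCheck 24 25).exec τ) := by rw [hτ]; rfl
  have r24 : τ.reg 24 = P.ea j := by rw [hτ]; simp [hσ, hE.ea j hj]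
  have r25 : τ.reg 25 = P.eb j := by rw [hτ]; simp [hσ, hE.eb j hj]
  have r49 : τ.reg 49 = u := by rw [hτ]; simp [h49]
  have r54 : τ.reg 54 = σ.reg 54 := by rw [hτ]; simp
  have a17 : τ.arr 17 = ρX := by rw [hτ]; simp [h17]
  have a18 : τ.arr 18 = ρY := by rw [hτ]; simp [h18]
  rw [e, key 25 24 (P.eb j) (P.ea j) _ (by rw [hag.2 17 (by decide), a17])
    (by rw [hag.2 18 (by decide), a18]) (by rw [hag.1 49 (by decide), r49])
    (by rw [hag.1 25 (by decide), r25]) (by rw [hag.1 24 (by decide), r24]),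
    key 24 25 (P.ea j) (P.eb j) _ a17 a18 r49 r24 r25, r54, and_assoc]
  rfl

theorem checkCode_exec {σ : St} (hE : Env P σ) {ρX ρY K : ℕ → ℕ} {u : ℕ} (h17 : σ.arr 17 = ρX)
    (h18 : σ.arr 18 = ρY) (h49 : σ.reg 49 = u) (hK : ∀ v, σ.arr 16 (σ.reg 51 + v) = K v) :
    ((checkCode.exec σ).reg 54 ≠ 0 ↔ P.Step ρX ρY u ∧
      ∀ v < P.n, ρY v = v + 1 → ρX v = u + 1 → K v ≠ 0) ∧
    ∃ l : List ℕ, l.Nodup ∧ (∀ v, v ∈ l ↔ v < P.n ∧ ρY v = v + 1 ∧ ρX v = u + 1 ∧ K v ≠ 0) ∧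
      Listed (checkCode.exec σ) K l := by
  obtain ⟨σ1, h1⟩ : ∃ σ1, σ1 = (Cmd.set 54 1 ;; Cmd.set 9 0).exec σ := ⟨_, rfl⟩
  have ag1 := (Cmd.set 54 1 ;; Cmd.set 9 0).agree σ
  rw [← h1] at ag1
  have r54 : σ1.reg 54 = 1 := by rw [h1]; simp
  have r9 : σ1.reg 9 = 0 := by rw [h1]; simp
  have hE1 := hE.of_agree ag1 (by decide) (by decide)
  obtain ⟨σ2, h2⟩ : ∃ σ2, σ2 = (Cmd.loop 16 1 vertexStep).exec σ1 := ⟨_, rfl⟩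
  have hloop := exec_loop (P := vertexStep) (i := 16) (n := 1) (σ := σ1)
    (fun k τ => (τ.reg 54 ≠ 0 ↔ ∀ v < k, VertexStepOk ρX ρY K u v) ∧
      ∃ l : List ℕ, l.Nodup ∧ (∀ v, v ∈ l ↔ v < k ∧ ρY v = v + 1 ∧ ρX v = u + 1 ∧ K v ≠ 0) ∧
        Listed τ K l) ⟨by simp [r54], [], by simp [Listed, r9]⟩ (by
    rintro k τ hk hi hag ⟨i1, l, i2, i3, i4⟩
    obtain ⟨f1, l', f2, f3, f4⟩ := vertexStep_exec (σ := τ) (ρX := ρX) (ρY := ρY) (K := K) (u := u)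
      (by rw [hag.2 17 (by decide), ag1.2 17 (by decide), h17])
      (by rw [hag.2 18 (by decide), ag1.2 18 (by decide), h18])
      (by rw [hag.1 49 (by decide), ag1.1 49 (by decide), h49])
      (by rw [hag.2 16 (by decide), ag1.2 16 (by decide), hag.1 51 (by decide),
        ag1.1 51 (by decide)]; exact hK) hi i2 i3 i4
    refine ⟨?_, l', f2, f3, by simpa [Listed] using f4⟩
    rw [St.reg_setReg, if_neg (by decide), f1, i1]
    constructor
    · rintro ⟨a, b⟩ v hv
      rcases Nat.lt_succ_iff_lt_or_eq.1 hv with hv | rfl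
      exacts [a v hv, b]
    · exact fun h => ⟨fun v hv => h v (by omega), h k (by omega)⟩)
  rw [show (Cmd.loop 16 1 _).exec σ1 = σ2 from h2.symm, hE1.n] at hloop
  obtain ⟨i1, l, i2, i3, i4⟩ := hloop
  have ag2 := (Cmd.loop 16 1 vertexStep).agree σ1
  rw [← h2] at ag2
  have hE2 := hE1.of_agree ag2 (by decide) (by decide)
  have hloop2 := exec_loop (P := edgeStep) (i := 16) (n := 2) (σ := σ2)
    (fun k τ => τ.reg 54 ≠ 0 ↔ (∀ v < P.n, VertexStepOk ρX ρY K u v) ∧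
      ∀ j < k, P.EdgeStepOk ρX ρY u j) (by simp [i1]) (by
    rintro k τ hk hi hag h
    rw [St.reg_setReg, if_neg (by decide), edgeStep_exec (hE2.of_agree hag (by decide) (by decide))
      (by rw [hag.2 17 (by decide), ag2.2 17 (by decide), ag1.2 17 (by decide), h17])
      (by rw [hag.2 18 (by decide), ag2.2 18 (by decide), ag1.2 18 (by decide), h18])
      (by rw [hag.1 49 (by decide), ag2.1 49 (by decide), ag1.1 49 (by decide), h49])
      (by rwa [← hE2.M]) hi, h, and_assoc]
    refine and_congr_right fun _ => ?_
    constructor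
    · rintro ⟨a, b⟩ v hv
      rcases Nat.lt_succ_iff_lt_or_eq.1 hv with hv | rfl
      exacts [a v hv, b]
    · exact fun h => ⟨fun v hv => h v (by omega), h k (by omega)⟩)
  rw [hE2.M] at hloop2
  have e : checkCode.exec σ = (Cmd.loop 16 2 edgeStep).exec σ2 := by rw [h2, h1]; rfl
  have ag3 := (Cmd.loop 16 2 edgeStep).agree σ2
  rw [← e] at ag3 hloop2
  refine ⟨hloop2.trans ?_, l, i2, i3, ?_⟩
  · constructor
    · rintro ⟨a, b⟩
      exact ⟨⟨fun v hv => (a v hv).1, b⟩, fun v hv => (a v hv).2⟩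
    · rintro ⟨a, b⟩
      exact ⟨fun v hv => ⟨a.sub v hv, b v hv⟩, a.nbr⟩
  · unfold Listed
    rw [ag3.1 9 (by decide), ag3.2 9 (by decide)]
    exact i4

end Check


/-! ### Trying a single step. -/

open Cmd SepAlg.Expr

/-- Register `48` plus register `49` is the number of the current separation. -/
def tryCode : Cmd :=
  .ite (.get 16 (.reg 48 + .reg 49)) 1 (checkCode ;; .ite 0 (.reg 54)
    (combineCode ;; .put 16 (.reg 48 + .reg 49) (.reg 11 + 1)) .skip) .skip

/-- The tables for the separations in `K` are stored in the array `10`; the entries of `K` are the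
addresses plus one. -/
def TablesOk (P : Prob) (m : ℕ) (K H : ℕ → ℕ) (top : ℕ) : Prop :=
  ∀ c < (P.n + 1) ^ m, ∀ u < P.n, K (c * P.n + u) ≠ 0 →
    K (c * P.n + u) - 1 + P.Q ^ m ≤ top ∧ ∃ ρ, P.Rep m (tup P.n c) ρ ∧
      P.Spec m (tup P.n c) (classSet P.n ρ u) fun x => H (K (c * P.n + u) - 1 + x)

structure SepInv (P : Prob) (m : ℕ) (σ : St) : Prop where
  env : Env P σ
  marks : ∀ v, P.n < v → σ.arr 7 v = 0
  colors : ∀ v, P.n < v → σ.arr 8 v = 0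
  r7 : σ.reg 7 = m
  r8 : σ.reg 8 = m
  r43 : σ.reg 43 = (P.n + 1) ^ m
  r44 : σ.reg 44 = (P.n + 1) ^ m * P.n
  r45 : σ.reg 45 = P.n * P.n + 1
  tables : TablesOk P m (σ.arr 16) (σ.arr 10) (σ.reg 10)

theorem SepInv.of_agree {P : Prob} {m : ℕ} {σ τ : St} (h : SepInv P m σ) {c : Cmd}
    (hc : c.Agree σ τ) (hr : ∀ x ∈ [1, 2, 3, 4, 5, 6, 26, 7, 8, 10, 43, 44, 45], x ∉ c.regs)
    (ha : ∀ a ∈ [1, 2, 3, 7, 8, 10, 16], a ∉ c.arrs) : SepInv P m τ := by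
  refine ⟨h.env.of_agree hc (fun x hx => hr x (by revert x; decide))
      fun a hx => ha a (by revert a; decide), ?_, ?_, ?_, ?_, ?_, ?_, ?_, ?_⟩
  · rw [hc.2 7 (ha 7 (by decide))]; exact h.marks
  · rw [hc.2 8 (ha 8 (by decide))]; exact h.colors
  · rw [hc.1 7 (hr 7 (by decide)), h.r7]
  · rw [hc.1 8 (hr 8 (by decide)), h.r8]
  · rw [hc.1 43 (hr 43 (by decide)), h.r43]
  · rw [hc.1 44 (hr 44 (by decide)), h.r44]
  · rw [hc.1 45 (hr 45 (by decide)), h.r45]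
  · rw [hc.2 16 (ha 16 (by decide)), hc.2 10 (ha 10 (by decide)), hc.1 10 (hr 10 (by decide))]
    exact h.tables

/-- If a step leads to the separation `(c, u)` from separations with the tuple `d` in `K`, then
`(c, u)` belongs to `K`. -/
def Done (P : Prob) (m : ℕ) (c u d : ℕ) (K : ℕ → ℕ) : Prop :=
  ∀ ρX ρY, P.Rep m (tup P.n c) ρX → P.Rep m (tup P.n d) ρY → P.Step ρX ρY u →
    (∀ v < P.n, ρY v = v + 1 → ρX v = u + 1 → K (d * P.n + v) ≠ 0) → K (c * P.n + u) ≠ 0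

/-- `K'` extends `K`, and if nothing is new, then `T K` holds. -/
def Progress (s : ℕ) (K K' : ℕ → ℕ) (T : (ℕ → ℕ) → Prop) : Prop :=
  (∀ i, K i ≠ 0 → K' i ≠ 0) ∧ (K' = K ∧ T K ∨ ∃ i < s, K i = 0 ∧ K' i ≠ 0)

section Try

variable {P : Prob} {m : ℕ}

theorem Progress.refl {s : ℕ} {K : ℕ → ℕ} {T : (ℕ → ℕ) → Prop} (h : T K) : Progress s K K T :=
  ⟨fun _ h => h, .inl ⟨rfl, h⟩⟩

/-- The tests `T` and `T'` are asserted only if nothing has changed, and then both were made for the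
same `K`. -/
theorem Progress.trans {s : ℕ} {K K' K'' : ℕ → ℕ} {T T' T'' : (ℕ → ℕ) → Prop}
    (h : Progress s K K' T) (h' : Progress s K' K'' T') (hT : T K → T' K → T'' K) :
    Progress s K K'' T'' := by
  refine ⟨fun i hi => h'.1 i (h.1 i hi), ?_⟩
  rcases h.2 with ⟨rfl, h1⟩ | ⟨i, hi, h1, h2⟩
  · rcases h'.2 with ⟨rfl, h2⟩ | h2
    exacts [.inl ⟨rfl, hT h1 h2⟩, .inr h2]
  · exact .inr ⟨i, hi, h1, h'.1 i h2⟩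

theorem index_lt {n s c u : ℕ} (hc : c < s) (hu : u < n) : c * n + u < s * n := by
  calc c * n + u < (c + 1) * n := by rw [add_mul, one_mul]; omega
    _ ≤ s * n := Nat.mul_le_mul_right _ hc

theorem index_inj {n c u c' u' : ℕ} (hu : u < n) (hu' : u' < n) (h : c * n + u = c' * n + u') :
    c = c' ∧ u = u' := by
  have hn : 0 < n := by omega
  have h1 := congrArg (· / n) h
  have h2 := congrArg (· % n) h
  simp only [Nat.mul_add_mod_self_right, Nat.mod_eq_of_lt hu, Nat.mod_eq_of_lt hu'] at h2
  simp only [mul_comm _ n, Nat.mul_add_div hn, Nat.div_eq_of_lt hu, Nat.div_eq_of_lt hu',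
    add_zero] at h1
  exact ⟨h1, h2⟩

theorem classSet_congr {n u : ℕ} {ρ ρ' : ℕ → ℕ} (h : ∀ v < n, ρ' v = ρ v) :
    classSet n ρ' u = classSet n ρ u := by
  ext v
  rw [mem_classSet, mem_classSet]
  exact and_congr_right fun hv => by rw [h v hv]

/-- The two tuples are unrelated here, so their union may have `2 * m` vertices, and there may be up
to `n` parts. -/
def tryBound (n M Q m : ℕ) : ℕ := 100 * (1 + n + M) + combineBound n M Q m m n (2 * m)

/-- A table is computed only if the separation is new and all the tables it needs exist. The
invariant knows the components of the older tables through some `ρ`; by `Prob.Rep.unique` they are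
those in the arrays `17` and `18`. -/
theorem tryCode_exec (hP : P.Wf) {σ : St} (hI : SepInv P m σ) {c u d : ℕ}
    (hc : c < (P.n + 1) ^ m) (hu : u < P.n) (hd : d < (P.n + 1) ^ m) (h48 : σ.reg 48 = c * P.n)
    (h49 : σ.reg 49 = u) (h51 : σ.reg 51 = d * P.n) (h4 : ∀ j < m, σ.arr 4 j = tup P.n c j)
    (h5 : ∀ j < m, σ.arr 5 j = tup P.n d j) (h17 : P.Rep m (tup P.n c) (σ.arr 17))
    (h18 : P.Rep m (tup P.n d) (σ.arr 18)) :
    SepInv P m (tryCode.exec σ) ∧ Progress ((P.n + 1) ^ m * P.n) (σ.arr 16)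
      ((tryCode.exec σ).arr 16) (Done P m c u d) ∧
    tryCode.cost σ ≤ tryBound P.n P.M P.Q m := by
  classical
  have hk := cost_le_ub' checkCode σ (by decide)
  have hk' : checkCode.cost σ ≤ 50 * (1 + P.n + P.M) := by
    refine hk.trans ?_
    simp only [checkCode, vertexStep, edgeStep, nbrCheck, ub, hI.env.n, hI.env.M]
    omega
  clear hk
  have e : tryCode.exec σ = if σ.arr 16 (c * P.n + u) < 1 then
      (Cmd.ite 0 (.reg 54) (combineCode ;; .put 16 (.reg 48 + .reg 49) (.reg 11 + 1)) .skip).exec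
        (checkCode.exec σ) else σ := by
    simp only [tryCode, exec_ite, eval, h48, h49]; rfl
  have ec : tryCode.cost σ = 1 + if σ.arr 16 (c * P.n + u) < 1 then checkCode.cost σ +
      (Cmd.ite 0 (.reg 54) (combineCode ;; .put 16 (.reg 48 + .reg 49) (.reg 11 + 1)) .skip).cost
        (checkCode.exec σ) else 1 := by
    simp only [tryCode, Cmd.cost, eval, h48, h49]
  rw [e, ec]
  by_cases h0 : σ.arr 16 (c * P.n + u) < 1
  · rw [if_pos h0, if_pos h0]
    obtain ⟨f1, l, f2, f3, f4, f5⟩ := checkCode_exec hI.env (ρX := σ.arr 17) (ρY := σ.arr 18)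
      (K := fun v => σ.arr 16 (d * P.n + v)) rfl rfl h49 fun v => by rw [h51]
    obtain ⟨σ1, h1⟩ : ∃ σ1, σ1 = checkCode.exec σ := ⟨_, rfl⟩
    have ag1 := checkCode.agree σ
    rw [← h1] at ag1 f1 f4 f5 ⊢
    have hI1 := hI.of_agree ag1 (by decide) (by decide)
    have e16 : σ1.arr 16 = σ.arr 16 := ag1.2 16 (by decide)
    simp only [exec_ite, Cmd.cost, eval, Nat.pos_iff_ne_zero]
    by_cases h54 : σ1.reg 54 = 0
    · rw [if_neg (by simp [h54]), if_neg (by simp [h54])]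
      refine ⟨hI1, ?_, ?_⟩
      · rw [exec_skip, e16]
        refine .refl fun ρX ρY hX hY hs hch => absurd ?_ (not_not.2 h54)
        have eX : ∀ v < P.n, σ.arr 17 v = ρX v := fun v hv => hX.unique hP h17 hv
        have eY : ∀ v < P.n, σ.arr 18 v = ρY v := fun v hv => hY.unique hP h18 hv
        refine f1.2 ⟨⟨fun y hy => ?_, fun j hj => ?_⟩, fun v hv => ?_⟩
        · rw [eX y hy, eY y hy]; exact hs.sub y hy
        · rw [eX _ (hP.ea j hj), eX _ (hP.eb j hj), eY _ (hP.ea j hj), eY _ (hP.eb j hj)]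
          exact hs.nbr j hj
        · rw [eX v hv, eY v hv]; exact hch v hv
      · unfold tryBound; omega
    · rw [if_pos (by simpa using h54), if_pos (by simpa using h54)]
      obtain ⟨hs, hch⟩ := f1.1 h54
      have hl' : ∀ v, v ∈ l ↔ v < P.n ∧ σ.arr 18 v = v + 1 ∧ σ.arr 17 v = u + 1 := fun v => by
        rw [f3]
        exact ⟨fun h => ⟨h.1, h.2.1, h.2.2.1⟩, fun h => ⟨h.1, h.2.1, h.2.2, hch v h.1 h.2.1 h.2.2⟩⟩
      have g4 : ∀ j < m, σ1.arr 4 j = tup P.n c j := by rw [ag1.2 4 (by decide)]; exact h4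
      have g5 : ∀ j < m, σ1.arr 5 j = tup P.n d j := by rw [ag1.2 5 (by decide)]; exact h5
      have hS := hs.splits hP (h17.tuple_congr g4) (h18.tuple_congr g5) f2 hl'
      have e8 := hI1.r8
      have e7 := hI1.r7
      have hS' : P.Splits (σ1.reg 7) (σ1.arr 4) (σ1.reg 8) (σ1.arr 5) (classSet P.n (σ.arr 17) u)
          (σ1.reg 9) fun x => classSet P.n (σ.arr 18) (l.getD x 0) := by
        rw [e7, e8, f4]; exact hS
      obtain ⟨c11, c10, ctop, cspec, c7, c8, ccost⟩ := combineCode_exec hP hI1.env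
        hI1.marks hI1.colors hS' (by
          intro x hx
          rw [f4] at hx
          obtain ⟨q1, q2, q3, q4⟩ := (f3 _).1 (List.getElem_mem hx)
          obtain ⟨t1, ρ, t2, t3⟩ := hI1.tables d hd l[x] q1 (by rw [e16]; exact q4)
          rw [f5 x hx, ← e16, List.getD_eq_getElem _ _ hx, e8]
          refine ⟨t1, ?_⟩
          rw [classSet_congr fun v hv => t2.unique hP h18 hv]
          exact t3.tuple_congr g5)
      obtain ⟨σ2, h2⟩ : ∃ σ2, σ2 = combineCode.exec σ1 := ⟨_, rfl⟩
      have ag2 := combineCode.agree σ1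
      rw [exec_seq]
      rw [← h2] at ag2 c11 c10 ctop cspec c7 c8 ⊢
      have k16 : ∀ i, ((Cmd.put 16 (.reg 48 + .reg 49) (.reg 11 + 1)).exec σ2).arr 16 i =
          if i = c * P.n + u then σ.reg 10 + 1 else σ.arr 16 i := fun i => by
        have a1 : σ2.reg 48 = c * P.n := by rw [ag2.1 48 (by decide), ag1.1 48 (by decide), h48]
        have a2 : σ2.reg 49 = u := by rw [ag2.1 49 (by decide), ag1.1 49 (by decide), h49]
        have a3 : σ2.reg 11 = σ.reg 10 := by rw [c11, ag1.1 10 (by decide)]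
        have a4 : σ2.arr 16 = σ.arr 16 := by rw [ag2.2 16 (by decide), e16]
        simp [a1, a2, a3, a4, Function.update_apply]
      obtain ⟨σ3, h3⟩ : ∃ σ3, σ3 = (Cmd.put 16 (.reg 48 + .reg 49) (.reg 11 + 1)).exec σ2 :=
        ⟨_, rfl⟩
      have ag3 := (Cmd.put 16 (.reg 48 + .reg 49) (.reg 11 + 1)).agree σ2
      rw [← h3] at k16 ag3 ⊢
      have e10 : σ1.reg 10 = σ.reg 10 := ag1.1 10 (by decide)
      have f10 : σ1.arr 10 = σ.arr 10 := ag1.2 10 (by decide)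
      have k10 : σ3.reg 10 = σ.reg 10 + P.Q ^ m := by rw [ag3.1 10 (by decide), c10, e10, e7]
      have ka : σ3.arr 10 = σ2.arr 10 := ag3.2 10 (by decide)
      refine ⟨⟨?_, ?_, ?_, ?_, ?_, ?_, ?_, ?_, ?_⟩, ⟨fun i hi => ?_, .inr ⟨c * P.n + u,
        index_lt hc hu, by omega, by rw [k16, if_pos rfl]; omega⟩⟩, ?_⟩
      · exact (hI1.env.of_agree ag2 (by decide) (by decide)).of_agree ag3 (by decide) (by decide)
      · rw [ag3.2 7 (by decide)]; exact c7
      · rw [ag3.2 8 (by decide)]; exact c8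
      · rw [ag3.1 7 (by decide), ag2.1 7 (by decide), hI1.r7]
      · rw [ag3.1 8 (by decide), ag2.1 8 (by decide), hI1.r8]
      · rw [ag3.1 43 (by decide), ag2.1 43 (by decide), hI1.r43]
      · rw [ag3.1 44 (by decide), ag2.1 44 (by decide), hI1.r44]
      · rw [ag3.1 45 (by decide), ag2.1 45 (by decide), hI1.r45]
      · intro c' hc' u' hu' hne
        rw [k16] at hne ⊢
        rw [k10, ka]
        by_cases hcu : c' * P.n + u' = c * P.n + u
        · obtain ⟨rfl, rfl⟩ := index_inj hu' hu hcu
          rw [if_pos rfl, Nat.add_sub_cancel]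
          refine ⟨le_rfl, σ.arr 17, h17, ?_⟩
          rw [e7, e10] at cspec
          exact cspec.tuple_congr fun j hj => (g4 j hj).symm
        · rw [if_neg hcu] at hne ⊢
          obtain ⟨t1, ρ, t2, t3⟩ := hI.tables c' hc' u' hu' hne
          refine ⟨by omega, ρ, t2, t3.congr fun x hx => ?_⟩
          rw [ctop _ (by rw [e10]; omega), f10]
      · rw [k16]
        split_ifs
        exacts [by omega, hi]
      · let W : Finset ℕ := (Finset.range m).image (σ1.arr 4) ∪ (Finset.range m).image (σ1.arr 5)
        have hW := ccost W (by
          rw [e7, e8]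
          rintro v (⟨-, j, hj, rfl⟩ | ⟨-, j, hj, rfl⟩)
          · exact Finset.mem_union_left _ (Finset.mem_image_of_mem _ (by simpa using hj))
          · exact Finset.mem_union_right _ (Finset.mem_image_of_mem _ (by simpa using hj)))
        have hcard : W.card ≤ 2 * m := by
          refine (Finset.card_union_le _ _).trans ?_
          have a := Finset.card_image_le (s := Finset.range m) (f := σ1.arr 4)
          have b := Finset.card_image_le (s := Finset.range m) (f := σ1.arr 5)
          rw [Finset.card_range] at a b
          omega
        have hlen : σ1.reg 9 ≤ P.n := by
          rw [f4, ← List.toFinset_card_of_nodup f2]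
          refine (Finset.card_le_card (t := Finset.range P.n) fun v hv => ?_).trans (by simp)
          rw [List.mem_toFinset, f3] at hv
          simpa using hv.1
        have := hW.trans (combineBound_mono (by have := hP.Q; omega) e7.le e8.le hlen hcard)
        unfold tryBound
        omega
  · rw [if_neg h0, if_neg h0]
    exact ⟨hI, .refl fun _ _ _ _ _ _ => by omega, by unfold tryBound; omega⟩

end Try


/-! ### Running through all steps. -/

open Cmd SepAlg.Expr

def clearTuple (a l : ℕ) : Cmd := .loop 16 l (.put a (.reg 16) 0)

def nextTuple (a l x : ℕ) : Cmd := incCode a l 26 (.reg 16) ;; .set x (.reg x + .reg 1)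

def innerBody : Cmd := repCode 5 8 18 ;; tryCode ;; nextTuple 5 8 51

def innerLoop : Cmd := (clearTuple 5 8 ;; .set 51 0) ;; .loop 50 43 innerBody

def middleLoop : Cmd := .loop 49 1 innerLoop

def outerBody : Cmd := repCode 4 7 17 ;; middleLoop ;; nextTuple 4 7 48

/-- Try all steps. -/
def roundCode : Cmd := (clearTuple 4 7 ;; .set 48 0) ;; .loop 47 43 outerBody

def repBound (n M m : ℕ) : ℕ := 20 * (1 + n + m + (n * n + 1) * (M + 1))

def innerBound (n M Q m : ℕ) : ℕ :=
  10 * (1 + m) + (n + 1) ^ m * (10 * (1 + m) + repBound n M m + tryBound n M Q m)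

def roundBound (n M Q m : ℕ) : ℕ :=
  10 * (1 + m) + (n + 1) ^ m * (10 * (1 + m) + repBound n M m + (1 + n * (1 + innerBound n M Q m)))

section Rounds

variable {P : Prob} {m : ℕ}

theorem clearTuple_exec {a l : ℕ} (n : ℕ) (σ : St) :
    ∀ j < σ.reg l, ((clearTuple a l).exec σ).arr a j = tup n 0 j := by
  refine exec_loop (fun k τ => ∀ j < k, τ.arr a j = tup n 0 j) (by simp) ?_
  intro k τ hk hi hag h j hj
  simp only [exec_put, eval, hi, St.arr_setReg, St.arr_setArr, if_true,
    Function.update_apply]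
  by_cases hjk : j = k
  · simp [hjk, tup, dig_zero]
  · rw [if_neg hjk, h j (by omega)]

/-- Register `x` keeps `n` times the number of the tuple, so that the position of a separation is
found by one addition. -/
theorem nextTuple_exec {a l x c : ℕ} (hl : l ∉ [16, 23, 24]) (hx : x ∉ [1, 16, 23, 24]) {σ : St}
    (hE : Env P σ) (hlm : σ.reg l = m) (ha : ∀ j < m, σ.arr a j = tup P.n c j)
    (hσ : σ.reg x = c * P.n) :
    (∀ j < m, ((nextTuple a l x).exec σ).arr a j = tup P.n (c + 1) j) ∧
      ((nextTuple a l x).exec σ).reg x = (c + 1) * P.n := by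
  have h := incCode_exec (a := a) (u := l) (q := 26) (e := .reg 16) (f := id) (c := c) hl
    (by decide) σ (fun i _ j _ h => h) (fun τ _ _ _ => rfl) (by rw [hE.n1]; omega)
    (by rw [hlm, hE.n1]; exact ha)
  rw [hlm, hE.n1] at h
  simp only [List.mem_cons, List.not_mem_nil, or_false, not_or] at hx
  refine ⟨by simpa [nextTuple, tup] using h.1, ?_⟩
  have h1 : ((incCode a l 26 (.reg 16)).exec σ).reg x = c * P.n := by
    rw [reg_exec (by simp [incCode, hx]), hσ]
  have h2 : ((incCode a l 26 (.reg 16)).exec σ).reg 1 = P.n := by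
    rw [reg_exec (by simp [incCode]), hE.n]
  simp [nextTuple, h1, h2, add_mul]

theorem repCode_cost {a l r : ℕ} (hl : l ∉ [16, 24, 25, 53]) {σ : St} (hI : SepInv P m σ)
    (hlm : σ.reg l = m) : (repCode a l r).cost σ ≤ repBound P.n P.M m := by
  refine (cost_le_ub' _ σ (by simp at hl; simp [repCode, relax, hl])).trans ?_
  simp only [repCode, relax, ub, hI.env.n, hI.env.M, hI.r45, hlm, repBound]
  ring_nf
  omega

theorem nextTuple_cost {a l x : ℕ} (hl : l ∉ [16, 23, 24, x]) {σ : St}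
    (hlm : σ.reg l = m) : (nextTuple a l x).cost σ ≤ 3 + 8 * m := by
  refine (cost_le_ub' _ σ (by simp at hl; simp [nextTuple, incCode, hl])).trans ?_
  simp only [nextTuple, incCode, ub, hlm]
  omega

theorem clearTuple_cost {a l : ℕ} (hl : l ≠ 16) {σ : St}
    (hlm : σ.reg l = m) : (clearTuple a l).cost σ ≤ 1 + 2 * m := by
  refine (cost_le_ub' _ σ (by simpa [clearTuple] using hl)).trans ?_
  simp only [clearTuple, ub, hlm]
  omega

theorem innerBody_exec (hP : P.Wf) {σ : St} (hI : SepInv P m σ) {c u d : ℕ}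
    (hc : c < (P.n + 1) ^ m) (hu : u < P.n) (hd : d < (P.n + 1) ^ m) (h48 : σ.reg 48 = c * P.n)
    (h49 : σ.reg 49 = u) (h51 : σ.reg 51 = d * P.n) (h4 : ∀ j < m, σ.arr 4 j = tup P.n c j)
    (h5 : ∀ j < m, σ.arr 5 j = tup P.n d j) (h17 : P.Rep m (tup P.n c) (σ.arr 17)) :
    (SepInv P m (innerBody.exec σ) ∧ Progress ((P.n + 1) ^ m * P.n) (σ.arr 16)
      ((innerBody.exec σ).arr 16) (Done P m c u d)) ∧
    ((innerBody.exec σ).reg 51 = (d + 1) * P.n ∧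
      ∀ j < m, (innerBody.exec σ).arr 5 j = tup P.n (d + 1) j) ∧
    innerBody.cost σ ≤ 9 * (1 + m) + repBound P.n P.M m + tryBound P.n P.M P.Q m := by
  obtain ⟨σ1, h1⟩ : ∃ σ1, σ1 = (repCode 5 8 18).exec σ := ⟨_, rfl⟩
  have ag1 := (repCode 5 8 18).agree σ
  have b1 := repCode_exec hP (a := 5) (l := 8) (r := 18) (by decide) (by decide) (by decide)
    hI.env hI.r45
  have c1 := repCode_cost (a := 5) (l := 8) (r := 18) (by decide) hI hI.r8
  rw [← h1] at ag1 b1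
  rw [hI.r8] at b1
  have hI1 := hI.of_agree ag1 (by decide) (by decide)
  have g4 : ∀ j < m, σ1.arr 4 j = tup P.n c j := by rw [ag1.2 4 (by decide)]; exact h4
  have g5 : ∀ j < m, σ1.arr 5 j = tup P.n d j := by rw [ag1.2 5 (by decide)]; exact h5
  have g51 : σ1.reg 51 = d * P.n := by rw [ag1.1 51 (by decide), h51]
  obtain ⟨hI2, hpr, c2⟩ := tryCode_exec hP hI1 hc hu hd (by rw [ag1.1 48 (by decide), h48])
    (by rw [ag1.1 49 (by decide), h49]) g51 g4 g5
    (by rw [ag1.2 17 (by decide)]; exact h17) (b1.tuple_congr fun j hj => (h5 j hj).symm)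
  obtain ⟨σ2, h2⟩ : ∃ σ2, σ2 = tryCode.exec σ1 := ⟨_, rfl⟩
  have ag2 := tryCode.agree σ1
  rw [← h2] at ag2 hI2 hpr
  have b3 := nextTuple_exec (a := 5) (l := 8) (x := 51) (c := d) (by decide) (by decide)
    hI2.env hI2.r8 (by rw [ag2.2 5 (by decide)]; exact g5) (by rw [ag2.1 51 (by decide), g51])
  have c3 := nextTuple_cost (a := 5) (l := 8) (x := 51) (by decide) hI2.r8
  have ag3 := (nextTuple 5 8 51).agree σ2
  have e : innerBody.exec σ = (nextTuple 5 8 51).exec σ2 := by rw [h2, h1]; rfl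
  have ec : innerBody.cost σ = (repCode 5 8 18).cost σ + (tryCode.cost σ1 +
    (nextTuple 5 8 51).cost σ2) := by rw [h2, h1]; rfl
  rw [← e] at b3 ag3
  refine ⟨⟨hI2.of_agree ag3 (by decide) (by decide), ?_⟩, ⟨b3.2, b3.1⟩, by omega⟩
  rw [ag3.2 16 (by decide), ← ag1.2 16 (by decide)]
  exact hpr

theorem innerLoop_exec (hP : P.Wf) {σ : St} (hI : SepInv P m σ) {c u : ℕ}
    (hc : c < (P.n + 1) ^ m) (hu : u < P.n) (h48 : σ.reg 48 = c * P.n)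
    (h49 : σ.reg 49 = u) (h4 : ∀ j < m, σ.arr 4 j = tup P.n c j)
    (h17 : P.Rep m (tup P.n c) (σ.arr 17)) :
    (SepInv P m (innerLoop.exec σ) ∧ Progress ((P.n + 1) ^ m * P.n) (σ.arr 16)
      ((innerLoop.exec σ).arr 16) fun K => ∀ d < (P.n + 1) ^ m, Done P m c u d K) ∧
    innerLoop.cost σ ≤ innerBound P.n P.M P.Q m := by
  obtain ⟨σ1, h1⟩ : ∃ σ1, σ1 = (clearTuple 5 8 ;; Cmd.set 51 0).exec σ := ⟨_, rfl⟩
  have ag1 := (clearTuple 5 8 ;; Cmd.set 51 0).agree σ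
  have b1 := clearTuple_exec (a := 5) (l := 8) P.n σ
  have c1 := clearTuple_cost (a := 5) (l := 8) (by decide) hI.r8
  rw [← h1] at ag1
  have hI1 := hI.of_agree ag1 (by decide) (by decide)
  rw [hI.r8] at b1
  have g5 : ∀ j < m, σ1.arr 5 j = tup P.n 0 j := by rw [h1]; simpa using b1
  have g51 : σ1.reg 51 = 0 := by rw [h1]; simp
  have hloop := exec_loop_cost_const (P := innerBody) (i := 50) (n := 43) (σ := σ1)
    (fun k τ => (SepInv P m τ ∧ Progress ((P.n + 1) ^ m * P.n) (σ.arr 16) (τ.arr 16)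
      fun K => ∀ d < k, Done P m c u d K) ∧ τ.reg 51 = k * P.n ∧ ∀ j < m, τ.arr 5 j = tup P.n k j)
    (9 * (1 + m) + repBound P.n P.M m + tryBound P.n P.M P.Q m)
    ⟨⟨hI1.of_agree (c := .set 50 0) (Cmd.agree _ _) (by decide) (by decide), by
      rw [St.arr_setReg, ag1.2 16 (by decide)]; exact .refl (by simp)⟩, by simp [g51], g5⟩ (by
    rintro k τ hk hi hag ⟨⟨i1, i2⟩, i3, i4⟩
    rw [hI1.r43] at hk
    obtain ⟨⟨f1, f2⟩, ⟨f3, f4⟩, f5⟩ := innerBody_exec hP i1 hc hu hk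
      (by rw [hag.1 48 (by decide), ag1.1 48 (by decide), h48])
      (by rw [hag.1 49 (by decide), ag1.1 49 (by decide), h49]) i3
      (by rw [hag.2 4 (by decide), ag1.2 4 (by decide)]; exact h4) i4
      (by rw [hag.2 17 (by decide), ag1.2 17 (by decide)]; exact h17)
    refine ⟨⟨⟨f1.of_agree (c := .set 50 (.lit (k + 1))) (Cmd.agree _ _) (by simp) (by simp),
      i2.trans f2 fun h h' d hd => ?_⟩, by simpa using f3, f4⟩, f5⟩
    rcases Nat.lt_succ_iff_lt_or_eq.1 hd with hd | rfl
    exacts [h d hd, h'])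
  rw [hI1.r43] at hloop
  have e : innerLoop.exec σ = (Cmd.loop 50 43 innerBody).exec σ1 := by rw [h1]; rfl
  have ec : innerLoop.cost σ = (clearTuple 5 8).cost σ + 1 +
    (Cmd.loop 50 43 innerBody).cost σ1 := by rw [h1]; rfl
  rw [e, ec]
  refine ⟨hloop.1.1, ?_⟩
  have : (P.n + 1) ^ m * (1 + (9 * (1 + m) + repBound P.n P.M m + tryBound P.n P.M P.Q m)) ≤
      (P.n + 1) ^ m * (10 * (1 + m) + repBound P.n P.M m + tryBound P.n P.M P.Q m) :=
    Nat.mul_le_mul_left _ (by omega)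
  have h2 := hloop.2
  unfold innerBound
  omega

theorem middleLoop_exec (hP : P.Wf) {σ : St} (hI : SepInv P m σ) {c : ℕ}
    (hc : c < (P.n + 1) ^ m) (h48 : σ.reg 48 = c * P.n) (h4 : ∀ j < m, σ.arr 4 j = tup P.n c j)
    (h17 : P.Rep m (tup P.n c) (σ.arr 17)) :
    (SepInv P m (middleLoop.exec σ) ∧ Progress ((P.n + 1) ^ m * P.n) (σ.arr 16)
      ((middleLoop.exec σ).arr 16) fun K => ∀ u < P.n, ∀ d < (P.n + 1) ^ m, Done P m c u d K) ∧
    middleLoop.cost σ ≤ 1 + P.n * (1 + innerBound P.n P.M P.Q m) := by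
  rw [← hI.env.n]
  refine exec_loop_cost_const (P := innerLoop) (i := 49) (n := 1) (σ := σ)
    (fun k τ => (SepInv P m τ ∧ Progress ((σ.reg 1 + 1) ^ m * σ.reg 1) (σ.arr 16) (τ.arr 16)
      fun K => ∀ u < k, ∀ d < (σ.reg 1 + 1) ^ m, Done P m c u d K)) _
    ⟨hI.of_agree (c := .set 49 0) (Cmd.agree _ _) (by decide) (by decide), .refl (by simp)⟩ ?_
  rintro k τ hk hi hag ⟨i1, i2⟩
  rw [hI.env.n] at hk i2 ⊢
  obtain ⟨⟨f1, f2⟩, f3⟩ := innerLoop_exec hP i1 hc hk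
    (by rw [hag.1 48 (by decide), h48]) hi
    (by rw [hag.2 4 (by decide)]; exact h4) (by rw [hag.2 17 (by decide)]; exact h17)
  refine ⟨⟨f1.of_agree (c := .set 49 (.lit (k + 1))) (Cmd.agree _ _) (by simp) (by simp),
    i2.trans f2 fun h h' u hu => ?_⟩, f3⟩
  rcases Nat.lt_succ_iff_lt_or_eq.1 hu with hu | rfl
  exacts [h u hu, h']

theorem outerBody_exec (hP : P.Wf) {σ : St} (hI : SepInv P m σ) {c : ℕ}
    (hc : c < (P.n + 1) ^ m) (h48 : σ.reg 48 = c * P.n)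
    (h4 : ∀ j < m, σ.arr 4 j = tup P.n c j) :
    (SepInv P m (outerBody.exec σ) ∧ Progress ((P.n + 1) ^ m * P.n) (σ.arr 16)
      ((outerBody.exec σ).arr 16) fun K => ∀ u < P.n, ∀ d < (P.n + 1) ^ m, Done P m c u d K) ∧
    ((outerBody.exec σ).reg 48 = (c + 1) * P.n ∧
      ∀ j < m, (outerBody.exec σ).arr 4 j = tup P.n (c + 1) j) ∧
    outerBody.cost σ ≤ 9 * (1 + m) + repBound P.n P.M m +
      (1 + P.n * (1 + innerBound P.n P.M P.Q m)) := by
  obtain ⟨σ1, h1⟩ : ∃ σ1, σ1 = (repCode 4 7 17).exec σ := ⟨_, rfl⟩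
  have ag1 := (repCode 4 7 17).agree σ
  have b1 := repCode_exec hP (a := 4) (l := 7) (r := 17) (by decide) (by decide) (by decide)
    hI.env hI.r45
  have c1 := repCode_cost (a := 4) (l := 7) (r := 17) (by decide) hI hI.r7
  rw [← h1] at ag1 b1
  rw [hI.r7] at b1
  have hI1 := hI.of_agree ag1 (by decide) (by decide)
  have g4 : ∀ j < m, σ1.arr 4 j = tup P.n c j := by rw [ag1.2 4 (by decide)]; exact h4
  have g48 : σ1.reg 48 = c * P.n := by rw [ag1.1 48 (by decide), h48]
  obtain ⟨⟨hI2, hpr⟩, c2⟩ := middleLoop_exec hP hI1 hc g48 g4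
    (b1.tuple_congr fun j hj => (h4 j hj).symm)
  obtain ⟨σ2, h2⟩ : ∃ σ2, σ2 = middleLoop.exec σ1 := ⟨_, rfl⟩
  have ag2 := middleLoop.agree σ1
  rw [← h2] at ag2 hI2 hpr
  have b3 := nextTuple_exec (a := 4) (l := 7) (x := 48) (c := c) (by decide) (by decide)
    hI2.env hI2.r7 (by rw [ag2.2 4 (by decide)]; exact g4) (by rw [ag2.1 48 (by decide), g48])
  have c3 := nextTuple_cost (a := 4) (l := 7) (x := 48) (by decide) hI2.r7
  have ag3 := (nextTuple 4 7 48).agree σ2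
  have e : outerBody.exec σ = (nextTuple 4 7 48).exec σ2 := by rw [h2, h1]; rfl
  have ec : outerBody.cost σ = (repCode 4 7 17).cost σ + (middleLoop.cost σ1 +
    (nextTuple 4 7 48).cost σ2) := by rw [h2, h1]; rfl
  rw [← e] at b3 ag3
  refine ⟨⟨hI2.of_agree ag3 (by decide) (by decide), ?_⟩, ⟨b3.2, b3.1⟩, by omega⟩
  rw [ag3.2 16 (by decide), ← ag1.2 16 (by decide)]
  exact hpr

/-- If a round finds nothing new, `K` was the same during all of its tests, and together these say
that `K` is closed under steps. -/
theorem roundCode_exec (hP : P.Wf) {σ : St} (hI : SepInv P m σ) :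
    (SepInv P m (roundCode.exec σ) ∧ Progress ((P.n + 1) ^ m * P.n) (σ.arr 16)
      ((roundCode.exec σ).arr 16) fun K => StepClosed P m fun c u => K (c * P.n + u) ≠ 0) ∧
    roundCode.cost σ ≤ roundBound P.n P.M P.Q m := by
  obtain ⟨σ1, h1⟩ : ∃ σ1, σ1 = (clearTuple 4 7 ;; Cmd.set 48 0).exec σ := ⟨_, rfl⟩
  have ag1 := (clearTuple 4 7 ;; Cmd.set 48 0).agree σ
  have b1 := clearTuple_exec (a := 4) (l := 7) P.n σ
  have c1 := clearTuple_cost (a := 4) (l := 7) (by decide) hI.r7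
  rw [← h1] at ag1
  have hI1 := hI.of_agree ag1 (by decide) (by decide)
  rw [hI.r7] at b1
  have g4 : ∀ j < m, σ1.arr 4 j = tup P.n 0 j := by rw [h1]; simpa using b1
  have g48 : σ1.reg 48 = 0 := by rw [h1]; simp
  have hloop := exec_loop_cost_const (P := outerBody) (i := 47) (n := 43) (σ := σ1)
    (fun k τ => (SepInv P m τ ∧ Progress ((P.n + 1) ^ m * P.n) (σ.arr 16) (τ.arr 16)
      fun K => ∀ c < k, ∀ u < P.n, ∀ d < (P.n + 1) ^ m, Done P m c u d K) ∧
      τ.reg 48 = k * P.n ∧ ∀ j < m, τ.arr 4 j = tup P.n k j)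
    (9 * (1 + m) + repBound P.n P.M m + (1 + P.n * (1 + innerBound P.n P.M P.Q m)))
    ⟨⟨hI1.of_agree (c := .set 47 0) (Cmd.agree _ _) (by decide) (by decide), by
      rw [St.arr_setReg, ag1.2 16 (by decide)]; exact .refl (by simp)⟩, by simp [g48], g4⟩ (by
    rintro k τ hk hi hag ⟨⟨i1, i2⟩, i3, i4⟩
    rw [hI1.r43] at hk
    obtain ⟨⟨f1, f2⟩, ⟨f3, f4⟩, f5⟩ := outerBody_exec hP i1 hk i3 i4
    refine ⟨⟨⟨f1.of_agree (c := .set 47 (.lit (k + 1))) (Cmd.agree _ _) (by simp) (by simp),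
      i2.trans f2 fun h h' d hd => ?_⟩, by simpa using f3, f4⟩, f5⟩
    rcases Nat.lt_succ_iff_lt_or_eq.1 hd with hd | rfl
    exacts [h d hd, h'])
  rw [hI1.r43] at hloop
  have e : roundCode.exec σ = (Cmd.loop 47 43 outerBody).exec σ1 := by rw [h1]; rfl
  have ec : roundCode.cost σ = (clearTuple 4 7).cost σ + 1 +
    (Cmd.loop 47 43 outerBody).cost σ1 := by rw [h1]; rfl
  rw [e, ec]
  obtain ⟨⟨⟨hI2, hpr⟩, -⟩, h2⟩ := hloop
  refine ⟨⟨hI2, hpr.1, hpr.2.imp_left fun h => ⟨h.1, ?_⟩⟩, ?_⟩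
  · exact fun c hc u hu d hd ρX ρY hX hY hs hch => h.2 c hc u hu d hd ρX ρY hX hY hs hch
  · have : (P.n + 1) ^ m * (1 + (9 * (1 + m) + repBound P.n P.M m +
        (1 + P.n * (1 + innerBound P.n P.M P.Q m)))) ≤
        (P.n + 1) ^ m * (10 * (1 + m) + repBound P.n P.M m +
        (1 + P.n * (1 + innerBound P.n P.M P.Q m))) :=
      Nat.mul_le_mul_left _ (by omega)
    unfold roundBound
    omega

end Rounds


/-! ### Reaching a closed set, and the search for a sufficient tuple length. -/

open Cmd SepAlg.Expr

/-- Repeat the rounds often enough. -/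
def roundsCode : Cmd := .set 46 (.reg 44 + 1) ;; .loop 52 46 roundCode

/-- For a new tuple length only the addresses are forgotten. Array `10` keeps growing, and
`initCode` prepares the cells of each new table. -/
def clearStarts : Cmd := .loop 55 44 (.put 16 (.reg 55) 0)

def prepareCode : Cmd :=
  (.set 7 (.reg 56 + 1) ;; .set 8 (.reg 7)) ;; powCode 43 26 7 ;;
    (.set 44 0 ;; addLoop 44 43 16 1) ;; clearStarts

/-- The position `(n + 1) ^ m * n - n` belongs to the empty tuple and the vertex 0, that is, to the
whole graph. -/
def answerCode : Cmd :=
  .ite 0 (.get 16 (.reg 44 - .reg 1))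
    (.set 42 1 ;; .ite (.get 10 (.get 16 (.reg 44 - .reg 1) - 1)) (.reg 4 + 1) (.set 0 1)
      (.set 0 0)) .skip

/-- Try all tuples with one more entry than register `56` says. Register `42` tells whether an
answer was found. -/
def sizeCode : Cmd := prepareCode ;; roundsCode ;; answerCode

def separationProgram : Cmd :=
  readCode ;; (.set 45 1 ;; addLoop 45 1 16 1) ;; .loop 56 1 (.ite (.reg 42) 1 sizeCode .skip)

def sizeBound (n M Q m : ℕ) : ℕ :=
  30 * (1 + m * (n + 2)) + 2 * ((n + 1) ^ m * n) +
    ((n + 1) ^ m * n + 1) * (1 + roundBound n M Q m)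

structure OuterInv (P : Prob) (σ : St) : Prop where
  env : Env P σ
  marks : ∀ v, P.n < v → σ.arr 7 v = 0
  colors : ∀ v, P.n < v → σ.arr 8 v = 0
  r45 : σ.reg 45 = P.n * P.n + 1

theorem OuterInv.of_agree {P : Prob} {σ τ : St} (h : OuterInv P σ) {c : Cmd}
    (hc : c.Agree σ τ) (hr : ∀ x ∈ [1, 2, 3, 4, 5, 6, 26, 45], x ∉ c.regs)
    (ha : ∀ a ∈ [1, 2, 3, 7, 8], a ∉ c.arrs) : OuterInv P τ := by
  refine ⟨h.env.of_agree hc (fun x hx => hr x (by revert x; decide))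
      fun a hx => ha a (by revert a; decide), ?_, ?_, ?_⟩
  · rw [hc.2 7 (ha 7 (by decide))]; exact h.marks
  · rw [hc.2 8 (ha 8 (by decide))]; exact h.colors
  · rw [hc.1 45 (hr 45 (by decide)), h.r45]

theorem SepInv.outer {P : Prob} {m : ℕ} {σ : St} (h : SepInv P m σ) : OuterInv P σ :=
  ⟨h.env, h.marks, h.colors, h.r45⟩

section Rounds

variable {P : Prob} {m : ℕ}

theorem Progress.card_lt {s : ℕ} {K K' : ℕ → ℕ} {T : (ℕ → ℕ) → Prop} (h : Progress s K K' T)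
    (hT : ¬ T K) : ((Finset.range s).filter fun i => K i ≠ 0).card <
      ((Finset.range s).filter fun i => K' i ≠ 0).card := by
  obtain ⟨i, hi, h0, h1⟩ := h.2.resolve_left fun h => hT h.2
  refine Finset.card_lt_card (Finset.ssubset_iff_of_subset (fun j hj => ?_) |>.2 ⟨i, ?_, ?_⟩)
  · rw [Finset.mem_filter] at hj ⊢
    exact ⟨hj.1, h.1 j hj.2⟩
  · simp [hi, h1]
  · simp [h0]

/-- As long as `K` is not closed, a round adds a separation. There are only `(n + 1) ^ m * n` of
them, so with one more round a position `t` that belongs to all closed sets must have been filled.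
-/
theorem roundsCode_exec (hP : P.Wf) {σ : St} (hI : SepInv P m σ) :
    SepInv P m (roundsCode.exec σ) ∧
    (∀ t, (∀ K : ℕ → ℕ, StepClosed P m (fun c u => K (c * P.n + u) ≠ 0) → K t ≠ 0) →
      (roundsCode.exec σ).arr 16 t ≠ 0) ∧
    roundsCode.cost σ ≤ 2 + ((P.n + 1) ^ m * P.n + 1) * (1 + roundBound P.n P.M P.Q m) := by
  obtain ⟨σ1, h1⟩ : ∃ σ1, σ1 = (Cmd.set 46 (.reg 44 + 1)).exec σ := ⟨_, rfl⟩
  have ag1 := (Cmd.set 46 (.reg 44 + 1)).agree σ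
  rw [← h1] at ag1
  have hI1 := hI.of_agree ag1 (by decide) (by decide)
  have r46 : σ1.reg 46 = (P.n + 1) ^ m * P.n + 1 := by
    rw [h1]; simp only [exec_set, St.reg_setReg, if_true, eval_add, eval_ofNat]
    simp [eval, hI.r44]
  have h := exec_loop_cost_const (P := roundCode) (i := 52) (n := 46) (σ := σ1)
    (fun k τ => SepInv P m τ ∧
      ∀ t, (∀ K : ℕ → ℕ, StepClosed P m (fun c u => K (c * P.n + u) ≠ 0) → K t ≠ 0) →
        τ.arr 16 t ≠ 0 ∨
          k ≤ ((Finset.range ((P.n + 1) ^ m * P.n)).filter fun i => τ.arr 16 i ≠ 0).card)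
    (roundBound P.n P.M P.Q m)
    ⟨hI1.of_agree (c := .set 52 0) (Cmd.agree _ _) (by decide) (by decide), fun t _ =>
      .inr (Nat.zero_le _)⟩ (by
    rintro k τ hk hi hag ⟨i1, i2⟩
    obtain ⟨⟨f1, f2⟩, f3⟩ := roundCode_exec hP i1
    refine ⟨⟨f1.of_agree (c := .set 52 (.lit (k + 1))) (Cmd.agree _ _) (by simp) (by simp),
      fun t ht => ?_⟩, f3⟩
    rw [St.arr_setReg]
    by_cases h0 : τ.arr 16 t = 0
    · have := f2.card_lt fun h => ht _ h h0
      have := (i2 t ht).resolve_left (not_not.2 h0)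
      exact .inr (by omega)
    · exact .inl (f2.1 t h0))
  have e : roundsCode.exec σ = (Cmd.loop 52 46 roundCode).exec σ1 := by rw [h1]; rfl
  have ec : roundsCode.cost σ = 1 + (Cmd.loop 52 46 roundCode).cost σ1 := by rw [h1]; rfl
  rw [e, ec]
  rw [r46] at h
  refine ⟨h.1.1, fun t ht => (h.1.2 t ht).resolve_right fun hc => ?_, by omega⟩
  have := Finset.card_filter_le (Finset.range ((P.n + 1) ^ m * P.n))
    (fun i => ((Cmd.loop 52 46 roundCode).exec σ1).arr 16 i ≠ 0)
  rw [Finset.card_range] at this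
  omega

theorem prepareCode_exec {σ : St} (hO : OuterInv P σ) (h56 : σ.reg 56 + 1 = m) :
    SepInv P m (prepareCode.exec σ) ∧
    prepareCode.cost σ ≤ 20 * (1 + m * (P.n + 2)) + 2 * ((P.n + 1) ^ m * P.n) := by
  obtain ⟨σ1, h1⟩ : ∃ σ1, σ1 = (Cmd.set 7 (.reg 56 + 1) ;; Cmd.set 8 (.reg 7)).exec σ := ⟨_, rfl⟩
  have ag1 := (Cmd.set 7 (.reg 56 + 1) ;; Cmd.set 8 (.reg 7)).agree σ
  rw [← h1] at ag1
  have a7 : σ1.reg 7 = m := by rw [h1]; simp [← h56, eval]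
  have a8 : σ1.reg 8 = m := by rw [h1]; simp [← h56, eval]
  have hO1 := hO.of_agree ag1 (by decide) (by decide)
  obtain ⟨σ2, h2⟩ : ∃ σ2, σ2 = (powCode 43 26 7).exec σ1 := ⟨_, rfl⟩
  have ag2 := (powCode 43 26 7).agree σ1
  have b43 := powCode_exec (d := 43) (q := 26) (e := 7) (by decide) (by decide) (by decide)
    (by decide) σ1
  have c2 : (powCode 43 26 7).cost σ1 ≤ 10 * (1 + m * (P.n + 2)) := by
    refine (cost_le_ub' _ σ1 (by decide)).trans ?_
    simp only [powCode, addLoop, ub, hO1.env.n1, a7]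
    ring_nf
    omega
  rw [← h2] at ag2 b43
  rw [a7, hO1.env.n1] at b43
  have hO2 := hO1.of_agree ag2 (by decide) (by decide)
  obtain ⟨σ3, h3⟩ : ∃ σ3, σ3 = (Cmd.set 44 0 ;; addLoop 44 43 16 1).exec σ2 := ⟨_, rfl⟩
  have ag3 := (Cmd.set 44 0 ;; addLoop 44 43 16 1).agree σ2
  have c3 : (Cmd.set 44 0 ;; addLoop 44 43 16 1).cost σ2 ≤ 2 + 3 * P.n := by
    refine (cost_le_ub' _ σ2 (by decide)).trans ?_
    simp only [addLoop, ub, hO2.env.n]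
    omega
  have d44 := addLoop_exec (x := 44) (y := 43) (i := 16) (n := 1) (by decide) (by decide)
    (by decide) (σ2.setReg 44 0)
  have e44 : σ3.reg 44 = (P.n + 1) ^ m * P.n := by
    rw [h3]
    simp [d44, hO2.env.n, b43, mul_comm]
  rw [← h3] at ag3
  have hO3 := hO2.of_agree ag3 (by decide) (by decide)
  obtain ⟨σ4, h4⟩ : ∃ σ4, σ4 = clearStarts.exec σ3 := ⟨_, rfl⟩
  have ag4 := clearStarts.agree σ3
  have c4 : clearStarts.cost σ3 ≤ 1 + 2 * ((P.n + 1) ^ m * P.n) := by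
    refine (cost_le_ub' _ σ3 (by decide)).trans ?_
    simp only [clearStarts, ub, e44]
    omega
  have f16 : ∀ j < σ3.reg 44, σ4.arr 16 j = 0 := by
    rw [h4]
    refine exec_loop (fun k τ => ∀ j < k, τ.arr 16 j = 0) (by simp) ?_
    intro k τ hk hi hag h j hj
    simp only [exec_put, eval, hi, St.arr_setReg, St.arr_setArr, if_true,
      Function.update_apply]
    split_ifs with hjk
    exacts [rfl, h j (by omega)]
  rw [← h4] at ag4
  have hO4 := hO3.of_agree ag4 (by decide) (by decide)
  have e : prepareCode.exec σ = σ4 := by rw [h4, h3, h2, h1]; rfl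
  have ec : prepareCode.cost σ = 2 + ((powCode 43 26 7).cost σ1 +
      ((Cmd.set 44 0 ;; addLoop 44 43 16 1).cost σ2 + clearStarts.cost σ3)) := by
    rw [h3, h2, h1]; rfl
  rw [e, ec]
  rw [e44] at f16
  refine ⟨⟨hO4.env, hO4.marks, hO4.colors, ?_, ?_, ?_, ?_, hO4.r45, ?_⟩, ?_⟩
  · rw [ag4.1 7 (by decide), ag3.1 7 (by decide), ag2.1 7 (by decide), a7]
  · rw [ag4.1 8 (by decide), ag3.1 8 (by decide), ag2.1 8 (by decide), a8]
  · rw [ag4.1 43 (by decide), ag3.1 43 (by decide), b43]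
  · rw [ag4.1 44 (by decide), e44]
  · intro c hc u hu hne
    exact absurd (f16 _ (index_lt hc hu)) hne
  · have hm : 1 ≤ m := by omega
    have hx : P.n + 2 ≤ m * (P.n + 2) := Nat.le_mul_of_pos_left _ hm
    omega

end Rounds

section Answer

variable {n : ℕ} {I : SeparationInstance n} {L : List (Fin n × Fin n × ℕ)} {m : ℕ}

theorem idx_zero {Q : ℕ} {X : ℕ → ℕ} : ∀ m, idx Q (fun _ => 0) X m = 0
  | 0 => rfl
  | m + 1 => by simp [idx, idx_zero m]

/-- All places of the tuple are empty and have color 0, so the index is 0 and the first cell of the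
table holds the answer. -/
theorem TablesOk.answer (hL : I.graph.IsListing L) {K H : ℕ → ℕ} {top : ℕ}
    (h : TablesOk (SeparationProb I L) m K H top) (h0 : K (((n + 1) ^ m - 1) * n) ≠ 0) :
    H (K (((n + 1) ^ m - 1) * n) - 1) ≤ I.k ↔ I.IsYes := by
  have hn := two_le_n I
  obtain ⟨-, ρ, hρ, hS⟩ := h ((n + 1) ^ m - 1)
    (Nat.sub_lt (Nat.pow_pos (Nat.succ_pos _)) Nat.one_pos) 0 (by change 0 < n; omega) h0
  have h1 := classSet_top hL hρ
  have hC : classSet n ρ 0 = Finset.range n := by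
    ext v
    rw [mem_classSet, Finset.mem_range]
    exact and_iff_left_of_imp fun hv => h1 v hv
  have h00 : (SeparationProb I L).Col fun _ => 0 :=
    ⟨fun _ => by simp [SeparationProb], fun _ _ => rfl⟩
  have hs := hS _ h00 I.k le_rfl
  rw [idx_zero] at hs
  rw [isYes_iff hL]
  refine hs.trans (exists_congr fun χ => ?_)
  change _ ∧ (∀ v, v ∉ classSet n ρ 0 → _) ∧ (SeparationProb I L).Feasible χ (classSet n ρ 0) ∧
    zeros χ (classSet n ρ 0) ≤ I.k ↔ _
  rw [hC]
  refine and_congr_right fun hχ => and_iff_right fun v hv => ?_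
  exact hχ.2 v (by simpa [SeparationProb] using hv)

/-- The answer in register `0` is correct if one was found. -/
def Found (I : SeparationInstance n) (σ : St) : Prop := σ.reg 42 ≠ 0 → (σ.reg 0 = 1 ↔ I.IsYes)

/-- Soundness holds for every `m`, because stored tables are correct. That `m` exceeds the treewidth
is only needed to ensure that an answer is found. -/
theorem sizeCode_exec (hL : I.graph.IsListing L) {σ : St} (hO : OuterInv (SeparationProb I L) σ)
    (h42 : σ.reg 42 = 0) (h56 : σ.reg 56 + 1 = m) :
    OuterInv (SeparationProb I L) (sizeCode.exec σ) ∧ Found I (sizeCode.exec σ) ∧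
    (treewidth I.graph.underlying + 1 ≤ m → (sizeCode.exec σ).reg 42 ≠ 0) ∧
    sizeCode.cost σ ≤ sizeBound n L.length (SeparationProb I L).Q m := by
  obtain ⟨s1, c1⟩ := prepareCode_exec hO h56
  obtain ⟨σ1, h1⟩ : ∃ σ1, σ1 = prepareCode.exec σ := ⟨_, rfl⟩
  have ag1 := prepareCode.agree σ
  rw [← h1] at s1 ag1
  obtain ⟨s2, t2, c2⟩ := roundsCode_exec separationProb_wf s1
  obtain ⟨σ2, h2⟩ : ∃ σ2, σ2 = roundsCode.exec σ1 := ⟨_, rfl⟩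
  have ag2 := roundsCode.agree σ1
  rw [← h2] at s2 t2 ag2
  have e42 : σ2.reg 42 = 0 := by rw [ag2.1 42 (by decide), ag1.1 42 (by decide), h42]
  have e : sizeCode.exec σ = answerCode.exec σ2 := by rw [h2, h1]; rfl
  have ec : sizeCode.cost σ = prepareCode.cost σ + (roundsCode.cost σ1 + answerCode.cost σ2) := by
    rw [h2, h1]; rfl
  have hc : answerCode.cost σ2 ≤ 4 := by
    simp only [answerCode, Cmd.cost]
    split_ifs <;> omega
  have ht : σ2.reg 44 - σ2.reg 1 = ((n + 1) ^ m - 1) * n := by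
    rw [s2.r44, s2.env.n, Nat.sub_one_mul]; rfl
  have ek : σ2.reg 4 = I.k := s2.env.k
  have hg : σ2.arr 16 (((n + 1) ^ m - 1) * n) ≠ 0 → answerCode.exec σ2 =
      if σ2.arr 10 (σ2.arr 16 (((n + 1) ^ m - 1) * n) - 1) ≤ I.k then
        (σ2.setReg 42 1).setReg 0 1 else (σ2.setReg 42 1).setReg 0 0 := fun h0 => by
    simp [answerCode, eval, ht, ek, Nat.pos_of_ne_zero h0]
  rw [e, ec]
  refine ⟨s2.outer.of_agree (answerCode.agree σ2) (by decide) (by decide), ?_, fun hm => ?_, ?_⟩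
  · unfold Found
    by_cases h0 : σ2.arr 16 (((n + 1) ^ m - 1) * n) = 0
    · simp [answerCode, eval, ht, h0, e42]
    · rw [← s2.tables.answer hL h0, hg h0]
      intro _
      split_ifs with h <;> simp [h]
  · rw [hg (t2 (((n + 1) ^ m - 1) * n) fun K hK => hK.top hL hm)]
    split_ifs <;> simp
  · unfold sizeBound
    change prepareCode.cost σ ≤ 20 * (1 + m * (n + 2)) + 2 * ((n + 1) ^ m * n) at c1
    change roundsCode.cost σ1 ≤
      2 + ((n + 1) ^ m * n + 1) * (1 + roundBound n L.length (SeparationProb I L).Q m) at c2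
    omega

theorem sizeBound_mono {n M Q m m' : ℕ} (hQ : 0 < Q) (h : m ≤ m') :
    sizeBound n M Q m ≤ sizeBound n M Q m' := by
  have h1 : (n + 1) ^ m ≤ (n + 1) ^ m' := Nat.pow_le_pow_right (by omega) h
  have h2 : tryBound n M Q m ≤ tryBound n M Q m' := by
    unfold tryBound
    have := combineBound_mono (n := n) (M := M) (r := n) (r' := n) hQ h h le_rfl
      (Nat.mul_le_mul_left 2 h)
    omega
  have h3 : repBound n M m ≤ repBound n M m' := by unfold repBound; omega
  unfold sizeBound roundBound innerBound
  gcongr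

/-- The treewidth is never computed. Once an answer is found, the remaining lengths are skipped at
constant cost, so only lengths up to the treewidth plus one are paid for. -/
theorem separationProgram_exec (hL : I.graph.IsListing L) :
    ((separationProgram.exec (St.init (I.encode L))).reg 0 = 1 ↔ I.IsYes) ∧
    separationProgram.cost (St.init (I.encode L)) ≤ 20 * (L.length + 1) + 3 + 3 * n +
      n * (3 + sizeBound n L.length (SeparationProb I L).Q (treewidth I.graph.underlying + 1)) := by
  set P := SeparationProb I L with hP
  set w := treewidth I.graph.underlying with hw
  obtain ⟨σ0, h0⟩ : ∃ σ0, σ0 = St.init (I.encode L) := ⟨_, rfl⟩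
  obtain ⟨r1, r2⟩ := readCode_exec hL []
  obtain ⟨σ1, h1⟩ : ∃ σ1, σ1 = readCode.exec σ0 := ⟨_, rfl⟩
  have ag1 := readCode.agree σ0
  rw [List.append_nil, ← h0] at r1 r2
  rw [← h1] at ag1 r1
  obtain ⟨σ2, h2⟩ : ∃ σ2, σ2 = (Cmd.set 45 1 ;; addLoop 45 1 16 1).exec σ1 := ⟨_, rfl⟩
  have ag2 := (Cmd.set 45 1 ;; addLoop 45 1 16 1).agree σ1
  have c2 : (Cmd.set 45 1 ;; addLoop 45 1 16 1).cost σ1 ≤ 2 + 3 * n := by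
    refine (cost_le_ub' _ σ1 (by decide)).trans ?_
    simp only [addLoop, ub, show σ1.reg 1 = n from r1.n]
    omega
  have d45 := addLoop_exec (x := 45) (y := 1) (i := 16) (n := 1) (by decide) (by decide)
    (by decide) (σ1.setReg 45 1)
  have e45 : σ2.reg 45 = P.n * P.n + 1 := by
    rw [h2]
    simp [d45, r1.n, add_comm]
    rfl
  rw [← h2] at ag2
  have hz : ∀ a ∈ [7, 8], ∀ v, σ2.arr a v = 0 := fun a ha v => by
    rw [ag2.2 a (by revert a; decide), ag1.2 a (by revert a; decide), h0]
    have : a ≠ 0 := by rintro rfl; revert ha; decide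
    simp [St.init, this]
  have hO : OuterInv P σ2 := ⟨r1.of_agree ag2 (by decide) (by decide),
    fun v _ => hz 7 (by decide) v, fun v _ => hz 8 (by decide) v, e45⟩
  have z42 : σ2.reg 42 = 0 := by
    rw [ag2.1 42 (by decide), ag1.1 42 (by decide), h0]
    rfl
  have hQ : 0 < P.Q := by simp [hP, SeparationProb]
  have h := exec_loop_cost_const (P := .ite (.reg 42) 1 sizeCode .skip) (i := 56) (n := 1)
    (σ := σ2) (fun k τ => OuterInv P τ ∧ Found I τ ∧ (w + 1 ≤ k → τ.reg 42 ≠ 0))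
    (2 + sizeBound n L.length P.Q (w + 1))
    ⟨hO.of_agree (c := .set 56 0) (Cmd.agree _ _) (by decide) (by decide),
      fun h => absurd (by simpa using z42) h, by omega⟩ (by
    rintro k τ hk hi hag ⟨i1, i2, i3⟩
    simp only [exec_ite, Cmd.cost, eval, Nat.lt_one_iff]
    by_cases h42 : τ.reg 42 = 0
    · have hkw : k < w + 1 := by
        by_contra hc
        exact i3 (by omega) h42
      obtain ⟨f1, f2, f3, f4⟩ := sizeCode_exec hL i1 h42 (m := k + 1) (by rw [hi])
      rw [if_pos h42, if_pos h42]
      refine ⟨⟨f1.of_agree (c := .set 56 (.lit (k + 1))) (Cmd.agree _ _) (by simp) (by simp),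
        ?_, ?_⟩, ?_⟩
      · simpa [Found] using f2
      · simpa using f3
      · have := sizeBound_mono (n := n) (M := L.length) hQ (show k + 1 ≤ w + 1 by omega)
        rw [← hP] at f4
        omega
    · rw [if_neg h42, if_neg h42]
      refine ⟨⟨i1.of_agree (c := .set 56 (.lit (k + 1))) (Cmd.agree _ _) (by simp) (by simp),
        ?_, ?_⟩, by omega⟩
      · simpa [Found] using i2
      · simp [h42])
  have en : σ2.reg 1 = n := hO.env.n
  have e : separationProgram.exec σ0 = (Cmd.loop 56 1 (.ite (.reg 42) 1 sizeCode .skip)).exec σ2 := by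
    rw [h2, h1]; rfl
  have ec : separationProgram.cost σ0 = readCode.cost σ0 + ((Cmd.set 45 1 ;;
      addLoop 45 1 16 1).cost σ1 + (Cmd.loop 56 1 (.ite (.reg 42) 1 sizeCode .skip)).cost σ2) := by
    rw [h2, h1]; rfl
  rw [← h0, e, ec]
  rw [en] at h
  obtain ⟨⟨-, h3, h4⟩, h5⟩ := h
  have hn := two_le_n I
  have htw := treewidth_le I.graph.underlying
  refine ⟨h3 (h4 (by omega)), ?_⟩
  have : n * (1 + (2 + sizeBound n L.length P.Q (w + 1))) =
    n * (3 + sizeBound n L.length P.Q (w + 1)) := by ring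
  omega

theorem separationProgram_wf : separationProgram.wf := by decide

end Answer


/-! ### Bounding the costs by powers of the input length. -/

theorem tryBound_le {n M Q m p : ℕ} (hn : n + 2 ≤ p) (hM : n + M + 1 ≤ p) (hQ : Q + 1 ≤ p)
    (hm : 1 ≤ m) (hmn : m ≤ n) : tryBound n M Q m ≤ 1000 * p ^ (4 * m) := by
  have hB : p ^ 2 ≤ p ^ (2 * m) := Nat.pow_le_pow_right (by omega) (by omega)
  have hp : p ≤ p ^ 2 := Nat.le_self_pow (by omega) p
  have hp4 : 3 * p ≤ p ^ 2 := by rw [sq]; exact Nat.mul_le_mul_right _ (by omega)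
  have e : p ^ (4 * m) = p ^ (2 * m) * p ^ (2 * m) := by rw [← pow_add]; congr 1; omega
  have hBB : p ^ (2 * m) ≤ p ^ (4 * m) := Nat.pow_le_pow_right (by omega) (by omega)
  have h1 : (m + m + 2 * m + 1) * (Q + 1) ≤ 4 * p ^ 2 := by
    calc _ ≤ (4 * p) * p := Nat.mul_le_mul (by omega) hQ
      _ = _ := by ring
  have h2 : Q ^ m ≤ p ^ (2 * m) :=
    (Nat.pow_le_pow_left (by omega) m).trans (Nat.pow_le_pow_right (by omega) (by omega))
  have h3 : (m + m + 1) * (Q + 1) ≤ 2 * p ^ 2 := by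
    calc _ ≤ (2 * p) * p := Nat.mul_le_mul (by omega) hQ
      _ = _ := by ring
  have h4 : Q ^ (2 * m) * (M + (m + m + 1) * (Q + 1) + 2 * m + n) ≤ 3 * p ^ (4 * m) := by
    calc _ ≤ p ^ (2 * m) * (3 * p ^ (2 * m)) :=
          Nat.mul_le_mul (Nat.pow_le_pow_left (by omega) _) (by omega)
      _ = _ := by rw [e]; ring
  unfold tryBound combineBound
  omega

theorem repBound_le {n M m p : ℕ} (hn : n + 2 ≤ p) (hM : M + 2 ≤ p) (hm : 1 ≤ m) (hmn : m ≤ n) :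
    repBound n M m ≤ 40 * p ^ (4 * m) := by
  have h1 : (n * n + 1) * (M + 1) ≤ p ^ 3 := by
    calc _ ≤ (p * p) * p := Nat.mul_le_mul (by nlinarith) (by omega)
      _ = _ := by ring
  have h2 : p ^ 3 ≤ p ^ (4 * m) := Nat.pow_le_pow_right (by omega) (by omega)
  have h3 : p ≤ p ^ (4 * m) := Nat.le_self_pow (by omega) p
  have h4 : 1 + n + m + (n * n + 1) * (M + 1) ≤ 2 * p ^ (4 * m) := by
    have : p ^ 3 + 2 * p ≤ 2 * p ^ 3 := by
      have : 2 * p ≤ p ^ 3 := by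
        rw [pow_succ]; exact Nat.mul_le_mul_right _ (by nlinarith)
      omega
    omega
  unfold repBound
  omega

/-- Trying one step and finding components cost at most a constant times `p ^ (4 * m)`. Each of the
loops over the two tuples contributes a factor `p ^ m`, the loop over the vertices a factor `p`, and
the rounds a factor `p ^ (m + 1)`, which makes `7 * m + 2`. -/
theorem sizeBound_le {n M Q m p : ℕ} (hn : n + 2 ≤ p) (hM : n + M + 1 ≤ p) (hQ : Q + 1 ≤ p)
    (hm : 1 ≤ m) (hmn : m ≤ n) : sizeBound n M Q m ≤ 2308 * p ^ (7 * m + 2) := by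
  have ht := tryBound_le hn hM hQ hm hmn
  have hr := repBound_le hn (show M + 2 ≤ p by omega) hm hmn
  have hA : (n + 1) ^ m ≤ p ^ m := Nat.pow_le_pow_left (by omega) m
  have hp : ∀ j k, j ≤ k → p ^ j ≤ p ^ k := fun j k h => Nat.pow_le_pow_right (by omega) h
  have hp1 : ∀ k, 1 ≤ k → p ≤ p ^ k := fun k h => by simpa using hp 1 k h
  have hi : innerBound n M Q m ≤ 1060 * p ^ (5 * m) := by
    have e : p ^ (5 * m) = p ^ m * p ^ (4 * m) := by rw [← pow_add]; congr 1; omega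
    have h1 : (n + 1) ^ m * (10 * (1 + m) + repBound n M m + tryBound n M Q m) ≤
        1050 * p ^ (5 * m) := by
      calc _ ≤ p ^ m * (1050 * p ^ (4 * m)) :=
            Nat.mul_le_mul hA (by have := hp1 (4 * m) (by omega); omega)
        _ = _ := by rw [e]; ring
    have := hp1 (5 * m) (by omega)
    unfold innerBound
    omega
  have ho : roundBound n M Q m ≤ 1122 * p ^ (6 * m + 1) := by
    have e : p ^ (6 * m + 1) = p ^ m * p ^ (5 * m + 1) := by rw [← pow_add]; congr 1; omega
    have h1 : n * (1 + innerBound n M Q m) ≤ 1061 * p ^ (5 * m + 1) := by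
      calc _ ≤ p * (1061 * p ^ (5 * m)) :=
            Nat.mul_le_mul (by omega) (by have := hp1 (5 * m) (by omega); omega)
        _ = _ := by ring
    have h2 : (n + 1) ^ m * (10 * (1 + m) + repBound n M m + (1 + n * (1 + innerBound n M Q m))) ≤
        1112 * p ^ (6 * m + 1) := by
      calc _ ≤ p ^ m * (1112 * p ^ (5 * m + 1)) :=
            Nat.mul_le_mul hA (by
              have := hp1 (5 * m + 1) (by omega)
              have := hp (4 * m) (5 * m + 1) (by omega)
              omega)
        _ = _ := by rw [e]; ring
    have := hp1 (6 * m + 1) (by omega)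
    unfold roundBound
    omega
  have h1 : (n + 1) ^ m * n + 1 ≤ 2 * p ^ (m + 1) := by
    have : (n + 1) ^ m * n ≤ p ^ (m + 1) := by
      rw [pow_succ]; exact Nat.mul_le_mul hA (by omega)
    have := hp1 (m + 1) (by omega)
    omega
  have h2 : ((n + 1) ^ m * n + 1) * (1 + roundBound n M Q m) ≤ 2246 * p ^ (7 * m + 2) := by
    have e : p ^ (7 * m + 2) = p ^ (m + 1) * p ^ (6 * m + 1) := by
      rw [← pow_add]; congr 1; omega
    calc _ ≤ (2 * p ^ (m + 1)) * (1123 * p ^ (6 * m + 1)) :=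
          Nat.mul_le_mul h1 (by have := hp1 (6 * m + 1) (by omega); omega)
      _ = _ := by rw [e]; ring
  have h3 : 1 + m * (n + 2) ≤ p ^ 2 := by nlinarith
  have h4 : 2 * p ^ (m + 1) ≤ p ^ (7 * m + 2) := by
    calc _ ≤ p * p ^ (m + 1) := Nat.mul_le_mul_right _ (by omega)
      _ = p ^ (m + 2) := by ring
      _ ≤ _ := hp _ _ (by omega)
  have h5 := hp 2 (7 * m + 2) (by omega)
  unfold sizeBound
  omega

theorem baseAddr_instance {n : ℕ} {I : SeparationInstance n} {L : List (Fin n × Fin n × ℕ)} :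
    baseAddr (I.encode L) = 8 + 3 * L.length := by
  have h5 : (I.encode L).getD 5 0 = L.length := by
    rw [SeparationInstance.encode, List.getD_append _ _ _ _ (by simp)]; rfl
  have hN : (I.encode L).getD (6 + 3 * L.length) 0 = 0 :=
    List.getD_eq_default _ _ (by rw [encode_length])
  rw [baseAddr, h5, hN, zero_mul, add_zero]

theorem exists_program : ∃ (P : RAMProgram) (C : ℕ),
    ∀ (n : ℕ) (I : SeparationInstance n) (L : List (Fin n × Fin n × ℕ)), I.graph.IsListing L →
      P.DecidesWithin (I.encode L) I.IsYes
        ((I.encode L).length ^ (7 * treewidth I.graph.underlying + C)) := by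
  refine ⟨.seq prologue separationProgram.comp, 14 + 2341 * separationProgram.factor + 10,
    fun n I L hL => ?_⟩
  obtain ⟨h1, h2⟩ := separationProgram_exec hL
  refine decidesWithin_of_exec separationProgram_wf _
    (by rw [baseAddr_instance, encode_length]; omega) ?_ h1
  rw [baseAddr_instance, encode_length]
  have hM := one_le_length hL
  have hn := card_vertices_le hL
  have hn2 := two_le_n I
  have hlab := card_labels_le_length L
  have htw := treewidth_le I.graph.underlying
  set w := treewidth I.graph.underlying with hw
  set M := L.length
  obtain ⟨p, hp⟩ : ∃ p, p = 6 + 3 * M := ⟨_, rfl⟩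
  rw [← hp]
  have hS := sizeBound_le (n := n) (M := M) (Q := (SeparationProb I L).Q) (m := w + 1) (p := p)
    (by omega) (by omega) (by simp only [SeparationProb]; omega) (by omega) (by omega)
  -- The exponent is `7 * m + 2` for `m = w + 1`, plus one for the loop over the tuple lengths.
  have e1 : p ^ (7 * w + 10) = p * p ^ (7 * (w + 1) + 2) := by
    rw [← pow_succ']; ring_nf
  have e0 : p ≤ p ^ (7 * w + 10) := Nat.le_self_pow (by omega) p
  have h3 : n * (3 + sizeBound n M (SeparationProb I L).Q (w + 1)) ≤ 2311 * p ^ (7 * w + 10) := by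
    have : 1 ≤ p ^ (7 * (w + 1) + 2) := Nat.one_le_pow _ _ (by omega)
    calc _ ≤ p * (2311 * p ^ (7 * (w + 1) + 2)) := Nat.mul_le_mul (by omega) (by omega)
      _ = _ := by rw [e1]; ring
  have hcost := Nat.mul_le_mul_left separationProgram.factor
    (show separationProgram.cost (St.init (I.encode L)) ≤ 2341 * p ^ (7 * w + 10) by omega)
  generalize separationProgram.factor = F at hcost ⊢
  calc _ ≤ (14 + 2341 * F) * p ^ (7 * w + 10) := by
        have : (14 + 2341 * F) * p ^ (7 * w + 10) =
          14 * p ^ (7 * w + 10) + F * (2341 * p ^ (7 * w + 10)) := by ring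
        omega
    -- The bound has to be a pure power of the input length, so the constant factor moves into the
    -- exponent by `K ≤ p ^ K`.
    _ ≤ p ^ (14 + 2341 * F) * p ^ (7 * w + 10) :=
        Nat.mul_le_mul_right _ (Nat.lt_pow_self (by omega)).le
    _ = _ := by rw [← pow_add]; congr 1; omega

end SepAlg

theorem mainTheorem1 :
    -- the running time, if a nice tree decomposition with `O(width * |V|)` nodes is given
    (∃ P : RAMProgram, ∀ c : ℕ, ∃ C : ℕ,
      ∀ (n : ℕ) (I : SeparationInstance n) (L : List (Fin n × Fin n × ℕ)) (N : ℕ)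
        (D : RootedTreeDecomposition I.graph.underlying N) (bags : Fin N → List (Fin n)),
        I.graph.IsListing L → D.IsNice → D.IsBagListing bags → N ≤ c * (D.width * n) →
          P.DecidesWithin (I.encode L ++ D.encode bags) I.IsYes
            (C * ((I.graph.maxLabel + 2) ^ (D.width + 2) * D.width * n * I.graph.edges.card))) ∧
    -- membership in XP for the treewidth of the underlying graph (no decomposition is given)
    (∃ (P : RAMProgram) (f : ℕ → ℕ), Computable f ∧
      ∀ (n : ℕ) (I : SeparationInstance n) (L : List (Fin n × Fin n × ℕ)),
        I.graph.IsListing L →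
          P.DecidesWithin (I.encode L) I.IsYes
            ((I.encode L).length ^ f (treewidth I.graph.underlying))) ∧
    -- polynomial time for bounded treewidth of the underlying graph
    (∀ w : ℕ, ∃ (P : RAMProgram) (d : ℕ),
      ∀ (n : ℕ) (I : SeparationInstance n) (L : List (Fin n × Fin n × ℕ)),
        I.graph.IsListing L → treewidth I.graph.underlying ≤ w →
          P.DecidesWithin (I.encode L) I.IsYes ((I.encode L).length ^ d)) := by
  obtain ⟨P, C, hP⟩ := SepAlg.exists_program
  refine ⟨SepAlg.exists_program_of_decomposition, ⟨P, fun w => 7 * w + C, ?_, hP⟩,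
    fun w => ⟨P, 7 * w + C, fun n I L hL hw => ?_⟩⟩
  · exact (Primrec.nat_add.comp (Primrec.nat_mul.comp (Primrec.const 7) Primrec.id)
      (Primrec.const C)).to_comp
  · obtain ⟨t, σ, h1, h2, h3⟩ := hP n I L hL
    refine ⟨t, σ, h1, h2.trans (Nat.pow_le_pow_right ?_ (by gcongr)), h3⟩
    rw [SepAlg.encode_length]
    omega
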